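/- Let $k$ be an algebraically closed field of characteristic zero, $R=k[[t]]$, $\Delta=\operatorname{Spec}R$. Let $\tilde\phi:\tilde C=\operatorname{Spec}O\to\Delta$ be a finite flat cover of degree $d$, étale over $\Delta\setminus\{0\}$, with branch divisor $\operatorname{br}(\tilde\phi)$ defined by the ideal $\langle t^a\rangle$; here the branch divisor of a finite locally free morphism is the zero locus of the discriminant section $O\to(\det\phi_*O_X)^{\vee\otimes 2}$ given by the trace form. Let $\Sigma\subset\Delta$ be the divisor defined by $\langle t^b\rangle$, and put $\delta=(b-a)/2$ and $F=O/t^bO$. For a $k$-scheme $T$, a crimp of $\tilde\phi$ over $T$ with branch divisor $\Sigma$ is a factorization $\tilde C\times T\xrightarrow{\nu}C\xrightarrow{\phi}\Delta\times T$ of $\tilde\phi\times\mathrm{id}_T$ in which $\phi$ is a finite locally free cover of degree $d$ with $\operatorname{br}(\phi)=\Sigma\times T$ and $\nu$ is an isomorphism over the complement of $\Sigma\times T$. Isomorphisms of crimps are isomorphisms of the curves $C$ commuting with $\nu$ and $\phi$. Let $\operatorname{Crimp}(\tilde\phi,\Sigma)$ be the functor sending $T$ to the set of isomorphism classes of crimps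 over $T$. Let $\operatorname{Quot}(F,\delta)$ be the Quot scheme over $k$ parametrizing $T$-flat quotients $F\otimes_kO_T\to Q$ on $\Delta\times T$ that are finite and locally free over $T$ of rank $\delta$ (this is the empty scheme if $\delta$ is not a non-negative integer). Let $Y$ be the locus in $\operatorname{Quot}(F,\delta)$ with the following functor of points: a morphism $T\to\operatorname{Quot}(F,\delta)$, with corresponding sequence $0\to S\to F\otimes_kO_T\to Q\to0$, factors through $Y$ if and only if 1. $S$ is a subalgebra of $F\otimes_kO_T$, i.e. it contains $1$ and is closed under multiplication; and 2. for the algebra $O_C=O_{\tilde C\times T}\times_{F\otimes_k O_T}S$, which is locally free of rank $d$ over $O_{\Delta\times T}$, the cokernel $B$ of the discriminant section $O_{\Delta\times T}\to(\det O_C)^{\vee\otimes 2}$ is annihilated by $t^b$. Then $\operatorname{Quot}(F,\delta)$ exists as a scheme, $Y$ is a closed subscheme of it, and sending a $T$-point of $Y$ to the crimp $\tilde C\times T\to\operatorname{Spec}O_C\to\Delta\times T$ defines an isomorphism $Y\to\operatorname{Crimp}(\tilde\phi,\Sigma)$. In particular, $\operatorname{Crimp}(\tilde\phi,\Sigma)$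 is represented by a projective $k$-scheme. -/

import Mathlib

open CategoryTheory CategoryTheory.Limits AlgebraicGeometry Opposite
open scoped TensorProduct PowerSeries LaurentSeries

universe u

namespace Crimping

noncomputable section

/-! ### Finite covers and their discriminants -/

/-- `φ : X ⟶ Y` is a finite cover of degree `d` (i.e. `φ` is affine and `φ_* O_X` is a locally
free `O_Y`-module of rank `d`) and, locally on `Y`, the discriminant of a basis of `φ_* O_X`
with respect to the trace form satisfies `P`. In a basis `e` of `φ_* O_X` over `U`, the
discriminant section of `(det φ_* O_X)^{∨ ⊗ 2}` is multiplication by `discr e`. -/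
def IsCoverWithDiscr {X Y : Scheme.{u}} (φ : X ⟶ Y) (d : ℕ)
    (P : ∀ U : Y.Opens, Γ(Y, U) → Prop) : Prop :=
  IsAffineHom φ ∧ ∀ y : Y, ∃ U : Y.Opens, IsAffineOpen U ∧ y ∈ U ∧
    letI := (φ.app U).hom.toAlgebra
    ∃ e : Module.Basis (Fin d) Γ(Y, U) Γ(X, φ ⁻¹ᵁ U), P U (Algebra.discr Γ(Y, U) e)

/-- The restriction of a global function to an open subset. -/
def res {Y : Scheme.{u}} (g : Γ(Y, ⊤)) (U : Y.Opens) : Γ(Y, U) :=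
  (Y.presheaf.map (homOfLE le_top).op).hom g

/-- `φ` is a finite cover of degree `d` whose branch divisor (the zero locus of the
discriminant) is the closed subscheme `{g = 0}`. -/
def IsCoverWithBranch {X Y : Scheme.{u}} (φ : X ⟶ Y) (d : ℕ) (g : Γ(Y, ⊤)) : Prop :=
  IsCoverWithDiscr φ d fun U δ => Ideal.span {δ} = Ideal.span {res g U}

theorem discr_map {R S R' S' ι : Type*} [CommRing R] [CommRing S] [CommRing R'] [CommRing S']
    [Algebra R S] [Algebra R' S'] [Fintype ι] [DecidableEq ι]
    (f : R →+* R') (h : S →+* S')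
    (hfh : ∀ r, h (algebraMap R S r) = algebraMap R' S' (f r))
    (e : Module.Basis ι R S) (e' : Module.Basis ι R' S') (he : ∀ i, e' i = h (e i)) :
    Algebra.discr R' e' = f (Algebra.discr R e) := by
  have key : ∀ x : S, Algebra.trace R' S' (h x) = f (Algebra.trace R S x) := by
    intro x
    rw [Algebra.trace_eq_matrix_trace e, Algebra.trace_eq_matrix_trace e',
      AddMonoidHom.map_trace f]
    congr 1
    ext i j
    rw [Algebra.leftMulMatrix_eq_repr_mul, Matrix.map_apply, Algebra.leftMulMatrix_eq_repr_mul]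
    have h1 : h x * e' j = ∑ l, f (e.repr (x * e j) l) • e' l := by
      rw [he, ← map_mul]
      conv_lhs => rw [← e.sum_repr (x * e j)]
      rw [map_sum]
      refine Finset.sum_congr rfl fun l _ => ?_
      rw [Algebra.smul_def, map_mul, hfh, Algebra.smul_def, he]
    rw [h1, e'.repr_sum_self]
  rw [Algebra.discr_def, Algebra.discr_def, RingHom.map_det]
  congr 1
  ext i j
  simp only [Algebra.traceMatrix_apply, Algebra.traceForm_apply, RingHom.mapMatrix_apply,
    Matrix.map_apply]
  rw [he, he, ← map_mul, key]

theorem exists_basis_of_isPushout {ι : Type} [Fintype ι] [DecidableEq ι]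
    {A B A' B' : CommRingCat.{u}} {p : A ⟶ B} {q : A ⟶ A'} {q' : B ⟶ B'} {p' : A' ⟶ B'}
    (H : IsPushout p q q' p')
    (e : letI := p.hom.toAlgebra; Module.Basis ι A B) :
    letI := p.hom.toAlgebra
    letI := p'.hom.toAlgebra
    ∃ e' : Module.Basis ι A' B', Algebra.discr A' e' = q.hom (Algebra.discr A e) := by
  algebraize [p.hom, q.hom, q'.hom, p'.hom, p'.hom.comp q.hom]
  have : IsScalarTower A B B' := .of_algebraMap_eq' congr($(H.1.1).hom).symm
  have hp : Algebra.IsPushout A A' B B' := CommRingCat.isPushout_iff_isPushout.mp H.flip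
  refine ⟨hp.out.basis e, discr_map q.hom q'.hom ?_ e _ fun i => ?_⟩
  · intro r
    exact congr($(H.1.1).hom r)
  · exact hp.out.basis_apply e i

theorem res_appTop {X Y : Scheme.{u}} (f : X ⟶ Y) (g : Γ(Y, ⊤)) (U : Y.Opens) (V : X.Opens)
    (h : V ≤ f ⁻¹ᵁ U) :
    (f.appLE U V h).hom (res g U) = res (f.appTop.hom g) V := by
  have : (Y.presheaf.map (homOfLE le_top).op) ≫ f.appLE U V h
      = f.appTop ≫ X.presheaf.map (homOfLE le_top).op := by
    rw [Scheme.Hom.map_appLE]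
    rfl
  exact congrArg (fun q => q.hom g) this

theorem IsCoverWithBranch.of_isPullback {X Y X' Y' : Scheme.{u}} {φ : X ⟶ Y} {φ' : X' ⟶ Y'}
    {h : X' ⟶ X} {f : Y' ⟶ Y} (H : IsPullback h φ' φ f) {d : ℕ} {g : Γ(Y, ⊤)}
    (hφ : IsCoverWithBranch φ d g) : IsCoverWithBranch φ' d (f.appTop.hom g) := by
  obtain ⟨haff, hloc⟩ := hφ
  refine ⟨MorphismProperty.of_isPullback H haff, fun y' => ?_⟩
  obtain ⟨U, hU, hyU, e, he⟩ := hloc (f y')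
  obtain ⟨_, ⟨V, hV, rfl⟩, hyV, hVU⟩ :=
    Y'.isBasis_affineOpens.exists_subset_of_mem_open
      (show y' ∈ ((f ⁻¹ᵁ U : Y'.Opens) : Set Y') from hyU) (f ⁻¹ᵁ U).isOpen
  refine ⟨V, hV, hyV, ?_⟩
  have hVU' : V ≤ f ⁻¹ᵁ U := hVU
  have hle : φ' ⁻¹ᵁ V ≤ h ⁻¹ᵁ φ ⁻¹ᵁ U := by
    rw [← Scheme.Hom.comp_preimage, H.w, Scheme.Hom.comp_preimage]
    exact fun x hx => hVU' hx
  have hUY : φ' ⁻¹ᵁ V = h ⁻¹ᵁ (φ ⁻¹ᵁ U) ⊓ φ' ⁻¹ᵁ V := (inf_eq_right.mpr hle).symm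
  have hpo := (isIso_pushoutSection_iff H hVU' le_rfl hUY).mp
    (isIso_pushoutSection_of_isAffineOpen H hVU' le_rfl hUY hU hV (hU.preimage φ))
  rw [← Scheme.Hom.app_eq_appLE, ← Scheme.Hom.app_eq_appLE] at hpo
  obtain ⟨e', he'⟩ := exists_basis_of_isPushout hpo e
  refine ⟨e', ?_⟩
  have h2 := congrArg (Ideal.map (f.appLE U V hVU').hom) he
  rw [Ideal.map_span, Ideal.map_span, Set.image_singleton, Set.image_singleton,
    res_appTop] at h2
  rw [he']
  exact h2

/-! ### Products over the base field -/

section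

variable {k : Type u} [Field k]

variable (k) in
/-- The structure morphism `Spec A ⟶ Spec k`. -/
def specStr (A : Type u) [CommRing A] [Algebra k A] :
    Spec (CommRingCat.of A) ⟶ Spec (CommRingCat.of k) :=
  Spec.map (CommRingCat.ofHom (algebraMap k A))

/-- The morphism `Spec B ⟶ Spec A` given by a `k`-algebra homomorphism `A → B`. -/
def specMap {A B : Type u} [CommRing A] [Algebra k A] [CommRing B] [Algebra k B]
    (f : A →ₐ[k] B) : Spec (CommRingCat.of B) ⟶ Spec (CommRingCat.of A) :=
  Spec.map (CommRingCat.ofHom f.toRingHom)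

theorem specMap_str {A B : Type u} [CommRing A] [Algebra k A] [CommRing B] [Algebra k B]
    (f : A →ₐ[k] B) : specMap f ≫ specStr k A = specStr k B := by
  rw [specMap, specStr, specStr, ← Spec.map_comp, ← CommRingCat.ofHom_comp]
  congr 2
  exact f.comp_algebraMap

variable (k) in
/-- The affine `k`-scheme `Spec A`. -/
def specOver (A : Type u) [CommRing A] [Algebra k A] : Over (Spec (CommRingCat.of k)) :=
  Over.mk (specStr k A)

/-- The morphism `Spec B ⟶ Spec A` over `k` given by a `k`-algebra homomorphism `A → B`. -/
def specOverMap {A B : Type u} [CommRing A] [Algebra k A] [CommRing B] [Algebra k B]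
    (f : A →ₐ[k] B) : specOver k B ⟶ specOver k A :=
  Over.homMk (specMap f) (specMap_str f)

/-- The morphism of schemes underlying a point `x : Spec A ⟶ T` over `k`. -/
def pointHom {A : Type u} [CommRing A] [Algebra k A] {T : Over (Spec (CommRingCat.of k))}
    (x : specOver k A ⟶ T) : Spec (CommRingCat.of A) ⟶ T.left :=
  x.left

theorem pointHom_str {A : Type u} [CommRing A] [Algebra k A]
    {T : Over (Spec (CommRingCat.of k))} (x : specOver k A ⟶ T) :
    pointHom x ≫ T.hom = specStr k A :=
  Over.w x

/-- The product `Spec B × T` over `k`. -/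
def prodSpec (B : Type u) [CommRing B] [Algebra k B] (T : Over (Spec (CommRingCat.of k))) :
    Scheme.{u} :=
  pullback (specStr k B) T.hom

/-- The first projection `Spec B × T ⟶ Spec B`. -/
def prodFst (B : Type u) [CommRing B] [Algebra k B] (T : Over (Spec (CommRingCat.of k))) :
    prodSpec B T ⟶ Spec (CommRingCat.of B) :=
  pullback.fst (specStr k B) T.hom

/-- The second projection `Spec B × T ⟶ T`. -/
def prodSnd (B : Type u) [CommRing B] [Algebra k B] (T : Over (Spec (CommRingCat.of k))) :
    prodSpec B T ⟶ T.left :=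
  pullback.snd (specStr k B) T.hom

theorem isPullback_prodSpec (B : Type u) [CommRing B] [Algebra k B]
    (T : Over (Spec (CommRingCat.of k))) :
    IsPullback (prodFst B T) (prodSnd B T) (specStr k B) T.hom :=
  IsPullback.of_hasPullback _ _

/-- The morphism `Spec B × T' ⟶ Spec B × T` induced by `T' ⟶ T`. -/
def prodMapRight (B : Type u) [CommRing B] [Algebra k B] {T' T : Over (Spec (CommRingCat.of k))}
    (g : T' ⟶ T) : prodSpec B T' ⟶ prodSpec B T :=
  (isPullback_prodSpec B T).lift (prodFst B T') (prodSnd B T' ≫ g.left) (by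
    rw [Category.assoc, Over.w, (isPullback_prodSpec B T').w])

/-- The morphism `Spec B' × T ⟶ Spec B × T` induced by `B → B'`. -/
def prodMapLeft {B B' : Type u} [CommRing B] [Algebra k B] [CommRing B'] [Algebra k B']
    (f : B →ₐ[k] B') (T : Over (Spec (CommRingCat.of k))) : prodSpec B' T ⟶ prodSpec B T :=
  (isPullback_prodSpec B T).lift (prodFst B' T ≫ specMap f) (prodSnd B' T) (by
    rw [Category.assoc, specMap_str, (isPullback_prodSpec B' T).w])

/-- For a point `x : Spec A ⟶ T`, the morphism
`Spec (A ⊗ B) = Spec B × Spec A ⟶ Spec B × T` induced by `x`. -/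
def tensorPoint (B : Type u) [CommRing B] [Algebra k B] {T : Over (Spec (CommRingCat.of k))}
    {A : Type u} [CommRing A] [Algebra k A] (x : specOver k A ⟶ T) :
    Spec (CommRingCat.of (A ⊗[k] B)) ⟶ prodSpec B T :=
  (isPullback_prodSpec B T).lift
    (specMap (Algebra.TensorProduct.includeRight : B →ₐ[k] A ⊗[k] B))
    (specMap (Algebra.TensorProduct.includeLeft : A →ₐ[k] A ⊗[k] B) ≫ pointHom x) (by
    rw [Category.assoc, pointHom_str, specMap_str, specMap_str])

theorem prodMapRight_fst (B : Type u) [CommRing B] [Algebra k B]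
    {T' T : Over (Spec (CommRingCat.of k))} (g : T' ⟶ T) :
    prodMapRight B g ≫ prodFst B T = prodFst B T' :=
  IsPullback.lift_fst _ _ _ _

theorem prodMapRight_snd (B : Type u) [CommRing B] [Algebra k B]
    {T' T : Over (Spec (CommRingCat.of k))} (g : T' ⟶ T) :
    prodMapRight B g ≫ prodSnd B T = prodSnd B T' ≫ g.left :=
  IsPullback.lift_snd _ _ _ _

theorem prodMapLeft_fst {B B' : Type u} [CommRing B] [Algebra k B] [CommRing B'] [Algebra k B']
    (f : B →ₐ[k] B') (T : Over (Spec (CommRingCat.of k))) :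
    prodMapLeft f T ≫ prodFst B T = prodFst B' T ≫ specMap f :=
  IsPullback.lift_fst _ _ _ _

theorem prodMapLeft_snd {B B' : Type u} [CommRing B] [Algebra k B] [CommRing B'] [Algebra k B']
    (f : B →ₐ[k] B') (T : Over (Spec (CommRingCat.of k))) :
    prodMapLeft f T ≫ prodSnd B T = prodSnd B' T :=
  IsPullback.lift_snd _ _ _ _

theorem prodMapRight_id (B : Type u) [CommRing B] [Algebra k B]
    (T : Over (Spec (CommRingCat.of k))) : prodMapRight B (𝟙 T) = 𝟙 _ := by
  apply (isPullback_prodSpec B T).hom_ext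
  · rw [prodMapRight_fst, Category.id_comp]
  · rw [prodMapRight_snd, Category.id_comp, Over.id_left, Category.comp_id]

theorem prodMapRight_comp (B : Type u) [CommRing B] [Algebra k B]
    {T T' T'' : Over (Spec (CommRingCat.of k))} (g' : T'' ⟶ T') (g : T' ⟶ T) :
    prodMapRight B (g' ≫ g) = prodMapRight B g' ≫ prodMapRight B g := by
  apply (isPullback_prodSpec B T).hom_ext
  · rw [Category.assoc, prodMapRight_fst, prodMapRight_fst, prodMapRight_fst]
  · rw [Category.assoc, prodMapRight_snd, prodMapRight_snd, ← Category.assoc, prodMapRight_snd,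
      Category.assoc, Over.comp_left]

theorem isPullback_prodMapRight (B : Type u) [CommRing B] [Algebra k B]
    {T' T : Over (Spec (CommRingCat.of k))} (g : T' ⟶ T) :
    IsPullback (prodMapRight B g) (prodSnd B T') (prodSnd B T) g.left := by
  refine IsPullback.of_right ?_ (prodMapRight_snd B g) (isPullback_prodSpec B T)
  rw [prodMapRight_fst, Over.w]
  exact isPullback_prodSpec B T'

theorem isPullback_prodMapLeft {B B' : Type u} [CommRing B] [Algebra k B] [CommRing B']
    [Algebra k B'] (f : B →ₐ[k] B') {T' T : Over (Spec (CommRingCat.of k))} (g : T' ⟶ T) :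
    IsPullback (prodMapRight B' g) (prodMapLeft f T') (prodMapLeft f T) (prodMapRight B g) := by
  refine IsPullback.of_bot ?_ ?_ (isPullback_prodMapRight B g)
  · rw [prodMapLeft_snd, prodMapLeft_snd]
    exact isPullback_prodMapRight B' g
  · apply (isPullback_prodSpec B T).hom_ext
    · rw [Category.assoc, Category.assoc, prodMapLeft_fst, prodMapRight_fst, prodMapLeft_fst,
        ← Category.assoc, prodMapRight_fst]
    · rw [Category.assoc, Category.assoc, prodMapLeft_snd, prodMapRight_snd, prodMapRight_snd,
        ← Category.assoc, prodMapLeft_snd]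

end

/-! ### Crimps -/

section

variable {k : Type u} [Field k]

/-- The function `t ^ b` on `Δ × T`, where `Δ = Spec k⟦t⟧`. Its zero locus is `Σ × T`. -/
def sigma (b : ℕ) (T : Over (Spec (CommRingCat.of k))) : Γ(prodSpec k⟦X⟧ T, ⊤) :=
  (prodFst k⟦X⟧ T).appTop.hom
    ((Scheme.ΓSpecIso (CommRingCat.of k⟦X⟧)).inv.hom ((PowerSeries.X : k⟦X⟧) ^ b))

theorem sigma_map (b : ℕ) {T' T : Over (Spec (CommRingCat.of k))} (g : T' ⟶ T) :
    (prodMapRight k⟦X⟧ g).appTop.hom (sigma b T) = sigma b T' := by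
  have h := congrArg (fun q => q.appTop.hom
    ((Scheme.ΓSpecIso (CommRingCat.of k⟦X⟧)).inv.hom ((PowerSeries.X : k⟦X⟧) ^ b)))
    (prodMapRight_fst k⟦X⟧ g)
  simp only [Scheme.Hom.comp_appTop] at h
  exact h

theorem isIso_restrict_of_isPullback {X Y X' Y' : Scheme.{u}} {f : X ⟶ Y} {f' : X' ⟶ Y'}
    {h : X' ⟶ X} {g : Y' ⟶ Y} (H : IsPullback h f' f g) (U : Y.Opens) (hf : IsIso (f ∣_ U)) :
    IsIso (f' ∣_ (g ⁻¹ᵁ U)) := by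
  rw [← Scheme.Hom.resLE_eq_morphismRestrict] at hf ⊢
  have hUY : f' ⁻¹ᵁ (g ⁻¹ᵁ U) = h ⁻¹ᵁ (f ⁻¹ᵁ U) ⊓ f' ⁻¹ᵁ (g ⁻¹ᵁ U) := by
    rw [← Scheme.Hom.comp_preimage, ← Scheme.Hom.comp_preimage, H.w, inf_idem]
  have hp := Scheme.Hom.isPullback_resLE H (le_refl (g ⁻¹ᵁ U)) (le_refl (f ⁻¹ᵁ U)) hUY
  exact hp.isIso_snd_of_isIso

variable (O : Type u) [CommRing O] [Algebra k O] [Algebra k⟦X⟧ O] [IsScalarTower k k⟦X⟧ O]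

/-- The base change `C̃ × T ⟶ Δ × T` of the cover `C̃ = Spec O ⟶ Δ`. -/
def baseCover (T : Over (Spec (CommRingCat.of k))) : prodSpec O T ⟶ prodSpec k⟦X⟧ T :=
  prodMapLeft (IsScalarTower.toAlgHom k k⟦X⟧ O) T

/-- A crimp over `T` of the cover `C̃ = Spec O ⟶ Δ`: a factorization
`C̃ × T ⟶ C ⟶ Δ × T` where `C ⟶ Δ × T` is a finite cover of degree `d` with branch divisor
`Σ × T` and `C̃ × T ⟶ C` is an isomorphism away from `Σ × T`. -/
structure Crimp (d b : ℕ) (T : Over (Spec (CommRingCat.of k))) where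
  /-- the crimped curve -/
  C : Scheme.{u}
  /-- the crimping morphism -/
  ν : prodSpec O T ⟶ C
  /-- the cover -/
  φ : C ⟶ prodSpec k⟦X⟧ T
  comp_eq : ν ≫ φ = baseCover O T
  cover : IsCoverWithBranch φ d (sigma b T)
  isIso_away : IsIso (ν ∣_ (φ ⁻¹ᵁ (prodSpec k⟦X⟧ T).basicOpen (sigma b T)))

variable {O} {d b : ℕ}

/-- Isomorphism of crimps. -/
instance Crimp.setoid (T : Over (Spec (CommRingCat.of k))) : Setoid (Crimp O d b T) where
  r D D' := ∃ i : D.C ≅ D'.C, D.ν ≫ i.hom = D'.ν ∧ i.hom ≫ D'.φ = D.φ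
  iseqv :=
    { refl := fun D => ⟨Iso.refl _, by simp, by simp⟩
      symm := by
        rintro D D' ⟨i, h1, h2⟩
        exact ⟨i.symm, by simp [← h1], by simp [← h2]⟩
      trans := by
        rintro D D' D'' ⟨i, h1, h2⟩ ⟨j, h3, h4⟩
        refine ⟨i ≪≫ j, ?_, ?_⟩
        · rw [Iso.trans_hom, ← Category.assoc, h1, h3]
        · rw [Iso.trans_hom, Category.assoc, h4, h2] }

/-- The crimping morphism of the pullback of a crimp. -/
def Crimp.pullbackNu {T T' : Over (Spec (CommRingCat.of k))} (D : Crimp O d b T) (g : T' ⟶ T) :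
    prodSpec O T' ⟶ pullback D.φ (prodMapRight k⟦X⟧ g) :=
  pullback.lift (prodMapRight O g ≫ D.ν) (baseCover O T') (by
    rw [Category.assoc, D.comp_eq]
    exact (isPullback_prodMapLeft _ g).w)

theorem Crimp.isPullback_nu {T T' : Over (Spec (CommRingCat.of k))} (D : Crimp O d b T)
    (g : T' ⟶ T) :
    IsPullback (prodMapRight O g) (D.pullbackNu g) D.ν
      (pullback.fst D.φ (prodMapRight k⟦X⟧ g)) := by
  refine IsPullback.of_bot ?_ ?_ (IsPullback.of_hasPullback D.φ (prodMapRight k⟦X⟧ g))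
  · rw [D.comp_eq, Crimp.pullbackNu, pullback.lift_snd]
    exact isPullback_prodMapLeft _ g
  · rw [Crimp.pullbackNu, pullback.lift_fst]

/-- The pullback of a crimp along `g : T' ⟶ T`. -/
def Crimp.pullback {T T' : Over (Spec (CommRingCat.of k))} (D : Crimp O d b T) (g : T' ⟶ T) :
    Crimp O d b T' where
  C := Limits.pullback D.φ (prodMapRight k⟦X⟧ g)
  ν := D.pullbackNu g
  φ := Limits.pullback.snd _ _
  comp_eq := by rw [Crimp.pullbackNu, pullback.lift_snd]
  cover := by
    rw [← sigma_map b g]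
    exact D.cover.of_isPullback (IsPullback.of_hasPullback D.φ (prodMapRight k⟦X⟧ g))
  isIso_away := by
    have hU : (pullback.snd D.φ (prodMapRight k⟦X⟧ g)) ⁻¹ᵁ
        (prodSpec k⟦X⟧ T').basicOpen (sigma b T')
        = (pullback.fst D.φ (prodMapRight k⟦X⟧ g)) ⁻¹ᵁ
          (D.φ ⁻¹ᵁ (prodSpec k⟦X⟧ T).basicOpen (sigma b T)) := by
      rw [← sigma_map b g, ← Scheme.Hom.comp_preimage, pullback.condition,
        Scheme.Hom.comp_preimage, Scheme.preimage_basicOpen_top (prodMapRight k⟦X⟧ g)]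
    have := isIso_restrict_of_isPullback (D.isPullback_nu g) _ D.isIso_away
    rw [hU]
    exact this

/-- The projection from the curve of the pullback of a crimp. -/
def Crimp.pullbackFst {T T' : Over (Spec (CommRingCat.of k))} (D : Crimp O d b T)
    (g : T' ⟶ T) : (D.pullback g).C ⟶ D.C :=
  pullback.fst _ _

theorem Crimp.isPullback_pullback {T T' : Over (Spec (CommRingCat.of k))} (D : Crimp O d b T)
    (g : T' ⟶ T) :
    IsPullback (D.pullbackFst g) (D.pullback g).φ D.φ (prodMapRight k⟦X⟧ g) :=
  IsPullback.of_hasPullback _ _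

theorem Crimp.pullback_ν_fst {T T' : Over (Spec (CommRingCat.of k))} (D : Crimp O d b T)
    (g : T' ⟶ T) : (D.pullback g).ν ≫ D.pullbackFst g = prodMapRight O g ≫ D.ν :=
  pullback.lift_fst _ _ _

theorem Crimp.equiv_pullback {T T' : Over (Spec (CommRingCat.of k))} (D : Crimp O d b T)
    (D' : Crimp O d b T') (g : T' ⟶ T) (h : D'.C ⟶ D.C)
    (H : IsPullback h D'.φ D.φ (prodMapRight k⟦X⟧ g))
    (hν : D'.ν ≫ h = prodMapRight O g ≫ D.ν) : D' ≈ D.pullback g := by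
  refine ⟨H.isoIsPullback _ _ (D.isPullback_pullback g), ?_,
    H.isoIsPullback_hom_snd _ _ (D.isPullback_pullback g)⟩
  apply (D.isPullback_pullback g).hom_ext
  · rw [Category.assoc, IsPullback.isoIsPullback_hom_fst, hν, Crimp.pullback_ν_fst]
  · rw [Category.assoc, IsPullback.isoIsPullback_hom_snd, D'.comp_eq, (D.pullback g).comp_eq]

theorem Crimp.pullback_equiv {T T' : Over (Spec (CommRingCat.of k))} {D D' : Crimp O d b T}
    (h : D ≈ D') (g : T' ⟶ T) : D.pullback g ≈ D'.pullback g := by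
  obtain ⟨i, h1, h2⟩ := h
  refine Crimp.equiv_pullback D' (D.pullback g) g (D.pullbackFst g ≫ i.hom) ?_ ?_
  · refine IsPullback.of_iso (D.isPullback_pullback g) (Iso.refl _) i (Iso.refl _) (Iso.refl _)
      ?_ ?_ ?_ ?_
    · rw [Iso.refl_hom, Category.id_comp]
    · rw [Iso.refl_hom, Iso.refl_hom, Category.id_comp, Category.comp_id]
    · rw [Iso.refl_hom, Category.comp_id, h2]
    · rw [Iso.refl_hom, Iso.refl_hom, Category.id_comp, Category.comp_id]
  · rw [← Category.assoc, Crimp.pullback_ν_fst, Category.assoc, h1]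

variable (O d b) in
/-- The functor of crimps, sending a `k`-scheme `T` to the set of isomorphism classes of crimps
over `T`. -/
def crimpFunctor : (Over (Spec (CommRingCat.of k)))ᵒᵖ ⥤ Type (u + 1) where
  obj T := Quotient (Crimp.setoid (O := O) (d := d) (b := b) T.unop)
  map g := ↾(Quotient.map (fun D => D.pullback g.unop) fun _ _ h => Crimp.pullback_equiv h g.unop)
  map_id T := by
    ext D
    induction D using Quotient.inductionOn with | _ D => ?_
    refine Quotient.sound (Setoid.symm (Crimp.equiv_pullback D D (𝟙 _) (𝟙 _) ?_ ?_))
    · erw [prodMapRight_id]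
      exact IsPullback.of_horiz_isIso ⟨by rw [Category.id_comp, Category.comp_id]⟩
    · erw [prodMapRight_id, Category.id_comp, Category.comp_id]
  map_comp {T T' T''} g g' := by
    ext D
    induction D using Quotient.inductionOn with | _ D => ?_
    refine Quotient.sound (Setoid.symm (Crimp.equiv_pullback D _ (g'.unop ≫ g.unop)
      ((D.pullback g.unop).pullbackFst g'.unop ≫ D.pullbackFst g.unop) ?_ ?_))
    · rw [prodMapRight_comp]
      exact ((D.pullback g.unop).isPullback_pullback g'.unop).paste_horiz
        (D.isPullback_pullback g.unop)
    · rw [prodMapRight_comp, ← Category.assoc, Crimp.pullback_ν_fst, Category.assoc,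
        Crimp.pullback_ν_fst, Category.assoc]

end

/-! ### The Quot scheme -/

section

variable {k : Type u} [Field k]
variable (O : Type u) [CommRing O] [Algebra k O] [Algebra k⟦X⟧ O] [IsScalarTower k k⟦X⟧ O]

variable (k) in
/-- The `k⟦t⟧`-algebra `F = O / t ^ b O`. -/
abbrev ModT (b : ℕ) : Type u :=
  O ⧸ Ideal.span {algebraMap k⟦X⟧ O PowerSeries.X ^ b}

/-- A family over `T` of length-`δ` quotients of the `Δ`-module `F = O / t ^ b O`, that is, a
quasi-coherent quotient `Q = (F ⊗ O_T) / S` on `Δ × T` which is locally free of rank `δ`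
over `T`. It is given by its values on all points `x : Spec A ⟶ T` with values in `k`-algebras
`A`: for each of them a `k⟦t⟧`-stable `A`-submodule `S_x ⊆ A ⊗ F` with quotient locally free of
rank `δ`, compatible with base change. -/
@[ext]
structure QuotFamily (b : ℕ) (δ : ℚ) (T : Over (Spec (CommRingCat.of k))) where
  /-- the kernel of the quotient -/
  S : ∀ (A : Type u) [CommRing A] [Algebra k A], (specOver k A ⟶ T) →
    Submodule A (A ⊗[k] ModT k O b)
  smul_mem : ∀ (A : Type u) [CommRing A] [Algebra k A] (x : specOver k A ⟶ T) (r : k⟦X⟧),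
    ∀ s ∈ S A x, (1 ⊗ₜ[k] algebraMap k⟦X⟧ (ModT k O b) r) * s ∈ S A x
  finite : ∀ (A : Type u) [CommRing A] [Algebra k A] (x : specOver k A ⟶ T),
    Module.Finite A ((A ⊗[k] ModT k O b) ⧸ S A x)
  projective : ∀ (A : Type u) [CommRing A] [Algebra k A] (x : specOver k A ⟶ T),
    Module.Projective A ((A ⊗[k] ModT k O b) ⧸ S A x)
  rank_eq : ∀ (A : Type u) [CommRing A] [Algebra k A] (x : specOver k A ⟶ T)
    (p : PrimeSpectrum A), (Module.rankAtStalk ((A ⊗[k] ModT k O b) ⧸ S A x) p : ℚ) = δ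
  map_eq : ∀ (A B : Type u) [CommRing A] [Algebra k A] [CommRing B] [Algebra k B]
    (f : A →ₐ[k] B) (x : specOver k A ⟶ T), S B (specOverMap f ≫ x) =
      Submodule.span B (Algebra.TensorProduct.map f (AlgHom.id k (ModT k O b)) '' S A x)

variable {O} {b : ℕ} {δ : ℚ}

/-- The pullback of a family of quotients. -/
def QuotFamily.pullback {T T' : Over (Spec (CommRingCat.of k))} (Q : QuotFamily O b δ T)
    (g : T' ⟶ T) : QuotFamily O b δ T' where
  S A _ _ x := Q.S A (x ≫ g)
  smul_mem A _ _ x := Q.smul_mem A (x ≫ g)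
  finite A _ _ x := Q.finite A (x ≫ g)
  projective A _ _ x := Q.projective A (x ≫ g)
  rank_eq A _ _ x := Q.rank_eq A (x ≫ g)
  map_eq A B _ _ _ _ f x := by rw [Category.assoc, Q.map_eq]

variable (O b δ) in
/-- The Quot functor of length-`δ` quotients of the `Δ`-module `F = O / t ^ b O`. -/
def quotFunctor : (Over (Spec (CommRingCat.of k)))ᵒᵖ ⥤ Type (u + 1) where
  obj T := QuotFamily O b δ T.unop
  map g := ↾(fun Q => Q.pullback g.unop)
  map_id T := by
    refine ConcreteCategory.hom_ext _ _ fun Q => QuotFamily.ext ?_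
    funext A _ _ x
    change Q.S A _ = Q.S A _
    simp
  map_comp g g' := by
    refine ConcreteCategory.hom_ext _ _ fun Q => QuotFamily.ext ?_
    funext A _ _ x
    change Q.S A _ = Q.S A _
    simp

/-- The kernel `S ⊆ F ⊗ O_T` of the quotient is a subalgebra: it is closed under multiplication
and contains `1`. -/
structure QuotFamily.IsSubalgebra {T : Over (Spec (CommRingCat.of k))}
    (Q : QuotFamily O b δ T) : Prop where
  mul_mem : ∀ (A : Type u) [CommRing A] [Algebra k A] (x : specOver k A ⟶ T),
    ∀ s ∈ Q.S A x, ∀ s' ∈ Q.S A x, s * s' ∈ Q.S A x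
  one_mem : ∀ (A : Type u) [CommRing A] [Algebra k A] (x : specOver k A ⟶ T), 1 ∈ Q.S A x

section

variable {T : Over (Spec (CommRingCat.of k))} {Q : QuotFamily O b δ T} (hQ : Q.IsSubalgebra)
  {A : Type u} [CommRing A] [Algebra k A] (x : specOver k A ⟶ T)

variable (k O b A) in
/-- The projection `A ⊗ O ⟶ A ⊗ F`. -/
def projF : A ⊗[k] O →ₐ[A] A ⊗[k] ModT k O b :=
  Algebra.TensorProduct.map (AlgHom.id A A) (Ideal.Quotient.mkₐ k _)

variable (k O A) in
/-- The homomorphism `A ⊗ k⟦t⟧ ⟶ A ⊗ O` corresponding to `C̃ × Spec A ⟶ Δ × Spec A`. -/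
def coverAlgHom : A ⊗[k] k⟦X⟧ →ₐ[A] A ⊗[k] O :=
  Algebra.TensorProduct.map (AlgHom.id A A) (IsScalarTower.toAlgHom k k⟦X⟧ O)

/-- The fiber product `O_C = O_{C̃ × Spec A} ×_{A ⊗ F} S_x`, as a subalgebra of `A ⊗ O`. -/
def QuotFamily.IsSubalgebra.OC : Subalgebra A (A ⊗[k] O) where
  carrier := {z | projF k O b A z ∈ Q.S A x}
  mul_mem' {z w} hz hw := by
    rw [Set.mem_ofPred_eq, map_mul]
    exact hQ.mul_mem A x _ hz _ hw
  add_mem' {z w} hz hw := by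
    rw [Set.mem_ofPred_eq, map_add]
    exact add_mem hz hw
  algebraMap_mem' r := by
    rw [Set.mem_ofPred_eq, AlgHom.commutes,
      Algebra.algebraMap_eq_smul_one (A := A ⊗[k] ModT k O b)]
    exact (Q.S A x).smul_mem r (hQ.one_mem A x)

theorem QuotFamily.IsSubalgebra.coverAlgHom_mem (y : A ⊗[k] k⟦X⟧) :
    coverAlgHom k O A y ∈ hQ.OC x := by
  induction y with
  | zero => rw [map_zero]; exact zero_mem _
  | add y z hy hz => rw [map_add]; exact add_mem hy hz
  | tmul a r =>
    change projF k O b A (coverAlgHom k O A (a ⊗ₜ r)) ∈ Q.S A x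
    have h := (Q.S A x).smul_mem a (Q.smul_mem A x r 1 (hQ.one_mem A x))
    rw [mul_one, TensorProduct.smul_tmul', smul_eq_mul, mul_one] at h
    exact h

/-- The structure homomorphism `A ⊗ k⟦t⟧ ⟶ O_C`, corresponding to `C ⟶ Δ × Spec A`. -/
def QuotFamily.IsSubalgebra.str : A ⊗[k] k⟦X⟧ →ₐ[A] hQ.OC x :=
  (coverAlgHom k O A).codRestrict (hQ.OC x) (hQ.coverAlgHom_mem x)

/-- The morphism `C = Spec O_C ⟶ Δ × Spec A`. -/
def QuotFamily.IsSubalgebra.curveφ :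
    Spec (CommRingCat.of (hQ.OC x)) ⟶ Spec (CommRingCat.of (A ⊗[k] k⟦X⟧)) :=
  Spec.map (CommRingCat.ofHom (hQ.str x).toRingHom)

/-- The morphism `C̃ × Spec A ⟶ C = Spec O_C`. -/
def QuotFamily.IsSubalgebra.curveν :
    Spec (CommRingCat.of (A ⊗[k] O)) ⟶ Spec (CommRingCat.of (hQ.OC x)) :=
  Spec.map (CommRingCat.ofHom (hQ.OC x).val.toRingHom)

end

/-- The conditions defining the closed subscheme `Y` of the Quot scheme. The kernel `S` is a
subalgebra, and `t ^ b` annihilates the cokernel `B` of the discriminant section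
`O ⟶ (det O_C)^{∨ ⊗ 2}`: locally on `Δ × Spec A` the algebra `O_C` is free of rank `d` and
`B` is the quotient by the discriminant of a basis, so this says that the latter
divides `t ^ b`. -/
def QuotFamily.IsInY {T : Over (Spec (CommRingCat.of k))} (Q : QuotFamily O b δ T) (d : ℕ) :
    Prop :=
  ∃ hQ : Q.IsSubalgebra, ∀ (A : Type u) [CommRing A] [Algebra k A] (x : specOver k A ⟶ T),
    IsCoverWithDiscr (hQ.curveφ x) d fun U δ =>
      δ ∣ res ((Scheme.ΓSpecIso (CommRingCat.of (A ⊗[k] k⟦X⟧))).inv.hom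
        (1 ⊗ₜ[k] (PowerSeries.X : k⟦X⟧) ^ b)) U

/-- The crimp `D` is the one constructed from the family of quotients `Q`: over each point
`x : Spec A ⟶ T` it restricts to `C̃ × Spec A ⟶ Spec O_C ⟶ Δ × Spec A`. -/
def QuotFamily.IsSubalgebra.Constructs {T : Over (Spec (CommRingCat.of k))}
    {Q : QuotFamily O b δ T} (hQ : Q.IsSubalgebra) {d : ℕ} (D : Crimp O d b T) : Prop :=
  ∀ (A : Type u) [CommRing A] [Algebra k A] (x : specOver k A ⟶ T),
    ∃ ψ : Spec (CommRingCat.of (hQ.OC x)) ⟶ D.C,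
      IsPullback ψ (hQ.curveφ x) D.φ (tensorPoint k⟦X⟧ x) ∧
      hQ.curveν x ≫ ψ = tensorPoint O x ≫ D.ν

end

/-! ### Projective schemes over a field -/

section

attribute [local instance] MvPolynomial.gradedAlgebra

variable (k : Type u) [Field k]

/-- Projective space `ℙ^n` over `k`. -/
def projSpace (n : ℕ) : Over (Spec (CommRingCat.of k)) :=
  Over.mk (Proj.toSpecZero (MvPolynomial.homogeneousSubmodule (Fin (n + 1)) k) ≫
    Spec.map (CommRingCat.ofHom
      (algebraMap k (MvPolynomial.homogeneousSubmodule (Fin (n + 1)) k 0))))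

variable {k}

/-- A `k`-scheme is projective if it has a closed embedding into some `ℙ^n` over `k`. -/
def IsProjective (Y : Over (Spec (CommRingCat.of k))) : Prop :=
  ∃ (n : ℕ) (i : Y ⟶ projSpace k n), IsClosedImmersion i.left

end

end

end Crimping

/-!
The proof compares three kinds of data over a `k`-scheme `T`: quotients of `F`, lattices of
functions in `O`, and crimps. All of them are studied through points `Spec A → T`.

*The Quot scheme.* Since `F = O / t^b O` is a finite-dimensional vector space, a quotient of
`A ⊗ F` of rank `m` is locally on `Spec A` the image of a matrix with `m` rows which
contains the identity matrix, and it is determined by the Plücker coordinates of that matrix. The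
points of projective space which arise in this way, and whose kernel is stable under `k⟦t⟧`, are
given in each standard chart by explicit equations (`chartEqs`). They define a closed subscheme of
projective space, which represents the Quot functor: `exists_quotFunctor_representableBy`.

*Closedness of `Y`.* A point `S` of the Quot scheme over `A` corresponds to its preimage `E` in
`A ⊗ O` (`liftSub`). The `A`-module `E / t E` is projective of rank `d`, since `(A ⊗ O) / E` is
projective (`projective_quotient_map`); by Nakayama's lemma a basis of it lifts to a basis `e` of
`E` near the points with `t = 0` (`IsQuotSub.exists_locBasis`), while `E = A ⊗ O` where `t` is
invertible. The discriminant of `e` divides a power `t^c` with `c` independent of `S`, up to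
functions which are invertible at `t = 0`. Hence it divides `t^b` if and only if the cofactor is
divisible by `t^(c - b)`, which means that finitely many elements of `A` vanish
(`LocBasis.hasLocDiscr_bcSub_iff`). This condition commutes with base change, and being a
subalgebra is also given by equations, so that `Y` is a closed subscheme:
`QuotFamily.exists_closed`.

*The order of the discriminant.* At a point with values in a field, the discriminant of `E` has
order `a + 2 δ` in `t`, where `δ` is the colength of `E` (`LocBasis.associated_discr`). If
`2 δ = b - a`, then the discriminant can divide `t^b` only if both define the same divisor
(`HasLocDiscr.of_rank`); conversely, a lattice with branch divisor `t^b` has colength `(b - a) / 2`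
(`HasLocDiscr.rank_eq`).

*From crimps to the Quot scheme.* The functions on a crimp over `Spec A` embed in `A ⊗ O`, because
`t` is a nonzerodivisor on them and the crimp is an isomorphism where `t` is invertible. Their image
is a lattice which contains `t^b (A ⊗ O)`. Its formation commutes with base change; applied to the
quotients `A / I`, this shows that `(A ⊗ O) / E` is flat over `A`, hence projective, of rank
`(b - a) / 2`. This defines the family of the crimp: `Crimp.family`, `Crimp.isInY_family`.

*From the Quot scheme to crimps.* A crimp is determined by its lattices (`Crimp.equiv_of_sub_eq`),
and the algebras of a family in `Y` over the affine open subsets of `T` form a quasi-coherent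
sheaf, whose relative spectrum is a crimp (`QuotFamily.IsInY.exists_crimp`). Hence `Y` represents
the functor of crimps: `exists_crimpFunctor_representableBy`.
-/

namespace Crimping

noncomputable section

/-! ### Closed subschemes representing local conditions -/

theorem eq_toSpecΓ_comp_SpecMap {T : Scheme.{u}} {R : CommRingCat.{u}} (f : T ⟶ Spec R) :
    f = T.toSpecΓ ≫ Spec.map ((Scheme.ΓSpecIso R).inv ≫ f.appTop) := by
  rw [Spec.map_comp, ← Scheme.toSpecΓ_naturality_assoc, toSpecΓ_SpecMap_ΓSpecIso_inv,
    Category.comp_id]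

/-- A condition `P` on morphisms to `X` which is stable under precomposition, local on the source,
and given near each point of `X` by the vanishing of an ideal is represented by a closed subscheme
of `X`. The subscheme is cut out by the intersection of the kernels of the local models, finitely
many of which suffice because `X` is compact. -/
theorem exists_isClosedImmersion_iff_factors {X : Scheme.{u}} [CompactSpace X]
    [QuasiSeparatedSpace X]
    (P : ∀ {T : Scheme.{u}}, (T ⟶ X) → Prop)
    (hcomp : ∀ {T T' : Scheme.{u}} (g : T' ⟶ T) (f : T ⟶ X), P f → P (g ≫ f))
    (hloc : ∀ {T : Scheme.{u}} (𝒰 : Scheme.OpenCover.{u} T) (f : T ⟶ X),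
      (∀ i, P (𝒰.f i ≫ f)) → P f)
    (hX : ∀ x : X, ∃ (R : CommRingCat.{u}) (j : Spec R ⟶ X) (I : Ideal R), IsOpenImmersion j ∧
      x ∈ Set.range j ∧ ∀ (A : CommRingCat.{u}) (φ : R ⟶ A),
        P (Spec.map φ ≫ j) ↔ I ≤ RingHom.ker φ.hom) :
    ∃ (Z : Scheme.{u}) (i : Z ⟶ X), IsClosedImmersion i ∧
      ∀ {T : Scheme.{u}} (f : T ⟶ X), P f ↔ ∃ g : T ⟶ Z, g ≫ i = f := by
  choose R j I hj hx hP using hX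
  have H : ∀ (x : X) {T : Scheme.{u}} (f : T ⟶ Spec (R x)),
      P (f ≫ j x) ↔ I x ≤ RingHom.ker ((Scheme.ΓSpecIso (R x)).inv ≫ f.appTop).hom := by
    intro x T f
    constructor
    · intro h r hr
      rw [RingHom.mem_ker]
      refine T.affineCover.ext_elem (U := ⊤) _ _ fun i => ?_
      have h1 := hcomp (T.affineCover.f i) _ h
      obtain ⟨φ, hφ⟩ : ∃ φ, Spec.map φ = T.affineCover.f i ≫ f :=
        ⟨_, Spec.map_preimage _⟩
      rw [← Category.assoc, ← hφ] at h1
      replace h1 := (hP x _ φ).1 h1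
      have h2 := congrArg (fun q => q.appTop.hom ((Scheme.ΓSpecIso (R x)).inv.hom r)) hφ
      simp only [Scheme.Hom.comp_appTop] at h2
      rw [map_zero]
      refine h2.symm.trans ?_
      have h3 := congrArg (fun q => q.hom r) (Scheme.ΓSpecIso_inv_naturality φ)
      refine h3.symm.trans ?_
      rw [CommRingCat.hom_comp, RingHom.comp_apply, h1 hr, map_zero]
      rfl
    · intro h
      refine hloc T.affineCover _ fun i => ?_
      rw [← Category.assoc, eq_toSpecΓ_comp_SpecMap (T.affineCover.f i ≫ f), Category.assoc]
      refine hcomp _ _ ((hP x _ _).2 (h.trans fun r hr => ?_))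
      rw [RingHom.mem_ker] at hr ⊢
      rw [Scheme.Hom.comp_appTop, ← Category.assoc, CommRingCat.hom_comp, RingHom.comp_apply, hr,
        map_zero]
  -- Finitely many of the charts cover `X`.
  obtain ⟨s, hs⟩ : ∃ s : Finset X, ⋃ x ∈ s, Set.range (j x) = Set.univ := by
    obtain ⟨s, hs⟩ := CompactSpace.elim_nhds_subcover (fun x => Set.range (j x))
      (fun x => (hj x).base_open.isOpen_range.mem_nhds (hx x))
    exact ⟨s, hs⟩
  let g : ∀ l : s, Spec (CommRingCat.of (R l.1 ⧸ I l.1)) ⟶ X := fun l =>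
    Spec.map (CommRingCat.ofHom (Ideal.Quotient.mk (I l.1))) ≫ j l.1
  have hg : ∀ l, P (g l) := fun l => (hP _ _ _).2 (by
    rw [CommRingCat.hom_ofHom, Ideal.mk_ker])
  -- The closed subscheme: the scheme-theoretic union of the images of the local models.
  let J : X.IdealSheafData := ⨅ l, (g l).ker
  have hcov : ∀ {T : Scheme.{u}} (f : T ⟶ X), ∃ 𝒰 : Scheme.OpenCover.{u} T,
      ∀ i, ∃ (x : X) (k : 𝒰.X i ⟶ Spec (R x)), x ∈ s ∧ k ≫ j x = 𝒰.f i ≫ f := by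
    intro T f
    let 𝒱 : Scheme.OpenCover.{u} X :=
      { I₀ := s
        X := fun x => Spec (R x.1)
        f := fun x => j x.1
        mem₀ := by
          rw [Scheme.presieve₀_mem_precoverage_iff]
          refine ⟨fun x => ?_, fun x => hj x⟩
          have : x ∈ ⋃ x ∈ s, Set.range (j x) := hs ▸ Set.mem_univ x
          simp only [Set.mem_iUnion] at this
          obtain ⟨y, hy, h⟩ := this
          exact ⟨⟨y, hy⟩, h⟩ }
    exact ⟨𝒱.pullback₁ f, fun i => ⟨i.1, pullback.snd f (j i.1), i.2, pullback.condition.symm⟩⟩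
  -- On the chart at `x`, the ideal `I x` is contained in the ideal of `J`, because all local
  -- models satisfy `P`.
  have hJ : P J.subschemeι := by
    obtain ⟨𝒰, h𝒰⟩ := hcov J.subschemeι
    refine hloc 𝒰 _ fun i => ?_
    obtain ⟨x, k, hxs, hk⟩ := h𝒰 i
    rw [← hk]
    have hk' : k = pullback.lift (𝒰.f i) k hk.symm ≫ pullback.snd J.subschemeι (j x) :=
      (pullback.lift_snd _ _ _).symm
    rw [hk', Category.assoc]
    refine hcomp _ _ ((H x _).2 fun r hr => ?_)
    have hker := Scheme.ker_ideal_of_isPullback_of_isOpenImmersion J.subschemeι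
      (pullback.snd J.subschemeι (j x)) (pullback.fst _ _) (j x)
      (IsPullback.of_hasPullback _ _).flip ⟨⊤, isAffineOpen_top _⟩
    have h1 : (Scheme.ΓSpecIso (R x)).inv.hom r ∈
        (pullback.snd J.subschemeι (j x)).ker.ideal ⟨⊤, isAffineOpen_top _⟩ := by
      rw [hker, Scheme.IdealSheafData.ker_subschemeι, Scheme.IdealSheafData.ideal_iInf,
        iInf_apply, Ideal.comap_iInf, Submodule.mem_iInf]
      intro l
      have : QuasiCompact (g l) := quasiCompact_of_compactSpace _
      have hker' := Scheme.ker_ideal_of_isPullback_of_isOpenImmersion (g l)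
        (pullback.snd (g l) (j x)) (pullback.fst _ _) (j x)
        (IsPullback.of_hasPullback _ _).flip ⟨⊤, isAffineOpen_top _⟩
      rw [← hker', Scheme.Hom.ker_apply]
      exact (H x _).1 (by rw [← pullback.condition]; exact hcomp _ _ (hg l)) hr
    rw [Scheme.Hom.ker_apply] at h1
    exact h1
  -- If `f` satisfies `P`, it factors locally through one of the local models.
  refine ⟨J.subscheme, J.subschemeι, inferInstance, fun {T} f => ⟨fun hf => ?_, ?_⟩⟩
  · obtain ⟨𝒰, h𝒰⟩ := hcov f
    choose x k hxs hk using h𝒰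
    have h1 : ∀ i, ∃ m : 𝒰.X i ⟶ J.subscheme, m ≫ J.subschemeι = 𝒰.f i ≫ f := by
      intro i
      have hle : J.subschemeι.ker ≤ (𝒰.f i ≫ f).ker := by
        have h2 := (H _ _).1 (by rw [hk i]; exact hcomp _ _ hf : P (k i ≫ j (x i)))
        rw [Scheme.IdealSheafData.ker_subschemeι]
        refine (iInf_le _ (⟨x i, hxs i⟩ : s)).trans ?_
        have : 𝒰.f i ≫ f = ((𝒰.X i).toSpecΓ ≫ Spec.map (CommRingCat.ofHom
            (Ideal.Quotient.lift (I (x i)) _ h2))) ≫ g ⟨x i, hxs i⟩ := by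
          rw [← hk i]
          simp only [g]
          rw [Category.assoc, ← Spec.map_comp_assoc, ← Category.assoc]
          congr 1
          exact eq_toSpecΓ_comp_SpecMap (k i)
        rw [this]
        exact Scheme.Hom.le_ker_comp _ _
      exact ⟨IsClosedImmersion.lift _ _ hle, IsClosedImmersion.lift_fac _ _ _⟩
    choose m hm using h1
    refine ⟨𝒰.glueMorphisms m fun a b => ?_, 𝒰.hom_ext _ _ fun i => ?_⟩
    · rw [← cancel_mono J.subschemeι, Category.assoc, Category.assoc, hm, hm,
        pullback.condition_assoc]
    · rw [← Category.assoc, Scheme.Cover.ι_glueMorphisms, hm]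
  · rintro ⟨g, rfl⟩
    exact hcomp _ _ hJ

/-! ### Morphisms and points with values in algebras -/

section
variable {k : Type u} [Field k]

theorem hom_ext_of_affine {X Y : Scheme.{u}} (f g : X ⟶ Y)
    (h : ∀ (A : CommRingCat.{u}) (p : Spec A ⟶ X), p ≫ f = p ≫ g) : f = g :=
  X.affineOpenCover.openCover.hom_ext _ _ fun _ => h _ _

/-- Gluing of morphisms from the members of an affine cover; the agreement on overlaps is tested
on affine schemes mapping to two members of the cover. -/
theorem AffineOpenCover.exists_glue {X Y : Scheme.{u}} (𝒰 : Scheme.AffineOpenCover.{u} X)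
    (f : ∀ i, Spec (𝒰.X i) ⟶ Y)
    (hf : ∀ (i j : 𝒰.I₀) (A : CommRingCat.{u}) (p : Spec A ⟶ Spec (𝒰.X i))
      (q : Spec A ⟶ Spec (𝒰.X j)), p ≫ 𝒰.f i = q ≫ 𝒰.f j → p ≫ f i = q ≫ f j) :
    ∃ φ : X ⟶ Y, ∀ i, 𝒰.f i ≫ φ = f i := by
  refine ⟨𝒰.openCover.glueMorphisms f fun (i j : 𝒰.I₀) => hom_ext_of_affine _ _ fun A p => ?_,
    fun i => Scheme.Cover.ι_glueMorphisms 𝒰.openCover f _ i⟩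
  refine (Category.assoc _ _ _).symm.trans (Eq.trans ?_ (Category.assoc _ _ _))
  exact hf i j A _ _ ((Category.assoc _ _ _).trans ((congrArg (fun q => p ≫ q)
    pullback.condition).trans (Category.assoc _ _ _).symm))

theorem AffineOpenCover.hom_ext {X Y : Scheme.{u}} (𝒰 : Scheme.AffineOpenCover.{u} X)
    (f g : X ⟶ Y) (h : ∀ i, 𝒰.f i ≫ f = 𝒰.f i ≫ g) : f = g :=
  Scheme.Cover.hom_ext 𝒰.openCover _ _ h

theorem AffineOpenCover.hom_ext_of_lift {X Y Z : Scheme.{u}} (𝒰 : Scheme.AffineOpenCover.{u} X)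
    (y : Y ⟶ X) (f g : Y ⟶ Z)
    (h : ∀ (A : CommRingCat.{u}) (p : Spec A ⟶ Y) (i : 𝒰.I₀) (q : Spec A ⟶ Spec (𝒰.X i)),
      p ≫ y = q ≫ 𝒰.f i → p ≫ f = p ≫ g) : f = g := by
  refine Scheme.Cover.hom_ext (Precoverage.ZeroHypercover.pullback₁ y 𝒰.openCover) _ _
    fun (i : 𝒰.I₀) => hom_ext_of_affine _ _ fun A p => ?_
  refine (Category.assoc _ _ _).symm.trans (Eq.trans ?_ (Category.assoc _ _ _))
  exact h A _ i (p ≫ pullback.snd _ _) ((Category.assoc _ _ _).trans ((congrArg (fun q => p ≫ q)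
    pullback.condition).trans (Category.assoc _ _ _).symm))

theorem pointHom_specOverMap {A B : Type u} [CommRing A] [Algebra k A] [CommRing B] [Algebra k B]
    (f : A →ₐ[k] B) {T : Over (Spec (CommRingCat.of k))} (x : specOver k A ⟶ T) :
    pointHom (specOverMap f ≫ x) = specMap f ≫ pointHom x := rfl

theorem pointHom_comp {A : Type u} [CommRing A] [Algebra k A]
    {T T' : Over (Spec (CommRingCat.of k))} (x : specOver k A ⟶ T) (g : T ⟶ T') :
    pointHom (x ≫ g) = pointHom x ≫ g.left := rfl

theorem pointHom_injective {A : Type u} [CommRing A] [Algebra k A]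
    {T : Over (Spec (CommRingCat.of k))} {x y : specOver k A ⟶ T} (h : pointHom x = pointHom y) :
    x = y :=
  Over.OverMorphism.ext h

/-- Every morphism `Spec A ⟶ T` is a point for a unique `k`-algebra structure on `A`. -/
theorem exists_point {T : Over (Spec (CommRingCat.of k))} (A : CommRingCat.{u})
    (f : Spec A ⟶ T.left) : ∃ (_ : Algebra k A) (x : specOver k A ⟶ T), pointHom x = f := by
  let := (Spec.preimage (f ≫ T.hom)).hom.toAlgebra
  exact ⟨this, Over.homMk f (Spec.map_preimage (f ≫ T.hom)).symm, rfl⟩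

/-- A morphism of affine schemes compatible with points of `T` comes from a `k`-algebra
homomorphism. -/
theorem exists_algHom_of_pointHom {T : Over (Spec (CommRingCat.of k))} {A B : Type u} [CommRing A]
    [Algebra k A] [CommRing B] [Algebra k B] (x : specOver k A ⟶ T) (y : specOver k B ⟶ T)
    (g : Spec (CommRingCat.of B) ⟶ Spec (CommRingCat.of A)) (h : g ≫ pointHom x = pointHom y) :
    ∃ f : A →ₐ[k] B, specMap f = g ∧ specOverMap f ≫ x = y := by
  obtain ⟨φ, rfl⟩ := Spec.map_surjective g
  have h1 : Spec.map φ ≫ specStr k A = specStr k B := by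
    rw [← pointHom_str x, ← Category.assoc, h, pointHom_str]
  have hc : ∀ r, φ.hom (algebraMap k A r) = algebraMap k B r := by
    intro r
    rw [specStr, specStr, ← Spec.map_comp] at h1
    exact congrArg (fun q => q.hom r) (Spec.map_injective h1)
  let f : A →ₐ[k] B := { φ.hom with commutes' := hc }
  exact ⟨f, rfl, pointHom_injective h⟩

/-- Morphisms of `k`-schemes are determined by their effect on points with values in
`k`-algebras. -/
theorem over_hom_ext_of_points {T Q : Over (Spec (CommRingCat.of k))} (f g : T ⟶ Q)
    (h : ∀ (A : Type u) [CommRing A] [Algebra k A] (x : specOver k A ⟶ T), x ≫ f = x ≫ g) :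
    f = g := by
  apply Over.OverMorphism.ext
  refine hom_ext_of_affine _ _ fun A p => ?_
  obtain ⟨_, x, rfl⟩ := exists_point A p
  exact congrArg pointHom (h _ x)

/-- A morphism of `k`-schemes is the same as a natural transformation between the functors of
points with values in `k`-algebras. -/
theorem exists_over_hom_of_points {T Q : Over (Spec (CommRingCat.of k))}
    (F : ∀ (A : Type u) [CommRing A] [Algebra k A], (specOver k A ⟶ T) → (specOver k A ⟶ Q))
    (hF : ∀ (A B : Type u) [CommRing A] [Algebra k A] [CommRing B] [Algebra k B]
      (f : A →ₐ[k] B) (x : specOver k A ⟶ T), F B (specOverMap f ≫ x) = specOverMap f ≫ F A x) :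
    ∃ φ : T ⟶ Q, ∀ (A : Type u) [CommRing A] [Algebra k A] (x : specOver k A ⟶ T),
      x ≫ φ = F A x := by
  obtain ⟨𝒰⟩ : Nonempty (Scheme.AffineOpenCover.{u} T.left) := ⟨T.left.affineOpenCover⟩
  choose alg x hx using fun i => exists_point (𝒰.X i) (𝒰.f i)
  have key : ∀ (i : 𝒰.I₀) (B : CommRingCat.{u}) (_ : Algebra k B) (y : specOver k B ⟶ T)
      (g : Spec B ⟶ Spec (𝒰.X i)), g ≫ 𝒰.f i = pointHom y →
      g ≫ pointHom (F _ (x i)) = pointHom (F _ y) := by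
    intro i B _ y g hg
    obtain ⟨f, rfl, rfl⟩ := exists_algHom_of_pointHom (x i) y g (by rw [hx]; exact hg)
    rw [hF, pointHom_specOverMap]
  obtain ⟨φ, hφ⟩ := AffineOpenCover.exists_glue 𝒰 (fun i => pointHom (F _ (x i))) (by
    intro i j A p q hpq
    obtain ⟨_, y, hy⟩ := exists_point A (p ≫ 𝒰.f i)
    rw [key i A _ y p hy.symm, key j A _ y q (hpq.symm.trans hy.symm)])
  have hφT : φ ≫ Q.hom = T.hom := by
    refine AffineOpenCover.hom_ext 𝒰 _ _ fun i => ?_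
    rw [← Category.assoc, hφ, pointHom_str, ← hx, pointHom_str]
  refine ⟨Over.homMk φ hφT, fun A _ _ y => pointHom_injective ?_⟩
  change pointHom y ≫ φ = _
  refine AffineOpenCover.hom_ext_of_lift 𝒰 (pointHom y) _ _ fun B p i q hpq => ?_
  obtain ⟨_, z, hz⟩ := exists_point B (p ≫ pointHom y)
  have h1 := key i _ _ z q (by rw [hz, hpq])
  obtain ⟨f, hf, rfl⟩ := exists_algHom_of_pointHom y z p hz.symm
  rw [hF, pointHom_specOverMap, hf, ← hφ] at h1
  rw [← h1, ← Category.assoc, ← Category.assoc, hpq]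

end

/-! ### Points of projective space -/

section
variable {k : Type u} [Field k]
attribute [local instance] MvPolynomial.gradedAlgebra
open HomogeneousLocalization

variable (k) in
/-- The grading of `k[X_0, …, X_n]` by degree. -/
abbrev grading (n : ℕ) : ℕ → Submodule k (MvPolynomial (Fin (n + 1)) k) :=
  MvPolynomial.homogeneousSubmodule (Fin (n + 1)) k

theorem X_mem_grading {n : ℕ} (i : Fin (n + 1)) : MvPolynomial.X i ∈ grading k n 1 :=
  MvPolynomial.isHomogeneous_X k i

variable (k) in
/-- The coordinate ring `k[X_0 / X_u, …, X_n / X_u]` of the standard chart `D₊(X_u)` of `ℙ^n`. -/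
abbrev ChartRing {n : ℕ} (u : Fin (n + 1)) : Type u :=
  Away (grading k n) (MvPolynomial.X u : MvPolynomial (Fin (n + 1)) k)

variable (k) in
/-- The coordinate function `X_i / X_u`. -/
def chartCoord {n : ℕ} (u i : Fin (n + 1)) : ChartRing k u :=
  Away.mk (grading k n) (X_mem_grading u) 1 (MvPolynomial.X i) (X_mem_grading i)

variable (k) in
/-- The structure map from the constants `k` to the coordinate ring of the chart `D₊(X_u)`. -/
def chartConst {n : ℕ} (u : Fin (n + 1)) : k →+* ChartRing k u :=
  (fromZeroRingHom (grading k n) _).comp (algebraMap k (grading k n 0))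

theorem chartConst_val {n : ℕ} (u : Fin (n + 1)) (r : k) :
    (chartConst k u r).val = algebraMap (MvPolynomial (Fin (n + 1)) k) _ (MvPolynomial.C r) := by
  rw [chartConst, RingHom.comp_apply]
  rfl

theorem chartCoord_val {n : ℕ} (u i : Fin (n + 1)) :
    (chartCoord k u i).val * algebraMap (MvPolynomial (Fin (n + 1)) k) _ (MvPolynomial.X u) =
      algebraMap (MvPolynomial (Fin (n + 1)) k) _ (MvPolynomial.X i) := by
  rw [chartCoord, Away.val_mk, ← Localization.mk_one_eq_algebraMap, Localization.mk_mul,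
    ← Localization.mk_one_eq_algebraMap, Localization.mk_eq_mk_iff, Localization.r_iff_exists]
  exact ⟨1, by simp [mul_comm]⟩

theorem chartRing_eq_eval₂ {n : ℕ} (u : Fin (n + 1)) (z : ChartRing k u) :
    ∃ a, z = MvPolynomial.eval₂ (chartConst k u) (chartCoord k u) a := by
  obtain ⟨m, a, ha, rfl⟩ := Away.mk_surjective (grading k n) (X_mem_grading u) z
  refine ⟨a, HomogeneousLocalization.val_injective _ ?_⟩
  have hu : IsUnit (algebraMap (MvPolynomial (Fin (n + 1)) k)
      (Localization.Away (MvPolynomial.X u : MvPolynomial (Fin (n + 1)) k))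
        (MvPolynomial.X u) ^ m) :=
    (IsLocalization.Away.algebraMap_isUnit _).pow m
  rw [← hu.mul_left_inj]
  have h1 : (Away.mk (grading k n) (X_mem_grading u) m a ha).val *
      algebraMap (MvPolynomial (Fin (n + 1)) k) _ (MvPolynomial.X u) ^ m =
      algebraMap (MvPolynomial (Fin (n + 1)) k) _ a := by
    rw [Away.val_mk, ← map_pow, ← Localization.mk_one_eq_algebraMap, Localization.mk_mul,
      ← Localization.mk_one_eq_algebraMap, Localization.mk_eq_mk_iff, Localization.r_iff_exists]
    exact ⟨1, by simp [mul_comm]⟩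
  rw [h1]
  have h2 : (MvPolynomial.eval₂ (chartConst k u) (chartCoord k u) a).val =
      MvPolynomial.eval₂ ((algebraMap (MvPolynomial (Fin (n + 1)) k) (Localization.Away
        (MvPolynomial.X u : MvPolynomial (Fin (n + 1)) k))).comp MvPolynomial.C)
        (fun i => (chartCoord k u i).val) a := by
    rw [← HomogeneousLocalization.algebraMap_apply, MvPolynomial.hom_eval₂]
    have : (algebraMap (ChartRing k u) (Localization.Away
        (MvPolynomial.X u : MvPolynomial (Fin (n + 1)) k))).comp (chartConst k u) =
        (algebraMap (MvPolynomial (Fin (n + 1)) k) _).comp MvPolynomial.C :=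
      RingHom.ext fun r => chartConst_val u r
    rw [this]
    rfl
  rw [h2, MvPolynomial.eval₂_eq', Finset.sum_mul]
  conv_lhs => rw [MvPolynomial.as_sum a, map_sum]
  refine Finset.sum_congr rfl fun d hd => ?_
  have hdeg : ∑ i, d i = m := by
    have := ha (MvPolynomial.mem_support_iff.1 hd)
    rw [smul_eq_mul, mul_one] at this
    rw [← this, Finsupp.weight_apply, Finsupp.sum_fintype _ _ (by simp)]
    simp
  rw [← hdeg, ← Finset.prod_pow_eq_pow_sum, mul_assoc, ← Finset.prod_mul_distrib]
  simp only [← mul_pow, chartCoord_val]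
  rw [MvPolynomial.monomial_eq, map_mul, Finsupp.prod_fintype _ _ (by simp), map_prod]
  simp only [map_pow]
  rfl

theorem chartRing_hom_ext {n : ℕ} {u : Fin (n + 1)} {A : Type u} [CommRing A]
    {φ ψ : ChartRing k u →+* A}
    (h : ∀ r, φ (chartConst k u r) = ψ (chartConst k u r))
    (h' : ∀ i, φ (chartCoord k u i) = ψ (chartCoord k u i)) : φ = ψ := by
  ext z
  obtain ⟨a, rfl⟩ := chartRing_eq_eval₂ u z
  rw [MvPolynomial.hom_eval₂, MvPolynomial.hom_eval₂]
  have h1 : φ.comp (chartConst k u) = ψ.comp (chartConst k u) := RingHom.ext h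
  have h2 : (fun i => φ (chartCoord k u i)) = fun i => ψ (chartCoord k u i) := funext h'
  rw [h1, h2]

variable {A : Type u} [CommRing A] [Algebra k A]

/-- Evaluation of the degree zero fractions `a / f ^ m` at `c`, where `f(c)` is a unit. -/
def awayEval {n : ℕ} (f : MvPolynomial (Fin (n + 1)) k) (c : Fin (n + 1) → A)
    (hc : IsUnit (MvPolynomial.aeval c f)) : Away (grading k n) f →+* A :=
  (IsLocalization.Away.lift (S := Localization.Away f) f
    (g := (MvPolynomial.aeval c : MvPolynomial (Fin (n + 1)) k →ₐ[k] A).toRingHom)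
    hc).comp (algebraMap (Away (grading k n) f) _)

theorem awayEval_mk {n : ℕ} {f : MvPolynomial (Fin (n + 1)) k} (c : Fin (n + 1) → A)
    (hc : IsUnit (MvPolynomial.aeval c f)) {d : ℕ} (hf : f ∈ grading k n d) (m : ℕ)
    (a : MvPolynomial (Fin (n + 1)) k) (ha : a ∈ grading k n (m • d)) :
    awayEval f c hc (Away.mk (grading k n) hf m a ha) * MvPolynomial.aeval c f ^ m =
      MvPolynomial.aeval c a := by
  have h1 : (Away.mk (grading k n) hf m a ha).val *
      algebraMap (MvPolynomial (Fin (n + 1)) k) (Localization.Away f) f ^ m =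
      algebraMap (MvPolynomial (Fin (n + 1)) k) _ a := by
    rw [Away.val_mk, ← map_pow, ← Localization.mk_one_eq_algebraMap, Localization.mk_mul,
      ← Localization.mk_one_eq_algebraMap, Localization.mk_eq_mk_iff, Localization.r_iff_exists]
    exact ⟨1, by simp [mul_comm]⟩
  have h := congrArg (IsLocalization.Away.lift (S := Localization.Away f) f
    (g := (MvPolynomial.aeval c : MvPolynomial (Fin (n + 1)) k →ₐ[k] A).toRingHom) hc) h1
  rw [map_mul, map_pow, IsLocalization.Away.lift_eq, IsLocalization.Away.lift_eq] at h
  exact h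

/-- Evaluation of the functions on the chart `D₊(X_u)` at the point with homogeneous
coordinates `c`. -/
def chartEval {n : ℕ} (u : Fin (n + 1)) (c : Fin (n + 1) → A) (hc : IsUnit (c u)) :
    ChartRing k u →+* A :=
  awayEval (MvPolynomial.X u) c (by rwa [MvPolynomial.aeval_X])

theorem chartEval_const {n : ℕ} (u : Fin (n + 1)) (c : Fin (n + 1) → A) (hc : IsUnit (c u))
    (r : k) :
    chartEval u c hc (chartConst k u r) = algebraMap k A r := by
  rw [chartEval, awayEval, RingHom.comp_apply, HomogeneousLocalization.algebraMap_apply,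
    chartConst_val,
    IsLocalization.Away.lift_eq]
  simp

theorem chartEval_coord {n : ℕ} (u : Fin (n + 1)) (c : Fin (n + 1) → A) (hc : IsUnit (c u))
    (i : Fin (n + 1)) : chartEval u c hc (chartCoord k u i) * c u = c i := by
  have h := awayEval_mk c (by rwa [MvPolynomial.aeval_X]) (X_mem_grading (k := k) u) 1
    (MvPolynomial.X i) (X_mem_grading i)
  simp only [pow_one, MvPolynomial.aeval_X] at h
  exact h

theorem chartEval_ext {n : ℕ} {u : Fin (n + 1)} (c : Fin (n + 1) → A) (hc : IsUnit (c u))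
    (φ : ChartRing k u →+* A) (h : ∀ r, φ (chartConst k u r) = algebraMap k A r)
    (h' : ∀ i, φ (chartCoord k u i) * c u = c i) : φ = chartEval u c hc := by
  refine chartRing_hom_ext (fun r => ?_) fun i => ?_
  · rw [h, chartEval_const]
  · rw [← hc.mul_left_inj, h', chartEval_coord]

variable (k) in
/-- The inclusion of the standard chart `D₊(X_u)` in `ℙ^n`. -/
def chartι {n : ℕ} (u : Fin (n + 1)) :
    Spec (CommRingCat.of (ChartRing k u)) ⟶ (projSpace k n).left :=
  Proj.awayι (grading k n) (MvPolynomial.X u) (X_mem_grading u) one_pos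

instance {n : ℕ} (u : Fin (n + 1)) : IsOpenImmersion (chartι k u) := by
  unfold chartι; exact inferInstanceAs (IsOpenImmersion (Proj.awayι _ _ _ _))

theorem chartι_str {n : ℕ} (u : Fin (n + 1)) :
    chartι k u ≫ (projSpace k n).hom = Spec.map (CommRingCat.ofHom (chartConst k u)) := by
  change Proj.awayι _ _ _ _ ≫ Proj.toSpecZero _ ≫ _ = _
  rw [Proj.awayι_toSpecZero_assoc, ← Spec.map_comp]
  rfl

variable (k) in
/-- The open subset `D₊(X_u)` of `ℙ^n`. -/
def stdOpen {n : ℕ} (u : Fin (n + 1)) : (projSpace k n).left.Opens :=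
  Proj.basicOpen (grading k n) (MvPolynomial.X u)

theorem opensRange_chartι {n : ℕ} (u : Fin (n + 1)) : (chartι k u).opensRange = stdOpen k u :=
  Proj.opensRange_awayι (grading k n) (MvPolynomial.X u) (X_mem_grading u) one_pos

theorem chartι_preimage_stdOpen {n : ℕ} (u w : Fin (n + 1)) :
    chartι k u ⁻¹ᵁ stdOpen k w =
      PrimeSpectrum.basicOpen (Away.isLocalizationElem (X_mem_grading u) (X_mem_grading w)) :=
  Proj.awayι_preimage_basicOpen _ _ _ _ one_pos

/-- A point of `T` given by a morphism of schemes. -/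
def mkPoint {T : Over (Spec (CommRingCat.of k))} (f : Spec (CommRingCat.of A) ⟶ T.left)
    (h : f ≫ T.hom = specStr k A) : specOver k A ⟶ T :=
  Over.homMk f h

/-- The point of `ℙ^n` with homogeneous coordinates `c`, where `c u` is a unit; it lies in the
chart `D₊(X_u)`. -/
def projPt {n : ℕ} (u : Fin (n + 1)) (c : Fin (n + 1) → A) (hc : IsUnit (c u)) :
    specOver k A ⟶ projSpace k n :=
  mkPoint (Spec.map (CommRingCat.ofHom (chartEval u c hc)) ≫ chartι k u) (by
    rw [Category.assoc, chartι_str]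
    rw [specStr, ← Spec.map_comp, ← CommRingCat.ofHom_comp]
    congr 2
    ext r
    exact chartEval_const u c hc r)

theorem projPt_left {n : ℕ} (u : Fin (n + 1)) (c : Fin (n + 1) → A) (hc : IsUnit (c u)) :
    pointHom (projPt u c hc) = Spec.map (CommRingCat.ofHom (chartEval u c hc)) ≫ chartι k u := rfl

theorem specOverMap_projPt {B : Type u} [CommRing B] [Algebra k B] (f : A →ₐ[k] B) {n : ℕ}
    (u : Fin (n + 1)) (c : Fin (n + 1) → A) (hc : IsUnit (c u)) :
    specOverMap f ≫ projPt u c hc = projPt u (fun i => f (c i)) (hc.map f) := by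
  apply pointHom_injective
  rw [pointHom_specOverMap, projPt_left, projPt_left, specMap, ← Spec.map_comp_assoc,
    ← CommRingCat.ofHom_comp]
  congr 3
  refine chartEval_ext _ _ _ (fun r => ?_) fun i => ?_
  · rw [RingHom.comp_apply, chartEval_const]
    exact f.commutes r
  · rw [RingHom.comp_apply]
    exact (map_mul f _ _).symm.trans (congrArg f (chartEval_coord u c hc i))

/-- The point with given homogeneous coordinates does not depend on the invertible coordinate
which is used to define it. -/
theorem projPt_chart {n : ℕ} (u w : Fin (n + 1)) (c : Fin (n + 1) → A) (hc : IsUnit (c u))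
    (hc' : IsUnit (c w)) : (projPt u c hc : specOver k A ⟶ _) = projPt w c hc' := by
  apply pointHom_injective
  have key : ∀ (u w : Fin (n + 1)) (hc : IsUnit (c u)) (hc' : IsUnit (c w))
      (x : MvPolynomial (Fin (n + 1)) k) (hx : x = MvPolynomial.X u * MvPolynomial.X w)
      (hcx : IsUnit (MvPolynomial.aeval c x)),
      Spec.map (CommRingCat.ofHom (chartEval u c hc)) ≫ chartι k u =
      Spec.map (CommRingCat.ofHom (awayEval x c hcx)) ≫ Proj.awayι (grading k n) x
        (hx ▸ SetLike.mul_mem_graded (X_mem_grading u) (X_mem_grading w)) (by simp) := by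
    intro u w hc hc' x hx hcx
    rw [← Proj.SpecMap_awayMap_awayι (grading k n) (X_mem_grading u) one_pos (X_mem_grading w) hx,
      ← Spec.map_comp_assoc, ← CommRingCat.ofHom_comp]
    refine congrArg (fun q => Spec.map (CommRingCat.ofHom q) ≫ chartι k u) (RingHom.ext fun z => ?_)
    obtain ⟨m, a, ha, rfl⟩ := Away.mk_surjective (grading k n) (X_mem_grading u) z
    rw [RingHom.comp_apply, awayMap_mk, ← (hcx.pow m).mul_left_inj, awayEval_mk, chartEval]
    rw [map_mul, ← awayEval_mk c (by rwa [MvPolynomial.aeval_X]) (X_mem_grading u) m a ha, hx,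
      map_mul, mul_pow, map_pow]
    ring
  rw [projPt_left, projPt_left]
  have hcx : IsUnit (MvPolynomial.aeval c (MvPolynomial.X u * MvPolynomial.X w :
      MvPolynomial (Fin (n + 1)) k)) := by
    rw [map_mul, MvPolynomial.aeval_X, MvPolynomial.aeval_X]
    exact hc.mul hc'
  exact (key u w hc hc' _ rfl hcx).trans (key w u hc' hc _ (mul_comm _ _) hcx).symm

theorem isUnit_of_projPt_eq {n : ℕ} {u w : Fin (n + 1)} {c c' : Fin (n + 1) → A} {hc : IsUnit (c u)}
    {hc' : IsUnit (c' w)} (h : (projPt u c hc : specOver k A ⟶ _) = projPt w c' hc') :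
    IsUnit (c w) := by
  have h1 := congrArg pointHom h
  rw [projPt_left, projPt_left] at h1
  have h2 : (Spec.map (CommRingCat.ofHom (chartEval (k := k) u c hc))) ⁻¹ᵁ
      (chartι k u ⁻¹ᵁ stdOpen k w) = ⊤ := by
    rw [← Scheme.Hom.comp_preimage, h1, Scheme.Hom.comp_preimage, ← opensRange_chartι,
      Scheme.Hom.preimage_opensRange]
    rfl
  rw [chartι_preimage_stdOpen] at h2
  have h4 : IsUnit (chartEval (k := k) u c hc
      (Away.isLocalizationElem (X_mem_grading u) (X_mem_grading w))) := by
    by_contra hnu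
    obtain ⟨I, hI, hmem⟩ := exists_max_ideal_of_mem_nonunits hnu
    have := h2.ge (Set.mem_univ (⟨I, hI.isPrime⟩ : PrimeSpectrum A))
    exact this hmem
  have h5 : Away.isLocalizationElem (X_mem_grading u) (X_mem_grading w) = chartCoord k u w := by
    apply HomogeneousLocalization.val_injective
    rw [Away.isLocalizationElem, chartCoord, Away.val_mk, Away.val_mk, pow_one]
  rw [h5] at h4
  rw [← chartEval_coord (k := k) u c hc w]
  exact h4.mul hc

theorem projPt_eq_iff {n : ℕ} (u w : Fin (n + 1)) (c c' : Fin (n + 1) → A) (hc : IsUnit (c u))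
    (hc' : IsUnit (c' w)) : (projPt u c hc : specOver k A ⟶ _) = projPt w c' hc' ↔
      ∀ i j, c i * c' j = c j * c' i := by
  constructor
  · intro h i j
    have hw := isUnit_of_projPt_eq h
    rw [projPt_chart u w c hc hw] at h
    have h1 := congrArg pointHom h
    rw [projPt_left, projPt_left, cancel_mono] at h1
    have h2 : chartEval (k := k) w c hw = chartEval w c' hc' :=
      congrArg (fun q => q.hom) (Spec.map_injective h1)
    have hi := chartEval_coord (k := k) w c hw
    have hi' := chartEval_coord (k := k) w c' hc'
    rw [h2] at hi
    rw [← hi, ← hi j, ← hi' j, ← hi' i]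
    ring
  · intro h
    have hw : IsUnit (c w) := by
      have := hc.mul hc'
      rw [h u w] at this
      exact isUnit_of_mul_isUnit_left this
    rw [projPt_chart u w c hc hw]
    apply pointHom_injective
    rw [projPt_left, projPt_left]
    congr 3
    refine chartEval_ext _ _ _ (fun r => chartEval_const _ _ _ _) fun i => ?_
    rw [← hw.mul_left_inj, mul_assoc, mul_comm (c' w), ← mul_assoc, chartEval_coord, h, mul_comm]

theorem iSup_opensRange_chartι (n : ℕ) (x : (projSpace k n).left) :
    ∃ u, x ∈ Set.range (chartι k u) := by
  have h := Proj.iSup_basicOpen_eq_top' (grading k n)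
    (fun i : Fin (n + 1) => MvPolynomial.X i) (fun i => ⟨1, X_mem_grading i⟩) (by
      refine top_le_iff.1 fun p _ => ?_
      have hp : p ∈ Algebra.adjoin k (Set.range (MvPolynomial.X (R := k) (σ := Fin (n + 1)))) := by
        rw [MvPolynomial.adjoin_range_X]; trivial
      induction hp using Algebra.adjoin_induction with
      | mem x hx => exact Algebra.subset_adjoin hx
      | algebraMap r =>
        exact (Algebra.adjoin (grading k n 0) _).algebraMap_mem (algebraMap k (grading k n 0) r)
      | add x y _ _ hx hy => exact add_mem (hx trivial) (hy trivial)
      | mul x y _ _ hx hy => exact mul_mem (hx trivial) (hy trivial))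
  obtain ⟨u, hu⟩ := TopologicalSpace.Opens.mem_iSup.1 (h.ge (Set.mem_univ x))
  have hu' : x ∈ stdOpen k u := hu
  rw [← opensRange_chartι] at hu'
  exact ⟨u, hu'⟩

end

/-! ### Base change of submodules, kernels of normalized matrices and Plücker coordinates -/

section
variable {k : Type u} [Field k] {V : Type u} [AddCommGroup V] [Module k V]
  {A B C : Type u} [CommRing A] [Algebra k A] [CommRing B] [Algebra k B] [CommRing C] [Algebra k C]

variable (V) in
/-- The map `A ⊗ V → B ⊗ V` induced by `f : A → B`. -/
def bcMap (f : A →ₐ[k] B) : A ⊗[k] V →ₗ[k] B ⊗[k] V := LinearMap.rTensor V f.toLinearMap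

theorem bcMap_tmul (f : A →ₐ[k] B) (a : A) (x : V) : bcMap V f (a ⊗ₜ x) = f a ⊗ₜ x := rfl

theorem bcMap_smul (f : A →ₐ[k] B) (a : A) (x : A ⊗[k] V) :
    bcMap V f (a • x) = f a • bcMap V f x := by
  induction x with
  | zero => simp
  | add x y hx hy => rw [smul_add, map_add, hx, hy, map_add, smul_add]
  | tmul b x => rw [TensorProduct.smul_tmul', bcMap_tmul, bcMap_tmul, TensorProduct.smul_tmul',
      smul_eq_mul, map_mul, smul_eq_mul]

theorem bcMap_comp (f : A →ₐ[k] B) (g : B →ₐ[k] C) (x : A ⊗[k] V) :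
    bcMap V (g.comp f) x = bcMap V g (bcMap V f x) := by
  induction x with
  | zero => simp
  | add x y hx hy => rw [map_add, hx, hy, map_add, map_add]
  | tmul b x => rfl

/-- The base change of a submodule of `A ⊗ V` along `f : A → B`. -/
def bcSub (f : A →ₐ[k] B) (S : Submodule A (A ⊗[k] V)) : Submodule B (B ⊗[k] V) :=
  Submodule.span B (bcMap V f '' S)

theorem bcMap_mem_bcSub (f : A →ₐ[k] B) {S : Submodule A (A ⊗[k] V)} {x : A ⊗[k] V} (hx : x ∈ S) :
    bcMap V f x ∈ bcSub f S := Submodule.subset_span ⟨x, hx, rfl⟩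

theorem bcSub_le_iff {f : A →ₐ[k] B} {S : Submodule A (A ⊗[k] V)} {S' : Submodule B (B ⊗[k] V)} :
    bcSub f S ≤ S' ↔ ∀ x ∈ S, bcMap V f x ∈ S' := by
  rw [bcSub, Submodule.span_le]
  exact Set.image_subset_iff

theorem bcSub_comp (f : A →ₐ[k] B) (g : B →ₐ[k] C) (S : Submodule A (A ⊗[k] V)) :
    bcSub (g.comp f) S = bcSub g (bcSub f S) := by
  apply le_antisymm
  · rw [bcSub_le_iff]
    intro x hx
    rw [bcMap_comp]
    exact bcMap_mem_bcSub _ (bcMap_mem_bcSub _ hx)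
  · rw [bcSub_le_iff]
    intro x hx
    induction hx using Submodule.span_induction with
    | mem x h =>
      obtain ⟨y, hy, rfl⟩ := h
      rw [← bcMap_comp]
      exact bcMap_mem_bcSub _ hy
    | zero => rw [map_zero]; exact zero_mem _
    | add x y _ _ hx hy => rw [map_add]; exact add_mem hx hy
    | smul b x _ hx => rw [bcMap_smul]; exact Submodule.smul_mem _ _ hx

variable (k) in
/-- The localization homomorphism `A → A_g` as a homomorphism of `k`-algebras. -/
abbrev locHom (g : A) : A →ₐ[k] Localization.Away g :=
  IsScalarTower.toAlgHom k A (Localization.Away g)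

theorem isBaseChange_bcMap [Algebra A B] [IsScalarTower k A B] :
    IsBaseChange B ({ bcMap V (IsScalarTower.toAlgHom k A B) with
      map_smul' := fun a x => by
        change bcMap V _ _ = a • bcMap V _ _
        rw [bcMap_smul]
        exact algebraMap_smul _ _ _ } : A ⊗[k] V →ₗ[A] B ⊗[k] V) := by
  refine IsBaseChange.of_equiv (TensorProduct.AlgebraTensorModule.cancelBaseChange k A B B V) ?_
  intro x
  induction x with
  | zero => simp
  | add x y hx hy => rw [TensorProduct.tmul_add, map_add, hx, hy, map_add]
  | tmul a x =>
    rw [TensorProduct.AlgebraTensorModule.cancelBaseChange_tmul]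
    change _ = (algebraMap A B a) ⊗ₜ x
    rw [Algebra.smul_def, mul_one]

theorem exists_pow_smul_eq_bcMap [Algebra A B] [IsScalarTower k A B] (g : A)
    [IsLocalization.Away g B] (y : B ⊗[k] V) :
    ∃ (n : ℕ) (x : A ⊗[k] V), g ^ n • y = bcMap V (IsScalarTower.toAlgHom k A B) x := by
  have h := (isLocalizedModule_iff_isBaseChange (Submonoid.powers g) B _).2
    (isBaseChange_bcMap (k := k) (V := V) (A := A) (B := B))
  obtain ⟨⟨x, ⟨_, n, rfl⟩⟩, h⟩ := h.surj y
  exact ⟨n, x, h⟩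

theorem exists_pow_smul_eq_of_bcMap_eq [Algebra A B] [IsScalarTower k A B] (g : A)
    [IsLocalization.Away g B] {x y : A ⊗[k] V}
    (hxy : bcMap V (IsScalarTower.toAlgHom k A B) x = bcMap V (IsScalarTower.toAlgHom k A B) y) :
    ∃ n : ℕ, g ^ n • x = g ^ n • y := by
  have h := (isLocalizedModule_iff_isBaseChange (Submonoid.powers g) B _).2
    (isBaseChange_bcMap (k := k) (V := V) (A := A) (B := B))
  obtain ⟨⟨_, n, rfl⟩, h⟩ := h.exists_of_eq hxy
  exact ⟨n, h⟩

/-- Membership in the localization of a submodule, with denominators cleared. -/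
theorem exists_pow_smul_mem_of_bcMap_mem [Algebra A B] [IsScalarTower k A B] (g : A)
    [IsLocalization.Away g B] {S : Submodule A (A ⊗[k] V)} {x : A ⊗[k] V}
    (hx : bcMap V (IsScalarTower.toAlgHom k A B) x ∈ bcSub (IsScalarTower.toAlgHom k A B) S) :
    ∃ n : ℕ, g ^ n • x ∈ S := by
  have key : ∀ y ∈ bcSub (IsScalarTower.toAlgHom k A B) S, ∃ (n : ℕ), ∃ s ∈ S,
      g ^ n • y = bcMap V (IsScalarTower.toAlgHom k A B) s := by
    intro y hy
    induction hy using Submodule.span_induction with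
    | mem y h =>
      obtain ⟨s, hs, rfl⟩ := h
      exact ⟨0, s, hs, by simp⟩
    | zero => exact ⟨0, 0, zero_mem _, by simp⟩
    | add y z _ _ hy hz =>
      obtain ⟨n, s, hs, h⟩ := hy
      obtain ⟨n', s', hs', h'⟩ := hz
      refine ⟨n + n', g ^ n' • s + g ^ n • s', add_mem (S.smul_mem _ hs) (S.smul_mem _ hs'), ?_⟩
      rw [map_add, bcMap_smul, bcMap_smul, ← h, ← h', smul_add]
      simp only [IsScalarTower.coe_toAlgHom', algebraMap_smul, smul_smul, pow_add]
      rw [mul_comm (g ^ n') (g ^ n)]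
    | smul b y _ hy =>
      obtain ⟨n, s, hs, h⟩ := hy
      obtain ⟨⟨a, ⟨_, n', rfl⟩⟩, h'⟩ := IsLocalization.surj (Submonoid.powers g) b
      refine ⟨n' + n, a • s, S.smul_mem _ hs, ?_⟩
      rw [bcMap_smul, ← h]
      simp only [IsScalarTower.coe_toAlgHom']
      rw [← h', mul_smul, algebraMap_smul, pow_add, mul_smul, smul_comm (g ^ n) b,
        smul_comm b (g ^ n') _]
  obtain ⟨n, s, hs, h⟩ := key _ hx
  rw [← algebraMap_smul B] at h
  have h1 : bcMap V (IsScalarTower.toAlgHom k A B) (g ^ n • x) =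
      bcMap V (IsScalarTower.toAlgHom k A B) s := by
    rw [bcMap_smul]; exact h
  obtain ⟨m, h2⟩ := exists_pow_smul_eq_of_bcMap_eq g h1
  refine ⟨m + n, ?_⟩
  rw [pow_add, mul_smul, h2]
  exact S.smul_mem _ hs

theorem mem_of_forall_prime {M : Type*} [AddCommGroup M] [Module A M] {S : Submodule A M} {x : M}
    (h : ∀ p : PrimeSpectrum A, ∃ g ∉ p.asIdeal, g • x ∈ S) : x ∈ S := by
  let I : Ideal A := S.comap (LinearMap.toSpanSingleton A M x)
  have hI : I = ⊤ := by
    by_contra hne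
    obtain ⟨m, hm, hle⟩ := Ideal.exists_le_maximal I hne
    obtain ⟨g, hg, hgx⟩ := h ⟨m, hm.isPrime⟩
    exact hg (hle hgx)
  have : (1 : A) ∈ I := hI ▸ trivial
  simpa [I] using this

theorem mem_iff_forall_prime {S : Submodule A (A ⊗[k] V)} {x : A ⊗[k] V} :
    x ∈ S ↔ ∀ p : PrimeSpectrum A, ∃ g ∉ p.asIdeal,
      bcMap V (locHom k g) x ∈ bcSub (locHom k g) S := by
  refine ⟨fun hx p => ⟨1, fun h => p.2.ne_top ((Ideal.eq_top_iff_one _).2 h),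
    bcMap_mem_bcSub _ hx⟩, fun h => mem_of_forall_prime fun p => ?_⟩
  obtain ⟨g, hg, hx⟩ := h p
  obtain ⟨n, hn⟩ := exists_pow_smul_mem_of_bcMap_mem g hx
  exact ⟨g ^ n, fun h => hg (p.2.mem_of_pow_mem n h), hn⟩

theorem submodule_eq_of_forall_prime {S S' : Submodule A (A ⊗[k] V)}
    (h : ∀ p : PrimeSpectrum A, ∃ g ∉ p.asIdeal, bcSub (locHom k g) S = bcSub (locHom k g) S') :
    S = S' := by
  ext x
  constructor
  · intro hx
    refine mem_iff_forall_prime.2 fun p => ?_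
    obtain ⟨g, hg, hS⟩ := h p
    exact ⟨g, hg, hS ▸ bcMap_mem_bcSub _ hx⟩
  · intro hx
    refine mem_iff_forall_prime.2 fun p => ?_
    obtain ⟨g, hg, hS⟩ := h p
    exact ⟨g, hg, hS ▸ bcMap_mem_bcSub _ hx⟩

variable {ι : Type} [Fintype ι] (v : Module.Basis ι k V) {m : ℕ}

/-- The `A`-linear map `A ⊗ V → A^m` with matrix `r` in the basis `v` of `V`. -/
def chartLin (r : Fin m → ι → A) : A ⊗[k] V →ₗ[A] (Fin m → A) :=
  (v.baseChange A).constr A fun i a => r a i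

theorem chartLin_basis (r : Fin m → ι → A) (i : ι) (a : Fin m) :
    chartLin v r (1 ⊗ₜ v i) a = r a i := by
  rw [← Module.Basis.baseChange_apply, chartLin, Module.Basis.constr_basis]

theorem chartLin_bcMap (f : A →ₐ[k] B) (r : Fin m → ι → A) (x : A ⊗[k] V) (a : Fin m) :
    chartLin v (fun a i => f (r a i)) (bcMap V f x) a = f (chartLin v r x a) := by
  rw [← (v.baseChange A).sum_repr x, map_sum, map_sum, map_sum, Finset.sum_apply,
    Finset.sum_apply, map_sum]
  refine Finset.sum_congr rfl fun i _ => ?_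
  rw [bcMap_smul, map_smul, map_smul, Pi.smul_apply, Pi.smul_apply, smul_eq_mul, smul_eq_mul,
    map_mul, Module.Basis.baseChange_apply, bcMap_tmul, map_one, chartLin_basis, chartLin_basis]

/-- Extension of a row by zero to `Option ι`. The additional index `none`, whose column is zero,
ensures that the set of tuples `Fin m → Option ι` which index the Plücker coordinates is never
empty, so that it indexes the coordinates of some `ℙ^n` also when `V = 0` and `m > 0`. -/
def ext0 (r : ι → A) (o : Option ι) : A := o.elim 0 r

/-- The basis vector `1 ⊗ v i`, with value `0` at the additional index `none`. -/
def basis0 (A : Type u) [CommRing A] [Algebra k A] (o : Option ι) : A ⊗[k] V :=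
  o.elim 0 fun i => 1 ⊗ₜ v i

theorem chartLin_basis0 (r : Fin m → ι → A) (o : Option ι) (a : Fin m) :
    chartLin v r (basis0 v A o) a = ext0 (r a) o := by
  cases o with
  | none => simp [basis0, ext0]
  | some i => exact chartLin_basis v r i a

theorem bcMap_basis0 (f : A →ₐ[k] B) (o : Option ι) :
    bcMap V f (basis0 v A o) = basis0 v B o := by
  cases o with
  | none => simp [basis0]
  | some i => simp [basis0, bcMap_tmul]

/-- The matrix `r` is normalized at `w`: its columns with indices `w` form the identity matrix. -/
def IsNorm (r : Fin m → ι → A) (w : Fin m → Option ι) : Prop :=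
  ∀ a b, ext0 (r a) (w b) = if a = b then 1 else 0

theorem map_ext0 (f : A →ₐ[k] B) (r : ι → A) (o : Option ι) :
    ext0 (fun i => f (r i)) o = f (ext0 r o) := by
  cases o <;> simp [ext0]

theorem IsNorm.map {r : Fin m → ι → A} {w : Fin m → Option ι} (h : IsNorm r w) (f : A →ₐ[k] B) :
    IsNorm (fun a i => f (r a i)) w := by
  intro a b
  rw [map_ext0, h a b]
  split <;> simp

/-- The element `v i - ∑ a, r a i • v (w a)`. If `r` is normalized at `w`, these elements generate
the kernel of `chartLin v r`. -/
def kerGen (r : Fin m → ι → A) (w : Fin m → Option ι) (i : ι) : A ⊗[k] V :=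
  1 ⊗ₜ v i - ∑ a, r a i • basis0 v A (w a)

theorem kerGen_mem {r : Fin m → ι → A} {w : Fin m → Option ι} (h : IsNorm r w) (i : ι) :
    kerGen v r w i ∈ LinearMap.ker (chartLin v r) := by
  rw [LinearMap.mem_ker, kerGen]
  ext a
  rw [map_sub, map_sum, Pi.sub_apply, Finset.sum_apply, chartLin_basis]
  simp only [map_smul, Pi.smul_apply, chartLin_basis0, h a _]
  simp

theorem sub_sum_chartLin (r : Fin m → ι → A) (w : Fin m → Option ι) (x : A ⊗[k] V) :
    x - ∑ a, chartLin v r x a • basis0 v A (w a) =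
      ∑ i, (v.baseChange A).repr x i • kerGen v r w i := by
  simp only [kerGen, smul_sub, Finset.sum_sub_distrib]
  congr 1
  · conv_lhs => rw [← (v.baseChange A).sum_repr x]
    simp only [Module.Basis.baseChange_apply]
  · simp only [Finset.smul_sum]
    rw [Finset.sum_comm]
    refine Finset.sum_congr rfl fun a _ => ?_
    conv_lhs => rw [← (v.baseChange A).sum_repr x]
    rw [map_sum, Finset.sum_apply, Finset.sum_smul]
    refine Finset.sum_congr rfl fun i _ => ?_
    rw [map_smul, Pi.smul_apply, Module.Basis.baseChange_apply, chartLin_basis, smul_eq_mul,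
      mul_smul]

theorem ker_chartLin_eq_span {r : Fin m → ι → A} {w : Fin m → Option ι} (h : IsNorm r w) :
    LinearMap.ker (chartLin v r) = Submodule.span A (Set.range (kerGen v r w)) := by
  apply le_antisymm
  · intro x hx
    rw [LinearMap.mem_ker] at hx
    have := sub_sum_chartLin v r w x
    simp only [hx, Pi.zero_apply, zero_smul, Finset.sum_const_zero, sub_zero] at this
    rw [this]
    exact Submodule.sum_mem _ fun i _ =>
      Submodule.smul_mem _ _ (Submodule.subset_span ⟨i, rfl⟩)
  · rw [Submodule.span_le]
    rintro _ ⟨i, rfl⟩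
    exact kerGen_mem v h i

theorem bcMap_kerGen (f : A →ₐ[k] B) (r : Fin m → ι → A) (w : Fin m → Option ι) (i : ι) :
    bcMap V f (kerGen v r w i) = kerGen v (fun a i => f (r a i)) w i := by
  rw [kerGen, map_sub, map_sum, bcMap_tmul, map_one]
  simp only [bcMap_smul, bcMap_basis0]
  rfl

/-- The formation of the kernel of a normalized matrix commutes with base change, because its
generators `kerGen` do. -/
theorem bcSub_ker_chartLin {r : Fin m → ι → A} {w : Fin m → Option ι} (h : IsNorm r w)
    (f : A →ₐ[k] B) : bcSub f (LinearMap.ker (chartLin v r)) =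
      LinearMap.ker (chartLin v fun a i => f (r a i)) := by
  apply le_antisymm
  · rw [bcSub_le_iff]
    intro x hx
    rw [LinearMap.mem_ker] at hx ⊢
    ext a
    rw [chartLin_bcMap, hx]
    simp
  · rw [ker_chartLin_eq_span v (h.map f), Submodule.span_le]
    rintro _ ⟨i, rfl⟩
    rw [← bcMap_kerGen]
    exact bcMap_mem_bcSub _ (kerGen_mem v h i)

theorem chartLin_surjective {r : Fin m → ι → A} {w : Fin m → Option ι} (h : IsNorm r w) :
    Function.Surjective (chartLin v r) := by
  intro c
  refine ⟨∑ b, c b • basis0 v A (w b), ?_⟩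
  ext a
  rw [map_sum, Finset.sum_apply]
  simp only [map_smul, Pi.smul_apply, chartLin_basis0, h a _]
  simp

/-- The Plücker coordinate with index `w`: the minor of `r` given by the columns `w`. -/
def plucker (r : Fin m → ι → A) (w : Fin m → Option ι) : A :=
  Matrix.det (Matrix.of fun a b => ext0 (r a) (w b))

theorem map_plucker (f : A →ₐ[k] B) (r : Fin m → ι → A) (w : Fin m → Option ι) :
    plucker (fun a i => f (r a i)) w = f (plucker r w) := by
  rw [plucker, plucker, AlgHom.map_det]
  congr 1
  ext a b
  exact map_ext0 f (r a) (w b)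

theorem IsNorm.plucker_eq_one {r : Fin m → ι → A} {w : Fin m → Option ι} (h : IsNorm r w) :
    plucker r w = 1 := by
  rw [plucker, ← Matrix.det_one (n := Fin m)]
  congr 1
  ext a b
  rw [Matrix.of_apply, h a b, Matrix.one_apply]

/-- The entries of a normalized matrix are Plücker coordinates: the minor in which the column `w
a` is replaced by `o` is the entry of `r` in row `a` and column `o`. -/
theorem IsNorm.plucker_update {r : Fin m → ι → A} {w : Fin m → Option ι} (h : IsNorm r w)
    (a : Fin m) (o : Option ι) : plucker r (Function.update w a o) = ext0 (r a) o := by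
  have : (Matrix.of fun c b => ext0 (r c) (Function.update w a o b)) =
      (1 : Matrix (Fin m) (Fin m) A).updateCol a (fun c => ext0 (r c) o) := by
    ext c b
    rw [Matrix.of_apply, Matrix.updateCol_apply]
    split_ifs with hb
    · rw [hb, Function.update_self]
    · rw [Function.update_of_ne hb, h c b, Matrix.one_apply]
  rw [plucker, this, ← Matrix.cramer_apply, Matrix.cramer_one]
  rfl

/-- The product `G * r`; `r` is kept as a function of two variables. -/
def mulMat (G : Matrix (Fin m) (Fin m) A) (r : Fin m → ι → A) : Fin m → ι → A :=
  fun a i => ∑ b, G a b * r b i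

theorem ext0_mulMat (G : Matrix (Fin m) (Fin m) A) (r : Fin m → ι → A) (a : Fin m)
    (o : Option ι) : ext0 (mulMat G r a) o = ∑ b, G a b * ext0 (r b) o := by
  cases o <;> simp [ext0, mulMat]

theorem plucker_mulMat (G : Matrix (Fin m) (Fin m) A) (r : Fin m → ι → A)
    (w : Fin m → Option ι) : plucker (mulMat G r) w = G.det * plucker r w := by
  rw [plucker, plucker, ← Matrix.det_mul]
  congr 1
  ext a b
  rw [Matrix.of_apply, ext0_mulMat, Matrix.mul_apply]
  rfl

theorem chartLin_mulMat (G : Matrix (Fin m) (Fin m) A) (r : Fin m → ι → A) :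
    chartLin v (mulMat G r) = (Matrix.mulVecLin G).comp (chartLin v r) := by
  refine (v.baseChange A).ext fun i => ?_
  ext a
  rw [Module.Basis.baseChange_apply, chartLin_basis, LinearMap.comp_apply, Matrix.mulVecLin_apply,
    Matrix.mulVec, dotProduct]
  simp only [chartLin_basis]
  rfl

theorem ker_chartLin_mulMat {G : Matrix (Fin m) (Fin m) A} (hG : IsUnit G.det) (r : Fin m → ι → A) :
    LinearMap.ker (chartLin v (mulMat G r)) = LinearMap.ker (chartLin v r) := by
  rw [chartLin_mulMat, LinearMap.ker_comp, LinearMap.ker_eq_bot.2, Submodule.comap_bot]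
  intro x y h
  have := congrArg (fun z => G⁻¹.mulVec z) h
  simpa [Matrix.nonsing_inv_mul _ hG] using this

/-- A matrix with an invertible minor can be normalized by a change of basis of the target. -/
theorem exists_isNorm_mulMat {r : Fin m → ι → A} {w : Fin m → Option ι}
    (h : IsUnit (plucker r w)) : ∃ G : Matrix (Fin m) (Fin m) A, G.det * plucker r w = 1 ∧
      IsNorm (mulMat G r) w := by
  let H : Matrix (Fin m) (Fin m) A := Matrix.of fun a b => ext0 (r a) (w b)
  have hH : H⁻¹ * H = 1 := Matrix.nonsing_inv_mul H h
  refine ⟨H⁻¹, ?_, fun a b => ?_⟩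
  · rw [plucker, ← Matrix.det_mul]
    change (H⁻¹ * H).det = 1
    rw [hH, Matrix.det_one]
  · rw [ext0_mulMat, ← Matrix.one_apply, ← hH, Matrix.mul_apply]
    rfl

theorem IsNorm.eq_of_plucker_eq {r r' : Fin m → ι → A} {w : Fin m → Option ι} (h : IsNorm r w)
    (h' : IsNorm r' w) (hp : plucker r = plucker r') : r = r' := by
  ext a i
  have h1 := h.plucker_update a (some i)
  rw [hp, h'.plucker_update] at h1
  exact h1.symm

/-- The kernel of a normalized matrix and its vector of Plücker coordinates, up to
proportionality, determine each other. -/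
theorem ker_chartLin_eq_iff {r r' : Fin m → ι → A} {w w' : Fin m → Option ι} (h : IsNorm r w)
    (h' : IsNorm r' w') : LinearMap.ker (chartLin v r) = LinearMap.ker (chartLin v r') ↔
      ∀ i j, plucker r i * plucker r' j = plucker r j * plucker r' i := by
  constructor
  · intro hk
    -- `r'` is obtained from `r` by a change of basis of the target
    let G : Matrix (Fin m) (Fin m) A := Matrix.of fun a b => ext0 (r' a) (w b)
    have : r' = mulMat G r := by
      ext a i
      have h1 := kerGen_mem v h i
      rw [hk, LinearMap.mem_ker] at h1
      have h2 := congrFun h1 a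
      rw [kerGen, map_sub, map_sum, Pi.sub_apply, Finset.sum_apply, chartLin_basis,
        Pi.zero_apply, sub_eq_zero] at h2
      rw [h2]
      refine Finset.sum_congr rfl fun b _ => ?_
      rw [map_smul, Pi.smul_apply, chartLin_basis0, smul_eq_mul, mul_comm]
      rfl
    intro i j
    rw [this, plucker_mulMat, plucker_mulMat]
    ring
  · intro hp
    have hu : IsUnit (plucker r' w) := by
      have := hp w' w
      rw [h'.plucker_eq_one, h.plucker_eq_one, one_mul] at this
      rw [mul_comm] at this
      exact IsUnit.of_mul_eq_one _ this
    obtain ⟨G, hG, hn⟩ := exists_isNorm_mulMat hu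
    have : r = mulMat G r' := by
      refine h.eq_of_plucker_eq hn (funext fun i => ?_)
      rw [plucker_mulMat]
      have h3 := hp w i
      rw [h.plucker_eq_one, one_mul] at h3
      rw [h3, mul_left_comm, hG, mul_one]
    rw [this, ker_chartLin_mulMat v (IsUnit.of_mul_eq_one _ hG)]

end

/-! ### Projective quotients are kernels of normalized matrices locally -/

section

/-- A finite family which generates a finite projective module contains, near each point of the
base, a basis. Freeness is stated with denominators cleared. -/
theorem exists_notMem_of_rankAtStalk {A Q : Type u} [CommRing A] [AddCommGroup Q] [Module A Q]
    [Module.Finite A Q] [Module.Projective A Q] {ι : Type} [Finite ι] (q : ι → Q)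
    (hq : Submodule.span A (Set.range q) = ⊤) (p : PrimeSpectrum A) :
    ∃ (w : Fin (Module.rankAtStalk Q p) → ι) (g : A), g ∉ p.asIdeal ∧
      (∀ x : Q, ∃ (n : ℕ) (c : _ → A), g ^ n • x = ∑ a, c a • q (w a)) ∧
      ∀ c : Fin (Module.rankAtStalk Q p) → A, ∑ a, c a • q (w a) = 0 →
        ∃ n : ℕ, ∀ a, g ^ n * c a = 0 := by
  classical
  have := Fintype.ofFinite ι
  let Ap := Localization.AtPrime p.asIdeal
  let Qp := LocalizedModule p.asIdeal.primeCompl Q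
  let fN := LocalizedModule.mkLinearMap p.asIdeal.primeCompl Q
  have : Module.FinitePresentation A Q := Module.finitePresentation_of_projective A Q
  have hsp : Submodule.span Ap (Set.range fun i : ULift.{u} ι => fN (q i.down)) = ⊤ := by
    have h := span_eq_top_of_isLocalizedModule Ap p.asIdeal.primeCompl
      fN (v := Set.range q) hq
    rw [← h]
    congr 1
    ext x
    constructor
    · rintro ⟨i, rfl⟩; exact ⟨_, ⟨i.down, rfl⟩, rfl⟩
    · rintro ⟨_, ⟨i, rfl⟩, rfl⟩; exact ⟨⟨i⟩, rfl⟩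
  obtain ⟨κ, a, b, hb⟩ := Module.exists_basis_of_span_of_flat _ hsp
  have hfin : Fintype κ := @Fintype.ofFinite _ (Module.Finite.finite_basis b)
  have hcard : Fintype.card κ = Module.rankAtStalk Q p := by
    rw [← Module.finrank_eq_card_basis b]
    rfl
  let e : κ ≃ Fin (Module.rankAtStalk Q p) := Fintype.equivFinOfCardEq hcard
  let w : Fin (Module.rankAtStalk Q p) → ι := fun i => (a (e.symm i)).down
  let f : (Fin (Module.rankAtStalk Q p) → A) →ₗ[A] Q := Fintype.linearCombination A fun i => q (w i)
  let b' := b.reindex e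
  have hb' : ∀ i, b' i = fN (q (w i)) := fun i => by simp [b', hb, w]
  let fM : (Fin (Module.rankAtStalk Q p) → A) →ₗ[A] (Fin (Module.rankAtStalk Q p) → Ap) :=
    LinearMap.pi fun i => (Algebra.linearMap A Ap).comp (LinearMap.proj i)
  have hbij : Function.Bijective (IsLocalizedModule.map p.asIdeal.primeCompl fM fN f) := by
    have : IsLocalizedModule.map p.asIdeal.primeCompl fM fN f =
        (b'.equivFun.symm.toLinearMap.restrictScalars A) := by
      apply IsLocalizedModule.linearMap_ext p.asIdeal.primeCompl fM fN
      rw [IsLocalizedModule.map_comp]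
      refine LinearMap.pi_ext' fun i => LinearMap.ext_ring ?_
      have h1 : fM (Pi.single i 1) = Pi.single i 1 := by
        ext j
        simp only [fM, LinearMap.pi_apply, LinearMap.comp_apply, LinearMap.proj_apply,
          Algebra.linearMap_apply, Pi.single_apply]
        split <;> simp
      simp only [LinearMap.comp_apply, LinearMap.single_apply, h1, LinearMap.coe_restrictScalars,
        LinearEquiv.coe_coe]
      rw [show f (Pi.single i 1) = q (w i) by simp [f]]
      rw [Module.Basis.equivFun_symm_apply]
      simp [Pi.single_apply, hb']
    rw [this]
    exact b'.equivFun.symm.bijective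
  obtain ⟨g, hg, hgb⟩ := Module.FinitePresentation.exists_notMem_bijective f p.asIdeal fM fN hbij
  refine ⟨w, g, hg, fun x => ?_, fun c hc => ?_⟩
  · obtain ⟨y, hy⟩ := hgb.2 (LocalizedModule.mk x 1)
    induction y using LocalizedModule.induction_on with | _ c s => ?_
    rw [LocalizedModule.map_mk, LocalizedModule.mk_eq] at hy
    obtain ⟨⟨_, n, rfl⟩, hy⟩ := hy
    obtain ⟨_, n', rfl⟩ := s
    refine ⟨n + n', g ^ n • c, ?_⟩
    have : g ^ n • f c = g ^ n • g ^ n' • x := by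
      simpa [Submonoid.smul_def] using hy
    rw [pow_add, mul_smul, ← this, ← map_smul]
    simp [f, Fintype.linearCombination_apply, Finset.smul_sum, mul_smul]
  · have h0 : LocalizedModule.map (Submonoid.powers g) f (LocalizedModule.mk c 1) =
        LocalizedModule.map (Submonoid.powers g) f 0 := by
      rw [LocalizedModule.map_mk, map_zero]
      rw [show f c = 0 by simpa [f, Fintype.linearCombination_apply] using hc]
      simp
    have h1 := hgb.1 h0
    rw [← LocalizedModule.zero_mk 1, LocalizedModule.mk_eq] at h1
    obtain ⟨⟨_, n, rfl⟩, h1⟩ := h1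
    refine ⟨n, fun a => ?_⟩
    simpa [Submonoid.smul_def] using congrFun h1 a

variable {k : Type u} [Field k] {V : Type u} [AddCommGroup V] [Module k V]
  {A B C : Type u} [CommRing A] [Algebra k A] [CommRing B] [Algebra k B] [CommRing C] [Algebra k C]
  {ι : Type} [Fintype ι] (v : Module.Basis ι k V) {m : ℕ}

/-- The submodule `S` of `A ⊗ V` is stable under the operators in `W`. For `V = F` and `W` the
multiplications by elements of `k⟦t⟧`, the stable submodules are the submodules over `A ⊗ k⟦t⟧`.
-/
def Stable (W : Set (V →ₗ[k] V)) (S : Submodule A (A ⊗[k] V)) : Prop :=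
  ∀ e ∈ W, ∀ s ∈ S, e.baseChange A s ∈ S

/-- Locally on `Spec A`, the submodule `S` is the kernel of a normalized matrix with `m` rows.
Equivalently, `(A ⊗ V) / S` is finite and projective of rank `m`: `isLocKer_of_projective`,
`IsLocKer.projective`. -/
def IsLocKer (v : Module.Basis ι k V) (m : ℕ) (S : Submodule A (A ⊗[k] V)) : Prop :=
  ∀ p : PrimeSpectrum A, ∃ g ∉ p.asIdeal, ∃ (w : Fin m → Option ι)
    (r : Fin m → ι → Localization.Away g), IsNorm r w ∧
      bcSub (locHom k g) S = LinearMap.ker (chartLin v r)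

variable {v}

theorem isLocKer_of_projective {S : Submodule A (A ⊗[k] V)} [Module.Finite A (A ⊗[k] V ⧸ S)]
    [Module.Projective A (A ⊗[k] V ⧸ S)]
    (hr : ∀ p, Module.rankAtStalk (R := A) (A ⊗[k] V ⧸ S) p = m) : IsLocKer v m S := by
  classical
  intro p
  have hsp : Submodule.span A (Set.range fun i => S.mkQ (1 ⊗ₜ[k] v i)) = ⊤ := by
    have : (Set.range fun i => S.mkQ (1 ⊗ₜ[k] v i)) = S.mkQ '' Set.range (v.baseChange A) := by
      rw [← Set.range_comp]
      congr 1
      ext i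
      simp
    rw [this, ← Submodule.map_span, Module.Basis.span_eq, Submodule.map_top, Submodule.range_mkQ]
  obtain ⟨w, g, hg, h1, h2⟩ := exists_notMem_of_rankAtStalk _ hsp p
  revert w
  rw [hr p]
  intro w h1 h2
  choose N c hc using fun i => h1 (S.mkQ (1 ⊗ₜ[k] v i))
  have hgu : IsUnit (algebraMap A (Localization.Away g) g) :=
    IsLocalization.Away.algebraMap_isUnit g
  let gi : Localization.Away g := ↑hgu.unit⁻¹
  have hgi : gi * algebraMap A (Localization.Away g) g = 1 := hgu.val_inv_mul
  have hgin : ∀ n, gi ^ n * algebraMap A (Localization.Away g) g ^ n = 1 := fun n => by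
    rw [← mul_pow, hgi, one_pow]
  have hzero : ∀ c' : Fin m → A, (∑ a, c' a • S.mkQ (1 ⊗ₜ[k] v (w a)) = 0) →
      ∀ a, algebraMap A (Localization.Away g) (c' a) = 0 := by
    intro c' hc' a
    obtain ⟨n, hn⟩ := h2 c' hc'
    have := congrArg (algebraMap A (Localization.Away g)) (hn a)
    rw [map_mul, map_pow, map_zero] at this
    exact ((hgu.pow n).mul_right_eq_zero).1 this
  -- The matrix expresses the images of the basis of `V` in the local basis of the quotient.
  let r : Fin m → ι → Localization.Away g := fun a i => gi ^ N i * algebraMap A _ (c i a)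
  have hnorm : IsNorm r fun a => some (w a) := by
    intro a b
    change gi ^ N (w b) * algebraMap A _ (c (w b) a) = _
    have := hzero (fun a => (if a = b then g ^ N (w b) else 0) - c (w b) a) (by
      simp only [sub_smul, Finset.sum_sub_distrib]
      rw [← hc]
      simp) a
    rw [map_sub, sub_eq_zero] at this
    rw [← this]
    split_ifs
    · rw [map_pow, hgin]
    · rw [map_zero, mul_zero]
  refine ⟨g, hg, fun a => some (w a), r, hnorm, le_antisymm ?_ ?_⟩
  · rw [bcSub_le_iff]
    intro x hx
    rw [LinearMap.mem_ker]
    let y := (v.baseChange A).repr x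
    have hxy : x = ∑ i, y i • (1 ⊗ₜ v i : A ⊗[k] V) := by
      conv_lhs => rw [← (v.baseChange A).sum_repr x]
      simp [y]
    -- a common exponent
    let M := ∑ i, N i
    have hM : ∀ i, N i ≤ M := fun i => Finset.single_le_sum (fun _ _ => Nat.zero_le _)
      (Finset.mem_univ i)
    have hs : ∑ a, (∑ i, y i * g ^ (M - N i) * c i a) • S.mkQ (1 ⊗ₜ[k] v (w a)) = 0 := by
      simp only [Finset.sum_smul]
      rw [Finset.sum_comm]
      have : ∀ i, ∑ a, (y i * g ^ (M - N i) * c i a) • S.mkQ (1 ⊗ₜ[k] v (w a)) =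
          g ^ M • S.mkQ (y i • (1 ⊗ₜ v i : A ⊗[k] V)) := by
        intro i
        simp only [mul_smul (y i * g ^ (M - N i))]
        rw [← Finset.smul_sum, ← hc, smul_smul, mul_assoc, ← pow_add, Nat.sub_add_cancel (hM i),
          map_smul, smul_smul, mul_comm]
      simp only [this]
      rw [← Finset.smul_sum, ← map_sum, ← hxy,
        show S.mkQ x = 0 from (Submodule.Quotient.mk_eq_zero S).2 hx, smul_zero]
    ext a
    have h3 := hzero _ hs a
    rw [Pi.zero_apply, hxy, map_sum, map_sum, Finset.sum_apply]
    rw [map_sum] at h3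
    refine (((hgu.pow M).mul_right_eq_zero).1 ?_)
    rw [Finset.mul_sum, ← h3]
    refine Finset.sum_congr rfl fun i _ => ?_
    rw [bcMap_smul, map_smul, Pi.smul_apply, bcMap_tmul, map_one, chartLin_basis, smul_eq_mul]
    change _ * (algebraMap A _ (y i) * (gi ^ N i * _)) = _
    rw [map_mul, map_mul, map_pow]
    conv_lhs => rw [← Nat.sub_add_cancel (hM i), pow_add]
    linear_combination (algebraMap A (Localization.Away g) (y i)) * (algebraMap A _ (c i a)) *
      (algebraMap A (Localization.Away g) g) ^ (M - N i) * hgin (N i)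
  · rw [ker_chartLin_eq_span v hnorm, Submodule.span_le]
    rintro _ ⟨i, rfl⟩
    have h4 : g ^ N i • (1 ⊗ₜ v i : A ⊗[k] V) - ∑ a, c i a • (1 ⊗ₜ v (w a) : A ⊗[k] V) ∈ S := by
      rw [← Submodule.Quotient.mk_eq_zero, ← Submodule.mkQ_apply, map_sub, map_smul, hc, map_sum]
      simp
    have h5 := Submodule.smul_mem _ (gi ^ N i) (bcMap_mem_bcSub (locHom k g) h4)
    suffices h : kerGen v r (fun a => some (w a)) i = gi ^ N i • bcMap V (locHom k g)
        (g ^ N i • (1 ⊗ₜ v i : A ⊗[k] V) - ∑ a, c i a • (1 ⊗ₜ v (w a) : A ⊗[k] V)) by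
      rw [h]; exact h5
    rw [map_sub, map_sum, bcMap_smul, smul_sub, smul_smul, kerGen, map_pow]
    change _ = (gi ^ N i * algebraMap A _ g ^ N i) • bcMap V (locHom k g) _ - _
    rw [hgin, one_smul, bcMap_tmul, map_one, Finset.smul_sum]
    congr 1
    refine Finset.sum_congr rfl fun a _ => ?_
    rw [bcMap_smul, bcMap_tmul, map_one, smul_smul]
    rfl

theorem isLocalizedModule_of_bcSub_eq {S : Submodule A (A ⊗[k] V)} {g : A} {w : Fin m → Option ι}
    {r : Fin m → ι → Localization.Away g} (hn : IsNorm r w)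
    (hS : bcSub (locHom k g) S = LinearMap.ker (chartLin v r)) :
    ∃ f : (A ⊗[k] V ⧸ S) →ₗ[A] (Fin m → Localization.Away g),
      IsLocalizedModule (Submonoid.powers g) f := by
  have hle : S ≤ LinearMap.ker (((chartLin v r).restrictScalars A).comp
      ({ bcMap V (locHom k g) with
        map_smul' := fun a x => by
          change bcMap V _ _ = a • bcMap V _ _
          rw [bcMap_smul]
          exact algebraMap_smul _ _ _ } : A ⊗[k] V →ₗ[A] Localization.Away g ⊗[k] V)) := by
    intro x hx
    have := hS ▸ bcMap_mem_bcSub (locHom k g) hx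
    exact this
  refine ⟨S.liftQ _ hle, ?_, ?_, ?_⟩
  · rintro ⟨_, n, rfl⟩
    have hu := (IsLocalization.Away.algebraMap_isUnit (S := Localization.Away g) g).pow n
    rw [Module.End.isUnit_iff]
    constructor
    · intro x y h
      ext a
      have := congrFun h a
      change g ^ n • x a = g ^ n • y a at this
      rw [Algebra.smul_def, Algebra.smul_def, map_pow] at this
      exact hu.mul_left_cancel this
    · intro y
      refine ⟨fun a => ↑hu.unit⁻¹ * y a, ?_⟩
      ext a
      change g ^ n • (_ * y a) = y a
      rw [Algebra.smul_def, map_pow, ← mul_assoc, hu.mul_val_inv, one_mul]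
  · intro y
    obtain ⟨z, rfl⟩ := chartLin_surjective v hn y
    obtain ⟨n, x, hx⟩ := exists_pow_smul_eq_bcMap g z
    refine ⟨(S.mkQ x, ⟨g ^ n, n, rfl⟩), ?_⟩
    change g ^ n • chartLin v r z = chartLin v r (bcMap V (locHom k g) x)
    rw [← hx]
    ext a
    rw [← algebraMap_smul (Localization.Away g), ← algebraMap_smul (Localization.Away g) (g ^ n) z,
      map_smul]
  · intro x y h
    obtain ⟨x, rfl⟩ := S.mkQ_surjective x
    obtain ⟨y, rfl⟩ := S.mkQ_surjective y
    have h1 : chartLin v r (bcMap V (locHom k g) x) = chartLin v r (bcMap V (locHom k g) y) := h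
    have h2 : bcMap V (locHom k g) (x - y) ∈ bcSub (locHom k g) S := by
      rw [hS, LinearMap.mem_ker, map_sub, map_sub, h1, sub_self]
    obtain ⟨n, hn⟩ := exists_pow_smul_mem_of_bcMap_mem g h2
    refine ⟨⟨g ^ n, n, rfl⟩, ?_⟩
    change g ^ n • S.mkQ x = g ^ n • S.mkQ y
    rw [← sub_eq_zero, ← smul_sub, ← map_sub, ← map_smul]
    exact (Submodule.Quotient.mk_eq_zero S).2 hn

theorem IsLocKer.projective {S : Submodule A (A ⊗[k] V)} (h : IsLocKer v m S) :
    Module.Finite A (A ⊗[k] V ⧸ S) ∧ Module.Projective A (A ⊗[k] V ⧸ S) ∧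
      ∀ p, Module.rankAtStalk (R := A) (A ⊗[k] V ⧸ S) p = m := by
  have hfin : Module.Finite A (A ⊗[k] V ⧸ S) := by
    have := Module.Finite.of_basis (v.baseChange A)
    infer_instance
  choose g hg w r hn hS using h
  choose f hf using fun p => isLocalizedModule_of_bcSub_eq (hn p) (hS p)
  have hspan : Ideal.span (Set.range g) = ⊤ := by
    by_contra hne
    obtain ⟨q, hq, hle⟩ := Ideal.exists_le_maximal _ hne
    exact hg ⟨q, hq.isPrime⟩ (hle (Ideal.subset_span ⟨_, rfl⟩))
  choose P hP using fun x : Set.range g => x.2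
  have hg' : ∀ x : Set.range g, IsLocalization.Away x.1 (Localization.Away (g (P x))) := by
    intro x; rw [← hP x]; infer_instance
  have hf' : ∀ x : Set.range g, IsLocalizedModule (Submonoid.powers x.1) (f (P x)) := by
    intro x; rw [← hP x]; infer_instance
  have hfp : Module.FinitePresentation A (A ⊗[k] V ⧸ S) :=
    Module.FinitePresentation.of_localizationSpan' (Rₚ := fun x => Localization.Away (g (P x)))
      (Set.range g) hspan (fun x => f (P x)) (fun x => inferInstance)
  have hflat : Module.Flat A (A ⊗[k] V ⧸ S) := by
    refine Module.flat_of_isLocalized_span (R := A) A _ (Set.range g) hspan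
      (fun x => Fin m → Localization.Away (g (P x))) (fun x => f (P x)) (fun x => ?_)
    have := IsLocalization.flat (Localization.Away (g (P x))) (Submonoid.powers (g (P x)))
    infer_instance
  refine ⟨hfin, Module.Flat.projective_of_finitePresentation, fun p => ?_⟩
  have hb := (isLocalizedModule_iff_isBaseChange (Submonoid.powers (g p)) (Localization.Away (g p))
    (f p)).1 (hf p)
  obtain ⟨q, hq⟩ : p ∈ Set.range (PrimeSpectrum.comap (algebraMap A (Localization.Away (g p)))) :=
    by
    rw [PrimeSpectrum.localization_away_comap_range (Localization.Away (g p)) (g p)]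
    exact hg p
  have : Module.Projective A (A ⊗[k] V ⧸ S) := Module.Flat.projective_of_finitePresentation
  have h1 := Module.rankAtStalk_isBaseChange hb q
  have : Nontrivial (Localization.Away (g p)) := q.nontrivial
  rw [hq, Module.rankAtStalk_eq_finrank_of_free] at h1
  rw [← h1]
  simp

end

/-! ### Gluing points over localizations -/

section
variable {k : Type u} [Field k]
  {A B C : Type u} [CommRing A] [Algebra k A] [CommRing B] [Algebra k B] [CommRing C] [Algebra k C]

/-- The extension of `f` to the localization at an element whose image is a unit. -/
def locLift (f : A →ₐ[k] B) (g : A) (hg : IsUnit (f g)) : Localization.Away g →ₐ[k] B :=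
  IsLocalization.liftAlgHom (M := Submonoid.powers g) (f := f) (by
    rintro ⟨_, n, rfl⟩
    change IsUnit (f (g ^ n))
    rw [map_pow]
    exact hg.pow n)

theorem locLift_comp (f : A →ₐ[k] B) (g : A) (hg : IsUnit (f g)) :
    (locLift f g hg).comp (locHom k g) = f := by
  ext a
  simp [locLift]

theorem eq_locLift (f : A →ₐ[k] B) (g : A) (hg : IsUnit (f g)) (h : Localization.Away g →ₐ[k] B)
    (hh : h.comp (locHom k g) = f) : h = locLift f g hg := by
  have h1 := (hh.trans (locLift_comp f g hg).symm)
  apply AlgHom.coe_ringHom_injective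
  refine IsLocalization.ringHom_ext (Submonoid.powers g) ?_
  ext a
  exact congrArg (fun q => q a) h1

theorem isUnit_locHom (g : A) : IsUnit (locHom k g g) :=
  IsLocalization.Away.algebraMap_isUnit g

theorem isUnit_locHom_of_dvd {g g' : A} (h : g ∣ g') : IsUnit (locHom k g' g) :=
  isUnit_of_dvd_unit (map_dvd _ h) (isUnit_locHom g')

theorem span_range_eq_top_of_notMem {A : Type u} [CommRing A] {g : PrimeSpectrum A → A} (hg : ∀ p,
    g p ∉ p.asIdeal) :
    Ideal.span (Set.range g) = ⊤ := by
  by_contra hne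
  obtain ⟨q, hq, hle⟩ := Ideal.exists_le_maximal _ hne
  exact hg ⟨q, hq.isPrime⟩ (hle (Ideal.subset_span ⟨_, rfl⟩))

theorem specMap_comp (f : A →ₐ[k] B) (g : B →ₐ[k] C) :
    specMap (g.comp f) = specMap g ≫ specMap f := by
  rw [specMap, specMap, specMap, ← Spec.map_comp]
  rfl

theorem specMap_injective {f g : A →ₐ[k] B} (h : specMap f = specMap g) : f = g := by
  ext a
  exact congrArg (fun q => q.hom a) (Spec.map_injective h)

theorem specOverMap_comp (f : A →ₐ[k] B) (g : B →ₐ[k] C) {T : Over (Spec (CommRingCat.of k))}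
    (x : specOver k A ⟶ T) :
    specOverMap (g.comp f) ≫ x = specOverMap g ≫ specOverMap f ≫ x := by
  apply pointHom_injective
  rw [pointHom_specOverMap, pointHom_specOverMap, pointHom_specOverMap, specMap, specMap, specMap,
    ← Spec.map_comp_assoc]
  rfl

theorem spec_hom_ext_of_notMem {Y : Scheme.{u}} {g : PrimeSpectrum A → A}
    (hg : ∀ p, g p ∉ p.asIdeal) (f f' : Spec (CommRingCat.of A) ⟶ Y)
    (h : ∀ p, specMap (locHom k (g p)) ≫ f = specMap (locHom k (g p)) ≫ f') : f = f' :=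
  AffineOpenCover.hom_ext (Scheme.affineOpenCoverOfSpanRangeEqTop (R := CommRingCat.of A) g
    (span_range_eq_top_of_notMem hg)) _ _ h

theorem spec_exists_glue_of_notMem {Y : Scheme.{u}} {g : PrimeSpectrum A → A}
    (hg : ∀ p, g p ∉ p.asIdeal)
    (f : ∀ p, Spec (CommRingCat.of (Localization.Away (g p))) ⟶ Y)
    (hf : ∀ (p q : PrimeSpectrum A) (B : CommRingCat.{u})
      (α : Spec B ⟶ Spec (CommRingCat.of (Localization.Away (g p))))
      (β : Spec B ⟶ Spec (CommRingCat.of (Localization.Away (g q)))),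
      α ≫ specMap (locHom k (g p)) = β ≫ specMap (locHom k (g q)) → α ≫ f p = β ≫ f q) :
    ∃ φ : Spec (CommRingCat.of A) ⟶ Y, ∀ p, specMap (locHom k (g p)) ≫ φ = f p :=
  AffineOpenCover.exists_glue (Scheme.affineOpenCoverOfSpanRangeEqTop (R := CommRingCat.of A) g
    (span_range_eq_top_of_notMem hg)) f hf

theorem point_ext_of_forall_prime {T : Over (Spec (CommRingCat.of k))} (x y : specOver k A ⟶ T)
    (h : ∀ p : PrimeSpectrum A, ∃ g ∉ p.asIdeal,
      specOverMap (locHom k g) ≫ x = specOverMap (locHom k g) ≫ y) : x = y := by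
  choose g hg h using h
  apply pointHom_injective
  refine spec_hom_ext_of_notMem (k := k) hg _ _ fun p => ?_
  exact congrArg pointHom (h p)

/-- Gluing of points of `T` over a Zariski cover of `Spec A`; the agreement on overlaps is tested
on algebras in which both denominators are invertible. -/
theorem exists_point_of_forall_prime {T : Over (Spec (CommRingCat.of k))}
    {g : PrimeSpectrum A → A} (hg : ∀ p, g p ∉ p.asIdeal)
    (x : ∀ p, specOver k (Localization.Away (g p)) ⟶ T)
    (hx : ∀ (p q : PrimeSpectrum A) (B : Type u) [CommRing B] [Algebra k B] (f : A →ₐ[k] B)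
      (hp : IsUnit (f (g p))) (hq : IsUnit (f (g q))),
      specOverMap (locLift f (g p) hp) ≫ x p = specOverMap (locLift f (g q) hq) ≫ x q) :
    ∃ y : specOver k A ⟶ T, ∀ p, specOverMap (locHom k (g p)) ≫ y = x p := by
  obtain ⟨φ, hφ⟩ := spec_exists_glue_of_notMem (k := k) hg (fun p => pointHom (x p)) (by
    intro p q B α β hαβ
    obtain ⟨_, z, hz⟩ := exists_point (T := specOver k A) B (α ≫ specMap (locHom k (g p)))
    obtain ⟨a, rfl, ha'⟩ := exists_algHom_of_pointHom (T := specOver k A)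
      (specOverMap (locHom k (g p))) z α hz.symm
    obtain ⟨b, rfl, hb'⟩ := exists_algHom_of_pointHom (T := specOver k A)
      (specOverMap (locHom k (g q))) z β (hαβ.symm.trans hz.symm)
    have hab : a.comp (locHom k (g p)) = b.comp (locHom k (g q)) :=
      specMap_injective (k := k) ((specMap_comp _ _).trans (Eq.trans hαβ (specMap_comp _ _).symm))
    have hp : IsUnit (a.comp (locHom k (g p)) (g p)) := (isUnit_locHom (k := k) (g p)).map a
    have hq : IsUnit (a.comp (locHom k (g p)) (g q)) := hab ▸ (isUnit_locHom (k := k) (g q)).map b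
    have h3 := congrArg pointHom (hx p q B (a.comp (locHom k (g p))) hp hq)
    rw [← eq_locLift _ _ hp a rfl, ← eq_locLift _ _ hq b hab.symm] at h3
    exact h3)
  refine ⟨mkPoint φ ?_, fun p => pointHom_injective (hφ p)⟩
  refine spec_hom_ext_of_notMem (k := k) hg _ _ fun p => ?_
  rw [← Category.assoc, hφ, pointHom_str, specMap_str]

end

/-! ### The Plücker embedding -/

section
variable {k : Type u} [Field k] {V : Type u} [AddCommGroup V] [Module k V]
  {A B C : Type u} [CommRing A] [Algebra k A] [CommRing B] [Algebra k B] [CommRing C] [Algebra k C]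
  {ι : Type} [Fintype ι] (v : Module.Basis ι k V) {m : ℕ}

variable (ι m) in
/-- The dimension of the projective space of the Plücker coordinates. -/
def plDim : ℕ := Nat.card (Fin m → Option ι) - 1

variable (ι m) in
/-- A numbering of the Plücker coordinates. -/
def plIdx : Fin (plDim ι m + 1) ≃ (Fin m → Option ι) :=
  (finCongr (Nat.sub_add_cancel (Nat.card_pos (α := Fin m → Option ι)))).trans
    (Finite.equivFin (Fin m → Option ι)).symm

/-- The point of projective space whose homogeneous coordinates are the Plücker coordinates of a
normalized matrix. -/
def plPt (r : Fin m → ι → A) (w : Fin m → Option ι) (h : IsNorm r w) :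
    specOver k A ⟶ projSpace k (plDim ι m) :=
  projPt ((plIdx ι m).symm w) (fun i => plucker r (plIdx ι m i)) (by
    rw [Equiv.apply_symm_apply, h.plucker_eq_one]; exact isUnit_one)

theorem specOverMap_plPt (f : A →ₐ[k] B) {r : Fin m → ι → A} {w : Fin m → Option ι}
    (h : IsNorm r w) : specOverMap f ≫ plPt r w h = plPt _ w (h.map f) := by
  rw [plPt, specOverMap_projPt, plPt]
  congr 1
  ext i
  rw [map_plucker]

theorem plPt_eq_iff {r r' : Fin m → ι → A} {w w' : Fin m → Option ι} (h : IsNorm r w)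
    (h' : IsNorm r' w') : (plPt r w h : specOver k A ⟶ _) = plPt r' w' h' ↔
      LinearMap.ker (chartLin v r) = LinearMap.ker (chartLin v r') := by
  rw [ker_chartLin_eq_iff v h h', plPt, plPt, projPt_eq_iff]
  constructor
  · intro H i j
    simpa using H ((plIdx ι m).symm i) ((plIdx ι m).symm j)
  · intro H i j
    exact H _ _

theorem bcMap_locLift (f : A →ₐ[k] B) (g : A) (hg : IsUnit (f g)) (x : A ⊗[k] V) :
    bcMap V (locLift f g hg) (bcMap V (locHom k g) x) = bcMap V f x := by
  rw [← bcMap_comp, locLift_comp]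

theorem bcSub_locLift (f : A →ₐ[k] B) (g : A) (hg : IsUnit (f g)) (S : Submodule A (A ⊗[k] V)) :
    bcSub (locLift f g hg) (bcSub (locHom k g) S) = bcSub f S := by
  rw [← bcSub_comp, locLift_comp]

/-- `S` is the kernel of a normalized matrix and `x` is its Plücker point. -/
def IsPluckerPtOfNorm (x : specOver k A ⟶ projSpace k (plDim ι m)) (S : Submodule A
    (A ⊗[k] V)) : Prop :=
  ∃ (r : Fin m → ι → A) (w : Fin m → Option ι) (h : IsNorm r w),
    x = plPt r w h ∧ S = LinearMap.ker (chartLin v r)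

variable {v}

theorem IsPluckerPtOfNorm.map {x : specOver k A ⟶ projSpace k (plDim ι m)} {S : Submodule A
    (A ⊗[k] V)}
    (h : IsPluckerPtOfNorm v x S) (f : A →ₐ[k] B) : IsPluckerPtOfNorm v (specOverMap f ≫ x)
      (bcSub f S) := by
  obtain ⟨r, w, h, rfl, rfl⟩ := h
  exact ⟨_, w, h.map f, specOverMap_plPt f h, bcSub_ker_chartLin v h f⟩

theorem IsPluckerPtOfNorm.unique_right {x : specOver k A ⟶ projSpace k (plDim ι m)}
    {S S' : Submodule A (A ⊗[k] V)} (h : IsPluckerPtOfNorm v x S)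
        (h' : IsPluckerPtOfNorm v x S') : S = S' := by
  obtain ⟨r, w, h, rfl, rfl⟩ := h
  obtain ⟨r', w', h', hx, rfl⟩ := h'
  exact (plPt_eq_iff v h h').1 hx

theorem IsPluckerPtOfNorm.unique_left {x y : specOver k A ⟶ projSpace k (plDim ι m)}
    {S : Submodule A (A ⊗[k] V)} (h : IsPluckerPtOfNorm v x S) (h' : IsPluckerPtOfNorm v y S) : x =
        y := by
  obtain ⟨r, w, h, rfl, rfl⟩ := h
  obtain ⟨r', w', h', rfl, hS⟩ := h'
  exact (plPt_eq_iff v h h').2 hS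

theorem IsPluckerPtOfNorm.map_locLift {g : A} {x : specOver k A ⟶ projSpace k (plDim ι m)}
    {S : Submodule (Localization.Away g) (Localization.Away g ⊗[k] V)}
    (h : IsPluckerPtOfNorm v (specOverMap (locHom k g) ≫ x) S) (f : A →ₐ[k] B) (hg : IsUnit (f g)) :
    IsPluckerPtOfNorm v (specOverMap f ≫ x) (bcSub (locLift f g hg) S) := by
  have := h.map (locLift f g hg)
  rwa [← specOverMap_comp, locLift_comp] at this

variable (v) in
/-- Locally on `Spec A`, `S` is the kernel of a normalized matrix and `x` its Plücker point. Each
of `x` and `S` determines the other: `IsPluckerPt.unique_left`, `IsPluckerPt.unique_right`. -/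
def IsPluckerPt (x : specOver k A ⟶ projSpace k (plDim ι m)) (S : Submodule A (A ⊗[k] V)) : Prop :=
  ∀ p : PrimeSpectrum A, ∃ g ∉ p.asIdeal,
    IsPluckerPtOfNorm v (specOverMap (locHom k g) ≫ x) (bcSub (locHom k g) S)

theorem IsPluckerPt.map {x : specOver k A ⟶ projSpace k (plDim ι m)} {S : Submodule A (A ⊗[k] V)}
    (h : IsPluckerPt v x S) (f : A →ₐ[k] B) : IsPluckerPt v (specOverMap f ≫ x) (bcSub f S) := by
  intro q
  obtain ⟨g, hg, h⟩ := h (PrimeSpectrum.comap f.toRingHom q)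
  refine ⟨f g, hg, ?_⟩
  have hu : IsUnit (((locHom k (f g)).comp f) g) := isUnit_locHom (k := k) (f g)
  have := h.map_locLift ((locHom k (f g)).comp f) hu
  rwa [bcSub_locLift, specOverMap_comp, bcSub_comp] at this

theorem notMem_mul {p : PrimeSpectrum A} {g g' : A} (h : g ∉ p.asIdeal) (h' : g' ∉ p.asIdeal) :
    g * g' ∉ p.asIdeal := fun h1 => (p.2.mem_or_mem h1).elim h h'

theorem IsPluckerPt.unique_right {x : specOver k A ⟶ projSpace k (plDim ι m)}
    {S S' : Submodule A (A ⊗[k] V)} (h : IsPluckerPt v x S) (h' : IsPluckerPt v x S') : S = S' := by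
  refine submodule_eq_of_forall_prime fun p => ?_
  obtain ⟨g, hg, h⟩ := h p
  obtain ⟨g', hg', h'⟩ := h' p
  refine ⟨g * g', notMem_mul hg hg', ?_⟩
  have h1 := h.map_locLift (locHom k (g * g')) (isUnit_locHom_of_dvd (dvd_mul_right _ _))
  have h2 := h'.map_locLift (locHom k (g * g')) (isUnit_locHom_of_dvd (dvd_mul_left _ _))
  rw [← bcSub_comp, locLift_comp] at h1 h2
  exact h1.unique_right h2

theorem IsPluckerPt.unique_left {x y : specOver k A ⟶ projSpace k (plDim ι m)}
    {S : Submodule A (A ⊗[k] V)} (h : IsPluckerPt v x S) (h' : IsPluckerPt v y S) : x = y := by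
  refine point_ext_of_forall_prime _ _ fun p => ?_
  obtain ⟨g, hg, h⟩ := h p
  obtain ⟨g', hg', h'⟩ := h' p
  refine ⟨g * g', notMem_mul hg hg', ?_⟩
  have h1 := h.map_locLift (locHom k (g * g')) (isUnit_locHom_of_dvd (dvd_mul_right _ _))
  have h2 := h'.map_locLift (locHom k (g * g')) (isUnit_locHom_of_dvd (dvd_mul_left _ _))
  rw [← bcSub_comp, locLift_comp] at h1 h2
  exact h1.unique_left h2

/-- The Plücker embedding: a submodule with locally free quotient of rank `m` has a Plücker point,
glued from the Plücker points of its local matrices. -/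
theorem IsLocKer.exists_isPluckerPt {S : Submodule A (A ⊗[k] V)} (h : IsLocKer v m S) :
    ∃ x : specOver k A ⟶ projSpace k (plDim ι m), IsPluckerPt v x S := by
  choose g hg w r hn hS using h
  have hrel : ∀ p, IsPluckerPtOfNorm v (plPt (r p) (w p) (hn p)) (bcSub (locHom k (g p)) S) :=
    fun p => ⟨r p, w p, hn p, rfl, hS p⟩
  obtain ⟨x, hx⟩ := exists_point_of_forall_prime hg (fun p => plPt (r p) (w p) (hn p)) (by
    intro p q B _ _ f hp hq
    have h1 := (hrel p).map (locLift f _ hp)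
    have h2 := (hrel q).map (locLift f _ hq)
    rw [← bcSub_comp, locLift_comp] at h1 h2
    exact h1.unique_left h2)
  exact ⟨x, fun p => ⟨g p, hg p, hx p ▸ hrel p⟩⟩

variable (v) in
/-- The submodule with Plücker point `x`. It consists of the elements which lie, after every base
change over which `x` becomes the Plücker point of a normalized matrix, in the kernel of that
matrix. -/
def subOf (x : specOver k A ⟶ projSpace k (plDim ι m)) : Submodule A (A ⊗[k] V) where
  carrier := {s | ∀ (B : Type u) [CommRing B] [Algebra k B] (f : A →ₐ[k] B)
    (S : Submodule B (B ⊗[k] V)), IsPluckerPtOfNorm v (specOverMap f ≫ x) S → bcMap V f s ∈ S}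
  add_mem' {s s'} hs hs' B _ _ f S hS := by
    rw [map_add]
    exact add_mem (hs B f S hS) (hs' B f S hS)
  zero_mem' B _ _ f S hS := by
    rw [map_zero]
    exact zero_mem _
  smul_mem' a s hs B _ _ f S hS := by
    rw [bcMap_smul]
    exact S.smul_mem _ (hs B f S hS)

/-- If `x` is locally the Plücker point of some submodule, then these submodules glue to `subOf v
x`. -/
theorem isPluckerPt_subOf {x : specOver k A ⟶ projSpace k (plDim ι m)}
    (hx : ∀ p : PrimeSpectrum A, ∃ g ∉ p.asIdeal, ∃ S,
      IsPluckerPtOfNorm v (specOverMap (locHom k g) ≫ x) S) :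
    IsPluckerPt v x (subOf v x) := by
  classical
  choose g hg S hS using hx
  obtain ⟨t', ht, htop⟩ := (Ideal.span_eq_top_iff_finite _).1 (span_range_eq_top_of_notMem hg)
  rw [← Set.image_univ, Finset.subset_set_image_iff] at ht
  obtain ⟨t, -, rfl⟩ := ht
  have hcov : ∀ {B : Type u} [CommRing B] [Algebra k B] (f : A →ₐ[k] B) (q : PrimeSpectrum B),
      ∃ p ∈ t, f (g p) ∉ q.asIdeal := by
    intro B _ _ f q
    by_contra! h
    have h1 : Ideal.span (t.image g : Set A) ≤ (PrimeSpectrum.comap f.toRingHom q).asIdeal := by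
      rw [Ideal.span_le]
      intro a ha
      obtain ⟨p, hp, rfl⟩ := Finset.mem_image.1 ha
      exact h p hp
    rw [htop, top_le_iff] at h1
    exact (PrimeSpectrum.comap f.toRingHom q).2.ne_top h1
  -- An element of `S p0` extends, after clearing denominators, to an element of each `S p` in
  -- the cover, since both submodules have the same Plücker point on the overlap.
  have htf : ∀ p0 y, y ∈ S p0 → ∀ (x' : A ⊗[k] V) (n : ℕ),
      (g p0) ^ n • y = bcMap V (locHom k (g p0)) x' →
      ∀ p, ∃ N : ℕ, ∀ M ≥ N, bcMap V (locHom k (g p)) ((g p0) ^ M • x') ∈ S p := by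
    intro p0 y hy x' n hx' p
    let h0 : Localization.Away (g p) := locHom k (g p) (g p0)
    have h1 := (hS p).map (locHom k h0)
    rw [← specOverMap_comp] at h1
    have hu : IsUnit (((locHom k h0).comp (locHom k (g p))) (g p0)) := isUnit_locHom (k := k) h0
    have h2 := (hS p0).map_locLift ((locHom k h0).comp (locHom k (g p))) hu
    have h3 := h1.unique_right h2
    have h4 : bcMap V (locHom k h0) (bcMap V (locHom k (g p)) x') ∈ bcSub (locHom k h0) (S p) := by
      rw [h3, ← bcMap_comp, ← bcMap_locLift _ _ hu, ← hx',
        ← algebraMap_smul (Localization.Away (g p0)) (g p0 ^ n) y, bcMap_smul]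
      exact Submodule.smul_mem _ _ (bcMap_mem_bcSub _ hy)
    obtain ⟨N, hN⟩ := exists_pow_smul_mem_of_bcMap_mem h0 h4
    refine ⟨N, fun M hM => ?_⟩
    rw [bcMap_smul, map_pow, ← Nat.sub_add_cancel hM, pow_add, mul_smul]
    exact Submodule.smul_mem _ _ hN
  intro p0
  refine ⟨g p0, hg p0, ?_⟩
  suffices h : bcSub (locHom k (g p0)) (subOf v x) = S p0 by rw [h]; exact hS p0
  apply le_antisymm
  · rw [bcSub_le_iff]
    intro s hs
    exact hs _ _ _ (hS p0)
  · intro y hy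
    obtain ⟨n, x', hx'⟩ := exists_pow_smul_eq_bcMap (g p0) y
    choose N hN using htf p0 y hy x' n hx'
    let M := t.sup N
    have hM : ∀ p ∈ t, bcMap V (locHom k (g p)) ((g p0) ^ M • x') ∈ S p :=
      fun p hp => hN p M (Finset.le_sup hp)
    -- An element lying in all `S p` of the finite cover lies in `subOf v x`.
    have hmem : (g p0) ^ M • x' ∈ subOf v x := by
      intro B _ _ f S' hS'
      refine mem_iff_forall_prime.2 fun q => ?_
      obtain ⟨p, hp, hq⟩ := hcov f q
      refine ⟨f (g p), hq, ?_⟩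
      have h1 := hS'.map (locHom k (f (g p)))
      rw [← specOverMap_comp] at h1
      have hu : IsUnit (((locHom k (f (g p))).comp f) (g p)) := isUnit_locHom (k := k) (f (g p))
      have h2 := (hS p).map_locLift ((locHom k (f (g p))).comp f) hu
      rw [h1.unique_right h2, ← bcMap_comp, ← bcMap_locLift _ _ hu]
      exact bcMap_mem_bcSub _ (hM p hp)
    have h5 := bcMap_mem_bcSub (locHom k (g p0)) hmem
    have hu := (isUnit_locHom (k := k) (g p0)).pow (M + n)
    have h6 : bcMap V (locHom k (g p0)) (g p0 ^ M • x') = (locHom k (g p0) (g p0)) ^ (M + n) • y :=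
      by
      rw [bcMap_smul, ← hx', ← algebraMap_smul (Localization.Away (g p0)) (g p0 ^ n) y, map_pow,
        map_pow, pow_add, mul_smul]
      rfl
    rw [h6] at h5
    have h7 := Submodule.smul_mem _ (↑hu.unit⁻¹ : Localization.Away (g p0)) h5
    rwa [smul_smul, hu.val_inv_mul, one_smul] at h7
end

/-! ### Equations of the Quot scheme -/

section
variable {k : Type u} [Field k] {V : Type u} [AddCommGroup V] [Module k V]
  {A B C : Type u} [CommRing A] [Algebra k A] [CommRing B] [Algebra k B] [CommRing C] [Algebra k C]
  {ι : Type} [Fintype ι] (v : Module.Basis ι k V) {m : ℕ} (W : Set (V →ₗ[k] V)) (δ : ℚ)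

theorem bcMap_baseChange (f : A →ₐ[k] B) (e : V →ₗ[k] V) (x : A ⊗[k] V) :
    bcMap V f (e.baseChange A x) = e.baseChange B (bcMap V f x) := by
  induction x with
  | zero => simp
  | add x y hx hy => rw [map_add, map_add, hx, hy, map_add, map_add]
  | tmul a x => rfl

variable {W δ v}

theorem Stable.map {S : Submodule A (A ⊗[k] V)} (h : Stable W S) (f : A →ₐ[k] B) :
    Stable W (bcSub f S) := by
  intro e he s hs
  induction hs using Submodule.span_induction with
  | mem s hs =>
    obtain ⟨s, hs, rfl⟩ := hs
    rw [← bcMap_baseChange]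
    exact bcMap_mem_bcSub f (h e he s hs)
  | zero => rw [map_zero]; exact zero_mem _
  | add x y _ _ hx hy => rw [map_add]; exact add_mem hx hy
  | smul a x _ hx => rw [map_smul]; exact Submodule.smul_mem _ _ hx

theorem stable_of_forall_prime {S : Submodule A (A ⊗[k] V)}
    (h : ∀ p : PrimeSpectrum A, ∃ g ∉ p.asIdeal, Stable W (bcSub (locHom k g) S)) : Stable W S := by
  intro e he s hs
  refine mem_iff_forall_prime.2 fun p => ?_
  obtain ⟨g, hg, h⟩ := h p
  refine ⟨g, hg, ?_⟩
  rw [bcMap_baseChange]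
  exact h e he _ (bcMap_mem_bcSub _ hs)

theorem stable_ker_chartLin {r : Fin m → ι → A} {w : Fin m → Option ι} (h : IsNorm r w)
    (hr : ∀ e ∈ W, ∀ i a, chartLin v r (e.baseChange A (kerGen v r w i)) a = 0) :
    Stable W (LinearMap.ker (chartLin v r)) := by
  intro e he s hs
  have hle : LinearMap.ker (chartLin v r) ≤ (LinearMap.ker (chartLin v r)).comap (e.baseChange A) :=
    by
    conv_lhs => rw [ker_chartLin_eq_span v h]
    rw [Submodule.span_le]
    rintro _ ⟨i, rfl⟩
    exact funext fun a => hr e he i a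
  exact hle hs

variable (W δ) in
/-- `S` is stable under `W`, and the quotient of `A ⊗ V` by `S` is finite and projective of rank
`δ` over `A`. The rank is a rational number, so that no `S` satisfies this over a nonzero `A` if
`δ` is not a natural number. -/
structure IsQuotSub (S : Submodule A (A ⊗[k] V)) : Prop where
  stable : Stable W S
  finite : Module.Finite A (A ⊗[k] V ⧸ S)
  projective : Module.Projective A (A ⊗[k] V ⧸ S)
  rank_eq : ∀ p : PrimeSpectrum A, (Module.rankAtStalk (R := A) (A ⊗[k] V ⧸ S) p : ℚ) = δ

variable (v W δ) in
/-- The point `x` of projective space is the Plücker point of a submodule satisfying `IsQuotSub W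
δ`, stated locally on `Spec A`. If `m ≠ δ`, this holds only over the zero ring. -/
def IsQuotPt (x : specOver k A ⟶ projSpace k (plDim ι m)) : Prop :=
  ∀ p : PrimeSpectrum A, (m : ℚ) = δ ∧ ∃ g ∉ p.asIdeal, ∃ S : Submodule _ (_ ⊗[k] V),
    IsPluckerPtOfNorm v (specOverMap (locHom k g) ≫ x) S ∧ Stable W S

theorem isQuotPt_of_forall_prime {x : specOver k A ⟶ projSpace k (plDim ι m)}
    (h : ∀ p : PrimeSpectrum A, ∃ g ∉ p.asIdeal, IsQuotPt v W δ (specOverMap (locHom k g) ≫ x)) :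
    IsQuotPt v W δ x := by
  intro p
  obtain ⟨g, hg, h⟩ := h p
  obtain ⟨q, hq⟩ : p ∈ Set.range (PrimeSpectrum.comap (algebraMap A (Localization.Away g))) := by
    rw [PrimeSpectrum.localization_away_comap_range (Localization.Away g) g]
    exact hg
  obtain ⟨hm, y, hy, S, h, hS⟩ := h q
  obtain ⟨⟨a, ⟨_, n, rfl⟩⟩, ha⟩ := IsLocalization.surj (Submonoid.powers g) y
  have hp : a ∉ p.asIdeal := by
    intro hap
    rw [← hq] at hap
    have : algebraMap A (Localization.Away g) a ∈ q.asIdeal := hap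
    rw [← ha] at this
    rcases q.2.mem_or_mem this with h1 | h1
    · exact hy h1
    · rw [map_pow] at h1
      exact q.2.ne_top (Ideal.eq_top_of_isUnit_mem _ h1 ((isUnit_locHom (k := k) g).pow n))
  have hu := isUnit_locHom_of_dvd (k := k) (dvd_mul_right g a)
  have hu' : IsUnit (locLift (locHom k (g * a)) g hu y) := by
    have h2 := congrArg (locLift (locHom k (g * a)) g hu) ha
    rw [map_mul] at h2
    have h3 : locLift (locHom k (g * a)) g hu (locHom k g a) = locHom k (g * a) a := by
      rw [← AlgHom.comp_apply, locLift_comp]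
    refine isUnit_of_mul_isUnit_left (y := locLift (locHom k (g * a)) g hu (locHom k g (g ^ n))) ?_
    refine (h2.trans h3) ▸ isUnit_locHom_of_dvd (dvd_mul_left a g)
  have h4 := h.map_locLift (locLift (locHom k (g * a)) g hu) hu'
  rw [← specOverMap_comp, locLift_comp] at h4
  exact ⟨hm, g * a, notMem_mul hg hp, _, h4, hS.map _⟩

theorem IsQuotPt.isPluckerPt_subOf {x : specOver k A ⟶ projSpace k (plDim ι m)}
    (h : IsQuotPt v W δ x) :
    IsPluckerPt v x (subOf v x) :=
  Crimping.isPluckerPt_subOf fun p => by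
    obtain ⟨-, g, hg, S, h, -⟩ := h p
    exact ⟨g, hg, S, h⟩

theorem IsQuotPt.isQuotSub {x : specOver k A ⟶ projSpace k (plDim ι m)} (h : IsQuotPt v W δ x) :
    IsQuotSub W δ (subOf v x) := by
  have hloc : IsLocKer v m (subOf v x) := by
    intro p
    obtain ⟨g, hg, r, w, hn, -, hS⟩ := h.isPluckerPt_subOf p
    exact ⟨g, hg, w, r, hn, hS⟩
  obtain ⟨h1, h2, h3⟩ := hloc.projective
  refine ⟨stable_of_forall_prime fun p => ?_, h1, h2, fun p => ?_⟩
  · obtain ⟨g, hg, hr⟩ := h.isPluckerPt_subOf p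
    obtain ⟨-, g', hg', S, hS, hst⟩ := h p
    refine ⟨g * g', notMem_mul hg hg', ?_⟩
    have h4 := hr.map_locLift (locHom k (g * g')) (isUnit_locHom_of_dvd (dvd_mul_right _ _))
    have h5 := hS.map_locLift (locHom k (g * g')) (isUnit_locHom_of_dvd (dvd_mul_left _ _))
    rw [← bcSub_comp, locLift_comp] at h4
    rw [h4.unique_right h5]
    exact hst.map _
  · rw [h3, (h p).1]

/-- Submodules satisfying `IsQuotSub` have a Plücker point in the projective space for `m = ⌊δ⌋₊`.
The floor is harmless: if it differs from `δ`, then `A` is the zero ring. -/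
theorem IsQuotSub.exists_isPluckerPt {S : Submodule A (A ⊗[k] V)} (h : IsQuotSub W δ S)
    (hm : m = ⌊δ⌋₊) : ∃ x : specOver k A ⟶ projSpace k (plDim ι m), IsQuotPt v W δ x ∧
      IsPluckerPt v x S := by
  have := h.finite
  have := h.projective
  have hδ : ∀ p : PrimeSpectrum A, (m : ℚ) = δ := by
    intro p
    rw [hm, ← h.rank_eq p, Nat.floor_natCast]
  have hk : IsLocKer v m S := isLocKer_of_projective fun p => by
    rw [hm, ← h.rank_eq p, Nat.floor_natCast]
  obtain ⟨x, hx⟩ := hk.exists_isPluckerPt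
  refine ⟨x, fun p => ⟨hδ p, ?_⟩, hx⟩
  obtain ⟨g, hg, hr⟩ := hx p
  exact ⟨g, hg, _, hr, h.stable.map _⟩

/-- The candidate for the normalized matrix with Plücker coordinates `c`, where `c u = 1`: its
entry in row `a` and column `i` is the coordinate whose index is that of `u` with the entry in
position `a` replaced by `i`. -/
def chartRow (u : Fin (plDim ι m + 1)) (c : Fin (plDim ι m + 1) → A) : Fin m → ι → A :=
  fun a i => c ((plIdx ι m).symm (Function.update (plIdx ι m u) a (some i)))

variable (v W δ) in
/-- The equations of the Quot scheme in the chart `D₊(X_u)`: the matrix `chartRow u c` is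
normalized, its Plücker coordinates are `c`, its kernel is stable under `W`, and `m = δ`. -/
def chartEqs (u : Fin (plDim ι m + 1)) (c : Fin (plDim ι m + 1) → A) : Set A :=
  {z | (∃ a b, z = ext0 (chartRow u c a) (plIdx ι m u b) - if a = b then 1 else 0) ∨
    (∃ j, z = c j - plucker (chartRow u c) (plIdx ι m j)) ∨
    (∃ e ∈ W, ∃ i a, z = chartLin v (chartRow u c)
      (e.baseChange A (kerGen v (chartRow u c) (plIdx ι m u) i)) a) ∨
    ((m : ℚ) ≠ δ ∧ z = 1)}

theorem map_mem_chartEqs (f : A →ₐ[k] B) (u : Fin (plDim ι m + 1)) (c : Fin (plDim ι m + 1) → A) :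
    f '' chartEqs v W δ u c = chartEqs v W δ u fun i => f (c i) := by
  have hrow : (chartRow u fun i => f (c i)) = fun a i => f (chartRow u c a i) := rfl
  have e1 : ∀ a b, ext0 (chartRow u (fun i => f (c i)) a) (plIdx ι m u b) - (if a = b then 1 else 0)
      = f (ext0 (chartRow u c a) (plIdx ι m u b) - if a = b then 1 else 0) := by
    intro a b
    rw [hrow, map_ext0, map_sub]
    split <;> simp
  have e2 : ∀ j, f (c j) - plucker (chartRow u (fun i => f (c i))) (plIdx ι m j) =
      f (c j - plucker (chartRow u c) (plIdx ι m j)) := by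
    intro j
    rw [hrow, map_plucker, map_sub]
  have e3 : ∀ (e : V →ₗ[k] V) (i a), chartLin v (chartRow u (fun i => f (c i)))
      (e.baseChange B (kerGen v (chartRow u (fun i => f (c i))) (plIdx ι m u) i)) a =
      f (chartLin v (chartRow u c) (e.baseChange A (kerGen v (chartRow u c) (plIdx ι m u) i)) a) :=
        by
    intro e i a
    rw [hrow, ← bcMap_kerGen, ← bcMap_baseChange, chartLin_bcMap]
  ext z
  simp only [chartEqs, Set.mem_image, Set.mem_ofPred_eq, e1, e2, e3]
  constructor
  · rintro ⟨z, (⟨a, b, rfl⟩ | ⟨j, rfl⟩ | ⟨e, he, i, a, rfl⟩ | ⟨h, rfl⟩), rfl⟩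
    · exact Or.inl ⟨a, b, rfl⟩
    · exact Or.inr (Or.inl ⟨j, rfl⟩)
    · exact Or.inr (Or.inr (Or.inl ⟨e, he, i, a, rfl⟩))
    · exact Or.inr (Or.inr (Or.inr ⟨h, map_one f⟩))
  · rintro (⟨a, b, rfl⟩ | ⟨j, rfl⟩ | ⟨e, he, i, a, rfl⟩ | ⟨h, rfl⟩)
    · exact ⟨_, Or.inl ⟨a, b, rfl⟩, rfl⟩
    · exact ⟨_, Or.inr (Or.inl ⟨j, rfl⟩), rfl⟩
    · exact ⟨_, Or.inr (Or.inr (Or.inl ⟨e, he, i, a, rfl⟩)), rfl⟩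
    · exact ⟨1, Or.inr (Or.inr (Or.inr ⟨h, rfl⟩)), map_one f⟩

theorem chartEqs_eq_zero {u : Fin (plDim ι m + 1)} {c : Fin (plDim ι m + 1) → A} (hu : c u = 1)
    {S : Submodule A (A ⊗[k] V)} (h : IsPluckerPtOfNorm v (projPt u c (hu ▸ isUnit_one)) S)
        (hS : Stable W S)
    (hm : (m : ℚ) = δ) : ∀ z ∈ chartEqs v W δ u c, z = 0 := by
  obtain ⟨r', w', h', hx, rfl⟩ := h
  rw [plPt, projPt_eq_iff] at hx
  have hunit : IsUnit (plucker r' (plIdx ι m u)) := by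
    have := hx u ((plIdx ι m).symm w')
    rw [hu, one_mul, Equiv.apply_symm_apply, h'.plucker_eq_one] at this
    exact IsUnit.of_mul_eq_one_right _ this.symm
  obtain ⟨G, hG, hn⟩ := exists_isNorm_mulMat hunit
  have hc : ∀ j, plucker (mulMat G r') j = c ((plIdx ι m).symm j) := by
    intro j
    have := hx u ((plIdx ι m).symm j)
    rw [hu, one_mul, Equiv.apply_symm_apply] at this
    rw [plucker_mulMat, this, mul_left_comm, hG, mul_one]
  have hrow : chartRow u c = mulMat G r' := by
    ext a i
    rw [chartRow, ← hc, hn.plucker_update]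
    rfl
  rintro z (⟨a, b, rfl⟩ | ⟨j, rfl⟩ | ⟨e, he, i, a, rfl⟩ | ⟨h, rfl⟩)
  · rw [hrow, hn a b, sub_self]
  · rw [hrow, hc, Equiv.symm_apply_apply, sub_self]
  · rw [hrow]
    have h1 := kerGen_mem v hn i
    rw [ker_chartLin_mulMat v (IsUnit.of_mul_eq_one _ hG)] at h1
    have h2 := hS e he _ h1
    rw [← ker_chartLin_mulMat v (IsUnit.of_mul_eq_one _ hG)] at h2
    exact congrFun h2 a
  · exact absurd hm h

theorem isQuotPt_projPt_iff {u : Fin (plDim ι m + 1)} {c : Fin (plDim ι m + 1) → A} (hu : c u = 1) :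
    IsQuotPt v W δ (projPt u c (hu ▸ isUnit_one) : specOver k A ⟶ _) ↔
      ∀ z ∈ chartEqs v W δ u c, z = 0 := by
  constructor
  · intro h z hz
    rw [← Submodule.mem_bot A]
    refine mem_of_forall_prime fun p => ?_
    obtain ⟨hm, g, hg, S, hS, hst⟩ := h p
    rw [specOverMap_projPt] at hS
    have h1 := chartEqs_eq_zero (c := fun i => locHom k g (c i)) (by rw [hu, map_one]) hS hst hm
      (locHom k g z) (by rw [← map_mem_chartEqs]; exact ⟨z, hz, rfl⟩)
    rw [← map_zero (locHom k g)] at h1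
    obtain ⟨⟨_, n, rfl⟩, h2⟩ := IsLocalization.exists_of_eq (M := Submonoid.powers g) h1
    refine ⟨g ^ n, fun h => hg (p.2.mem_of_pow_mem n h), ?_⟩
    rw [Submodule.mem_bot, smul_eq_mul]
    rw [mul_zero] at h2
    exact h2
  · intro h p
    have hm : (m : ℚ) = δ := by
      by_contra hm
      have := h 1 (Or.inr (Or.inr (Or.inr ⟨hm, rfl⟩)))
      exact p.2.ne_top ((Ideal.eq_top_iff_one _).2 (this ▸ zero_mem _))
    have hn : IsNorm (chartRow u c) (plIdx ι m u) := fun a b =>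
      sub_eq_zero.1 (h _ (Or.inl ⟨a, b, rfl⟩))
    -- The equations say that `chartRow u c` is a normalized matrix with Plücker coordinates `c`.
    have hrel : IsPluckerPtOfNorm v (projPt u c (hu ▸ isUnit_one) : specOver k A ⟶ _)
        (LinearMap.ker (chartLin v (chartRow u c))) := by
      refine ⟨_, _, hn, ?_, rfl⟩
      rw [plPt, projPt_eq_iff]
      have hc : ∀ j, plucker (chartRow u c) (plIdx ι m j) = c j := fun j =>
        (sub_eq_zero.1 (h _ (Or.inr (Or.inl ⟨j, rfl⟩)))).symm
      intro i j
      rw [hc, hc]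
      ring
    refine ⟨hm, 1, fun h => p.2.ne_top ((Ideal.eq_top_iff_one _).2 h), _, hrel.map _,
      (stable_ker_chartLin hn fun e he i a => h _ (Or.inr (Or.inr (Or.inl ⟨e, he, i, a,
        rfl⟩)))).map _⟩

end

/-! ### Representability of the Quot functor -/

section
attribute [local instance] MvPolynomial.gradedAlgebra
variable {k : Type u} [Field k]

instance (n : ℕ) : (projSpace k n).left.IsSeparated :=
  inferInstanceAs (Proj (grading k n)).IsSeparated

instance (n : ℕ) : CompactSpace (projSpace k n).left := by
  refine ⟨?_⟩
  have : (Set.univ : Set (projSpace k n).left) = ⋃ u, Set.range (chartι k u) := by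
    ext x
    simpa using iSup_opensRange_chartι n x
  rw [this]
  exact isCompact_iUnion fun u => isCompact_range (chartι k u).continuous

variable {V : Type u} [AddCommGroup V] [Module k V]
  {ι : Type} [Fintype ι] (v : Module.Basis ι k V) {m : ℕ} (W : Set (V →ₗ[k] V)) (δ : ℚ)

/-- All points of `T` with values in `k`-algebras are mapped by `f` to points satisfying
`IsQuotPt`. -/
def IsQuotHom {T : Scheme.{u}} (f : T ⟶ (projSpace k (plDim ι m)).left) : Prop :=
  ∀ (A : Type u) [CommRing A] [Algebra k A] (x : specOver k A ⟶ projSpace k (plDim ι m))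
    (j : Spec (CommRingCat.of A) ⟶ T), pointHom x = j ≫ f → IsQuotPt v W δ x

variable {v W δ}

theorem isQuotHom_left_iff {T : Over (Spec (CommRingCat.of k))} (f : T ⟶ projSpace k (plDim ι m)) :
    IsQuotHom v W δ f.left ↔ ∀ (A : Type u) [CommRing A] [Algebra k A] (x : specOver k A ⟶ T),
      IsQuotPt v W δ (x ≫ f) := by
  constructor
  · intro h A _ _ x
    exact h A (x ≫ f) (pointHom x) rfl
  · intro h A _ _ x j hx
    have h1 : j ≫ T.hom = specStr k A := by
      rw [← pointHom_str x, hx, Category.assoc, Over.w]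
    have : x = mkPoint j h1 ≫ f := pointHom_injective hx
    rw [this]
    exact h A _

theorem IsQuotHom.comp {T T' : Scheme.{u}} (g : T' ⟶ T) (f : T ⟶ (projSpace k (plDim ι m)).left)
    (h : IsQuotHom v W δ f) : IsQuotHom v W δ (g ≫ f) := fun A _ _ x j hx =>
  h A x (j ≫ g) (hx.trans (Category.assoc _ _ _).symm)

/-- Morphisms from an affine scheme factor locally through the members of an open cover. -/
theorem exists_locHom_factor {A : Type u} [CommRing A] [Algebra k A] {T : Scheme.{u}}
    (𝒰 : Scheme.OpenCover.{u} T) (j : Spec (CommRingCat.of A) ⟶ T) (p : PrimeSpectrum A) :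
    ∃ g ∉ p.asIdeal, ∃ i, ∃ j' : Spec (CommRingCat.of (Localization.Away g)) ⟶ 𝒰.X i,
      j' ≫ 𝒰.f i = specMap (locHom k g) ≫ j := by
  obtain ⟨i, y, hy⟩ := 𝒰.exists_eq (j p)
  let U : Set (PrimeSpectrum A) := {q | j q ∈ Set.range (𝒰.f i)}
  have hU : IsOpen U := (j ⁻¹ᵁ (𝒰.f i).opensRange).isOpen
  obtain ⟨_, ⟨_, ⟨g, rfl⟩, rfl⟩, hpg, hle⟩ :=
    (PrimeSpectrum.isBasis_basic_opens (R := A)).exists_subset_of_mem_open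
      (show p ∈ U from ⟨y, hy⟩) hU
  refine ⟨g, hpg, i, IsOpenImmersion.lift (𝒰.f i) (specMap (locHom k g) ≫ j) ?_,
    IsOpenImmersion.lift_fac _ _ _⟩
  rintro _ ⟨q, rfl⟩
  rw [Scheme.Hom.comp_apply]
  apply hle
  exact fun hq => q.2.ne_top (Ideal.eq_top_of_isUnit_mem _ hq (isUnit_locHom (k := k) g))

theorem isQuotHom_of_cover {T : Scheme.{u}} (𝒰 : Scheme.OpenCover.{u} T)
    (f : T ⟶ (projSpace k (plDim ι m)).left) (h : ∀ i, IsQuotHom v W δ (𝒰.f i ≫ f)) :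
    IsQuotHom v W δ f := by
  intro A _ _ x j hx
  refine isQuotPt_of_forall_prime fun p => ?_
  obtain ⟨g, hg, i, j', hj⟩ := exists_locHom_factor (k := k) 𝒰 j p
  refine ⟨g, hg, h i _ _ j' ?_⟩
  rw [pointHom_specOverMap, hx, ← Category.assoc, ← hj, Category.assoc]

theorem isQuotHom_chart_iff (u : Fin (plDim ι m + 1)) : ∃ I : Ideal (ChartRing k u),
    ∀ (A : CommRingCat.{u}) (φ : CommRingCat.of (ChartRing k u) ⟶ A),
      IsQuotHom v W δ (Spec.map φ ≫ chartι k u) ↔ I ≤ RingHom.ker φ.hom := by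
  let _ : Algebra k (ChartRing k u) := (chartConst k u).toAlgebra
  have key : ∀ (A : Type u) [CommRing A] [Algebra k A]
      (x : specOver k A ⟶ projSpace k (plDim ι m))
      (φ : CommRingCat.of (ChartRing k u) ⟶ CommRingCat.of A),
      pointHom x = Spec.map φ ≫ chartι k u →
      (IsQuotPt v W δ x ↔ Ideal.span (chartEqs v W δ u (chartCoord k u)) ≤ RingHom.ker φ.hom) := by
    intro A _ _ x φ hx
    have hconst : ∀ r, φ.hom (chartConst k u r) = algebraMap k A r := by
      intro r
      have h := pointHom_str x
      rw [hx, Category.assoc, chartι_str, specStr, ← Spec.map_comp] at h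
      exact congrArg (fun q => q.hom r) (Spec.map_injective h)
    let f : ChartRing k u →ₐ[k] A := { φ.hom with commutes' := hconst }
    have hu : φ.hom (chartCoord k u u) = 1 := by
      have : chartCoord k u u = 1 := by
        apply HomogeneousLocalization.val_injective
        rw [chartCoord, HomogeneousLocalization.Away.val_mk, HomogeneousLocalization.val_one,
          ← Localization.mk_one, Localization.mk_eq_mk_iff, Localization.r_iff_exists]
        exact ⟨1, by simp⟩
      rw [this, map_one]
    have hxe : x = projPt u (fun i => f (chartCoord k u i)) (by
        change IsUnit (φ.hom _); rw [hu]; exact isUnit_one) := by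
      apply pointHom_injective
      rw [projPt_left, hx]
      congr 2
      ext1
      refine chartEval_ext _ (hu ▸ isUnit_one) _ hconst fun i => ?_
      change _ * φ.hom _ = _
      rw [hu, mul_one]
      rfl
    rw [hxe, isQuotPt_projPt_iff hu, Ideal.span_le, ← map_mem_chartEqs]
    constructor
    · intro h z hz
      exact h _ ⟨z, hz, rfl⟩
    · rintro h _ ⟨z, hz, rfl⟩
      exact h hz
  refine ⟨Ideal.span (chartEqs v W δ u (chartCoord k u)), fun A φ => ⟨fun h => ?_, ?_⟩⟩
  · obtain ⟨_, x, hx⟩ := exists_point (T := projSpace k (plDim ι m)) A (Spec.map φ ≫ chartι k u)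
    exact (key A x φ hx).1 (h A x (𝟙 _) (hx.trans (Category.id_comp _).symm))
  · intro h B _ _ x j hx
    obtain ⟨ψ, rfl⟩ := Spec.map_surjective j
    rw [← Category.assoc, ← Spec.map_comp] at hx
    refine (key B x _ hx).2 fun z hz => ?_
    have := h hz
    rw [RingHom.mem_ker] at this ⊢
    rw [CommRingCat.hom_comp, RingHom.comp_apply, this, map_zero]

variable (v W δ m) in
/-- The closed subscheme of projective space defined by the equations `chartEqs` in the standard
charts. -/
theorem exists_quotScheme : ∃ (Z : Scheme.{u}) (i : Z ⟶ (projSpace k (plDim ι m)).left),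
    IsClosedImmersion i ∧ ∀ {T : Scheme.{u}} (f : T ⟶ (projSpace k (plDim ι m)).left),
      IsQuotHom v W δ f ↔ ∃ g : T ⟶ Z, g ≫ i = f := by
  refine exists_isClosedImmersion_iff_factors (fun f => IsQuotHom v W δ f) (fun g f h => h.comp g)
    (fun 𝒰 f h => isQuotHom_of_cover 𝒰 f h) fun x => ?_
  obtain ⟨u, hu⟩ := iSup_opensRange_chartι _ x
  obtain ⟨I, hI⟩ := isQuotHom_chart_iff (v := v) (W := W) (δ := δ) u
  exact ⟨_, chartι k u, I, inferInstance, hu, hI⟩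

variable (O : Type u) [CommRing O] [Algebra k O] [Algebra k⟦X⟧ O] [IsScalarTower k k⟦X⟧ O]

/-- The multiplications by elements of `k⟦t⟧`, as operators on `F = O / t^b O`. -/
def scalars (b : ℕ) : Set (ModT k O b →ₗ[k] ModT k O b) :=
  Set.range fun r : k⟦X⟧ => LinearMap.mulLeft k (algebraMap k⟦X⟧ (ModT k O b) r)

theorem mulLeft_baseChange {A F : Type u} [CommRing A] [Algebra k A] [CommRing F] [Algebra k F]
    (y : F) (x : A ⊗[k] F) : (LinearMap.mulLeft k y).baseChange A x = (1 ⊗ₜ[k] y) * x := by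
  induction x with
  | zero => simp
  | add x z hx hz => rw [map_add, hx, hz, mul_add]
  | tmul a x => simp

variable {O} {b : ℕ} {T : Over (Spec (CommRingCat.of k))}

theorem QuotFamily.isQuotSub (Q : QuotFamily O b δ T) {A : Type u} [CommRing A] [Algebra k A]
    (x : specOver k A ⟶ T) : IsQuotSub (scalars O b) δ (Q.S A x) where
  stable := by
    rintro _ ⟨r, rfl⟩ s hs
    rw [mulLeft_baseChange]
    exact Q.smul_mem A x r s hs
  finite := Q.finite A x
  projective := Q.projective A x
  rank_eq := Q.rank_eq A x

theorem QuotFamily.map_eq_bcSub (Q : QuotFamily O b δ T) {A B : Type u} [CommRing A] [Algebra k A]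
    [CommRing B] [Algebra k B] (f : A →ₐ[k] B) (x : specOver k A ⟶ T) :
    Q.S B (specOverMap f ≫ x) = bcSub f (Q.S A x) :=
  Q.map_eq A B f x

/-- The family of quotients given by a morphism from `T` to the Quot scheme. -/
def QuotFamily.ofHom (v : Module.Basis ι k (ModT k O b))
    (f : T ⟶ projSpace k (plDim ι m)) (hf : IsQuotHom v (scalars O b) δ f.left) :
    QuotFamily O b δ T where
  S A _ _ x := subOf v (x ≫ f)
  smul_mem A _ _ x r s hs := by
    rw [← mulLeft_baseChange]
    exact ((isQuotHom_left_iff f).1 hf A x).isQuotSub.stable _ ⟨r, rfl⟩ s hs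
  finite A _ _ x := ((isQuotHom_left_iff f).1 hf A x).isQuotSub.finite
  projective A _ _ x := ((isQuotHom_left_iff f).1 hf A x).isQuotSub.projective
  rank_eq A _ _ x := ((isQuotHom_left_iff f).1 hf A x).isQuotSub.rank_eq
  map_eq A B _ _ _ _ g x := by
    have h1 := ((isQuotHom_left_iff f).1 hf A x).isPluckerPt_subOf.map g
    have h2 := ((isQuotHom_left_iff f).1 hf B (specOverMap g ≫ x)).isPluckerPt_subOf
    rw [Category.assoc] at h2
    change subOf v ((specOverMap g ≫ x) ≫ f) = bcSub g (subOf v (x ≫ f))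
    rw [Category.assoc]
    exact h2.unique_right h1

theorem QuotFamily.exists_ofHom (v : Module.Basis ι k (ModT k O b)) (Q : QuotFamily O b δ T)
    (hm : m = ⌊δ⌋₊) : ∃ (f : T ⟶ projSpace k (plDim ι m)) (hf : IsQuotHom v (scalars O b) δ f.left),
      QuotFamily.ofHom v f hf = Q := by
  choose F hF hrel using fun (A : Type u) [CommRing A] [Algebra k A] (x : specOver k A ⟶ T) =>
    (Q.isQuotSub x).exists_isPluckerPt (v := v) hm
  obtain ⟨f, hf⟩ := exists_over_hom_of_points F (by
    intro A B _ _ _ _ g x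
    have h1 := (hrel A x).map g
    rw [← Q.map_eq_bcSub] at h1
    exact (hrel B _).unique_left h1)
  have hfP : IsQuotHom v (scalars O b) δ f.left := by
    rw [isQuotHom_left_iff]
    intro A _ _ x
    rw [hf]
    exact hF A x
  refine ⟨f, hfP, QuotFamily.ext ?_⟩
  funext A _ _ x
  change subOf v (x ≫ f) = _
  rw [hf]
  exact (hF A x).isPluckerPt_subOf.unique_right (hrel A x)

theorem QuotFamily.ofHom_injective (v : Module.Basis ι k (ModT k O b))
    {f f' : T ⟶ projSpace k (plDim ι m)} {hf : IsQuotHom v (scalars O b) δ f.left}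
    {hf' : IsQuotHom v (scalars O b) δ f'.left}
    (h : QuotFamily.ofHom v f hf = QuotFamily.ofHom v f' hf') : f = f' := by
  refine over_hom_ext_of_points _ _ fun A _ _ x => ?_
  have h1 := ((isQuotHom_left_iff f).1 hf A x).isPluckerPt_subOf
  have h2 := ((isQuotHom_left_iff f').1 hf' A x).isPluckerPt_subOf
  have h3 : subOf v (x ≫ f) = subOf v (x ≫ f') := congrArg (fun Q => Q.S A x) h
  rw [h3] at h1
  exact h1.unique_left h2

variable (O b δ) in
/-- The Quot functor is represented by a projective scheme. Since `F` is a finite-dimensional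
vector space, its quotients of rank `δ` are parametrized by a Grassmannian, in which stability
under `k⟦t⟧` is a closed condition. -/
theorem exists_quotFunctor_representableBy [Module.Finite k (ModT k O b)] :
    ∃ (Q : Over (Spec (CommRingCat.of k))) (_ : (quotFunctor O b δ).RepresentableBy Q) (n : ℕ)
      (i : Q ⟶ projSpace k n), IsClosedImmersion i.left := by
  let v := Module.finBasis k (ModT k O b)
  obtain ⟨Z, i, hi, hZ⟩ := exists_quotScheme v ⌊δ⌋₊ (scalars O b) δ
  let Q : Over (Spec (CommRingCat.of k)) := Over.mk (i ≫ (projSpace k _).hom)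
  let j : Q ⟶ projSpace k _ := Over.homMk i rfl
  have hj : ∀ {T} (f : T ⟶ Q), IsQuotHom v (scalars O b) δ (f ≫ j).left := fun f =>
    (hZ _).2 ⟨f.left, rfl⟩
  refine ⟨Q, ?_, _, j, hi⟩
  refine
    { homEquiv := fun {T} => Equiv.ofBijective (fun f => QuotFamily.ofHom v (f ≫ j) (hj f)) ⟨?_, ?_⟩
      homEquiv_comp := ?_ }
  · intro f f' h
    have h1 := congrArg (fun q => q.left) (QuotFamily.ofHom_injective v h)
    exact Over.OverMorphism.ext ((cancel_mono i).1 h1)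
  · intro F
    obtain ⟨f, hf, rfl⟩ := QuotFamily.exists_ofHom v F rfl
    obtain ⟨g, hg⟩ := (hZ _).1 hf
    have hg' : g ≫ Q.hom = T.hom := by
      change g ≫ i ≫ _ = _
      rw [← Category.assoc, hg, Over.w]
    refine ⟨Over.homMk g hg', ?_⟩
    have : Over.homMk g hg' ≫ j = f := Over.OverMorphism.ext hg
    subst this
    rfl
  · intro T T' f g
    refine QuotFamily.ext ?_
    funext A _ _ x
    change subOf v (x ≫ (f ≫ g) ≫ j) = subOf v ((x ≫ f) ≫ g ≫ j)
    simp only [Category.assoc]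

end

/-! ### Functions on `Δ × Spec A` and on `C̃ × Spec A` -/

section
variable {k : Type u} [Field k]
  {A B C : Type u} [CommRing A] [Algebra k A] [CommRing B] [Algebra k B] [CommRing C] [Algebra k C]

theorem one_tmul_mul_injective {F : Type u} [CommRing F] [Algebra k F] {y : F}
    (hy : Function.Injective fun x : F => y * x) :
    Function.Injective fun x : A ⊗[k] F => (1 ⊗ₜ[k] y) * x := by
  have h := Module.Flat.lTensor_preserves_injective_linearMap (M := A) (LinearMap.mulLeft k y) hy
  intro x x' hx
  apply h
  have : ∀ x : A ⊗[k] F, LinearMap.lTensor A (LinearMap.mulLeft k y) x = (1 ⊗ₜ[k] y) * x :=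
    fun x => mulLeft_baseChange y x
  rw [this, this]
  exact hx

variable (k A) in
/-- The coordinate `t` of `Δ × Spec A`. -/
def tR : A ⊗[k] k⟦X⟧ := 1 ⊗ₜ[k] PowerSeries.X

theorem tR_pow (n : ℕ) : tR k A ^ n = 1 ⊗ₜ[k] ((PowerSeries.X : k⟦X⟧) ^ n) := by
  rw [tR, Algebra.TensorProduct.tmul_pow, one_pow]

theorem tR_pow_mul_injective (n : ℕ) : Function.Injective fun x : A ⊗[k] k⟦X⟧ => tR k A ^ n * x :=
    by
  rw [tR_pow]
  exact one_tmul_mul_injective fun _ _ h => PowerSeries.X_pow_mul_cancel h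

variable (k A) in
/-- The expansion of functions on `Δ × Spec A` as power series. -/
def toPS : A ⊗[k] k⟦X⟧ →ₐ[A] A⟦X⟧ :=
  Algebra.TensorProduct.lift (Algebra.ofId A A⟦X⟧)
    ({ PowerSeries.map (algebraMap k A) with
        commutes' := fun r => by
          change PowerSeries.map (algebraMap k A) (PowerSeries.C r) = _
          rw [PowerSeries.map_C]
          exact (IsScalarTower.algebraMap_apply k A A⟦X⟧ r).symm } : k⟦X⟧ →ₐ[k] A⟦X⟧)
    fun _ _ => Commute.all _ _

theorem toPS_tmul (a : A) (f : k⟦X⟧) :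
    toPS k A (a ⊗ₜ f) = PowerSeries.C a * PowerSeries.map (algebraMap k A) f := rfl

theorem toPS_tR : toPS k A (tR k A) = PowerSeries.X := by
  rw [tR, toPS_tmul, map_one, one_mul, PowerSeries.map_X]

theorem toPS_map (f : A →ₐ[k] B) (z : A ⊗[k] k⟦X⟧) :
    toPS k B (Algebra.TensorProduct.map f (AlgHom.id k k⟦X⟧) z) =
      PowerSeries.map f.toRingHom (toPS k A z) := by
  induction z with
  | zero => simp
  | add x y hx hy => rw [map_add, map_add, hx, hy, map_add, map_add]
  | tmul a g =>
    rw [Algebra.TensorProduct.map_tmul, toPS_tmul, toPS_tmul, map_mul, PowerSeries.map_C]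
    congr 1
    ext n
    rw [PowerSeries.coeff_map, PowerSeries.coeff_map, PowerSeries.coeff_map]
    exact (f.commutes _).symm

theorem exists_eq_sum_add (c : ℕ) (z : A ⊗[k] k⟦X⟧) : ∃ w, z =
    ∑ j ∈ Finset.range c, PowerSeries.coeff j (toPS k A z) • tR k A ^ j + tR k A ^ c * w := by
  induction z with
  | zero => exact ⟨0, by simp⟩
  | add x y hx hy =>
    obtain ⟨w, hw⟩ := hx
    obtain ⟨w', hw'⟩ := hy
    refine ⟨w + w', ?_⟩
    conv_lhs => rw [hw, hw']
    simp only [map_add, add_smul, Finset.sum_add_distrib]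
    ring
  | tmul a f =>
    refine ⟨a ⊗ₜ PowerSeries.mk fun n => PowerSeries.coeff (n + c) f, ?_⟩
    have hf : f = ∑ j ∈ Finset.range c, PowerSeries.coeff j f • (PowerSeries.X : k⟦X⟧) ^ j +
        PowerSeries.X ^ c * PowerSeries.mk fun n => PowerSeries.coeff (n + c) f := by
      ext n
      rw [map_add, map_sum, PowerSeries.coeff_X_pow_mul']
      simp only [PowerSeries.coeff_smul, PowerSeries.coeff_X_pow, smul_eq_mul, mul_ite, mul_one,
        mul_zero, Finset.sum_ite_eq, Finset.mem_range, PowerSeries.coeff_mk]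
      split_ifs with h1 h2 h2
      · omega
      · simp
      · rw [Nat.sub_add_cancel h2, zero_add]
      · omega
    conv_lhs => rw [hf, TensorProduct.tmul_add, TensorProduct.tmul_sum]
    rw [tR_pow, Algebra.TensorProduct.tmul_mul_tmul, one_mul]
    congr 1
    refine Finset.sum_congr rfl fun j _ => ?_
    rw [toPS_tmul, PowerSeries.coeff_C_mul, PowerSeries.coeff_map, tR_pow,
      TensorProduct.tmul_smul, TensorProduct.smul_tmul', TensorProduct.smul_tmul', smul_eq_mul,
      mul_one, Algebra.smul_def, mul_comm]

/-- Divisibility by `t^c` in `A ⊗ k⟦t⟧` can be tested on the first `c` coefficients of the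
expansion as a power series. Note that `toPS` is not assumed to be injective. -/
theorem tR_pow_dvd_iff (c : ℕ) (z : A ⊗[k] k⟦X⟧) :
    tR k A ^ c ∣ z ↔ ∀ j < c, PowerSeries.coeff j (toPS k A z) = 0 := by
  constructor
  · rintro ⟨w, rfl⟩ j hj
    rw [map_mul, map_pow, toPS_tR, PowerSeries.coeff_X_pow_mul', if_neg (by omega)]
  · intro h
    obtain ⟨w, hw⟩ := exists_eq_sum_add c z
    rw [Finset.sum_eq_zero fun j hj => by rw [h j (Finset.mem_range.1 hj), zero_smul],
      zero_add] at hw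
    exact ⟨w, hw⟩

variable (k A) in
/-- The restriction of functions on `Δ × Spec A` to `{0} × Spec A`. -/
def constR : A ⊗[k] k⟦X⟧ →+* A :=
  (PowerSeries.constantCoeff (R := A)).comp (toPS k A).toRingHom

theorem constR_eq_zero_iff (z : A ⊗[k] k⟦X⟧) : constR k A z = 0 ↔ tR k A ∣ z := by
  have := tR_pow_dvd_iff 1 z
  rw [pow_one] at this
  rw [this]
  constructor
  · intro h j hj
    rw [Nat.lt_one_iff.1 hj, PowerSeries.coeff_zero_eq_constantCoeff]
    exact h
  · intro h
    have := h 0 one_pos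
    rwa [PowerSeries.coeff_zero_eq_constantCoeff] at this

theorem constR_algebraMap (a : A) : constR k A (algebraMap A _ a) = a := by
  rw [constR, RingHom.comp_apply]
  have : (toPS k A).toRingHom (algebraMap A _ a) = PowerSeries.C a := (toPS k A).commutes a
  rw [this, PowerSeries.constantCoeff_C]

theorem constR_map (f : A →ₐ[k] B) (z : A ⊗[k] k⟦X⟧) :
    constR k B (Algebra.TensorProduct.map f (AlgHom.id k k⟦X⟧) z) = f (constR k A z) := by
  change PowerSeries.constantCoeff (toPS k B _) = f (PowerSeries.constantCoeff (toPS k A z))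
  rw [toPS_map, ← PowerSeries.coeff_zero_eq_constantCoeff_apply, PowerSeries.coeff_map,
    PowerSeries.coeff_zero_eq_constantCoeff_apply]
  rfl

section
variable (O : Type u) [CommRing O] [Algebra k O] [Algebra k⟦X⟧ O] [IsScalarTower k k⟦X⟧ O]

variable (k A) in
/-- The coordinate `t` as a function on `C̃ × Spec A`. -/
def tM : A ⊗[k] O := 1 ⊗ₜ[k] algebraMap k⟦X⟧ O PowerSeries.X

theorem coverAlgHom_tR : coverAlgHom k O A (tR k A) = tM k A O := by
  rw [coverAlgHom, tR, Algebra.TensorProduct.map_tmul]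
  rfl

variable {O}

theorem projF_surjective (b : ℕ) : Function.Surjective (projF k O b A) :=
  LinearMap.lTensor_surjective A (g := (Ideal.Quotient.mkₐ k
    (Ideal.span {algebraMap k⟦X⟧ O PowerSeries.X ^ b})).toLinearMap) Ideal.Quotient.mk_surjective

theorem projF_eq_zero_iff (b : ℕ) (z : A ⊗[k] O) :
    projF k O b A z = 0 ↔ ∃ w, z = tM k A O ^ b * w := by
  have htM : tM k A O ^ b = 1 ⊗ₜ[k] (algebraMap k⟦X⟧ O PowerSeries.X ^ b) := by
    rw [tM, Algebra.TensorProduct.tmul_pow, one_pow]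
  constructor
  · intro hz
    let q : O →ₗ[k] ModT k O b := (Ideal.Quotient.mkₐ k
      (Ideal.span {algebraMap k⟦X⟧ O PowerSeries.X ^ b})).toLinearMap
    have hex : Function.Exact (LinearMap.mulLeft k (algebraMap k⟦X⟧ O PowerSeries.X ^ b)) q := by
      intro y
      change Ideal.Quotient.mk _ y = 0 ↔ _
      rw [Ideal.Quotient.eq_zero_iff_mem, Ideal.mem_span_singleton]
      constructor
      · rintro ⟨w, rfl⟩; exact ⟨w, rfl⟩
      · rintro ⟨w, rfl⟩; exact ⟨w, rfl⟩
    have hex' := lTensor_exact A hex (Ideal.Quotient.mk_surjective)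
    obtain ⟨w, rfl⟩ := (hex' z).1 hz
    refine ⟨w, ?_⟩
    rw [htM]
    exact mulLeft_baseChange _ w
  · rintro ⟨w, rfl⟩
    rw [map_mul, htM]
    have : projF k O b A (1 ⊗ₜ[k] (algebraMap k⟦X⟧ O PowerSeries.X ^ b)) = 0 := by
      rw [projF, Algebra.TensorProduct.map_tmul]
      have : (Ideal.Quotient.mkₐ k (Ideal.span {algebraMap k⟦X⟧ O PowerSeries.X ^ b}))
          (algebraMap k⟦X⟧ O PowerSeries.X ^ b) = 0 :=
        Ideal.Quotient.eq_zero_iff_mem.2 (Ideal.mem_span_singleton_self _)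
      rw [this, TensorProduct.tmul_zero]
    rw [this, zero_mul]

variable (k A O) in
/-- The algebra structure of functions on `C̃ × Spec A` over functions on `Δ × Spec A`. -/
abbrev coverAlgebra : Algebra (A ⊗[k] k⟦X⟧) (A ⊗[k] O) := (coverAlgHom k O A).toRingHom.toAlgebra

/-- A basis of `O` over `k⟦t⟧` gives a basis of `A ⊗ O` over `A ⊗ k⟦t⟧`. -/
theorem exists_basis_cover {d : ℕ} (o : Module.Basis (Fin d) k⟦X⟧ O) :
    letI := coverAlgebra k A O
    ∃ m : Module.Basis (Fin d) (A ⊗[k] k⟦X⟧) (A ⊗[k] O), ∀ i, m i = 1 ⊗ₜ o i := by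
  let := coverAlgebra k A O
  let e : A ⊗[k] O ≃ₗ[k] (Fin d → A ⊗[k] k⟦X⟧) :=
    (LinearEquiv.lTensor A (o.equivFun.restrictScalars k)).trans
      (TensorProduct.piRight k k A fun _ => k⟦X⟧)
  have he : ∀ a x, e (a ⊗ₜ x) = fun i => a ⊗ₜ o.equivFun x i := fun a x => by
    simp [e]
  have hsm : ∀ (r : A ⊗[k] k⟦X⟧) (x : A ⊗[k] O), e (coverAlgHom k O A r * x) = r • e x := by
    intro r x
    induction x with
    | zero => rw [mul_zero, map_zero, smul_zero]
    | add x y hx hy => rw [mul_add, map_add, hx, hy, map_add, smul_add]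
    | tmul a x =>
      induction r with
      | zero =>
        rw [map_zero, zero_mul, map_zero]
        exact (zero_smul (A ⊗[k] k⟦X⟧) (e (a ⊗ₜ[k] x))).symm
      | add r s hr hs => rw [map_add, add_mul, map_add, hr, hs, add_smul]
      | tmul a' f =>
        have : coverAlgHom k O A (a' ⊗ₜ[k] f) * (a ⊗ₜ[k] x) = (a' * a) ⊗ₜ[k] (f • x) := by
          rw [Algebra.smul_def f]
          exact Algebra.TensorProduct.tmul_mul_tmul _ _ _ _
        rw [this, he, he]
        ext i
        rw [Pi.smul_apply, map_smul, smul_eq_mul, Algebra.TensorProduct.tmul_mul_tmul,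
          Pi.smul_apply, smul_eq_mul]
  let e' : A ⊗[k] O ≃ₗ[A ⊗[k] k⟦X⟧] (Fin d → A ⊗[k] k⟦X⟧) :=
    { e with map_smul' := hsm }
  refine ⟨Module.Basis.ofEquivFun e', fun i => ?_⟩
  rw [Module.Basis.coe_ofEquivFun]
  apply e'.injective
  rw [LinearEquiv.apply_symm_apply]
  change _ = e _
  rw [he]
  ext j
  rw [Module.Basis.equivFun_self, Pi.single_apply]
  simp only [eq_comm (a := j)]
  split <;> simp [Algebra.TensorProduct.one_def]

theorem discr_cover {d : ℕ} (o : Module.Basis (Fin d) k⟦X⟧ O) :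
    letI := coverAlgebra k A O
    ∀ m : Module.Basis (Fin d) (A ⊗[k] k⟦X⟧) (A ⊗[k] O), (∀ i, m i = 1 ⊗ₜ o i) →
      Algebra.discr (A ⊗[k] k⟦X⟧) m = 1 ⊗ₜ Algebra.discr k⟦X⟧ o := by
  let := coverAlgebra k A O
  intro m hm
  refine discr_map (Algebra.TensorProduct.includeRight : k⟦X⟧ →ₐ[k] A ⊗[k] k⟦X⟧).toRingHom
    (Algebra.TensorProduct.includeRight : O →ₐ[k] A ⊗[k] O).toRingHom (fun r => ?_) o m hm
  change _ = coverAlgHom k O A _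
  change _ = coverAlgHom k O A (1 ⊗ₜ r)
  rw [coverAlgHom, Algebra.TensorProduct.map_tmul]
  rfl

end
end

/-! ### Local bases and discriminants -/

section
variable {R M : Type*} [CommRing R] [CommRing M] [Algebra R M] {d : ℕ}

/-- The family `e` of elements of `E` generates `E` after inverting `f`. In the lattices
considered below its members are then automatically independent (`LocBasis.indep`), so that `e` is
a basis of `E` over the open set `f ≠ 0`. -/
structure LocBasis (E : Submodule R M) (f : R) (e : Fin d → M) : Prop where
  mem : ∀ i, e i ∈ E
  span : ∀ x ∈ E, ∃ n : ℕ, f ^ n • x ∈ Submodule.span R (Set.range e)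

theorem exists_matrix_of_mem_span {e e' : Fin d → M}
    (h : ∀ i, e' i ∈ Submodule.span R (Set.range e)) :
    ∃ N : Matrix (Fin d) (Fin d) R, ∀ i, e' i = ∑ j, N i j • e j := by
  choose N hN using fun i => (Submodule.mem_span_range_iff_exists_fun R).1 (h i)
  exact ⟨N, fun i => (hN i).symm⟩

theorem discr_eq_of_matrix {e e' : Fin d → M} {N : Matrix (Fin d) (Fin d) R}
    (h : ∀ i, e' i = ∑ j, N i j • e j) :
    Algebra.discr R e' = N.det ^ 2 * Algebra.discr R e := by
  have := Algebra.discr_of_matrix_mulVec (A := R) e N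
  rw [← this]
  congr 1
  ext i
  rw [h i, Matrix.mulVec, dotProduct]
  refine Finset.sum_congr rfl fun j _ => ?_
  rw [Matrix.map_apply, Algebra.smul_def]

theorem discr_dvd_of_mem_span {e e' : Fin d → M}
    (h : ∀ i, e' i ∈ Submodule.span R (Set.range e)) :
    Algebra.discr R e ∣ Algebra.discr R e' := by
  obtain ⟨N, hN⟩ := exists_matrix_of_mem_span h
  rw [discr_eq_of_matrix hN]
  exact dvd_mul_left _ _

theorem discr_smul (r : R) (e : Fin d → M) :
    Algebra.discr R (fun i => r • e i) = r ^ (2 * d) * Algebra.discr R e := by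
  have h : ∀ i, r • e i = ∑ j, (Matrix.diagonal fun _ : Fin d => r) i j • e j := by
    intro i
    simp [Matrix.diagonal_apply, ite_smul]
  rw [discr_eq_of_matrix h, Matrix.det_diagonal, Finset.prod_const, Finset.card_univ,
    Fintype.card_fin, ← pow_mul, mul_comm d]

theorem exists_pow_smul_mem_span {ι : Type*} [Finite ι] {f : R} {L : Submodule R M} {x : ι → M}
    (h : ∀ i, ∃ n : ℕ, f ^ n • x i ∈ L) : ∃ n : ℕ, ∀ i, f ^ n • x i ∈ L := by
  have := Fintype.ofFinite ι
  choose n hn using h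
  refine ⟨∑ i, n i, fun i => ?_⟩
  obtain ⟨c, hc⟩ := Nat.exists_eq_add_of_le (Finset.single_le_sum (f := n)
    (fun i _ => Nat.zero_le _) (Finset.mem_univ i))
  rw [hc, add_comm, pow_add, mul_smul]
  exact L.smul_mem _ (hn i)

namespace LocBasis

variable {E : Submodule R M} {f : R} {e : Fin d → M}

theorem of_dvd (h : LocBasis E f e) {f' : R} (hf : f ∣ f') : LocBasis E f' e := by
  refine ⟨h.mem, fun x hx => ?_⟩
  obtain ⟨n, hn⟩ := h.span x hx
  obtain ⟨c, rfl⟩ := hf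
  refine ⟨n, ?_⟩
  rw [mul_comm, mul_pow, mul_smul]
  exact Submodule.smul_mem _ _ hn

theorem discr_dvd (h : LocBasis E f e) {e' : Fin d → M} (he' : ∀ i, e' i ∈ E) :
    ∃ n : ℕ, Algebra.discr R e ∣ f ^ n * Algebra.discr R e' := by
  obtain ⟨n, hn⟩ := exists_pow_smul_mem_span fun i => h.span _ (he' i)
  refine ⟨n * (2 * d), ?_⟩
  rw [pow_mul, ← discr_smul]
  exact discr_dvd_of_mem_span hn

/-- The matrices of `e` with respect to a basis `m` of `M` and of `f^n s m` with respect to `e`,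
where `s M ⊆ E`; their product is the scalar matrix `f^n s`. -/
theorem exists_mul_eq (h : LocBasis E f e) (m : Module.Basis (Fin d) R M) {s : R}
    (hs : ∀ i, s • m i ∈ E) : ∃ (P N : Matrix (Fin d) (Fin d) R) (n : ℕ),
      (∀ i, e i = ∑ j, P i j • m j) ∧ (∀ i, (f ^ n * s) • m i = ∑ j, N i j • e j) ∧
      N * P = (f ^ n * s) • 1 ∧ N.det * P.det = (f ^ n * s) ^ d := by
  obtain ⟨n, hn⟩ := exists_pow_smul_mem_span fun i => h.span _ (hs i)
  simp only [smul_smul] at hn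
  obtain ⟨N, hN⟩ := exists_matrix_of_mem_span hn
  have hP : ∀ i, e i = ∑ j, (m.repr (e i)) j • m j := fun i => (m.sum_repr _).symm
  have hNP : N * (Matrix.of fun i j => m.repr (e i) j) = (f ^ n * s) • 1 := by
    ext i j
    have h1 := congrArg (fun x => m.repr x j) (hN i)
    simp only [map_smul, map_sum, Finsupp.smul_apply, Finsupp.coe_finsetSum, Finset.sum_apply,
      m.repr_self, smul_eq_mul] at h1
    rw [Matrix.mul_apply, Matrix.smul_apply, Matrix.one_apply, smul_eq_mul]
    simp only [Matrix.of_apply]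
    rw [← h1, Finsupp.single_apply]
  refine ⟨Matrix.of fun i j => m.repr (e i) j, N, n, hP, hN, hNP, ?_⟩
  rw [← Matrix.det_mul, hNP, Matrix.det_smul, Matrix.det_one, mul_one, Fintype.card_fin]

theorem indep (h : LocBasis E f e) (m : Module.Basis (Fin d) R M) {s : R}
    (hs : ∀ i, s • m i ∈ E) (hreg : ∀ x : R, s * x = 0 → x = 0) {c : Fin d → R}
    (hc : ∑ i, c i • e i = 0) : ∃ n : ℕ, ∀ i, f ^ n * c i = 0 := by
  obtain ⟨P, N, n, hP, hN, hNP, hdet⟩ := h.exists_mul_eq m hs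
  have h1 : Matrix.vecMul c P = 0 := by
    ext j
    have h2 : ∑ i, c i • e i = ∑ j, (Matrix.vecMul c P j) • m j := by
      simp only [hP, Finset.smul_sum, smul_smul, Matrix.vecMul, dotProduct, Finset.sum_smul]
      rw [Finset.sum_comm]
    rw [hc] at h2
    exact (Fintype.linearIndependent_iff.1 m.linearIndependent _ h2.symm) j
  have h3 : P.det • c = 0 := by
    have := congrArg (fun v => Matrix.vecMul v P.adjugate) h1
    simp only [Matrix.vecMul_vecMul, Matrix.mul_adjugate, Matrix.vecMul_smul, Matrix.vecMul_one,
      Matrix.zero_vecMul] at this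
    exact this
  refine ⟨n * d, fun i => ?_⟩
  have h4 : (f ^ n * s) ^ d * c i = 0 := by
    rw [← hdet, mul_assoc, ← smul_eq_mul P.det, ← Pi.smul_apply, h3, Pi.zero_apply, mul_zero]
  have hpow : ∀ q : ℕ, ∀ x : R, s ^ q * x = 0 → x = 0 := by
    intro q
    induction q with
    | zero => intro x hx; simpa using hx
    | succ q ih =>
      intro x hx
      rw [pow_succ, mul_assoc] at hx
      exact hreg x (ih _ hx)
  apply hpow d
  rw [mul_left_comm, ← mul_assoc, pow_mul, ← mul_pow, h4]

end LocBasis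

/-- Near every point of `Spec R`, the submodule `E` of `M` has a local basis of length `d` whose
discriminant divides `g` after inverting `f`; if `c` holds, the discriminant and `g` divide each
other. Thus `c = False` says that the cokernel of the discriminant section is annihilated by `g`,
and `c = True` that the branch divisor is defined by `g`. The discriminant of elements of `E` is
formed with the trace of `M`, which is the trace of `E` wherever both are free (`trace_away`). -/
def HasLocDiscr (E : Submodule R M) (d : ℕ) (g : R) (c : Prop) : Prop :=
  ∀ y : PrimeSpectrum R, ∃ f ∉ y.asIdeal, ∃ e : Fin d → M, LocBasis E f e ∧
    ∃ n : ℕ, Algebra.discr R e ∣ f ^ n * g ∧ (c → g ∣ f ^ n * Algebra.discr R e)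

end

section
variable {R E M R' S' : Type*} [CommRing R] [CommRing E] [CommRing M] [CommRing R'] [CommRing S']
  [Algebra R E] [Algebra R M] [Algebra R R'] [Algebra E S'] [Algebra R' S'] {d : ℕ}
  {β : E →ₐ[R] M} (hβ : Function.Injective β)
  {f : R}
  (hc : ∀ r, algebraMap R' S' (algebraMap R R' r) = algebraMap E S' (algebraMap R E r))

include hc in
theorem algebraMap_smul_away (r : R) (x : E) :
    algebraMap E S' (r • x) = algebraMap R R' r • algebraMap E S' x := by
  rw [Algebra.smul_def, map_mul, Algebra.smul_def, hc]

variable (f) in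
include hc in
/-- A basis over the localization at `f` can be rescaled by powers of `f` to consist of elements
of `E`; this changes its discriminant by a unit. -/
theorem exists_rescale [IsLocalization.Away f R'] [IsLocalization.Away (algebraMap R E f) S']
    (e' : Module.Basis (Fin d) R' S') :
    ∃ (e : Fin d → E) (e'' : Module.Basis (Fin d) R' S'),
      (∀ i, e'' i = algebraMap E S' (e i)) ∧
      Associated (Algebra.discr R' e') (Algebra.discr R' e'') := by
  have h : ∀ i, ∃ (x : E) (n : ℕ), algebraMap R R' f ^ n • e' i = algebraMap E S' x := by
    intro i
    obtain ⟨n, x, hx⟩ := IsLocalization.Away.surj (algebraMap R E f) (e' i)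
    refine ⟨x, n, ?_⟩
    rw [← hx, Algebra.smul_def, map_pow, hc, mul_comm]
  choose x n hn using h
  have hu : ∀ i, IsUnit (algebraMap R R' f ^ n i) := fun i =>
    (IsLocalization.Away.algebraMap_isUnit f).pow _
  refine ⟨x, e'.isUnitSMul hu, fun i => ?_, ?_⟩
  · rw [Module.Basis.isUnitSMul_apply, hn]
  · have h1 : ∀ i, (e'.isUnitSMul hu) i =
        ∑ j, (Matrix.diagonal fun i => algebraMap R R' f ^ n i) i j • e' j := by
      intro i
      simp [Matrix.diagonal_apply, ite_smul, Module.Basis.isUnitSMul_apply]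
    rw [discr_eq_of_matrix h1, Matrix.det_diagonal]
    obtain ⟨w, hw⟩ : IsUnit ((∏ i, algebraMap R R' f ^ n i) ^ 2) :=
      (IsUnit.prod_univ_iff.2 hu).pow 2
    exact ⟨w, by rw [hw, mul_comm]⟩

include hβ hc in
theorem locBasis_of_basis [IsLocalization.Away f R']
    [IsLocalization.Away (algebraMap R E f) S'] {e : Fin d → E} {e'' : Module.Basis (Fin d) R' S'}
    (he : ∀ i, e'' i = algebraMap E S' (e i)) :
    LocBasis (LinearMap.range β.toLinearMap) f (β ∘ e) := by
  refine ⟨fun i => ⟨e i, rfl⟩, ?_⟩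
  rintro _ ⟨x, rfl⟩
  have h : ∀ i, ∃ (n : ℕ) (c : R), algebraMap R R' f ^ n * e''.repr (algebraMap E S' x) i =
      algebraMap R R' c := by
    intro i
    obtain ⟨n, c, hc⟩ := IsLocalization.Away.surj f (e''.repr (algebraMap E S' x) i)
    exact ⟨n, c, by rw [← hc, mul_comm]⟩
  choose n c hnc using h
  have key : algebraMap E S' (f ^ (∑ i, n i) • x - ∑ i, (f ^ (∑ j, n j - n i) * c i) • e i) = 0 :=
    by
    rw [map_sub, map_sum, algebraMap_smul_away hc, sub_eq_zero]
    conv_lhs => rw [← e''.sum_repr (algebraMap E S' x), Finset.smul_sum]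
    refine Finset.sum_congr rfl fun i _ => ?_
    rw [algebraMap_smul_away hc, he, smul_smul]
    congr 1
    rw [map_mul, ← hnc, map_pow, map_pow, ← mul_assoc, ← pow_add, Nat.sub_add_cancel]
    exact Finset.single_le_sum (f := n) (fun i _ => Nat.zero_le _) (Finset.mem_univ i)
  obtain ⟨⟨_, N, rfl⟩, hN⟩ := (IsLocalization.map_eq_zero_iff (Submonoid.powers
    (algebraMap R E f)) S' _).1 key
  refine ⟨N + ∑ i, n i, ?_⟩
  have h2 : f ^ (N + ∑ i, n i) • x = f ^ N • ∑ i, (f ^ (∑ j, n j - n i) * c i) • e i := by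
    rw [pow_add, mul_smul, ← sub_eq_zero, ← smul_sub, Algebra.smul_def, map_pow]
    exact hN
  have h3 : f ^ (N + ∑ i, n i) • β.toLinearMap x = β (f ^ (N + ∑ i, n i) • x) :=
    (map_smul β _ _).symm
  rw [h3, h2, map_smul, map_sum]
  refine Submodule.smul_mem _ _ (Submodule.sum_mem _ fun i _ => ?_)
  rw [map_smul]
  exact Submodule.smul_mem _ _ (Submodule.subset_span ⟨i, rfl⟩)

include hβ hc in
theorem exists_basis_of_locBasis [IsLocalization.Away f R']
    [IsLocalization.Away (algebraMap R E f) S'] {e : Fin d → E}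
    (h : LocBasis (LinearMap.range β.toLinearMap) f (β ∘ e))
    (m : Module.Basis (Fin d) R M) {s : R}
    (hs : ∀ i, s • m i ∈ LinearMap.range β.toLinearMap) (hreg : ∀ x : R, s * x = 0 → x = 0) :
    ∃ e'' : Module.Basis (Fin d) R' S', ∀ i, e'' i = algebraMap E S' (e i) := by
  have hind : LinearIndependent R' fun i => algebraMap E S' (e i) := by
    rw [Fintype.linearIndependent_iff]
    intro c hc0 i
    have h1 : ∀ i, ∃ (n : ℕ) (c' : R), algebraMap R R' f ^ n * c i = algebraMap R R' c' := by
      intro i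
      obtain ⟨n, c', hc'⟩ := IsLocalization.Away.surj f (c i)
      exact ⟨n, c', by rw [← hc', mul_comm]⟩
    choose n c' hnc using h1
    have key : algebraMap E S' (∑ i, (f ^ (∑ j, n j - n i) * c' i) • e i) = 0 := by
      have := congrArg (fun x => algebraMap R R' f ^ (∑ j, n j) • x) hc0
      simp only [smul_zero] at this
      rw [← this, map_sum, Finset.smul_sum]
      refine Finset.sum_congr rfl fun i _ => ?_
      rw [algebraMap_smul_away hc, smul_smul]
      congr 1
      rw [map_mul, ← hnc, map_pow, ← mul_assoc, ← pow_add, Nat.sub_add_cancel]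
      exact Finset.single_le_sum (f := n) (fun i _ => Nat.zero_le _) (Finset.mem_univ i)
    obtain ⟨⟨_, N, rfl⟩, hN⟩ := (IsLocalization.map_eq_zero_iff (Submonoid.powers
      (algebraMap R E f)) S' _).1 key
    have h2 : ∑ i, (f ^ N * (f ^ (∑ j, n j - n i) * c' i)) • (β ∘ e) i = 0 := by
      have := congrArg β hN
      simp only [map_zero, map_mul, map_pow, AlgHom.commutes, map_sum, map_smul] at this
      rw [← this, ← map_pow, ← Algebra.smul_def, Finset.smul_sum]
      refine Finset.sum_congr rfl fun i _ => ?_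
      rw [mul_smul]
      rfl
    obtain ⟨N', hN'⟩ := h.indep m hs hreg h2
    have h3 := congrArg (algebraMap R R') (hN' i)
    rw [map_mul, map_mul, map_mul, ← hnc, map_zero] at h3
    have hu : IsUnit (algebraMap R R' f) := IsLocalization.Away.algebraMap_isUnit f
    simp only [map_pow] at h3
    rwa [(hu.pow _).mul_right_eq_zero, (hu.pow _).mul_right_eq_zero, (hu.pow _).mul_right_eq_zero,
      (hu.pow _).mul_right_eq_zero] at h3
  have hspan : ⊤ ≤ Submodule.span R' (Set.range fun i => algebraMap E S' (e i)) := by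
    intro x _
    obtain ⟨n, y, hy⟩ := IsLocalization.Away.surj (algebraMap R E f) x
    obtain ⟨n', hn'⟩ := h.span (β y) ⟨y, rfl⟩
    obtain ⟨c, hcc⟩ := (Submodule.mem_span_range_iff_exists_fun R).1 hn'
    have h1 : ∑ i, c i • e i = f ^ n' • y := by
      apply hβ
      rw [map_sum, map_smul, ← hcc]
      exact Finset.sum_congr rfl fun i _ => map_smul β _ _
    have h2 : algebraMap R R' f ^ (n' + n) • x ∈
        Submodule.span R' (Set.range fun i => algebraMap E S' (e i)) := by
      have : algebraMap R R' f ^ (n' + n) • x = algebraMap E S' (f ^ n' • y) := by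
        rw [algebraMap_smul_away hc, ← hy, pow_add, mul_smul, map_pow]
        congr 1
        rw [Algebra.smul_def, map_pow, hc, mul_comm]
      rw [this, ← h1, map_sum]
      refine Submodule.sum_mem _ fun i _ => ?_
      rw [algebraMap_smul_away hc]
      exact Submodule.smul_mem _ _ (Submodule.subset_span ⟨i, rfl⟩)
    have hu : IsUnit (algebraMap R R' f ^ (n' + n)) :=
      (IsLocalization.Away.algebraMap_isUnit f).pow _
    exact (Submodule.smul_mem_iff_of_isUnit _ hu).1 h2
  exact ⟨Module.Basis.mk hind hspan, fun i => Module.Basis.mk_apply _ _ i⟩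

variable (f) in
include hβ hc in
/-- The trace of the localization of `E` at `f` is the restriction of the trace of the ambient
algebra `M`: the matrices of multiplication by `x` in the two bases are conjugate by the matrix of
`e` with respect to `m`, whose determinant is a nonzerodivisor after inverting `f`. -/
theorem trace_away [IsLocalization.Away f R'] [IsLocalization.Away (algebraMap R E f) S']
    {e : Fin d → E} {e'' : Module.Basis (Fin d) R' S'}
    (he : ∀ i, e'' i = algebraMap E S' (e i)) (m : Module.Basis (Fin d) R M) {s : R}
    (hs : ∀ i, s • m i ∈ LinearMap.range β.toLinearMap) (hreg : ∀ x : R, s * x = 0 → x = 0)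
    (x : E) :
    Algebra.trace R' S' (algebraMap E S' x) = algebraMap R R' (Algebra.trace R M (β x)) := by
  have h := locBasis_of_basis (f := f) hβ hc he
  obtain ⟨P, N, n, hP, hN, hNP, hdet⟩ := h.exists_mul_eq m hs
  obtain ⟨q, hq⟩ := exists_pow_smul_mem_span fun i => h.span (β (x * e i)) ⟨x * e i, rfl⟩
  obtain ⟨C, hC⟩ := exists_matrix_of_mem_span hq
  have hu : IsUnit (algebraMap R R' f) := IsLocalization.Away.algebraMap_isUnit f
  have h1 : algebraMap R R' f ^ q * Algebra.trace R' S' (algebraMap E S' x) =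
      algebraMap R R' C.trace := by
    rw [Algebra.trace_eq_matrix_trace e'', Matrix.trace, Matrix.trace, Finset.mul_sum, map_sum]
    refine Finset.sum_congr rfl fun i _ => ?_
    rw [Matrix.diag_apply, Matrix.diag_apply, Algebra.leftMulMatrix_eq_repr_mul]
    have h2 : algebraMap R R' f ^ q • (algebraMap E S' x * e'' i) =
        ∑ j, algebraMap R R' (C i j) • e'' j := by
      rw [he, ← map_mul, ← map_pow, ← algebraMap_smul_away hc]
      have h3 : f ^ q • (x * e i) = ∑ j, C i j • e j := by
        apply hβ
        rw [map_smul, hC, map_sum]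
        exact Finset.sum_congr rfl fun j _ => (map_smul β _ _).symm
      rw [h3, map_sum]
      refine Finset.sum_congr rfl fun j _ => ?_
      rw [algebraMap_smul_away hc, he]
    have h4 := congrArg (fun z => e''.repr z i) h2
    simp only [map_smul, Finsupp.smul_apply, smul_eq_mul] at h4
    rw [h4, e''.repr_sum_self]
  let L : Matrix (Fin d) (Fin d) R := Algebra.leftMulMatrix m (β x)
  have hL : ∀ j, β x * m j = ∑ l, L l j • m l := by
    intro j
    conv_lhs => rw [← m.sum_repr (β x * m j)]
    exact Finset.sum_congr rfl fun l _ =>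
      congrArg (· • m l) (Algebra.leftMulMatrix_eq_repr_mul m (β x) l j).symm
  -- Multiplication by `x`, expressed in `m` in two ways.
  have hPL : f ^ q • (P * L.transpose) = C * P := by
    ext i l
    have h5 : f ^ q • (β x * (β ∘ e) i) = ∑ j, C i j • (β ∘ e) j := by
      rw [← hC, map_mul]
      rfl
    have h6 : f ^ q • (β x * (β ∘ e) i) = ∑ l, (f ^ q • (P * L.transpose)) i l • m l := by
      rw [hP, Finset.mul_sum, Finset.smul_sum]
      simp only [mul_smul_comm, hL, Finset.smul_sum, smul_smul, Matrix.smul_apply,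
        Matrix.mul_apply, Matrix.transpose_apply, Finset.sum_smul, Finset.mul_sum, smul_eq_mul]
      rw [Finset.sum_comm]
    have h7 : ∑ j, C i j • (β ∘ e) j = ∑ l, (C * P) i l • m l := by
      simp only [hP, Finset.smul_sum, smul_smul, Matrix.mul_apply, Finset.sum_smul]
      rw [Finset.sum_comm]
    rw [h6, h7] at h5
    have h8 := congrArg (fun z => m.repr z l) h5
    simpa only [m.repr_sum_self] using h8
  -- Multiply by the adjugate of `P` and take traces.
  have hdet2 : P.det * (C.trace - f ^ q * L.trace) = 0 := by
    have h9 := congrArg (fun Z => Matrix.trace (Z * P.adjugate)) hPL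
    simp only [Matrix.mul_assoc, Matrix.mul_adjugate, Matrix.smul_mul, Matrix.trace_smul,
      Matrix.mul_smul, Matrix.mul_one] at h9
    rw [Matrix.trace_mul_comm P, Matrix.mul_assoc, Matrix.adjugate_mul, Matrix.mul_smul,
      Matrix.mul_one, Matrix.trace_smul, Matrix.trace_transpose] at h9
    simp only [smul_eq_mul] at h9
    rw [mul_sub, ← h9]
    ring
  have hpow : ∀ q : ℕ, ∀ x : R, s ^ q * x = 0 → x = 0 := by
    intro q
    induction q with
    | zero => intro x hx; simpa using hx
    | succ q ih =>
      intro x hx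
      rw [pow_succ, mul_assoc] at hx
      exact hreg x (ih _ hx)
  have h10 : (f ^ n) ^ d * (C.trace - f ^ q * L.trace) = 0 := by
    apply hpow d
    rw [← mul_assoc, ← mul_pow, mul_comm s, ← hdet, mul_assoc, hdet2, mul_zero]
  have h11 := congrArg (algebraMap R R') h10
  rw [map_mul, map_pow, map_pow, map_zero, ((hu.pow _).pow _).mul_right_eq_zero, map_sub,
    ← h1, map_mul, map_pow, ← mul_sub, (hu.pow _).mul_right_eq_zero, sub_eq_zero] at h11
  rw [h11, Algebra.trace_eq_matrix_trace m]

variable (f) in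
include hβ hc in
theorem discr_away [IsLocalization.Away f R'] [IsLocalization.Away (algebraMap R E f) S']
    {e : Fin d → E} {e'' : Module.Basis (Fin d) R' S'}
    (he : ∀ i, e'' i = algebraMap E S' (e i)) (m : Module.Basis (Fin d) R M) {s : R}
    (hs : ∀ i, s • m i ∈ LinearMap.range β.toLinearMap) (hreg : ∀ x : R, s * x = 0 → x = 0) :
    Algebra.discr R' e'' = algebraMap R R' (Algebra.discr R (β ∘ e)) := by
  rw [Algebra.discr_def, Algebra.discr_def, RingHom.map_det]
  congr 1
  ext i j
  simp only [Algebra.traceMatrix_apply, Algebra.traceForm_apply, RingHom.mapMatrix_apply,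
    Matrix.map_apply, Function.comp_apply]
  rw [he, he, ← map_mul, trace_away hβ f hc he m hs hreg, map_mul]

end

/-! ### Covers of affine schemes and local bases -/

section

theorem exists_basis_of_le {X Y : Scheme.{u}} (φ : X ⟶ Y) [IsAffineHom φ] {d : ℕ} {U V : Y.Opens}
    (hU : IsAffineOpen U) (hV : IsAffineOpen V) (h : V ≤ U)
    (e : letI := (φ.app U).hom.toAlgebra; Module.Basis (Fin d) Γ(Y, U) Γ(X, φ ⁻¹ᵁ U)) :
    letI := (φ.app U).hom.toAlgebra
    letI := (φ.app V).hom.toAlgebra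
    ∃ e' : Module.Basis (Fin d) Γ(Y, V) Γ(X, φ ⁻¹ᵁ V),
      Algebra.discr Γ(Y, V) e' = (Y.presheaf.map (homOfLE h).op).hom (Algebra.discr Γ(Y, U) e) := by
  have H : IsPullback (𝟙 X) φ φ (𝟙 Y) := IsPullback.of_horiz_isIso ⟨by simp⟩
  have h' : V ≤ (𝟙 Y : Y ⟶ Y) ⁻¹ᵁ U := h
  have hle : φ ⁻¹ᵁ V ≤ φ ⁻¹ᵁ U := fun x hx => h hx
  have hUY : φ ⁻¹ᵁ V = (𝟙 X : X ⟶ X) ⁻¹ᵁ (φ ⁻¹ᵁ U) ⊓ φ ⁻¹ᵁ V := (inf_eq_right.mpr hle).symm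
  have hpo := (isIso_pushoutSection_iff H h' le_rfl hUY).mp
    (isIso_pushoutSection_of_isAffineOpen H h' le_rfl hUY hU hV (hU.preimage φ))
  rw [← Scheme.Hom.app_eq_appLE, ← Scheme.Hom.app_eq_appLE] at hpo
  obtain ⟨e', he'⟩ := exists_basis_of_isPushout hpo e
  refine ⟨e', he'.trans ?_⟩
  have : (𝟙 Y : Y ⟶ Y).appLE U V h' = Y.presheaf.map (homOfLE h).op := by
    rw [Scheme.Hom.appLE, Scheme.Hom.id_app]
    exact Category.id_comp _
  rw [this]

theorem res_res {Y : Scheme.{u}} (g : Γ(Y, ⊤)) {U V : Y.Opens} (h : V ≤ U) :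
    (Y.presheaf.map (homOfLE h).op).hom (res g U) = res g V := by
  have : Y.presheaf.map (homOfLE le_top).op ≫ Y.presheaf.map (homOfLE h).op =
      Y.presheaf.map (homOfLE (le_top : V ≤ ⊤)).op := by
    rw [← Functor.map_comp]
    rfl
  exact congrArg (fun q => q.hom g) this

theorem specMap_app_algebraMap {R E : CommRingCat.{u}} (α : R ⟶ E) (U : (Spec R).Opens) :
    ((Scheme.ΓSpecIso R).inv ≫ (Spec R).presheaf.map (homOfLE le_top).op) ≫ (Spec.map α).app U =
      α ≫ (Scheme.ΓSpecIso E).inv ≫ (Spec E).presheaf.map (homOfLE le_top).op := by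
  rw [Category.assoc, Scheme.Hom.naturality, ← Category.assoc α,
    Scheme.ΓSpecIso_inv_naturality, Category.assoc]
  rfl

theorem isLocalization_basicOpen_spec (R : CommRingCat.{u}) (f : R) :
    @IsLocalization.Away _ _ f Γ(Spec R, PrimeSpectrum.basicOpen f) _
      ((Scheme.ΓSpecIso R).inv ≫ (Spec R).presheaf.map (homOfLE le_top).op).hom.toAlgebra := by
  have h : ((Scheme.ΓSpecIso R).inv ≫ (Spec R).presheaf.map (homOfLE le_top).op).hom.toAlgebra =
      StructureSheaf.openAlgebra R (op (PrimeSpectrum.basicOpen f)) :=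
    Algebra.algebra_ext _ _ fun r => rfl
  rw [h]
  exact StructureSheaf.IsLocalization.to_basicOpen R f

/-- The sections of `Spec R` over `D(f)`, and of `Spec E` over its preimage, are localizations,
compatibly with the structure map. -/
theorem exists_away_sections {R E : CommRingCat.{u}} (α : R ⟶ E) (f : R) : ∃
      (ρ : R →+* Γ(Spec R, PrimeSpectrum.basicOpen f))
      (ρ' : E →+* Γ(Spec E, Spec.map α ⁻¹ᵁ PrimeSpectrum.basicOpen f)),
      @IsLocalization.Away _ _ f Γ(Spec R, PrimeSpectrum.basicOpen f) _ ρ.toAlgebra ∧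
      @IsLocalization.Away _ _ (α.hom f) Γ(Spec E, Spec.map α ⁻¹ᵁ PrimeSpectrum.basicOpen f) _
        ρ'.toAlgebra ∧
      (∀ r, ((Spec.map α).app (PrimeSpectrum.basicOpen f)).hom (ρ r) = ρ' (α.hom r)) ∧
      ∀ g, res ((Scheme.ΓSpecIso R).inv.hom g) (PrimeSpectrum.basicOpen f) = ρ g := by
  refine ⟨((Scheme.ΓSpecIso R).inv ≫ (Spec R).presheaf.map (homOfLE le_top).op).hom,
    ((Scheme.ΓSpecIso E).inv ≫ (Spec E).presheaf.map (homOfLE le_top).op).hom, ?_, ?_, ?_, ?_⟩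
  · exact isLocalization_basicOpen_spec R f
  · exact isLocalization_basicOpen_spec E (α.hom f)
  · intro r
    have h := congrArg (fun q => (CommRingCat.Hom.hom q) r)
      (specMap_app_algebraMap α (PrimeSpectrum.basicOpen f))
    exact h
  · exact fun g => rfl

variable {R E M : Type u} [CommRing R] [CommRing E] [CommRing M]
  [Algebra R E] [Algebra R M] {d : ℕ} {β : E →ₐ[R] M}

theorem IsCoverWithDiscr.mono {X Y : Scheme.{u}} {φ : X ⟶ Y} {d : ℕ}
    {P P' : ∀ U : Y.Opens, Γ(Y, U) → Prop} (h : IsCoverWithDiscr φ d P)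
    (hP : ∀ U δ, P U δ → P' U δ) : IsCoverWithDiscr φ d P' := by
  refine ⟨h.1, fun y => ?_⟩
  obtain ⟨U, hU, hy, e, he⟩ := h.2 y
  exact ⟨U, hU, hy, e, hP _ _ he⟩

theorem algebraMap_dvd_iff_away {R R' : Type*} [CommRing R] [CommRing R'] [Algebra R R'] (f : R)
    [IsLocalization.Away f R'] (x y : R) :
    algebraMap R R' x ∣ algebraMap R R' y ↔ ∃ n : ℕ, x ∣ f ^ n * y := by
  constructor
  · rintro ⟨z, hz⟩
    obtain ⟨n, w, hw⟩ := IsLocalization.Away.surj f z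
    have h : algebraMap R R' (f ^ n * y) = algebraMap R R' (x * w) := by
      rw [map_mul, map_mul, hz, ← hw, map_pow]
      ring
    obtain ⟨⟨_, N, rfl⟩, hN⟩ := (IsLocalization.eq_iff_exists (Submonoid.powers f) R').1 h
    refine ⟨N + n, f ^ N * w, ?_⟩
    rw [pow_add, mul_assoc]
    simp only at hN
    rw [hN]
    ring
  · rintro ⟨n, hn⟩
    have h := map_dvd (algebraMap R R') hn
    rw [map_mul, map_pow] at h
    exact (((IsLocalization.Away.algebraMap_isUnit f).pow n).dvd_mul_left).1 h

theorem exists_pow_dvd_and {R : Type*} [CommRing R] {f x y : R} {c : Prop}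
    (h : ∃ n : ℕ, x ∣ f ^ n * y) (h' : c → ∃ n : ℕ, y ∣ f ^ n * x) :
    ∃ n : ℕ, x ∣ f ^ n * y ∧ (c → y ∣ f ^ n * x) := by
  obtain ⟨n, hn⟩ := h
  by_cases hc : c
  · obtain ⟨n', hn'⟩ := h' hc
    refine ⟨n + n', ?_, fun _ => ?_⟩
    · rw [add_comm, pow_add, mul_assoc]; exact hn.mul_left _
    · rw [pow_add, mul_assoc]; exact hn'.mul_left _
  · exact ⟨n, hn, fun h => absurd h hc⟩

/-- Translation of the branch condition to algebra: for a subalgebra `E` of a free algebra `M`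
which contains `s M` for a nonzerodivisor `s`, the condition on the cover `Spec E → Spec R` is the
condition `HasLocDiscr` on `E` as a submodule of `M`. -/
theorem hasLocDiscr_iff (hβ : Function.Injective β) (m : Module.Basis (Fin d) R M) {s : R}
    (hs : ∀ i, s • m i ∈ LinearMap.range β.toLinearMap) (hreg : ∀ x : R, s * x = 0 → x = 0)
    (g : R) (c : Prop) :
    IsCoverWithDiscr (Spec.map (CommRingCat.ofHom (algebraMap R E))) d (fun U δ =>
      δ ∣ res ((Scheme.ΓSpecIso (CommRingCat.of R)).inv.hom g) U ∧
        (c → res ((Scheme.ΓSpecIso (CommRingCat.of R)).inv.hom g) U ∣ δ)) ↔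
    HasLocDiscr (LinearMap.range β.toLinearMap) d g c := by
  constructor
  · rintro ⟨haff, h⟩ y
    obtain ⟨U, hU, hyU, e, he⟩ := h y
    -- Shrink the neighbourhood of `y` to a basic open set and rescale the basis to lie in `E`.
    obtain ⟨_, ⟨f, rfl⟩, hyf, hfU⟩ :=
      PrimeSpectrum.isTopologicalBasis_basic_opens.exists_subset_of_mem_open
        (show y ∈ U.carrier from hyU) U.isOpen
    have hle : (PrimeSpectrum.basicOpen f : (Spec (CommRingCat.of R)).Opens) ≤ U := hfU
    obtain ⟨e', he'⟩ := exists_basis_of_le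
      (Spec.map (CommRingCat.ofHom (algebraMap R E))) hU (IsAffineOpen.Spec_basicOpen f) hle e
    have h1 := (he'.dvd.trans (map_dvd
      ((Spec (CommRingCat.of R)).presheaf.map (homOfLE hle).op).hom he.1)).trans (res_res _ hle).dvd
    have h2 := fun hc => ((res_res _ hle).symm.dvd.trans (map_dvd
      ((Spec (CommRingCat.of R)).presheaf.map (homOfLE hle).op).hom (he.2 hc))).trans he'.symm.dvd
    obtain ⟨ρ, ρ', hρ, hρ', hc, hres⟩ := exists_away_sections
      (CommRingCat.ofHom (algebraMap R E)) f
    rw [hres] at h1 h2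
    let := ρ.toAlgebra
    let := ρ'.toAlgebra
    let := ((Spec.map (CommRingCat.ofHom (algebraMap R E))).app
      (PrimeSpectrum.basicOpen f)).hom.toAlgebra
    obtain ⟨e₁, e'', he₁, has⟩ := exists_rescale (R := R) (E := E) f hc e'
    refine ⟨f, hyf, β ∘ e₁, locBasis_of_basis hβ hc he₁, ?_⟩
    rw [has.dvd_iff_dvd_left, discr_away hβ f hc he₁ m hs hreg] at h1
    refine exists_pow_dvd_and ((algebraMap_dvd_iff_away f _ _).1 h1) fun hcc => ?_
    have h3 := h2 hcc
    rw [has.dvd_iff_dvd_right, discr_away hβ f hc he₁ m hs hreg] at h3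
    exact (algebraMap_dvd_iff_away f _ _).1 h3
  · intro h
    refine ⟨inferInstance, fun y => ?_⟩
    obtain ⟨f, hyf, e, he, n, hn, hn'⟩ := h y
    refine ⟨PrimeSpectrum.basicOpen f, IsAffineOpen.Spec_basicOpen (R := CommRingCat.of R) f, hyf,
      ?_⟩
    obtain ⟨ρ, ρ', hρ, hρ', hc, hres⟩ := exists_away_sections
      (CommRingCat.ofHom (algebraMap R E)) f
    let := ρ.toAlgebra
    let := ρ'.toAlgebra
    let := ((Spec.map (CommRingCat.ofHom (algebraMap R E))).app
      (PrimeSpectrum.basicOpen f)).hom.toAlgebra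
    choose e₁ he₁ using he.mem
    obtain rfl : β ∘ e₁ = e := funext he₁
    obtain ⟨e'', he''⟩ := exists_basis_of_locBasis (R' := Γ(Spec (CommRingCat.of R),
      PrimeSpectrum.basicOpen f)) hβ hc he m hs hreg
    refine ⟨e'', ?_, fun hcc => ?_⟩
    · rw [hres, discr_away hβ f hc he'' m hs hreg]
      exact (algebraMap_dvd_iff_away f _ _).2 ⟨n, hn⟩
    · rw [hres, discr_away hβ f hc he'' m hs hreg]
      exact (algebraMap_dvd_iff_away f _ _).2 ⟨n, hn' hcc⟩

end

/-! ### Colength and the order of the determinant -/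

section
variable {K : Type*} [Field K] {d : ℕ}

/-- The order of the determinant of a matrix over `K⟦t⟧` is the length of its cokernel, by the
Smith normal form. -/
theorem associated_det_X_pow_finrank (P : Matrix (Fin d) (Fin d) K⟦X⟧) (hP : P.det ≠ 0) :
    Associated P.det (PowerSeries.X ^ Module.finrank K
      ((Fin d → K⟦X⟧) ⧸ (Submodule.span K⟦X⟧ (Set.range P)).restrictScalars K)) := by
  have hli : LinearIndependent K⟦X⟧ P := Matrix.linearIndependent_rows_of_det_ne_zero hP
  let e := Module.Basis.span hli
  have hrank : Module.finrank K⟦X⟧ (Submodule.span K⟦X⟧ (Set.range P)) =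
      Module.finrank K⟦X⟧ (Fin d → K⟦X⟧) := by
    rw [Module.finrank_eq_card_basis e, Module.finrank_fin_fun, Fintype.card_fin]
  obtain ⟨b', a, ab', hab⟩ := Submodule.exists_smith_normal_form_of_rank_eq
    (Pi.basisFun K⟦X⟧ (Fin d)) hrank
  have hfac : P = (ab'.toMatrix e).transpose * Matrix.diagonal a *
      ((Pi.basisFun K⟦X⟧ (Fin d)).toMatrix b').transpose := by
    refine Matrix.ext fun i j => ?_
    have h1 : P i = ∑ l, ab'.toMatrix e l i • (a l • b' l) := by
      have h2 := congrArg (Submodule.subtype _) (ab'.sum_toMatrix_smul_self e i)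
      rw [map_sum] at h2
      simp only [map_smul, Submodule.subtype_apply, hab] at h2
      rw [h2]
      exact (congrArg Subtype.val (Module.Basis.span_apply hli i)).symm
    rw [h1, Matrix.mul_apply, Finset.sum_apply]
    refine Finset.sum_congr rfl fun l _ => ?_
    rw [Matrix.mul_diagonal, Pi.smul_apply, Pi.smul_apply, smul_eq_mul, smul_eq_mul, mul_assoc]
    rfl
  have hu1 : IsUnit (ab'.toMatrix e).transpose.det := by
    rw [Matrix.det_transpose]
    exact (Matrix.isUnit_iff_isUnit_det _).1 (@isUnit_of_invertible _ _ _
      (Module.Basis.invertibleToMatrix ab' e))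
  have hu2 : IsUnit ((Pi.basisFun K⟦X⟧ (Fin d)).toMatrix b').transpose.det := by
    rw [Matrix.det_transpose]
    exact (Matrix.isUnit_iff_isUnit_det _).1 (@isUnit_of_invertible _ _ _
      (Module.Basis.invertibleToMatrix _ b'))
  have hdet : Associated P.det (∏ i, a i) := by
    rw [hfac, Matrix.det_mul, Matrix.det_mul, Matrix.det_diagonal, mul_comm, ← mul_assoc]
    exact associated_unit_mul_left _ _ (hu2.mul hu1)
  have ha : ∀ i, a i ≠ 0 := by
    have := hdet.ne_zero_iff.1 hP
    rw [Finset.prod_ne_zero_iff] at this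
    exact fun i => this i (Finset.mem_univ i)
  have hirr : Irreducible (PowerSeries.X : K⟦X⟧) := PowerSeries.X_prime.irreducible
  choose n hn using fun i => IsDiscreteValuationRing.associated_pow_irreducible (ha i) hirr
  -- In a basis adapted to the span of the rows, the cokernel is the sum of the spaces of power
  -- series truncated at the orders `n i` of the elementary divisors.
  let Θ : (Fin d → K⟦X⟧) →ₗ[K] ((Σ i, Fin (n i)) → K) :=
    LinearMap.pi fun q => (PowerSeries.coeff (R := K) q.2) ∘ₗ
      ((b'.coord q.1).restrictScalars K)
  have hker : LinearMap.ker Θ =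
      (Submodule.span K⟦X⟧ (Set.range P)).restrictScalars K := by
    ext v
    rw [Submodule.restrictScalars_mem, LinearMap.mem_ker]
    have h1 : Θ v = 0 ↔ ∀ i, PowerSeries.X ^ n i ∣ b'.repr v i := by
      constructor
      · intro h i
        rw [PowerSeries.X_pow_dvd_iff]
        intro j hj
        exact congrFun h ⟨i, j, hj⟩
      · intro h
        ext ⟨i, j⟩
        exact (PowerSeries.X_pow_dvd_iff.1 (h i)) j j.2
    rw [h1]
    constructor
    · intro h
      rw [← b'.sum_repr v]
      refine Submodule.sum_mem _ fun i _ => ?_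
      obtain ⟨c, hc⟩ := (hn i).dvd_iff_dvd_left.2 (h i)
      rw [hc, mul_comm, mul_smul, ← hab]
      exact Submodule.smul_mem _ _ (ab' i).2
    · intro h i
      have h2 : b'.repr v i = ab'.repr ⟨v, h⟩ i * a i := by
        have h3 := congrArg (Submodule.subtype _) (ab'.sum_repr ⟨v, h⟩)
        rw [map_sum] at h3
        simp only [map_smul, Submodule.subtype_apply, hab, smul_smul] at h3
        have h4 := congrArg (fun z => b'.repr z i) h3
        simp only [b'.repr_sum_self] at h4
        exact h4.symm
      rw [h2]
      exact (hn i).symm.dvd.mul_left _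
  have hsurj : Function.Surjective Θ := by
    intro c
    refine ⟨∑ i, (PowerSeries.mk fun j => if h : j < n i then c ⟨i, j, h⟩ else 0) • b' i, ?_⟩
    ext ⟨i, j⟩
    change PowerSeries.coeff j.1 (b'.repr _ i) = _
    rw [b'.repr_sum_self, PowerSeries.coeff_mk, dif_pos j.2]
  have hfin : Module.finrank K
      ((Fin d → K⟦X⟧) ⧸ (Submodule.span K⟦X⟧ (Set.range P)).restrictScalars K) = ∑ i, n i := by
    rw [← hker, (Θ.quotKerEquivOfSurjective hsurj).finrank_eq, Module.finrank_fintype_fun_eq_card,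
      Fintype.card_sigma]
    simp
  rw [hfin, ← Finset.prod_pow_eq_pow_sum]
  exact hdet.trans (Associated.prod _ _ _ fun i _ => hn i)

variable {R M Q : Type*} [CommRing R] [Algebra K R] [CommRing M] [Algebra K M] [Algebra R M]
  [IsScalarTower K R M] [AddCommGroup Q] [Module K Q]

/-- The order in `t` of the determinant of a local basis of `E` is the colength of `E` in `M`. The
ring `R` need not be a discrete valuation ring; it only has to map to `K⟦t⟧` in such a way that
both rings have the same truncations modulo powers of `t`. -/
theorem LocBasis.associated_det {E : Submodule R M} {f : R} {e : Fin d → M} (he : LocBasis E f e)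
    (ψ : R →ₐ[K] K⟦X⟧) {t : R} (ht : ψ t = PowerSeries.X)
    (happ : ∀ (b : ℕ) (v : K⟦X⟧), ∃ r, PowerSeries.X ^ b ∣ v - ψ r)
    (hdvd : ∀ (b : ℕ) (z : R), PowerSeries.X ^ b ∣ ψ z → t ^ b ∣ z)
    (hf : IsUnit (ψ f)) (m : Module.Basis (Fin d) R M) {b : ℕ} (hb : ∀ i, t ^ b • m i ∈ E)
    (π : M →ₗ[K] Q) (hπ : Function.Surjective π) (hker : ∀ z, π z = 0 ↔ z ∈ E)
    (P : Matrix (Fin d) (Fin d) R) (hP : ∀ i, e i = ∑ j, P i j • m j) :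
    Associated (ψ P.det) (PowerSeries.X ^ Module.finrank K Q) := by
  obtain ⟨P', N, n, hP', hN, hNP, hdet⟩ := he.exists_mul_eq m hb
  obtain rfl : P = P' := by
    ext i j
    have h1 := congrArg (fun z => m.repr z j) ((hP i).symm.trans (hP' i))
    simpa only [m.repr_sum_self] using h1
  let P₁ : Matrix (Fin d) (Fin d) K⟦X⟧ := P.map ψ
  have hP₁ : P₁.det = ψ P.det := (AlgHom.map_det ψ P).symm
  let L := Submodule.span K⟦X⟧ (Set.range P₁)
  have hfn : IsUnit (ψ f ^ n) := hf.pow n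
  have hne : P₁.det ≠ 0 := by
    intro h0
    have h1 := congrArg ψ hdet
    rw [map_mul, ← hP₁, h0, mul_zero, map_pow, map_mul, map_pow, map_pow, ht] at h1
    exact pow_ne_zero d (mul_ne_zero hfn.ne_zero (pow_ne_zero b PowerSeries.X_ne_zero)) h1.symm
  rw [← hP₁]
  -- The span `L` of the rows of `P₁` contains `t^b K⟦t⟧^d`, because `N P = f^n t^b` and `f` is a
  -- unit.
  have hXL : ∀ v : Fin d → K⟦X⟧, (PowerSeries.X ^ b : K⟦X⟧) • v ∈ L := by
    intro v
    have h1 : ∀ i, (PowerSeries.X ^ b : K⟦X⟧) • (Pi.single i 1 : Fin d → K⟦X⟧) ∈ L := by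
      intro i
      rw [← Submodule.smul_mem_iff_of_isUnit _ hfn, smul_smul]
      have h2 : (ψ f ^ n * PowerSeries.X ^ b) • (Pi.single i 1 : Fin d → K⟦X⟧) =
          ∑ j, ψ (N i j) • P₁ j := by
        ext l : 1
        have h3 := congrArg ψ (congrFun (congrFun hNP i) l)
        rw [Matrix.mul_apply, map_sum, Matrix.smul_apply, Matrix.one_apply, smul_eq_mul] at h3
        rw [Finset.sum_apply, Pi.smul_apply, smul_eq_mul, Pi.single_apply]
        simp only [map_mul, map_pow, ht] at h3
        simp only [Pi.smul_apply, smul_eq_mul]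
        refine Eq.trans ?_ h3.symm
        by_cases hil : l = i
        · rw [if_pos hil, if_pos hil.symm, map_one]
        · rw [if_neg hil, if_neg (Ne.symm hil), map_zero]
      rw [h2]
      exact Submodule.sum_mem _ fun j _ => Submodule.smul_mem _ _ (Submodule.subset_span ⟨j, rfl⟩)
    rw [pi_eq_sum_univ' v, Finset.smul_sum]
    refine Submodule.sum_mem _ fun i _ => ?_
    rw [smul_comm]
    exact Submodule.smul_mem _ _ (h1 i)
  -- Coordinates with respect to `m` map `M` to `K⟦t⟧^d`, and `E` is the preimage of `L`.
  let Λ : M →ₗ[K] (Fin d → K⟦X⟧) :=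
    LinearMap.pi fun i => ψ.toLinearMap ∘ₗ (m.coord i).restrictScalars K
  have hΛ : ∀ z i, Λ z i = ψ (m.repr z i) := fun _ _ => rfl
  have hΛs : ∀ (r : R) z, Λ (r • z) = ψ r • Λ z := by
    intro r z
    ext i : 1
    rw [hΛ, map_smul, Finsupp.smul_apply, smul_eq_mul, map_mul, Pi.smul_apply, hΛ, smul_eq_mul]
  have hΛe : ∀ i, Λ (e i) = P₁ i := by
    intro i
    ext j : 1
    rw [hΛ, hP, m.repr_sum_self]
    rfl
  have happ' : ∀ v : Fin d → K⟦X⟧, ∃ (c : Fin d → R) (w : Fin d → K⟦X⟧), ∀ i,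
      v i = ψ (c i) + PowerSeries.X ^ b * w i := by
    intro v
    choose c hc using fun i => happ b (v i)
    choose w hw using hc
    exact ⟨c, w, fun i => by rw [← hw]; ring⟩
  have hker' : ∀ z, Λ z ∈ L ↔ z ∈ E := by
    intro z
    constructor
    · intro hz
      obtain ⟨v, hv⟩ := (Submodule.mem_span_range_iff_exists_fun _).1 hz
      obtain ⟨c, w, hcw⟩ := happ' v
      have h1 : Λ (z - ∑ i, c i • e i) = (PowerSeries.X ^ b : K⟦X⟧) • ∑ i, w i • P₁ i := by
        rw [map_sub, ← hv, map_sum, Finset.smul_sum, ← Finset.sum_sub_distrib]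
        refine Finset.sum_congr rfl fun i _ => ?_
        rw [hΛs, hΛe, hcw, add_smul, add_sub_cancel_left, mul_smul]
      have h2 : z - ∑ i, c i • e i ∈ E := by
        rw [← m.sum_repr (z - ∑ i, c i • e i)]
        refine Submodule.sum_mem _ fun i _ => ?_
        obtain ⟨q, hq⟩ := hdvd b (m.repr (z - ∑ i, c i • e i) i) (by
          rw [← hΛ, h1]
          exact ⟨_, rfl⟩)
        rw [hq, mul_comm, mul_smul]
        exact Submodule.smul_mem _ _ (hb i)
      rw [← sub_add_cancel z (∑ i, c i • e i)]
      exact E.add_mem h2 (Submodule.sum_mem _ fun i _ => Submodule.smul_mem _ _ (he.mem i))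
    · intro hz
      obtain ⟨q, hq⟩ := he.span z hz
      rw [← Submodule.smul_mem_iff_of_isUnit _ (hf.pow q), ← map_pow, ← hΛs]
      obtain ⟨c, hc⟩ := (Submodule.mem_span_range_iff_exists_fun _).1 hq
      rw [← hc, map_sum]
      refine Submodule.sum_mem _ fun i _ => ?_
      rw [hΛs, hΛe]
      exact Submodule.smul_mem _ _ (Submodule.subset_span ⟨i, rfl⟩)
  let Ψ := (L.restrictScalars K).mkQ ∘ₗ Λ
  have hΨ : Function.Surjective Ψ := by
    intro v
    obtain ⟨v, rfl⟩ := Submodule.mkQ_surjective _ v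
    obtain ⟨c, w, hcw⟩ := happ' v
    refine ⟨∑ i, c i • m i, ?_⟩
    change Submodule.Quotient.mk _ = Submodule.Quotient.mk _
    rw [Submodule.Quotient.eq, Submodule.restrictScalars_mem, ← neg_mem_iff, neg_sub]
    have h1 : v - Λ (∑ i, c i • m i) = (PowerSeries.X ^ b : K⟦X⟧) • w := by
      ext i : 1
      rw [Pi.sub_apply, hΛ, m.repr_sum_self, hcw, add_sub_cancel_left]
      rfl
    rw [h1]
    exact hXL w
  have hkk : LinearMap.ker Ψ = LinearMap.ker π := by
    ext z
    rw [LinearMap.mem_ker, LinearMap.mem_ker, hker, ← hker' z]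
    exact Submodule.Quotient.mk_eq_zero _
  have hfin : Module.finrank K Q = Module.finrank K ((Fin d → K⟦X⟧) ⧸ L.restrictScalars K) := by
    rw [← (π.quotKerEquivOfSurjective hπ).finrank_eq, ← (Ψ.quotKerEquivOfSurjective hΨ).finrank_eq,
      hkk]
  rw [hfin]
  exact associated_det_X_pow_finrank P₁ hne

end

/-! ### Lattices in `A ⊗ O` and their base change -/

section
variable {R M R' M' : Type*} [CommRing R] [CommRing M] [Algebra R M] [CommRing R'] [CommRing M']
  [Algebra R' M'] {d : ℕ}

/-- Local bases are compatible with base change. -/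
theorem LocBasis.map {E : Submodule R M} {f : R} {e : Fin d → M} (he : LocBasis E f e)
    (ρ : R →+* R') (h : M →+* M') (hh : ∀ r x, h (r • x) = ρ r • h x) :
    LocBasis (Submodule.span R' (h '' E)) (ρ f) (h ∘ e) := by
  refine ⟨fun i => Submodule.subset_span ⟨e i, he.mem i, rfl⟩, fun x hx => ?_⟩
  induction hx using Submodule.span_induction with
  | zero => exact ⟨0, by rw [smul_zero]; exact zero_mem _⟩
  | mem x hx =>
    obtain ⟨x, hx, rfl⟩ := hx
    obtain ⟨n, hn⟩ := he.span x hx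
    obtain ⟨c, hc⟩ := (Submodule.mem_span_range_iff_exists_fun R).1 hn
    refine ⟨n, ?_⟩
    rw [← map_pow, ← hh, ← hc, map_sum]
    refine Submodule.sum_mem _ fun i _ => ?_
    rw [hh]
    exact Submodule.smul_mem _ _ (Submodule.subset_span ⟨i, rfl⟩)
  | add x y _ _ hx hy =>
    obtain ⟨n, hn⟩ := hx
    obtain ⟨n', hn'⟩ := hy
    refine ⟨n + n', ?_⟩
    rw [smul_add]
    refine Submodule.add_mem _ ?_ ?_
    · rw [add_comm, pow_add, mul_smul]; exact Submodule.smul_mem _ _ hn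
    · rw [pow_add, mul_smul]; exact Submodule.smul_mem _ _ hn'
  | smul r x _ hx =>
    obtain ⟨n, hn⟩ := hx
    exact ⟨n, by rw [smul_comm]; exact Submodule.smul_mem _ _ hn⟩

end

section
variable {k : Type u} [Field k]
  {A B : Type u} [CommRing A] [Algebra k A] [CommRing B] [Algebra k B]
  {O : Type u} [CommRing O] [Algebra k O] [Algebra k⟦X⟧ O] [IsScalarTower k k⟦X⟧ O] {b : ℕ}

attribute [local instance] coverAlgebra

instance isScalarTower_cover : IsScalarTower A (A ⊗[k] k⟦X⟧) (A ⊗[k] O) :=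
  IsScalarTower.of_algebraMap_eq fun r => ((coverAlgHom k O A).commutes r).symm

theorem cover_smul_def (r : A ⊗[k] k⟦X⟧) (z : A ⊗[k] O) : r • z = coverAlgHom k O A r * z := rfl

theorem algebraMap_cover_smul (r : A) (z : A ⊗[k] O) :
    algebraMap A (A ⊗[k] k⟦X⟧) r • z = r • z := by
  rw [cover_smul_def, (coverAlgHom k O A).commutes, ← Algebra.smul_def]

theorem tR_pow_smul (n : ℕ) (z : A ⊗[k] O) : tR k A ^ n • z = tM k A O ^ n * z := by
  rw [cover_smul_def, map_pow, coverAlgHom_tR]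

theorem projF_cover_smul (a : A) (f : k⟦X⟧) (z : A ⊗[k] O) :
    projF k O b A ((a ⊗ₜ[k] f) • z) =
      a • ((1 ⊗ₜ[k] algebraMap k⟦X⟧ (ModT k O b) f) * projF k O b A z) := by
  rw [cover_smul_def, map_mul, ← smul_mul_assoc]
  congr 1
  have : coverAlgHom k O A (a ⊗ₜ[k] f) = a ⊗ₜ[k] algebraMap k⟦X⟧ O f := rfl
  rw [this, TensorProduct.smul_tmul', smul_eq_mul, mul_one]
  rfl

/-- The preimage in `A ⊗ O` of a submodule `S` of `A ⊗ F` under reduction modulo `t^b`. If `S` is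
a subalgebra, this is the algebra `O_C` of the crimp defined by `S`. -/
def liftSub (S : Submodule A (A ⊗[k] ModT k O b)) (hS : Stable (scalars O b) S) :
    Submodule (A ⊗[k] k⟦X⟧) (A ⊗[k] O) where
  carrier := {z | projF k O b A z ∈ S}
  zero_mem' := by
    rw [Set.mem_ofPred_eq, map_zero]
    exact S.zero_mem
  add_mem' {z w} hz hw := by
    rw [Set.mem_ofPred_eq, map_add]
    exact S.add_mem hz hw
  smul_mem' r z hz := by
    rw [Set.mem_ofPred_eq] at hz ⊢
    induction r with
    | zero =>
      rw [cover_smul_def, map_zero, zero_mul, map_zero]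
      exact S.zero_mem
    | add r s hr hs =>
      rw [cover_smul_def, map_add, add_mul, map_add]
      exact S.add_mem hr hs
    | tmul a f =>
      rw [projF_cover_smul, ← mulLeft_baseChange]
      exact S.smul_mem _ (hS _ ⟨f, rfl⟩ _ hz)

variable {S : Submodule A (A ⊗[k] ModT k O b)} {hS : Stable (scalars O b) S}

theorem mem_liftSub {z : A ⊗[k] O} : z ∈ liftSub S hS ↔ projF k O b A z ∈ S := Iff.rfl

theorem tR_pow_smul_mem_liftSub (z : A ⊗[k] O) : tR k A ^ b • z ∈ liftSub S hS := by
  rw [mem_liftSub, (projF_eq_zero_iff b _).2 ⟨z, tR_pow_smul b z⟩]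
  exact S.zero_mem

variable (O) in
/-- The pullback of functions along `C̃ × Spec B → C̃ × Spec A`. -/
def bcO (f : A →ₐ[k] B) : A ⊗[k] O →ₐ[k] B ⊗[k] O := Algebra.TensorProduct.map f (AlgHom.id k O)

/-- The pullback of functions along `Δ × Spec B → Δ × Spec A`. -/
def bcR (f : A →ₐ[k] B) : A ⊗[k] k⟦X⟧ →ₐ[k] B ⊗[k] k⟦X⟧ :=
  Algebra.TensorProduct.map f (AlgHom.id k k⟦X⟧)

theorem bcO_tmul (f : A →ₐ[k] B) (a : A) (x : O) : bcO O f (a ⊗ₜ x) = f a ⊗ₜ x := rfl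

theorem bcO_coverAlgHom (f : A →ₐ[k] B) (r : A ⊗[k] k⟦X⟧) :
    bcO O f (coverAlgHom k O A r) = coverAlgHom k O B (bcR f r) := by
  induction r with
  | zero => simp only [map_zero]
  | add r s hr hs => simp only [map_add, hr, hs]
  | tmul a g => rfl

theorem bcO_smul (f : A →ₐ[k] B) (r : A ⊗[k] k⟦X⟧) (z : A ⊗[k] O) :
    bcO O f (r • z) = bcR f r • bcO O f z := by
  rw [cover_smul_def, map_mul, bcO_coverAlgHom, cover_smul_def]

theorem bcR_tR (f : A →ₐ[k] B) : bcR f (tR k A) = tR k B := by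
  rw [tR, bcR, Algebra.TensorProduct.map_tmul, map_one]
  rfl

theorem projF_bcO (f : A →ₐ[k] B) (z : A ⊗[k] O) :
    projF k O b B (bcO O f z) = bcMap (ModT k O b) f (projF k O b A z) := by
  induction z with
  | zero => simp only [map_zero]
  | add r s hr hs => simp only [map_add, hr, hs]
  | tmul a g => rfl

/-- The formation of the lattice of `S` commutes with base change. -/
theorem liftSub_bcSub (f : A →ₐ[k] B) (hS : Stable (scalars O b) S)
    (hS' : Stable (scalars O b) (bcSub f S)) :
    liftSub (bcSub f S) hS' =
      Submodule.span (B ⊗[k] k⟦X⟧) (bcO O f '' (liftSub S hS : Set (A ⊗[k] O))) := by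
  apply le_antisymm
  · have key : ∀ y ∈ bcSub f S, ∃ z ∈ Submodule.span (B ⊗[k] k⟦X⟧)
        (bcO O f '' (liftSub S hS : Set (A ⊗[k] O))), projF k O b B z = y := by
      intro y hy
      induction hy using Submodule.span_induction with
      | zero => exact ⟨0, zero_mem _, map_zero _⟩
      | mem y hy =>
        obtain ⟨s, hs, rfl⟩ := hy
        obtain ⟨z, rfl⟩ := projF_surjective b s
        exact ⟨bcO O f z, Submodule.subset_span ⟨z, hs, rfl⟩, projF_bcO f z⟩
      | add y y' _ _ hy hy' =>
        obtain ⟨z, hz, rfl⟩ := hy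
        obtain ⟨z', hz', rfl⟩ := hy'
        exact ⟨z + z', add_mem hz hz', map_add _ _ _⟩
      | smul r y _ hy =>
        obtain ⟨z, hz, rfl⟩ := hy
        refine ⟨algebraMap B (B ⊗[k] k⟦X⟧) r • z, Submodule.smul_mem _ _ hz, ?_⟩
        rw [algebraMap_cover_smul, map_smul]
    intro z hz
    obtain ⟨z', hz', h⟩ := key _ hz
    obtain ⟨w, hw⟩ := (projF_eq_zero_iff b (z - z')).1 (by rw [map_sub, h, sub_self])
    have h2 : z - z' ∈ Submodule.span (B ⊗[k] k⟦X⟧)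
        (bcO O f '' (liftSub S hS : Set (A ⊗[k] O))) := by
      rw [hw]
      clear hw
      induction w with
      | zero => rw [mul_zero]; exact zero_mem _
      | add w w' hw hw' => rw [mul_add]; exact add_mem hw hw'
      | tmul c x =>
        have : tR k B ^ b • (c ⊗ₜ[k] x : B ⊗[k] O) =
            algebraMap B (B ⊗[k] k⟦X⟧) c • bcO O f (tR k A ^ b • (1 ⊗ₜ[k] x)) := by
          rw [bcO_smul, map_pow, bcR_tR, smul_comm, bcO_tmul, map_one, algebraMap_cover_smul,
            TensorProduct.smul_tmul', smul_eq_mul, mul_one]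
        rw [← tR_pow_smul, this]
        exact Submodule.smul_mem _ _ (Submodule.subset_span
          ⟨_, tR_pow_smul_mem_liftSub _, rfl⟩)
    rw [← sub_add_cancel z z']
    exact add_mem h2 hz'
  · rw [Submodule.span_le]
    rintro _ ⟨z, hz, rfl⟩
    change projF k O b B (bcO O f z) ∈ bcSub f S
    rw [projF_bcO]
    exact bcMap_mem_bcSub f hz

theorem LocBasis.bcO {f : A ⊗[k] k⟦X⟧} {d : ℕ} {e : Fin d → A ⊗[k] O}
    (he : LocBasis (liftSub S hS) f e) (g : A →ₐ[k] B) (hS' : Stable (scalars O b) (bcSub g S)) :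
    LocBasis (liftSub (bcSub g S) hS') (bcR g f) (Crimping.bcO O g ∘ e) := by
  rw [liftSub_bcSub g hS hS']
  exact he.map (bcR g).toRingHom (Crimping.bcO O g).toRingHom fun r x => bcO_smul g r x

/-- The expansion of a function on `Δ × Spec K` is invertible if and only if the function does not
vanish at `t = 0`. -/
theorem isUnit_toPS_iff {K : Type u} [Field K] [Algebra k K] (z : K ⊗[k] k⟦X⟧) :
    IsUnit (toPS k K z) ↔ constR k K z ≠ 0 := by
  rw [PowerSeries.isUnit_iff_constantCoeff, isUnit_iff_ne_zero]
  rfl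

theorem exists_X_pow_dvd_sub_toPS {K : Type u} [Field K] [Algebra k K] (b : ℕ) (v : K⟦X⟧) :
    ∃ r : K ⊗[k] k⟦X⟧, PowerSeries.X ^ b ∣ v - toPS k K r := by
  refine ⟨∑ j ∈ Finset.range b, PowerSeries.coeff j v • tR k K ^ j, ?_⟩
  rw [PowerSeries.X_pow_dvd_iff]
  intro m hm
  rw [map_sub, map_sum, map_sum]
  simp only [map_smul, map_pow, toPS_tR, PowerSeries.coeff_X_pow,
    smul_eq_mul, mul_ite, mul_one, mul_zero]
  rw [Finset.sum_ite_eq, if_pos (Finset.mem_range.2 hm), sub_self]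

variable {d : ℕ}

/-- The formation of discriminants commutes with base change. -/
theorem discr_bcO (o : Module.Basis (Fin d) k⟦X⟧ O) (e : Fin d → A ⊗[k] O) (g : A →ₐ[k] B) :
    Algebra.discr (B ⊗[k] k⟦X⟧) (bcO O g ∘ e) = bcR g (Algebra.discr (A ⊗[k] k⟦X⟧) e) := by
  obtain ⟨m, hm⟩ := exists_basis_cover (A := A) o
  obtain ⟨m', hm'⟩ := exists_basis_cover (A := B) o
  let P : Matrix (Fin d) (Fin d) (A ⊗[k] k⟦X⟧) := Matrix.of fun i j => m.repr (e i) j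
  have hP : ∀ i, e i = ∑ j, P i j • m j := fun i => (m.sum_repr _).symm
  have hP' : ∀ i, (bcO O g ∘ e) i = ∑ j, (P.map (bcR g)) i j • m' j := by
    intro i
    rw [Function.comp_apply, hP, map_sum]
    refine Finset.sum_congr rfl fun j _ => ?_
    rw [bcO_smul, hm, hm', bcO_tmul, map_one]
    rfl
  rw [discr_eq_of_matrix hP, discr_eq_of_matrix hP', discr_cover o m hm, discr_cover o m' hm',
    map_mul, map_pow]
  refine congrArg₂ (· * ·) ?_ ?_
  · rw [AlgHom.map_det]
    rfl
  · change _ = (g 1) ⊗ₜ _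
    rw [map_one]
    rfl

/-- At a point with values in a field `K`, the discriminant of a local basis of the lattice of `S`
has order `2 δ + a` in `t`, where `δ` is the colength of the lattice and `a` the order of the
discriminant of `O`. -/
theorem LocBasis.associated_discr {f : A ⊗[k] k⟦X⟧} {e : Fin d → A ⊗[k] O}
    (he : LocBasis (liftSub S hS) f e) {K : Type u} [Field K] [Algebra k K] (g : A →ₐ[k] K)
    (hf : g (constR k A f) ≠ 0) (o : Module.Basis (Fin d) k⟦X⟧ O) {a : ℕ}
    (ha : Associated (Algebra.discr k⟦X⟧ o) (PowerSeries.X ^ a)) :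
    Associated (toPS k K (bcR g (Algebra.discr (A ⊗[k] k⟦X⟧) e)))
      (PowerSeries.X ^ (2 * Module.finrank K ((K ⊗[k] ModT k O b) ⧸ bcSub g S) + a)) := by
  have hS' := hS.map g
  have he' := he.bcO g hS'
  obtain ⟨m', hm'⟩ := exists_basis_cover (A := K) o
  let P : Matrix (Fin d) (Fin d) (K ⊗[k] k⟦X⟧) :=
    Matrix.of fun i j => m'.repr ((Crimping.bcO O g ∘ e) i) j
  have hP : ∀ i, (Crimping.bcO O g ∘ e) i = ∑ j, P i j • m' j := fun i => (m'.sum_repr _).symm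
  have h1 := he'.associated_det (K := K) (toPS k K) toPS_tR exists_X_pow_dvd_sub_toPS
    (fun b z h => (tR_pow_dvd_iff b z).2 (PowerSeries.X_pow_dvd_iff.1 h))
    ((isUnit_toPS_iff _).2 (by rw [bcR, constR_map]; exact hf)) m'
    (fun i => tR_pow_smul_mem_liftSub _)
    ((bcSub g S).mkQ ∘ₗ (projF k O b K).toLinearMap)
    ((Submodule.mkQ_surjective _).comp (projF_surjective b))
    (fun z => Submodule.Quotient.mk_eq_zero _) P hP
  have h2 : toPS k K (bcR g (Algebra.discr (A ⊗[k] k⟦X⟧) e)) =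
      toPS k K P.det ^ 2 * PowerSeries.map (algebraMap k K) (Algebra.discr k⟦X⟧ o) := by
    rw [← discr_bcO o, discr_eq_of_matrix hP, discr_cover o m' hm', map_mul, map_pow, toPS_tmul,
      map_one, one_mul]
  -- The discriminant of `e` is the square of the determinant of its matrix times the
  -- discriminant of `O`.
  rw [h2, pow_add, mul_comm 2, pow_mul]
  refine (h1.pow_pow (n := 2)).mul_mul ?_
  have h3 := ha.map (PowerSeries.map (algebraMap k K))
  rwa [map_pow, PowerSeries.map_X] at h3

end

/-! ### The order of the discriminant at points of `Spec A` -/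

section
variable {k : Type u} [Field k]
  {A B : Type u} [CommRing A] [Algebra k A] [CommRing B] [Algebra k B]
  {O : Type u} [CommRing O] [Algebra k O] [Algebra k⟦X⟧ O] [IsScalarTower k k⟦X⟧ O] {b : ℕ}

attribute [local instance] coverAlgebra

variable (k) in
/-- The point `(0, p)` of `Δ × Spec A`. -/
def zeroPt (p : PrimeSpectrum A) : PrimeSpectrum (A ⊗[k] k⟦X⟧) := p.comap (constR k A)

theorem mem_zeroPt {p : PrimeSpectrum A} {f : A ⊗[k] k⟦X⟧} :
    f ∈ (zeroPt k p).asIdeal ↔ constR k A f ∈ p.asIdeal := Iff.rfl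

theorem exists_eq_zeroPt {y : PrimeSpectrum (A ⊗[k] k⟦X⟧)} (hy : tR k A ∈ y.asIdeal) :
    ∃ p : PrimeSpectrum A, y = zeroPt k p := by
  refine ⟨y.comap (algebraMap A _), PrimeSpectrum.ext (Ideal.ext fun f => ?_)⟩
  rw [mem_zeroPt]
  change _ ↔ algebraMap A (A ⊗[k] k⟦X⟧) (constR k A f) ∈ y.asIdeal
  obtain ⟨w, hw⟩ := (constR_eq_zero_iff (f - algebraMap A _ (constR k A f))).1
    (by rw [map_sub, constR_algebraMap, sub_self])
  have h : f = algebraMap A _ (constR k A f) + tR k A * w := by rw [← hw]; ring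
  conv_lhs => rw [h]
  exact (Ideal.add_mem_iff_left _ (Ideal.mul_mem_right _ _ hy))

variable (k) in
/-- The homomorphism to the residue field at `p`. -/
def toκ (p : PrimeSpectrum A) : A →ₐ[k] p.asIdeal.ResidueField :=
  IsScalarTower.toAlgHom k A p.asIdeal.ResidueField

theorem toκ_ne_zero_iff {p : PrimeSpectrum A} {a : A} : toκ k p a ≠ 0 ↔ a ∉ p.asIdeal := by
  rw [ne_eq, not_iff_not]
  exact Ideal.algebraMap_residueField_eq_zero

variable {S : Submodule A (A ⊗[k] ModT k O b)} {hS : Stable (scalars O b) S} {d : ℕ}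

/-- If the branch divisor is defined by `t^b`, then the colength `δ` of the lattice at every point
satisfies `2 δ + a = b`. -/
theorem HasLocDiscr.rank_eq (h : HasLocDiscr (liftSub S hS) d (tR k A ^ b) True)
    (o : Module.Basis (Fin d) k⟦X⟧ O) {a : ℕ}
    (ha : Associated (Algebra.discr k⟦X⟧ o) (PowerSeries.X ^ a)) (p : PrimeSpectrum A) :
    2 * Module.finrank p.asIdeal.ResidueField
      ((p.asIdeal.ResidueField ⊗[k] ModT k O b) ⧸ bcSub (toκ k p) S) + a = b := by
  obtain ⟨f, hf, e, he, n, hn, hn'⟩ := h (zeroPt k p)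
  have hf' := (toκ_ne_zero_iff (k := k)).2 (mt mem_zeroPt.2 hf)
  have h1 := he.associated_discr (toκ k p) hf' o ha
  have hu : IsUnit (toPS k _ (bcR (toκ k p) f) ^ n) := by
    refine IsUnit.pow _ ((isUnit_toPS_iff _).2 ?_)
    rw [bcR, constR_map]
    exact hf'
  have h2 := map_dvd (toPS k p.asIdeal.ResidueField) (map_dvd (bcR (toκ k p)) hn)
  have h3 := map_dvd (toPS k p.asIdeal.ResidueField) (map_dvd (bcR (toκ k p)) (hn' trivial))
  simp only [map_mul, map_pow, bcR_tR, toPS_tR] at h2 h3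
  rw [hu.dvd_mul_left, h1.dvd_iff_dvd_left] at h2
  rw [hu.dvd_mul_left, h1.dvd_iff_dvd_right] at h3
  have hX : ¬ IsUnit (PowerSeries.X : p.asIdeal.ResidueField⟦X⟧) := PowerSeries.X_prime.not_isUnit
  exact le_antisymm ((pow_dvd_pow_iff PowerSeries.X_ne_zero hX).1 h2)
    ((pow_dvd_pow_iff PowerSeries.X_ne_zero hX).1 h3)

/-- If the discriminant divides `t^b` and the colength `δ` of the lattice satisfies `2 δ + a = b`
at every point, then the branch divisor is defined by `t^b`: the cofactor of the discriminant in
`t^b` has order zero at the points with `t = 0`, so it is invertible there. -/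
theorem HasLocDiscr.of_rank {c c' : Prop} (h : HasLocDiscr (liftSub S hS) d (tR k A ^ b) c)
    (o : Module.Basis (Fin d) k⟦X⟧ O) {a : ℕ}
    (ha : Associated (Algebra.discr k⟦X⟧ o) (PowerSeries.X ^ a))
    (hr : ∀ p : PrimeSpectrum A, 2 * Module.finrank p.asIdeal.ResidueField
      ((p.asIdeal.ResidueField ⊗[k] ModT k O b) ⧸ bcSub (toκ k p) S) + a = b) :
    HasLocDiscr (liftSub S hS) d (tR k A ^ b) c' := by
  intro y
  obtain ⟨f, hf, e, he, n, ⟨g, hg⟩, -⟩ := h y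
  -- It suffices to show that the cofactor `g` is invertible near `y`.
  have hgy : g ∉ y.asIdeal := by
    intro hgy
    have hfy : f ^ n ∉ y.asIdeal := fun h => hf (y.2.mem_of_pow_mem _ h)
    have h1 : f ^ n * tR k A ^ b ∈ y.asIdeal := hg ▸ Ideal.mul_mem_left _ _ hgy
    have h2 : tR k A ∈ y.asIdeal :=
      y.2.mem_of_pow_mem _ ((y.2.mem_or_mem h1).resolve_left hfy)
    obtain ⟨p, rfl⟩ := exists_eq_zeroPt h2
    have hf' := (toκ_ne_zero_iff (k := k)).2 (mt mem_zeroPt.2 hf)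
    -- Both sides of `discr e * g = f^n t^b` have order `b` in `t` at the point, so `g` is a unit
    -- there.
    obtain ⟨w, hw⟩ := (he.associated_discr (toκ k p) hf' o ha).symm
    have hu : IsUnit (toPS k _ (bcR (toκ k p) f) ^ n) := by
      refine IsUnit.pow _ ((isUnit_toPS_iff _).2 ?_)
      rw [bcR, constR_map]
      exact hf'
    have h3 := congrArg (fun z => toPS k p.asIdeal.ResidueField (bcR (toκ k p) z)) hg
    simp only [map_mul, map_pow, bcR_tR, toPS_tR] at h3
    rw [← hw, hr p, mul_comm, mul_assoc] at h3
    have h4 := PowerSeries.X_pow_mul_cancel h3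
    have h5 : IsUnit (toPS k p.asIdeal.ResidueField (bcR (toκ k p) g)) :=
      isUnit_of_mul_isUnit_right (h4 ▸ hu)
    rw [isUnit_toPS_iff, bcR, constR_map] at h5
    exact toκ_ne_zero_iff.1 h5 (mem_zeroPt.1 hgy)
  refine ⟨f * g, notMem_mul hf hgy, e, he.of_dvd ⟨g, rfl⟩, n + 1, ⟨f * g ^ (n + 2), ?_⟩,
    fun _ => ⟨f ^ (2 * n + 1) * g ^ n, ?_⟩⟩
  · linear_combination (f * g ^ (n + 1)) * hg
  · linear_combination -(f ^ (n + 1) * g ^ n) * hg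

end

/-! ### The branch condition for families of quotients -/

section
variable {k : Type u} [Field k]
  {A B : Type u} [CommRing A] [Algebra k A] [CommRing B] [Algebra k B]
  {O : Type u} [CommRing O] [Algebra k O] [Algebra k⟦X⟧ O] [IsScalarTower k k⟦X⟧ O] {b : ℕ}
  {δ : ℚ} {T : Over (Spec (CommRingCat.of k))} {Q : QuotFamily O b δ T} {d : ℕ}

attribute [local instance] coverAlgebra

theorem tR_pow_mul_eq_zero {n : ℕ} {x : A ⊗[k] k⟦X⟧} (h : tR k A ^ n * x = 0) : x = 0 :=
  tR_pow_mul_injective n (h.trans (mul_zero _).symm)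

/-- The lattice in `A ⊗ O` given by the value of a family of quotients at a point of `T`. -/
def QuotFamily.sub (Q : QuotFamily O b δ T) (x : specOver k A ⟶ T) :
    Submodule (A ⊗[k] k⟦X⟧) (A ⊗[k] O) := liftSub (Q.S A x) (Q.isQuotSub x).stable

theorem QuotFamily.IsSubalgebra.mem_sub {hQ : Q.IsSubalgebra} {x : specOver k A ⟶ T}
    {z : A ⊗[k] O} : z ∈ Q.sub x ↔ z ∈ hQ.OC x := Iff.rfl

theorem QuotFamily.IsSubalgebra.isCover_iff (hQ : Q.IsSubalgebra) (x : specOver k A ⟶ T)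
    (o : Module.Basis (Fin d) k⟦X⟧ O) (c : Prop) :
    IsCoverWithDiscr (hQ.curveφ x) d (fun U δ =>
      δ ∣ res ((Scheme.ΓSpecIso (CommRingCat.of (A ⊗[k] k⟦X⟧))).inv.hom (tR k A ^ b)) U ∧
      (c → res ((Scheme.ΓSpecIso (CommRingCat.of (A ⊗[k] k⟦X⟧))).inv.hom (tR k A ^ b)) U ∣ δ)) ↔
    HasLocDiscr (Q.sub x) d (tR k A ^ b) c := by
  let := (hQ.str x).toRingHom.toAlgebra
  let β : hQ.OC x →ₐ[A ⊗[k] k⟦X⟧] A ⊗[k] O :=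
    { (hQ.OC x).val.toRingHom with commutes' := fun r => rfl }
  have hrange : LinearMap.range β.toLinearMap = Q.sub x := by
    ext z
    rw [QuotFamily.IsSubalgebra.mem_sub (hQ := hQ)]
    exact ⟨fun ⟨w, hw⟩ => hw ▸ w.2, fun h => ⟨⟨z, h⟩, rfl⟩⟩
  obtain ⟨m, hm⟩ := exists_basis_cover (A := A) o
  rw [← hrange]
  exact hasLocDiscr_iff (β := β) Subtype.val_injective m (s := tR k A ^ b)
    (fun i => hrange ▸ tR_pow_smul_mem_liftSub _) (fun x hx => tR_pow_mul_eq_zero hx) _ c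

theorem QuotFamily.isInY_iff (o : Module.Basis (Fin d) k⟦X⟧ O) :
    Q.IsInY d ↔ Q.IsSubalgebra ∧ ∀ (A : Type u) [CommRing A] [Algebra k A]
      (x : specOver k A ⟶ T), HasLocDiscr (Q.sub x) d (tR k A ^ b) False := by
  constructor
  · rintro ⟨hQ, h⟩
    refine ⟨hQ, fun A _ _ x => (hQ.isCover_iff x o False).1 ?_⟩
    exact (h A x).mono fun U δ h => ⟨h, False.elim⟩
  · rintro ⟨hQ, h⟩
    refine ⟨hQ, fun A _ _ x => ?_⟩
    exact ((hQ.isCover_iff x o False).2 (h A x)).mono fun U δ h => h.1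

theorem QuotFamily.two_mul_finrank (Q : QuotFamily O b δ T) (x : specOver k A ⟶ T) {a : ℕ}
    (hδ : δ = ((b : ℚ) - a) / 2) (p : PrimeSpectrum A) :
    2 * Module.finrank p.asIdeal.ResidueField
      ((p.asIdeal.ResidueField ⊗[k] ModT k O b) ⧸ bcSub (toκ k p) (Q.S A x)) + a = b := by
  rw [← Q.map_eq_bcSub]
  have h := Q.rank_eq p.asIdeal.ResidueField (specOverMap (toκ k p) ≫ x) ⊥
  rw [Module.rankAtStalk_eq_finrank_of_free] at h
  rw [Pi.natCast_apply, Nat.cast_id] at h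
  replace h := h.trans hδ
  have h2 : ((2 * Module.finrank p.asIdeal.ResidueField
      ((p.asIdeal.ResidueField ⊗[k] ModT k O b) ⧸ Q.S _ (specOverMap (toκ k p) ≫ x)) + a : ℕ) : ℚ)
      = b := by
    push_cast
    rw [h]
    ring
  exact_mod_cast h2

/-- On `Y`, the condition that `t^b` annihilates the cokernel of the discriminant section forces
the branch divisor to be defined by `t^b`, since the rank of the quotient is `(b - a) / 2`. -/
theorem QuotFamily.IsInY.hasLocDiscr (h : Q.IsInY d) (o : Module.Basis (Fin d) k⟦X⟧ O) {a : ℕ}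
    (ha : Associated (Algebra.discr k⟦X⟧ o) (PowerSeries.X ^ a)) (hδ : δ = ((b : ℚ) - a) / 2)
    (x : specOver k A ⟶ T) : HasLocDiscr (Q.sub x) d (tR k A ^ b) True :=
  (((Q.isInY_iff o).1 h).2 A x).of_rank o ha (Q.two_mul_finrank x hδ)

theorem IsCoverWithDiscr.toBranch {X Y : Scheme.{u}} {φ : X ⟶ Y} {g : Γ(Y, ⊤)}
    (h : IsCoverWithDiscr φ d fun U δ => δ ∣ res g U ∧ (True → res g U ∣ δ)) :
    IsCoverWithBranch φ d g :=
  h.mono fun _ _ h => le_antisymm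
    (Ideal.span_singleton_le_span_singleton.2 (h.2 trivial))
    (Ideal.span_singleton_le_span_singleton.2 h.1)
end

/-! ### Quotients by a nonzerodivisor and Nakayama's lemma -/

section

theorem exists_prod_equiv_of_exact {A N K P : Type*} [CommRing A] [AddCommGroup N] [Module A N]
    [AddCommGroup K] [Module A K] [AddCommGroup P] [Module A P] [Module.Projective A P]
    {f : N →ₗ[A] K} {g : K →ₗ[A] P} (hf : Function.Injective f) (hg : Function.Surjective g)
    (h : Function.Exact f g) : Nonempty (K ≃ₗ[A] N × P) := by
  obtain ⟨l, hl⟩ := Module.projective_lifting_property g LinearMap.id hg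
  exact ⟨((h.splitSurjectiveEquiv hf) ⟨l, hl⟩).1⟩

variable {A M : Type u} [CommRing A] [AddCommGroup M] [Module A M]

/-- If `M / E` and `M / τM` are finite and projective for an injective endomorphism `τ` which
preserves `E`, then `E / τE` is finite and projective of the same rank as `M / τM`. -/
theorem projective_quotient_map {τ : M →ₗ[A] M} (hτ : Function.Injective τ) {E : Submodule A M}
    (hE : E.map τ ≤ E) [Module.Finite A (M ⧸ E)] [Module.Projective A (M ⧸ E)]
    [Module.Finite A (M ⧸ LinearMap.range τ)] [Module.Projective A (M ⧸ LinearMap.range τ)] :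
    Module.Finite A (E ⧸ (E.map τ).submoduleOf E) ∧
    Module.Projective A (E ⧸ (E.map τ).submoduleOf E) ∧
    Module.rankAtStalk (R := A) (E ⧸ (E.map τ).submoduleOf E) =
      Module.rankAtStalk (R := A) (M ⧸ LinearMap.range τ) := by
  -- The two filtrations of `M / τE`, by `τM / τE` and by `E / τE`, split; here `τM / τE` is
  -- isomorphic to `M / E`.
  obtain ⟨ea⟩ : Nonempty ((M ⧸ E.map τ) ≃ₗ[A] (M ⧸ E) × (M ⧸ LinearMap.range τ)) := by
    refine exists_prod_equiv_of_exact (f := E.mapQ (E.map τ) τ (Submodule.le_comap_map _ _))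
      (g := Submodule.factor LinearMap.map_le_range) ?_ (Submodule.factor_surjective _) ?_
    · rw [← LinearMap.ker_eq_bot, LinearMap.ker_eq_bot']
      intro x hx
      obtain ⟨x, rfl⟩ := Submodule.mkQ_surjective _ x
      rw [Submodule.mkQ_apply, Submodule.mapQ_apply, Submodule.Quotient.mk_eq_zero] at hx
      obtain ⟨y, hy, hxy⟩ := hx
      rw [Submodule.mkQ_apply, Submodule.Quotient.mk_eq_zero, ← hτ hxy]
      exact hy
    · intro x
      obtain ⟨x, rfl⟩ := Submodule.mkQ_surjective _ x
      constructor
      · intro h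
        replace h := (Submodule.Quotient.mk_eq_zero _).1 h
        obtain ⟨y, rfl⟩ := h
        exact ⟨Submodule.Quotient.mk y, rfl⟩
      · rintro ⟨y, hy⟩
        obtain ⟨y, rfl⟩ := Submodule.mkQ_surjective _ y
        rw [← hy]
        exact (Submodule.Quotient.mk_eq_zero _).2 ⟨y, rfl⟩
  obtain ⟨eb⟩ : Nonempty ((M ⧸ E.map τ) ≃ₗ[A] (E ⧸ (E.map τ).submoduleOf E) × (M ⧸ E)) := by
    refine exists_prod_equiv_of_exact
      (f := Submodule.mapQ ((E.map τ).submoduleOf E) (E.map τ) E.subtype le_rfl)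
      (g := Submodule.factor hE) ?_ (Submodule.factor_surjective _) ?_
    · rw [← LinearMap.ker_eq_bot, LinearMap.ker_eq_bot']
      intro x hx
      obtain ⟨x, rfl⟩ := Submodule.mkQ_surjective _ x
      exact (Submodule.Quotient.mk_eq_zero _).2 ((Submodule.Quotient.mk_eq_zero _).1 hx :)
    · intro x
      obtain ⟨x, rfl⟩ := Submodule.mkQ_surjective _ x
      constructor
      · intro h
        replace h := (Submodule.Quotient.mk_eq_zero _).1 h
        exact ⟨Submodule.Quotient.mk ⟨x, h⟩, rfl⟩
      · rintro ⟨y, hy⟩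
        obtain ⟨y, rfl⟩ := Submodule.mkQ_surjective _ y
        rw [← hy]
        exact (Submodule.Quotient.mk_eq_zero _).2 y.2
  have : Module.Finite A (M ⧸ E.map τ) := Module.Finite.equiv ea.symm
  have : Module.Projective A (M ⧸ E.map τ) := Module.Projective.of_equiv ea.symm
  let e := eb.symm.trans ea
  have h1 : Module.Finite A (E ⧸ (E.map τ).submoduleOf E) :=
    Module.Finite.of_surjective
      (LinearMap.fst A (E ⧸ (E.map τ).submoduleOf E) (M ⧸ E) ∘ₗ eb.toLinearMap)
      (Prod.fst_surjective.comp eb.surjective)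
  have h2 : Module.Projective A (E ⧸ (E.map τ).submoduleOf E) :=
    Module.Projective.of_split (eb.symm.toLinearMap ∘ₗ LinearMap.inl A _ _)
      (LinearMap.fst A (E ⧸ (E.map τ).submoduleOf E) (M ⧸ E) ∘ₗ eb.toLinearMap) (by ext; simp)
  refine ⟨h1, h2, ?_⟩
  have h3 := Module.rankAtStalk_eq_of_equiv e
  rw [Module.rankAtStalk_prod, Module.rankAtStalk_prod, add_comm] at h3
  exact add_left_cancel h3

theorem exists_pow_smul_sub_smul_mem {R M : Type*} [CommRing R] [AddCommGroup M] [Module R M]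
    {E L : Submodule R M} (hE : E.FG) (t g : R)
    (h : ∀ x ∈ E, ∃ N : ℕ, ∃ y ∈ E, g ^ N • x - t • y ∈ L) :
    ∃ N : ℕ, ∀ x ∈ E, ∃ y ∈ E, g ^ N • x - t • y ∈ L := by
  obtain ⟨s, hs⟩ := hE
  choose! N hN using h
  refine ⟨∑ x ∈ s, N x, fun x hx => ?_⟩
  rw [← hs] at hx
  induction hx using Submodule.span_induction with
  | zero => exact ⟨0, zero_mem _, by rw [smul_zero, smul_zero, sub_zero]; exact zero_mem _⟩
  | mem x hx =>
    obtain ⟨y, hy, hxy⟩ := hN x (hs ▸ Submodule.subset_span hx)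
    obtain ⟨c, hc⟩ := Nat.exists_eq_add_of_le (Finset.single_le_sum (f := N)
      (fun i _ => Nat.zero_le _) hx)
    refine ⟨g ^ c • y, Submodule.smul_mem _ _ hy, ?_⟩
    rw [hc, add_comm, pow_add, mul_smul, smul_comm t, ← smul_sub]
    exact Submodule.smul_mem _ _ hxy
  | add x x' _ _ hx hx' =>
    obtain ⟨y, hy, hxy⟩ := hx
    obtain ⟨y', hy', hxy'⟩ := hx'
    refine ⟨y + y', add_mem hy hy', ?_⟩
    rw [smul_add, smul_add, add_sub_add_comm]
    exact add_mem hxy hxy'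
  | smul r x _ hx =>
    obtain ⟨y, hy, hxy⟩ := hx
    refine ⟨r • y, Submodule.smul_mem _ _ hy, ?_⟩
    rw [smul_comm, smul_comm t, ← smul_sub]
    exact Submodule.smul_mem _ _ hxy

/-- A form of Nakayama's lemma: if `g E ⊆ t E + L`, then the Cayley-Hamilton theorem for `g` on
`(E + L) / L` gives an element `f` congruent to a power of `g` modulo `t` such that `f E ⊆ L`. -/
theorem exists_smul_le_of_pow_smul_le {R M : Type*} [CommRing R] [AddCommGroup M] [Module R M]
    {E L : Submodule R M} (hE : E.FG) (t g : R) (h : ∀ x ∈ E, ∃ y ∈ E, g • x - t • y ∈ L) :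
    ∃ (f w : R) (n : ℕ), f = g ^ n + t * w ∧ ∀ x ∈ E, f • x ∈ L := by
  let K := E.map L.mkQ
  have hfin : Module.Finite R K := Module.Finite.iff_fg.2 (hE.map _)
  obtain ⟨p, hp, -, hc, h0⟩ :=
    LinearMap.exists_monic_and_natDegree_eq_and_coeff_mem_pow_and_aeval_eq_zero
    (M := K) R (algebraMap R (Module.End R K) g) (Ideal.span {t}) (by
      rintro _ ⟨⟨_, x, hx, rfl⟩, rfl⟩
      obtain ⟨y, hy, hxy⟩ := h x hx
      have : algebraMap R (Module.End R K) g ⟨L.mkQ x, x, hx, rfl⟩ = t • ⟨L.mkQ y, y, hy, rfl⟩ := by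
        apply Subtype.ext
        change g • L.mkQ x = t • L.mkQ y
        rw [← map_smul, ← map_smul, ← sub_eq_zero, ← map_sub]
        exact (Submodule.Quotient.mk_eq_zero _).2 hxy
      rw [this]
      exact Submodule.smul_mem_smul (Ideal.mem_span_singleton_self t) trivial)
  have h1 : t ∣ p.eval g - g ^ p.natDegree := by
    rw [Polynomial.eval_eq_sum_range, Finset.sum_range_succ, hp.coeff_natDegree, one_mul,
      add_sub_cancel_right]
    refine Finset.dvd_sum fun i hi => Dvd.dvd.mul_right ?_ _
    have := hc i
    rw [Ideal.span_singleton_pow, Ideal.mem_span_singleton] at this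
    exact (dvd_pow_self t (by have := Finset.mem_range.1 hi; omega)).trans this
  obtain ⟨w, hw⟩ := h1
  refine ⟨p.eval g, w, p.natDegree, by rw [← hw]; ring, fun x hx => ?_⟩
  have h2 := congrArg (fun φ => (φ ⟨L.mkQ x, x, hx, rfl⟩ : K)) h0
  rw [Polynomial.aeval_algebraMap_apply_eq_algebraMap_eval] at h2
  have h3 := congrArg Subtype.val h2
  change p.eval g • L.mkQ x = 0 at h3
  rw [← map_smul] at h3
  exact (Submodule.Quotient.mk_eq_zero _).1 h3

end

/-! ### Local bases of lattices -/

section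
variable {k : Type u} [Field k]
  {A B : Type u} [CommRing A] [Algebra k A] [CommRing B] [Algebra k B]
  {O : Type u} [CommRing O] [Algebra k O] [Algebra k⟦X⟧ O] [IsScalarTower k k⟦X⟧ O] {b : ℕ}
  {δ : ℚ} {d : ℕ}

attribute [local instance] coverAlgebra

/-- `F = O / t^b O` is a finite-dimensional vector space. -/
theorem finite_modT (o : Module.Basis (Fin d) k⟦X⟧ O) (b : ℕ) : Module.Finite k (ModT k O b) := by
  let v : Fin d × Fin b → ModT k O b := fun i =>
    Ideal.Quotient.mk (Ideal.span {algebraMap k⟦X⟧ O PowerSeries.X ^ b}) ((PowerSeries.X : k⟦X⟧) ^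
      (i.2 : ℕ) • o i.1)
  refine ⟨Submodule.fg_def.2 ⟨Set.range v, Set.finite_range v, ?_⟩⟩
  rw [eq_top_iff]
  rintro x -
  obtain ⟨x, rfl⟩ := Ideal.Quotient.mk_surjective x
  rw [← o.sum_repr x, map_sum]
  refine Submodule.sum_mem _ fun i _ => ?_
  obtain ⟨w, hw⟩ : (PowerSeries.X : k⟦X⟧) ^ b ∣ o.repr x i -
      ∑ j ∈ Finset.range b, PowerSeries.coeff j (o.repr x i) • PowerSeries.X ^ j := by
    rw [PowerSeries.X_pow_dvd_iff]
    intro m hm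
    rw [map_sub, map_sum]
    simp only [map_smul, PowerSeries.coeff_X_pow, smul_eq_mul, mul_ite, mul_one, mul_zero]
    rw [Finset.sum_ite_eq, if_pos (Finset.mem_range.2 hm), sub_self]
  rw [eq_add_of_sub_eq hw, add_smul, map_add]
  refine add_mem ?_ ?_
  · have : Ideal.Quotient.mk (Ideal.span {algebraMap k⟦X⟧ O PowerSeries.X ^ b})
        ((PowerSeries.X ^ b * w) • o i) = 0 := by
      rw [Ideal.Quotient.eq_zero_iff_mem, Ideal.mem_span_singleton, Algebra.smul_def, map_mul,
        map_pow, mul_assoc]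
      exact dvd_mul_right _ _
    rw [this]
    exact zero_mem _
  · rw [Finset.sum_smul, map_sum]
    refine Submodule.sum_mem _ fun j hj => ?_
    rw [smul_assoc]
    exact Submodule.smul_mem _ _ (Submodule.subset_span
      (Set.mem_range_self (f := v) (i, ⟨j, Finset.mem_range.1 hj⟩)))

variable {S : Submodule A (A ⊗[k] ModT k O b)}

theorem liftSub_fg (o : Module.Basis (Fin d) k⟦X⟧ O) (hS : Stable (scalars O b) S) (h : S.FG) :
    (liftSub S hS).FG := by
  classical
  obtain ⟨s, hs⟩ := h
  obtain ⟨m, hm⟩ := exists_basis_cover (A := A) o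
  choose l hl using projF_surjective (k := k) (A := A) (O := O) b
  refine ⟨s.image l ∪ Finset.univ.image fun i => tR k A ^ b • m i, ?_⟩
  apply le_antisymm
  · rw [Submodule.span_le]
    intro z hz
    rcases Finset.mem_union.1 hz with h | h
    · obtain ⟨y, hy, rfl⟩ := Finset.mem_image.1 h
      change projF k O b A (l y) ∈ S
      rw [hl, ← hs]
      exact Submodule.subset_span hy
    · obtain ⟨i, -, rfl⟩ := Finset.mem_image.1 h
      exact tR_pow_smul_mem_liftSub _
  · set L := Submodule.span (A ⊗[k] k⟦X⟧)
      ((s.image l ∪ Finset.univ.image fun i => tR k A ^ b • m i : Finset (A ⊗[k] O)) :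
        Set (A ⊗[k] O)) with hL
    have key : ∀ y ∈ S, ∃ z ∈ L, projF k O b A z = y := by
      intro y hy
      rw [← hs] at hy
      induction hy using Submodule.span_induction with
      | zero => exact ⟨0, zero_mem _, map_zero _⟩
      | mem y hy =>
        exact ⟨l y, Submodule.subset_span (Finset.mem_union_left _
          (Finset.mem_image_of_mem _ hy)), hl y⟩
      | add y y' _ _ hy hy' =>
        obtain ⟨z, hz, rfl⟩ := hy
        obtain ⟨z', hz', rfl⟩ := hy'
        exact ⟨z + z', add_mem hz hz', map_add _ _ _⟩
      | smul r y _ hy =>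
        obtain ⟨z, hz, rfl⟩ := hy
        refine ⟨algebraMap A (A ⊗[k] k⟦X⟧) r • z, Submodule.smul_mem _ _ hz, ?_⟩
        rw [algebraMap_cover_smul, map_smul]
    intro z hz
    obtain ⟨z', hz', h⟩ := key _ hz
    obtain ⟨w, hw⟩ := (projF_eq_zero_iff b (z - z')).1 (by rw [map_sub, h, sub_self])
    rw [← sub_add_cancel z z']
    refine add_mem ?_ hz'
    rw [hw, ← tR_pow_smul, ← m.sum_repr w, cover_smul_def, Finset.mul_sum]
    refine Submodule.sum_mem _ fun i _ => ?_
    rw [← cover_smul_def, smul_comm]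
    exact Submodule.smul_mem _ _ (Submodule.subset_span (Finset.mem_union_right _
      (Finset.mem_image_of_mem _ (Finset.mem_univ i))))

theorem tM_mul_injective (o : Module.Basis (Fin d) k⟦X⟧ O) :
    Function.Injective (LinearMap.mulLeft A (tM k A O)) := by
  obtain ⟨m, hm⟩ := exists_basis_cover (A := A) o
  intro x y hxy
  apply m.repr.injective
  ext i
  have h := congrArg (fun z => m.repr z i) hxy
  have h2 : ∀ z, LinearMap.mulLeft A (tM k A O) z = tR k A • z := fun z => by
    rw [LinearMap.mulLeft_apply, ← pow_one (tM k A O), ← tR_pow_smul, pow_one]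
  simp only [h2, map_smul, Finsupp.smul_apply, smul_eq_mul] at h
  refine tR_pow_mul_injective 1 ?_
  change tR k A ^ 1 * _ = tR k A ^ 1 * _
  rwa [pow_one]

theorem exists_quotient_tM_equiv (o : Module.Basis (Fin d) k⟦X⟧ O) :
    Nonempty (((A ⊗[k] O) ⧸ LinearMap.range (LinearMap.mulLeft A (tM k A O))) ≃ₗ[A]
      (Fin d → A)) := by
  obtain ⟨m, hm⟩ := exists_basis_cover (A := A) o
  let φ : A ⊗[k] O →ₗ[A] Fin d → A :=
    { toFun := fun z i => constR k A (m.repr z i)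
      map_add' := fun z w => by
        ext i
        rw [map_add, Finsupp.add_apply, map_add]
        rfl
      map_smul' := fun r z => by
        ext i
        rw [← algebraMap_cover_smul, map_smul, Finsupp.smul_apply, smul_eq_mul, map_mul,
          constR_algebraMap]
        rfl }
  have hsurj : Function.Surjective φ := by
    intro c
    refine ⟨∑ i, algebraMap A (A ⊗[k] k⟦X⟧) (c i) • m i, ?_⟩
    ext j
    change constR k A (m.repr (∑ i, algebraMap A (A ⊗[k] k⟦X⟧) (c i) • m i) j) = c j
    rw [m.repr_sum_self, constR_algebraMap]
  have hker : LinearMap.range (LinearMap.mulLeft A (tM k A O)) = LinearMap.ker φ := by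
    ext z
    have h2 : ∀ w, LinearMap.mulLeft A (tM k A O) w = tR k A • w := fun w => by
      rw [LinearMap.mulLeft_apply, ← pow_one (tM k A O), ← tR_pow_smul, pow_one]
    constructor
    · rintro ⟨w, rfl⟩
      rw [h2, LinearMap.mem_ker]
      ext i
      change constR k A (m.repr (tR k A • w) i) = 0
      rw [map_smul, Finsupp.smul_apply, constR_eq_zero_iff]
      exact dvd_mul_right _ _
    · intro h
      choose w hw using fun i => (constR_eq_zero_iff (k := k) (m.repr z i)).1 (congrFun h i)
      refine ⟨∑ i, w i • m i, ?_⟩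
      rw [h2, cover_smul_def, Finset.mul_sum]
      conv_rhs => rw [← m.sum_repr z]
      refine Finset.sum_congr rfl fun i _ => ?_
      rw [hw, mul_smul, cover_smul_def (tR k A)]
  exact ⟨(Submodule.quotEquivOfEq _ _ hker).trans (φ.quotKerEquivOfSurjective hsurj)⟩

/-- The lattice of `S` is locally free of rank `d` near the points with `t = 0`: generators of `E
/ t E`, which is locally free of rank `d` over `A`, lift to a local basis of `E`. -/
theorem IsQuotSub.exists_locBasis (h : IsQuotSub (scalars O b) δ S)
    (o : Module.Basis (Fin d) k⟦X⟧ O) (p : PrimeSpectrum A) :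
    ∃ g ∉ p.asIdeal, ∃ (f : A ⊗[k] k⟦X⟧) (e : Fin d → A ⊗[k] O) (n : ℕ),
      LocBasis (liftSub S h.stable) f e ∧ constR k A f = g ^ n := by
  have := finite_modT o b
  have := h.finite
  have := h.projective
  have : Nontrivial A := p.nontrivial
  let π : A ⊗[k] O →ₗ[A] A ⊗[k] ModT k O b ⧸ S := S.mkQ ∘ₗ (projF k O b A).toLinearMap
  have hπ : Function.Surjective π := (Submodule.mkQ_surjective _).comp (projF_surjective b)
  let E := LinearMap.ker π
  have hmemE : ∀ z, z ∈ E ↔ z ∈ liftSub S h.stable := fun z => Submodule.Quotient.mk_eq_zero _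
  let τ := LinearMap.mulLeft A (tM k A O)
  have hτ1 : ∀ w, τ w = tR k A • w := fun w => by
    rw [LinearMap.mulLeft_apply, ← pow_one (tM k A O), ← tR_pow_smul, pow_one]
  have hE : E.map τ ≤ E := by
    rintro _ ⟨z, hz, rfl⟩
    rw [hτ1, hmemE]
    exact Submodule.smul_mem _ _ ((hmemE z).1 hz)
  obtain ⟨ε⟩ := exists_quotient_tM_equiv (A := A) o
  have : Module.Finite A ((A ⊗[k] O) ⧸ E) :=
    Module.Finite.equiv (π.quotKerEquivOfSurjective hπ).symm
  have : Module.Projective A ((A ⊗[k] O) ⧸ E) :=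
    Module.Projective.of_equiv (π.quotKerEquivOfSurjective hπ).symm
  have : Module.Finite A ((A ⊗[k] O) ⧸ LinearMap.range τ) := Module.Finite.equiv ε.symm
  have : Module.Projective A ((A ⊗[k] O) ⧸ LinearMap.range τ) := Module.Projective.of_equiv ε.symm
  obtain ⟨h1, h2, h3⟩ := projective_quotient_map (tM_mul_injective (A := A) o) hE
  replace h3 := h3.trans ((Module.rankAtStalk_eq_of_equiv ε).trans
    (Module.rankAtStalk_eq_finrank_of_free (R := A) (M := Fin d → A)))
  rw [Module.finrank_fin_fun] at h3
  obtain ⟨n, q, hq⟩ := Module.Finite.exists_fin (R := A) (M := E ⧸ (E.map τ).submoduleOf E)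
  obtain ⟨w, g, hg, hspan, -⟩ := exists_notMem_of_rankAtStalk q hq p
  revert w
  rw [h3, Pi.natCast_apply, Nat.cast_id]
  intro w hspan
  -- Lift a local basis of `E / t E` to `E`. After multiplication by a power of `g`, every
  -- element of `E` is a combination of the lifts plus an element of `t E`.
  choose e he using fun i => Submodule.mkQ_surjective ((E.map τ).submoduleOf E) (q (w i))
  let e' : Fin d → A ⊗[k] O := fun i => e i
  let L := Submodule.span (A ⊗[k] k⟦X⟧) (Set.range e')
  have key : ∀ x ∈ liftSub S h.stable, ∃ N : ℕ, ∃ y ∈ liftSub S h.stable,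
      algebraMap A (A ⊗[k] k⟦X⟧) g ^ N • x - tR k A • y ∈ L := by
    intro x hx
    obtain ⟨N, c, hc⟩ := hspan (Submodule.Quotient.mk ⟨x, (hmemE x).2 hx⟩)
    simp only [← he, ← map_smul, ← map_sum] at hc
    obtain ⟨y, hy, hxy⟩ := (Submodule.Quotient.eq _).1 hc
    refine ⟨N, y, (hmemE y).1 hy, ?_⟩
    rw [hτ1] at hxy
    rw [hxy, ← map_pow, algebraMap_cover_smul]
    have : (Submodule.subtype E) (g ^ N • ⟨x, (hmemE x).2 hx⟩ - ∑ i, c i • e i) =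
      g ^ N • x - ∑ i, c i • e' i := by
      rw [map_sub, map_smul, map_sum]
      rfl
    rw [this, sub_sub_cancel]
    refine Submodule.sum_mem _ fun i _ => ?_
    rw [← algebraMap_cover_smul]
    exact Submodule.smul_mem _ _ (Submodule.subset_span ⟨i, rfl⟩)
  have hfp : Module.FinitePresentation A (A ⊗[k] ModT k O b ⧸ S) :=
    Module.finitePresentation_of_projective A _
  have hSfg : S.FG := by
    have := Module.FinitePresentation.fg_ker S.mkQ (Submodule.mkQ_surjective S)
    rwa [Submodule.ker_mkQ] at this
  -- Since `E` is finitely generated, one power of `g` suffices, and Nakayama's lemma applies.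
  have hfg := liftSub_fg o h.stable hSfg
  obtain ⟨N, hN⟩ : ∃ N : ℕ, ∀ x ∈ liftSub S h.stable, ∃ y ∈ liftSub S h.stable,
      algebraMap A (A ⊗[k] k⟦X⟧) g ^ N • x - tR k A • y ∈ L :=
    exists_pow_smul_sub_smul_mem hfg _ _ key
  obtain ⟨f, c, n', hf, hfL⟩ := exists_smul_le_of_pow_smul_le hfg _ _ hN
  refine ⟨g, hg, f, e', N * n', ⟨fun i => (hmemE _).1 (e i).2, fun x hx => ⟨1, ?_⟩⟩, ?_⟩
  · rw [pow_one]
    exact hfL x hx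
  · rw [hf, map_add, map_mul, (constR_eq_zero_iff (tR k A)).2 dvd_rfl, zero_mul, add_zero,
      ← pow_mul, map_pow, constR_algebraMap]

end

/-! ### The branch condition after base change -/

section
variable {R M : Type*} [CommRing R] [CommRing M] [Algebra R M] {d : ℕ} {E : Submodule R M}

/-- Where `t` is invertible, `E` agrees with `M`. -/
theorem locBasis_smul_basis (m : Module.Basis (Fin d) R M) {t : R} {b : ℕ}
    (hs : ∀ i, t ^ b • m i ∈ E) : LocBasis E t fun i => t ^ b • m i := by
  refine ⟨hs, fun x _ => ⟨b, ?_⟩⟩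
  rw [← m.sum_repr x, Finset.smul_sum]
  refine Submodule.sum_mem _ fun i _ => ?_
  rw [smul_comm]
  exact Submodule.smul_mem _ _ (Submodule.subset_span ⟨i, rfl⟩)

/-- The discriminant of a local basis divides a power of `t` which does not depend on `E`. -/
theorem LocBasis.exists_discr_mul_eq {f t : R} {e : Fin d → M} (he : LocBasis E f e)
    (m : Module.Basis (Fin d) R M) {a b : ℕ} (hs : ∀ i, t ^ b • m i ∈ E)
    (ha : Algebra.discr R m ∣ t ^ a) :
    ∃ (g : R) (N : ℕ), Algebra.discr R e * g = f ^ N * t ^ (2 * b * d + a + b) := by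
  obtain ⟨P, N, n, hP, -, -, hdet⟩ := he.exists_mul_eq m hs
  obtain ⟨w, hw⟩ := ha
  -- With `discr e = det P ^ 2 * discr m`, `det N * det P = (f^n t^b)^d` and `discr m * w = t^a`,
  -- this cofactor gives the exponent `2 b d + a` of `t`; the further factor `t^b` allows to
  -- compare with divisors of `t^b`.
  refine ⟨t ^ b * w * N.det ^ 2, 2 * n * d, ?_⟩
  rw [discr_eq_of_matrix hP]
  calc _ = (N.det * P.det) ^ 2 * (Algebra.discr R m * w) * t ^ b := by ring
    _ = _ := by rw [hdet, ← hw]; ring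

/-- The condition that the discriminant divides `t^b`, expressed by the cofactor `g` of the
discriminant in a higher power of `t`. -/
theorem hasLocDiscr_iff_dvd {f t g : R} {e : Fin d → M} (he : LocBasis E f e)
    (m : Module.Basis (Fin d) R M) {a b N : ℕ} (hs : ∀ i, t ^ b • m i ∈ E)
    (ha : Algebra.discr R m ∣ t ^ a) (ht : ∀ (n : ℕ) (x y : R), t ^ n * x = t ^ n * y → x = y)
    (hf : ∀ y : PrimeSpectrum R, t ∈ y.asIdeal → f ∉ y.asIdeal)
    (hg : Algebra.discr R e * g = f ^ N * t ^ (2 * b * d + a + b)) :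
    HasLocDiscr E d (t ^ b) False ↔ t ^ (2 * b * d + a) ∣ g := by
  constructor
  · intro h
    rw [← Ideal.mem_span_singleton]
    refine mem_of_forall_prime fun y => ?_
    by_cases hy : t ∈ y.asIdeal
    · obtain ⟨f', hf', e', he', n, ⟨q, hq⟩, -⟩ := h y
      obtain ⟨n', q', hn'⟩ := he.discr_dvd he'.mem
      refine ⟨f ^ n' * f' ^ n, fun h => ?_, ?_⟩
      · rcases y.2.mem_or_mem h with h | h
        · exact hf y hy (y.2.mem_of_pow_mem _ h)
        · exact hf' (y.2.mem_of_pow_mem _ h)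
      · rw [Ideal.mem_span_singleton]
        refine ⟨f ^ N * q' * q, ht b _ _ ?_⟩
        rw [smul_eq_mul]
        calc _ = f ^ n' * (f' ^ n * t ^ b) * g := by ring
          _ = f ^ n' * Algebra.discr R e' * q * g := by rw [hq]; ring
          _ = (Algebra.discr R e * g) * q' * q := by rw [hn']; ring
          _ = _ := by rw [hg]; ring
    · exact ⟨t ^ (2 * b * d + a), fun h => hy (y.2.mem_of_pow_mem _ h),
        Ideal.mem_span_singleton.2 (dvd_mul_right _ _)⟩
  · rintro ⟨q, rfl⟩ y
    by_cases hy : t ∈ y.asIdeal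
    · refine ⟨f, hf y hy, e, he, N, ⟨q, ht (2 * b * d + a) _ _ ?_⟩, False.elim⟩
      linear_combination -hg
    -- Where `t` is invertible, use the basis `t^b m`, of discriminant `t^(2 b d) * discr m`.
    · refine ⟨t, hy, _, locBasis_smul_basis m hs, 2 * b * d + a, ?_, False.elim⟩
      rw [discr_smul]
      refine Dvd.dvd.mul_right ?_ _
      rw [pow_add]
      refine mul_dvd_mul (dvd_of_eq ?_) ha
      ring

end

section
variable {k : Type u} [Field k]
  {A B : Type u} [CommRing A] [Algebra k A] [CommRing B] [Algebra k B]
  {O : Type u} [CommRing O] [Algebra k O] [Algebra k⟦X⟧ O] [IsScalarTower k k⟦X⟧ O] {b : ℕ}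
  {δ : ℚ} {d a : ℕ} {S : Submodule A (A ⊗[k] ModT k O b)}

attribute [local instance] coverAlgebra

theorem discr_cover_dvd (o : Module.Basis (Fin d) k⟦X⟧ O)
    (ha : Associated (Algebra.discr k⟦X⟧ o) (PowerSeries.X ^ a))
    {m : Module.Basis (Fin d) (A ⊗[k] k⟦X⟧) (A ⊗[k] O)} (hm : ∀ i, m i = 1 ⊗ₜ o i) :
    Algebra.discr (A ⊗[k] k⟦X⟧) m ∣ tR k A ^ a := by
  rw [discr_cover o m hm, tR_pow]
  exact map_dvd (Algebra.TensorProduct.includeRight : k⟦X⟧ →ₐ[k] A ⊗[k] k⟦X⟧) ha.dvd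

theorem notMem_of_isUnit_constR {f : A ⊗[k] k⟦X⟧} (hf : IsUnit (constR k A f))
    (y : PrimeSpectrum (A ⊗[k] k⟦X⟧)) (hy : tR k A ∈ y.asIdeal) : f ∉ y.asIdeal := by
  obtain ⟨p, rfl⟩ := exists_eq_zeroPt hy
  exact fun h => p.2.ne_top (Ideal.eq_top_of_isUnit_mem _ (mem_zeroPt.1 h) hf)

/-- After every base change over which `f` becomes invertible at `t = 0`, the branch condition is
the vanishing of finitely many coefficients of the cofactor `g`, which is defined before the base
change. -/
theorem LocBasis.hasLocDiscr_bcSub_iff {hS : Stable (scalars O b) S} {f : A ⊗[k] k⟦X⟧}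
    {e : Fin d → A ⊗[k] O} (he : LocBasis (liftSub S hS) f e) (o : Module.Basis (Fin d) k⟦X⟧ O)
    (ha : Associated (Algebra.discr k⟦X⟧ o) (PowerSeries.X ^ a)) {g : A ⊗[k] k⟦X⟧} {N : ℕ}
    (hg : Algebra.discr (A ⊗[k] k⟦X⟧) e * g = f ^ N * tR k A ^ (2 * b * d + a + b))
    (φ : A →ₐ[k] B) (hu : IsUnit (φ (constR k A f))) (hS' : Stable (scalars O b) (bcSub φ S)) :
    HasLocDiscr (liftSub (bcSub φ S) hS') d (tR k B ^ b) False ↔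
      ∀ j < 2 * b * d + a, φ (PowerSeries.coeff j (toPS k A g)) = 0 := by
  obtain ⟨m, hm⟩ := exists_basis_cover (A := B) o
  rw [hasLocDiscr_iff_dvd (he.bcO φ hS') m (a := a) (N := N) (g := bcR φ g)
    (fun i => tR_pow_smul_mem_liftSub _) (discr_cover_dvd o ha hm)
    (fun n x y h => tR_pow_mul_injective n h)
    (notMem_of_isUnit_constR (by rw [bcR, constR_map]; exact hu)) ?_, tR_pow_dvd_iff]
  · refine forall₂_congr fun j _ => ?_
    rw [bcR, toPS_map, PowerSeries.coeff_map]
    rfl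
  · have h := congrArg (bcR φ) hg
    rwa [map_mul, map_mul, map_pow, map_pow, bcR_tR, ← discr_bcO o] at h

variable (d) in
/-- The conditions defining `Y`, for a submodule `S` of `A ⊗ F`: it is a subalgebra which is
stable under `k⟦t⟧`, and `t^b` annihilates the cokernel of the discriminant section of its
lattice. -/
structure IsCrimpSub (S : Submodule A (A ⊗[k] ModT k O b)) : Prop where
  stable : Stable (scalars O b) S
  one_mem : 1 ∈ S
  mul_mem : ∀ s ∈ S, ∀ s' ∈ S, s * s' ∈ S
  discr : HasLocDiscr (liftSub S stable) d (tR k A ^ b) False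

theorem bcMap_mul (φ : A →ₐ[k] B) (s s' : A ⊗[k] ModT k O b) :
    bcMap (ModT k O b) φ (s * s') = bcMap (ModT k O b) φ s * bcMap (ModT k O b) φ s' :=
  map_mul (Algebra.TensorProduct.map φ (AlgHom.id k (ModT k O b))) s s'

theorem bcMap_one (φ : A →ₐ[k] B) : bcMap (ModT k O b) φ 1 = 1 :=
  map_one (Algebra.TensorProduct.map φ (AlgHom.id k (ModT k O b)))

end

/-! ### Equations for the branch condition -/

section
variable {k : Type u} [Field k]
  {A B : Type u} [CommRing A] [Algebra k A] [CommRing B] [Algebra k B]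
  {O : Type u} [CommRing O] [Algebra k O] [Algebra k⟦X⟧ O] [IsScalarTower k k⟦X⟧ O] {b : ℕ}
  {δ : ℚ} {d a : ℕ} {S : Submodule A (A ⊗[k] ModT k O b)}

attribute [local instance] coverAlgebra

theorem mul_mem_span_iff {A F : Type*} [CommRing A] [CommRing F] [Algebra A F] {ι : Type*}
    (u : ι → F) : (∀ s ∈ Submodule.span A (Set.range u), ∀ s' ∈ Submodule.span A (Set.range u),
      s * s' ∈ Submodule.span A (Set.range u)) ↔
      ∀ i i', u i * u i' ∈ Submodule.span A (Set.range u) := by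
  refine ⟨fun h i i' => h _ (Submodule.subset_span ⟨i, rfl⟩) _ (Submodule.subset_span ⟨i', rfl⟩),
    fun h s hs s' hs' => ?_⟩
  have h1 := Submodule.mul_mem_mul hs hs'
  rw [Submodule.span_mul_span] at h1
  refine Submodule.span_le.2 ?_ h1
  rintro _ ⟨_, ⟨i, rfl⟩, _, ⟨i', rfl⟩, rfl⟩
  exact h i i'

/-- If the lattice of `S` has a local basis near `t = 0`, then the conditions defining `Y` are the
vanishing of an ideal of `A`. Its generators are the values at `1` and at products of generators
of `S` of the map with kernel `S`, together with coefficients of the cofactor of the discriminant.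
-/
theorem exists_ideal_isCrimpSub {ι : Type} [Fintype ι] (v : Module.Basis ι k (ModT k O b))
    {m : ℕ} {r : Fin m → ι → A} {w : Fin m → Option ι} (hr : IsNorm r w)
    (hS : Stable (scalars O b) S) (hker : S = LinearMap.ker (chartLin v r))
    {f : A ⊗[k] k⟦X⟧} {e : Fin d → A ⊗[k] O} (he : LocBasis (liftSub S hS) f e)
    (hu : IsUnit (constR k A f)) (o : Module.Basis (Fin d) k⟦X⟧ O)
    (ha : Associated (Algebra.discr k⟦X⟧ o) (PowerSeries.X ^ a)) :
    ∃ I : Ideal A, ∀ (B : Type u) [CommRing B] [Algebra k B] (φ : A →ₐ[k] B),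
      IsCrimpSub d (bcSub φ S) ↔ I ≤ RingHom.ker φ := by
  obtain ⟨m₀, hm₀⟩ := exists_basis_cover (A := A) o
  obtain ⟨g, N, hg⟩ := he.exists_discr_mul_eq m₀ (fun i => tR_pow_smul_mem_liftSub _)
    (discr_cover_dvd o ha hm₀)
  refine ⟨Ideal.span (Set.range (chartLin v r 1) ∪ Set.range
    (fun i : (ι × ι) × Fin m => chartLin v r (kerGen v r w i.1.1 * kerGen v r w i.1.2) i.2) ∪
    (fun j => PowerSeries.coeff j (toPS k A g)) '' {j | j < 2 * b * d + a}), ?_⟩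
  intro B _ _ φ
  have hS' := hS.map φ
  have hB : bcSub φ S = LinearMap.ker (chartLin v fun a i => φ (r a i)) := by
    rw [hker, bcSub_ker_chartLin v hr]
  -- Membership of elements defined over `A` is the vanishing of their coordinates under
  -- `chartLin`.
  have hmem : ∀ z, bcMap (ModT k O b) φ z ∈ bcSub φ S ↔ ∀ a, φ (chartLin v r z a) = 0 := by
    intro z
    rw [hB, LinearMap.mem_ker, funext_iff]
    refine forall_congr' fun a => ?_
    rw [chartLin_bcMap]
    rfl
  have hdisc := he.hasLocDiscr_bcSub_iff o ha hg φ (hu.map φ) hS'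
  have hmul := mul_mem_span_iff (A := B) (kerGen v (fun a i => φ (r a i)) w)
  rw [← ker_chartLin_eq_span v (hr.map φ), ← hB] at hmul
  rw [Ideal.span_le, Set.union_subset_iff, Set.union_subset_iff]
  have h1 : Set.range (chartLin v r 1) ⊆ (RingHom.ker φ : Set A) ↔ 1 ∈ bcSub φ S := by
    rw [← bcMap_one φ, hmem, Set.range_subset_iff]
    rfl
  have h2 : (Set.range (fun i : (ι × ι) × Fin m =>
      chartLin v r (kerGen v r w i.1.1 * kerGen v r w i.1.2) i.2) ⊆ (RingHom.ker φ : Set A)) ↔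
      ∀ s ∈ bcSub φ S, ∀ s' ∈ bcSub φ S, s * s' ∈ bcSub φ S := by
    rw [hmul, Set.range_subset_iff]
    simp only [← bcMap_kerGen, ← bcMap_mul, hmem]
    exact ⟨fun h i i' a => h ((i, i'), a), fun h i => h i.1.1 i.1.2 i.2⟩
  have h3 : ((fun j => PowerSeries.coeff j (toPS k A g)) '' {j | j < 2 * b * d + a} ⊆
      (RingHom.ker φ : Set A)) ↔
      HasLocDiscr (liftSub (bcSub φ S) hS') d (tR k B ^ b) False := by
    rw [hdisc, Set.image_subset_iff]
    rfl
  rw [h1, h2, h3]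
  exact ⟨fun h => ⟨⟨h.one_mem, h.mul_mem⟩, h.discr⟩, fun h => ⟨hS', h.1.1, h.1.2, h.2⟩⟩

/-- The conditions defining `Y` are local on `Spec A`. -/
theorem isCrimpSub_of_forall_prime (h : IsQuotSub (scalars O b) δ S)
    (o : Module.Basis (Fin d) k⟦X⟧ O)
    (ha : Associated (Algebra.discr k⟦X⟧ o) (PowerSeries.X ^ a))
    (hloc : ∀ p : PrimeSpectrum A, ∃ g ∉ p.asIdeal, ∀ g', g ∣ g' →
      IsCrimpSub d (bcSub (locHom k g') S)) : IsCrimpSub d S where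
  stable := h.stable
  one_mem := by
    refine mem_iff_forall_prime.2 fun p => ?_
    obtain ⟨g, hg, h⟩ := hloc p
    exact ⟨g, hg, bcMap_one (k := k) (O := O) (b := b) (locHom k g) ▸ (h g dvd_rfl).one_mem⟩
  mul_mem s hs s' hs' := by
    refine mem_iff_forall_prime.2 fun p => ?_
    obtain ⟨g, hg, h⟩ := hloc p
    refine ⟨g, hg, ?_⟩
    rw [bcMap_mul]
    exact (h g dvd_rfl).mul_mem _ (bcMap_mem_bcSub _ hs) _ (bcMap_mem_bcSub _ hs')
  discr := by
    intro y
    obtain ⟨m, hm⟩ := exists_basis_cover (A := A) o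
    by_cases hy : tR k A ∈ y.asIdeal
    · obtain ⟨p, rfl⟩ := exists_eq_zeroPt hy
      obtain ⟨g₁, hg₁, f, e, n, he, hf⟩ := h.exists_locBasis o p
      obtain ⟨g₂, hg₂, h2⟩ := hloc p
      obtain ⟨g₀, N, hg₀⟩ := he.exists_discr_mul_eq m (fun i => tR_pow_smul_mem_liftSub _)
        (discr_cover_dvd o ha hm)
      have h3 := h2 (g₂ * g₁) (dvd_mul_right _ _)
      have hu : IsUnit (locHom k (g₂ * g₁) (constR k A f)) := by
        rw [hf, map_pow]
        exact (isUnit_locHom_of_dvd (dvd_mul_left _ _)).pow n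
      have h4 := (he.hasLocDiscr_bcSub_iff o ha hg₀ _ hu h3.stable).1 h3.discr
      -- Near `p`, the coefficients of the cofactor vanish after localization, hence after
      -- multiplication by a power of the denominator.
      have h5 : ∃ M : ℕ, ∀ j : Fin (2 * b * d + a),
          (g₂ * g₁) ^ M • PowerSeries.coeff j (toPS k A g₀) ∈ (⊥ : Submodule A A) := by
        refine exists_pow_smul_mem_span fun j => ?_
        have := h4 j j.2
        rw [← map_zero (locHom k (g₂ * g₁))] at this
        obtain ⟨⟨_, M, rfl⟩, hM⟩ := (IsLocalization.eq_iff_exists (Submonoid.powers (g₂ * g₁))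
          (Localization.Away (g₂ * g₁))).1 this
        exact ⟨M, (Submodule.mem_bot _).2 (hM.trans (mul_zero _))⟩
      obtain ⟨M, hM⟩ := h5
      have hg : g₂ * g₁ ∉ p.asIdeal := notMem_mul hg₂ hg₁
      obtain ⟨q, hq⟩ := (tR_pow_dvd_iff (2 * b * d + a)
        (algebraMap A _ ((g₂ * g₁) ^ M) * g₀)).2 fun j hj => by
        rw [map_mul, (toPS k A).commutes, PowerSeries.algebraMap_apply, PowerSeries.coeff_C_mul]
        exact (Submodule.mem_bot _).1 (hM ⟨j, hj⟩)
      rw [map_pow] at hq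
      have hf' : f * algebraMap A (A ⊗[k] k⟦X⟧) (g₂ * g₁) ∉ (zeroPt k p).asIdeal := by
        rw [mem_zeroPt, map_mul, constR_algebraMap, hf]
        exact notMem_mul (fun h => hg₁ (p.2.mem_of_pow_mem _ h)) hg
      refine ⟨_, hf', e, he.of_dvd (dvd_mul_right _ _), N + M,
        ⟨f ^ M * algebraMap A (A ⊗[k] k⟦X⟧) (g₂ * g₁) ^ N * q,
          tR_pow_mul_injective (2 * b * d + a) ?_⟩, False.elim⟩
      change tR k A ^ (2 * b * d + a) * _ = tR k A ^ (2 * b * d + a) * _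
      linear_combination
        (-(f ^ M) * algebraMap A (A ⊗[k] k⟦X⟧) (g₂ * g₁) ^ (N + M)) * hg₀ +
        (Algebra.discr (A ⊗[k] k⟦X⟧) e * f ^ M *
          algebraMap A (A ⊗[k] k⟦X⟧) (g₂ * g₁) ^ N) * hq
    -- Where `t` is invertible, use the basis `t^b m`.
    · refine ⟨tR k A, hy, _, locBasis_smul_basis m (fun i => tR_pow_smul_mem_liftSub _),
        2 * b * d + a, ?_, False.elim⟩
      rw [discr_smul]
      refine Dvd.dvd.mul_right ?_ _
      rw [pow_add]
      refine mul_dvd_mul (dvd_of_eq ?_) (discr_cover_dvd o ha hm)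
      ring

end

/-! ### The closed subscheme of crimps -/

section
variable {k : Type u} [Field k]
  {A B : Type u} [CommRing A] [Algebra k A] [CommRing B] [Algebra k B]
  {O : Type u} [CommRing O] [Algebra k O] [Algebra k⟦X⟧ O] [IsScalarTower k k⟦X⟧ O] {b : ℕ}
  {δ : ℚ} {d a : ℕ} {X : Over (Spec (CommRingCat.of k))}

attribute [local instance] coverAlgebra

theorem QuotFamily.isInY_iff_forall_isCrimpSub {T : Over (Spec (CommRingCat.of k))}
    {Q : QuotFamily O b δ T} (o : Module.Basis (Fin d) k⟦X⟧ O) :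
    Q.IsInY d ↔ ∀ (A : Type u) [CommRing A] [Algebra k A] (x : specOver k A ⟶ T),
      IsCrimpSub d (Q.S A x) := by
  rw [Q.isInY_iff o]
  constructor
  · rintro ⟨hQ, h⟩ A _ _ x
    exact ⟨(Q.isQuotSub x).stable, hQ.one_mem A x, hQ.mul_mem A x, h A x⟩
  · intro h
    exact ⟨⟨fun A _ _ x => (h A x).mul_mem, fun A _ _ x => (h A x).one_mem⟩,
      fun A _ _ x => (h A x).discr⟩

theorem exists_specMap_locHom_eq (g : A) {p : PrimeSpectrum A} (hg : g ∉ p.asIdeal) :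
    ∃ p' : PrimeSpectrum (Localization.Away g), specMap (locHom k g) p' = p :=
  (PrimeSpectrum.localization_away_comap_range (Localization.Away g) g).ge hg

theorem isOpenImmersion_specMap_locHom (g : A) : IsOpenImmersion (specMap (locHom k g)) :=
  inferInstanceAs (IsOpenImmersion (Spec.map (CommRingCat.ofHom
    (algebraMap A (Localization.Away g)))))

/-- Near every point of `Spec A`, the conditions defining `Y` are the vanishing of an ideal. -/
theorem IsQuotSub.exists_ideal {S : Submodule A (A ⊗[k] ModT k O b)}
    (h : IsQuotSub (scalars O b) δ S) {ι : Type} [Fintype ι] (v : Module.Basis ι k (ModT k O b))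
    {m : ℕ} {r : Fin m → ι → A} {w : Fin m → Option ι} (hr : IsNorm r w)
    (hker : S = LinearMap.ker (chartLin v r)) (o : Module.Basis (Fin d) k⟦X⟧ O)
    (ha : Associated (Algebra.discr k⟦X⟧ o) (PowerSeries.X ^ a)) (p : PrimeSpectrum A) :
    ∃ g ∉ p.asIdeal, ∃ I : Ideal (Localization.Away g),
      ∀ (B : Type u) [CommRing B] [Algebra k B] (φ : Localization.Away g →ₐ[k] B),
        IsCrimpSub d (bcSub φ (bcSub (locHom k g) S)) ↔ I ≤ RingHom.ker φ := by
  obtain ⟨g, hg, f, e, n, he, hf⟩ := h.exists_locBasis o p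
  exact ⟨g, hg, exists_ideal_isCrimpSub v (hr.map (locHom k g)) (h.stable.map (locHom k g))
    (by rw [hker, bcSub_ker_chartLin v hr]) (he.bcO (locHom k g) (h.stable.map _))
    (by rw [bcR, constR_map, hf, map_pow]; exact (isUnit_locHom g).pow n) o ha⟩

/-- Every point of `X` has an affine neighbourhood on which the conditions defining `Y` are the
vanishing of an ideal. -/
theorem QuotFamily.exists_chart_ideal (F : QuotFamily O b δ X) (o : Module.Basis (Fin d) k⟦X⟧ O)
    (ha : Associated (Algebra.discr k⟦X⟧ o) (PowerSeries.X ^ a)) (q : X.left) :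
    ∃ (R : Type u) (_ : CommRing R) (_ : Algebra k R) (y : specOver k R ⟶ X) (I : Ideal R),
      IsOpenImmersion (pointHom y) ∧ q ∈ Set.range (pointHom y) ∧
      ∀ (B : Type u) [CommRing B] [Algebra k B] (φ : R →ₐ[k] B),
        IsCrimpSub d (F.S B (specOverMap φ ≫ y)) ↔ I ≤ RingHom.ker φ := by
  have := finite_modT o b
  let v := Module.finBasis k (ModT k O b)
  obtain ⟨i, p, hp⟩ := X.left.affineOpenCover.openCover.exists_eq q
  obtain ⟨alg, x, hx⟩ := exists_point _ (X.left.affineOpenCover.f i)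
  have hj : IsOpenImmersion (pointHom x) := hx ▸ X.left.affineOpenCover.map_prop i
  have hq := F.isQuotSub x
  have := hq.finite
  have := hq.projective
  obtain ⟨g, hg, w, r, hr, hker⟩ := isLocKer_of_projective (v := v) (m := ⌊δ⌋₊)
    (fun p => by rw [← hq.rank_eq p, Nat.floor_natCast]) p
  rw [← F.map_eq_bcSub] at hker
  obtain ⟨p₁, hp₁⟩ := exists_specMap_locHom_eq (k := k) g hg
  let x₁ := specOverMap (locHom k g) ≫ x
  obtain ⟨g', hg', I, hI⟩ := (F.isQuotSub x₁).exists_ideal v hr hker o ha p₁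
  obtain ⟨p₂, hp₂⟩ := exists_specMap_locHom_eq (k := k) g' hg'
  have h1 := isOpenImmersion_specMap_locHom (k := k) g
  have h2 := isOpenImmersion_specMap_locHom (k := k) g'
  have h3 : pointHom (specOverMap (locHom k g') ≫ x₁) =
    specMap (locHom k g') ≫ specMap (locHom k g) ≫ pointHom x := rfl
  refine ⟨Localization.Away g', inferInstance, inferInstance, specOverMap (locHom k g') ≫ x₁, I,
    ?_, ⟨p₂, ?_⟩, fun B _ _ φ => ?_⟩
  · rw [h3]
    infer_instance
  · exact (congrArg (pointHom x) ((congrArg (specMap (locHom k g)) hp₂).trans hp₁)).trans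
      ((congrArg (fun h : Spec (X.left.affineOpenCover.X i) ⟶ X.left => h p) hx).trans hp)
  · rw [F.map_eq_bcSub, F.map_eq_bcSub]
    exact hI B φ

/-- The conditions defining `Y` for a family over `X` are represented by a closed subscheme of
`X`. -/
theorem QuotFamily.exists_closed (F : QuotFamily O b δ X) [CompactSpace X.left]
    [QuasiSeparatedSpace X.left] (o : Module.Basis (Fin d) k⟦X⟧ O)
    (ha : Associated (Algebra.discr k⟦X⟧ o) (PowerSeries.X ^ a)) :
    ∃ (Y : Over (Spec (CommRingCat.of k))) (j : Y ⟶ X), IsClosedImmersion j.left ∧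
      ∀ {T : Over (Spec (CommRingCat.of k))} (f : T ⟶ X),
        (∃ g : T ⟶ Y, g ≫ j = f) ↔ (F.pullback f).IsInY d := by
  obtain ⟨Z, i, hi, hZ⟩ := exists_isClosedImmersion_iff_factors (X := X.left)
    (fun {T} f => ∀ (A : Type u) [CommRing A] [Algebra k A] (x : specOver k A ⟶ X)
      (j : Spec (CommRingCat.of A) ⟶ T), pointHom x = j ≫ f → IsCrimpSub d (F.S A x))
    (fun g f h A _ _ x j hx => h A x (j ≫ g) (hx.trans (Category.assoc _ _ _).symm))
    (by
      intro T 𝒰 f h A _ _ x j hx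
      refine isCrimpSub_of_forall_prime (F.isQuotSub x) o ha fun p => ?_
      obtain ⟨g, hg, i, j', hj⟩ := exists_locHom_factor (k := k) 𝒰 j p
      refine ⟨g, hg, fun g' hg' => ?_⟩
      have hu := isUnit_locHom_of_dvd (k := k) hg'
      rw [← F.map_eq_bcSub]
      refine h i _ _ (specMap (locLift (locHom k g') g hu) ≫ j') ?_
      rw [pointHom_specOverMap, hx, Category.assoc, reassoc_of% hj, ← reassoc_of% specMap_comp,
        locLift_comp])
    (by
      intro q
      obtain ⟨R, _, _, y, I, hy, hq, hI⟩ := F.exists_chart_ideal o ha q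
      refine ⟨CommRingCat.of R, pointHom y, I, hy, hq, fun B φ => ?_⟩
      let alg : Algebra k B := (φ.hom.comp (algebraMap k R)).toAlgebra
      let φ' : R →ₐ[k] B := { φ.hom with commutes' := fun r => rfl }
      have hφ : specMap φ' = Spec.map φ := rfl
      constructor
      · intro h
        exact (hI B φ').1 (h B (specOverMap φ' ≫ y) (𝟙 _) (by
          rw [Category.id_comp, pointHom_specOverMap, hφ]))
      · intro h A _ _ x j hx
        obtain ⟨f, hf, hfx⟩ := exists_algHom_of_pointHom (specOverMap φ' ≫ y) x j (by
          rw [hx, pointHom_specOverMap, hφ])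
        rw [← hfx, ← specOverMap_comp, hI]
        intro r hr
        have := h hr
        rw [RingHom.mem_ker] at this ⊢
        change f (φ.hom r) = 0
        rw [this, map_zero])
  let Y : Over (Spec (CommRingCat.of k)) := Over.mk (i ≫ X.hom)
  refine ⟨Y, Over.homMk i rfl, hi, fun {T} f => ?_⟩
  rw [QuotFamily.isInY_iff_forall_isCrimpSub o]
  have h1 : (∃ g : T ⟶ Y, g ≫ Over.homMk i rfl = f) ↔ ∃ g : T.left ⟶ Z, g ≫ i = f.left := by
    constructor
    · rintro ⟨g, rfl⟩
      exact ⟨g.left, rfl⟩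
    · rintro ⟨g, hg⟩
      refine ⟨Over.homMk g ?_, Over.OverMorphism.ext hg⟩
      change g ≫ i ≫ _ = _
      rw [reassoc_of% hg, Over.w]
  rw [h1, ← hZ]
  constructor
  · intro h A _ _ x
    exact h A (x ≫ f) (pointHom x) (pointHom_comp x f)
  · intro h A _ _ x j hx
    have hj : j ≫ T.hom = specStr k A := by
      rw [← Over.w f, ← Category.assoc, ← hx, pointHom_str]
    have : x = Over.homMk j hj ≫ f := pointHom_injective hx
    rw [this]
    exact h A _

end

/-! ### Flatness and base change of quotients -/

section

/-- The quotient of a flat module `M` by `L` is flat if `L ∩ I M = I L` for all ideals `I`. -/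
theorem flat_quotient_of_inf_le {A M : Type u} [CommRing A] [AddCommGroup M] [Module A M]
    [Module.Flat A M] {L : Submodule A M}
    (h : ∀ I : Ideal A, ∀ z ∈ L, z ∈ I • (⊤ : Submodule A M) → z ∈ I • L) :
    Module.Flat A (M ⧸ L) := by
  rw [Module.Flat.iff_rTensor_injective']
  intro I
  rw [← LinearMap.ker_eq_bot, LinearMap.ker_eq_bot']
  intro z hz
  obtain ⟨w, rfl⟩ := LinearMap.lTensor_surjective I (Submodule.mkQ_surjective L) z
  have hz' : TensorProduct.lid A _ (LinearMap.rTensor (M ⧸ L) I.subtype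
      (LinearMap.lTensor I L.mkQ w)) = 0 := by rw [hz, map_zero]
  have h1 : ∀ w : I ⊗[A] M, TensorProduct.lid A _ (LinearMap.rTensor (M ⧸ L) I.subtype
      (LinearMap.lTensor I L.mkQ w)) = L.mkQ (TensorProduct.lid A _
        (LinearMap.rTensor M I.subtype w)) := by
    intro w
    induction w with
    | zero => simp
    | add x y hx hy => simp only [map_add, hx, hy]
    | tmul a x => simp
  rw [h1] at hz'
  have hmem : TensorProduct.lid A _ (LinearMap.rTensor M I.subtype w) ∈ L :=
    (Submodule.Quotient.mk_eq_zero _).1 hz'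
  have hI : ∀ w : I ⊗[A] M, TensorProduct.lid A _ (LinearMap.rTensor M I.subtype w) ∈
      I • (⊤ : Submodule A M) := by
    intro w
    induction w with
    | zero => simp
    | add x y hx hy => rw [map_add, map_add]; exact add_mem hx hy
    | tmul a x =>
      rw [LinearMap.rTensor_tmul, TensorProduct.lid_tmul]
      exact Submodule.smul_mem_smul a.2 trivial
  have h2 := h I _ hmem (hI w)
  have h3 : ∀ y ∈ I • L, ∃ w' : I ⊗[A] L, TensorProduct.lid A _ (LinearMap.rTensor M I.subtype
      (LinearMap.lTensor I L.subtype w')) = y := by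
    intro y hy
    induction hy using Submodule.smul_induction_on' with
    | smul r hr n hn => exact ⟨⟨r, hr⟩ ⊗ₜ ⟨n, hn⟩, by simp⟩
    | add x _ y _ hx hy =>
      obtain ⟨w, rfl⟩ := hx
      obtain ⟨w', rfl⟩ := hy
      exact ⟨w + w', by simp only [map_add]⟩
  -- As `M` is flat, `w` is determined by its image in `M`, so it comes from `I ⊗ L` and vanishes
  -- in `I ⊗ (M ⧸ L)`.
  obtain ⟨w', hw'⟩ := h3 _ h2
  have h4 := Module.Flat.rTensor_preserves_injective_linearMap (M := M) I.subtype
    I.injective_subtype ((TensorProduct.lid A M).injective hw')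
  rw [← h4, ← LinearMap.comp_apply, ← LinearMap.lTensor_comp]
  have : L.mkQ ∘ₗ L.subtype = 0 := by ext x; simp
  rw [this, LinearMap.lTensor_zero, LinearMap.zero_apply]

theorem isBaseChange_liftQ {A B M N : Type u} [CommRing A] [CommRing B] [Algebra A B]
    [AddCommGroup M] [Module A M] [AddCommGroup N] [Module A N] [Module B N] [IsScalarTower A B N]
    {f : M →ₗ[A] N} (hf : IsBaseChange B f) (S : Submodule A M) :
    IsBaseChange B (S.liftQ ((Submodule.span B (f '' S)).mkQ.restrictScalars A ∘ₗ f)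
      fun x hx => (Submodule.Quotient.mk_eq_zero _).2 (Submodule.subset_span ⟨x, hx, rfl⟩)) := by
  refine IsBaseChange.of_lift_unique _ fun Q _ _ _ _ g => ?_
  let := Module.addCommMonoidToAddCommGroup B (M := Q)
  refine ⟨(Submodule.span B (f '' S)).liftQ (hf.lift (g ∘ₗ S.mkQ)) ?_, ?_, ?_⟩
  · rw [Submodule.span_le]
    rintro _ ⟨x, hx, rfl⟩
    change hf.lift (g ∘ₗ S.mkQ) (f x) = 0
    rw [hf.lift_eq, LinearMap.comp_apply, Submodule.mkQ_apply,
      (Submodule.Quotient.mk_eq_zero S).2 hx,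
      map_zero]
  · ext x
    exact hf.lift_eq _ x
  · intro g' hg'
    refine Submodule.linearMap_qext _ (hf.algHom_ext _ _ fun x => ?_)
    refine Eq.trans ?_ (hf.lift_eq _ x).symm
    exact LinearMap.congr_fun hg' (S.mkQ x)

variable {R M : Type*} [CommRing R] [CommRing M] [Algebra R M] {d : ℕ} {L : Submodule R M}
  {g : R} {c : Prop}

/-- If the discriminant of `L` divides `g`, then so does, locally, the determinant of a local
basis of `L` with respect to `m`; hence `g M ⊆ L` by Cramer's rule. -/
theorem HasLocDiscr.smul_mem (h : HasLocDiscr L d g c) (m : Module.Basis (Fin d) R M) (z : M) :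
    g • z ∈ L := by
  refine mem_of_forall_prime (A := R) fun y => ?_
  obtain ⟨f, hf, e, he, n, hn, -⟩ := h y
  refine ⟨f ^ n, fun h => hf (y.2.mem_of_pow_mem _ h), ?_⟩
  rw [smul_smul]
  let P : Matrix (Fin d) (Fin d) R := Matrix.of fun i j => m.repr (e i) j
  have hP : ∀ i, e i = ∑ j, P i j • m j := fun i => (m.sum_repr _).symm
  rw [discr_eq_of_matrix hP, sq, mul_assoc] at hn
  obtain ⟨q, hq⟩ := (dvd_mul_right _ _).trans hn
  have h1 : ∀ i, P.det • m i = ∑ j, P.adjugate i j • e j := by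
    intro i
    simp only [hP, Finset.smul_sum, smul_smul]
    rw [Finset.sum_comm]
    simp only [← Finset.sum_smul]
    have h2 : ∀ l, ∑ j, P.adjugate i j * P j l = if i = l then P.det else 0 := by
      intro l
      rw [← Matrix.mul_apply, Matrix.adjugate_mul, Matrix.smul_apply, Matrix.one_apply]
      split <;> simp
    simp [h2]
  rw [hq, mul_comm, mul_smul, ← m.sum_repr z, Finset.smul_sum]
  refine L.smul_mem _ (Submodule.sum_mem _ fun i _ => ?_)
  rw [smul_comm, h1]
  exact L.smul_mem _ (Submodule.sum_mem _ fun j _ => L.smul_mem _ (he.mem j))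

theorem HasLocDiscr.fg (h : HasLocDiscr L d g c) : L.FG := by
  classical
  choose f hf e he _ using h
  have htop : Ideal.span (Set.range f) = ⊤ := by
    by_contra hne
    obtain ⟨q, hq, hle⟩ := Ideal.exists_le_maximal _ hne
    exact hf ⟨q, hq.isPrime⟩ (hle (Ideal.subset_span ⟨_, rfl⟩))
  obtain ⟨s, hs, hs'⟩ := (Ideal.span_eq_top_iff_finite _).1 htop
  choose y hy using fun r : s => hs r.2
  refine Submodule.fg_def.2 ⟨⋃ r, Set.range (e (y r)), Set.finite_iUnion fun r =>
    Set.finite_range _, le_antisymm ?_ fun x hx => ?_⟩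
  · rw [Submodule.span_le]
    refine Set.iUnion_subset fun r => ?_
    rintro _ ⟨i, rfl⟩
    exact (he _).mem i
  · refine mem_of_forall_prime (A := R) fun p => ?_
    obtain ⟨r, hr, hrp⟩ : ∃ r ∈ s, r ∉ p.asIdeal := by
      by_contra! hall
      exact p.2.ne_top (top_le_iff.1 (hs' ▸ Ideal.span_le.2 hall))
    obtain ⟨n, hn⟩ := (he (y ⟨r, hr⟩)).span x hx
    rw [hy ⟨r, hr⟩] at hn
    exact ⟨r ^ n, fun h => hrp (p.2.mem_of_pow_mem _ h),
      Submodule.span_mono (Set.subset_iUnion (fun r => Set.range (e (y r))) ⟨r, hr⟩) hn⟩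

end

/-! ### Points of the Quot scheme from lattices -/

section
variable {k : Type u} [Field k]
  {A B : Type u} [CommRing A] [Algebra k A] [CommRing B] [Algebra k B]
  {O : Type u} [CommRing O] [Algebra k O] [Algebra k⟦X⟧ O] [IsScalarTower k k⟦X⟧ O] {b : ℕ}
  {δ : ℚ} {d a : ℕ}

attribute [local instance] coverAlgebra

variable (b) in
/-- The image in `A ⊗ F` of a lattice `L` in `A ⊗ O`. -/
def imageSub (L : Submodule (A ⊗[k] k⟦X⟧) (A ⊗[k] O)) : Submodule A (A ⊗[k] ModT k O b) where
  carrier := projF k O b A '' L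
  zero_mem' := ⟨0, L.zero_mem, map_zero _⟩
  add_mem' := by
    rintro _ _ ⟨x, hx, rfl⟩ ⟨y, hy, rfl⟩
    exact ⟨x + y, L.add_mem hx hy, map_add _ _ _⟩
  smul_mem' := by
    rintro r _ ⟨x, hx, rfl⟩
    refine ⟨algebraMap A (A ⊗[k] k⟦X⟧) r • x, L.smul_mem _ hx, ?_⟩
    rw [algebraMap_cover_smul, map_smul]

variable {L : Submodule (A ⊗[k] k⟦X⟧) (A ⊗[k] O)}

theorem stable_imageSub : Stable (scalars O b) (imageSub b L) := by
  rintro _ ⟨r, rfl⟩ _ ⟨x, hx, rfl⟩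
  rw [mulLeft_baseChange]
  refine ⟨(1 ⊗ₜ[k] r : A ⊗[k] k⟦X⟧) • x, L.smul_mem _ hx, ?_⟩
  rw [projF_cover_smul, one_smul]

theorem mem_imageSub (hL : ∀ z, tR k A ^ b • z ∈ L) {z : A ⊗[k] O} :
    projF k O b A z ∈ imageSub b L ↔ z ∈ L := by
  refine ⟨fun ⟨x, hx, h⟩ => ?_, fun h => ⟨z, h, rfl⟩⟩
  obtain ⟨w, hw⟩ := (projF_eq_zero_iff b (z - x)).1 (by rw [map_sub, h, sub_self])
  rw [← sub_add_cancel z x, hw, ← tR_pow_smul]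
  exact L.add_mem (hL w) hx

/-- Lattices containing `t^b (A ⊗ O)` are the preimages of their images in `A ⊗ F`. -/
theorem liftSub_imageSub (hL : ∀ z, tR k A ^ b • z ∈ L) :
    liftSub (imageSub b L) stable_imageSub = L := by
  ext z
  exact mem_imageSub hL

theorem bcSub_imageSub (f : A →ₐ[k] B) :
    bcSub f (imageSub b L) = imageSub b (Submodule.span (B ⊗[k] k⟦X⟧) (bcO O f '' L)) := by
  apply le_antisymm
  · rw [bcSub_le_iff]
    rintro _ ⟨x, hx, rfl⟩
    rw [← projF_bcO]
    exact ⟨_, Submodule.subset_span ⟨x, hx, rfl⟩, rfl⟩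
  · have hS : Stable (scalars O b) (bcSub f (imageSub b L)) := stable_imageSub.map f
    have key : Submodule.span (B ⊗[k] k⟦X⟧) (bcO O f '' L) ≤
        liftSub (bcSub f (imageSub b L)) hS := by
      rw [Submodule.span_le]
      rintro _ ⟨x, hx, rfl⟩
      change projF k O b B (bcO O f x) ∈ bcSub f (imageSub b L)
      rw [projF_bcO]
      exact bcMap_mem_bcSub f (show projF k O b A x ∈ imageSub b L from ⟨x, hx, rfl⟩)
    rintro _ ⟨x, hx, rfl⟩
    exact key hx

theorem imageSub_fg (hL : L.FG) : (imageSub b L).FG := by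
  classical
  obtain ⟨s, hs⟩ := hL
  let u : (A ⊗[k] O) × ℕ → A ⊗[k] ModT k O b := fun i => projF k O b A (tR k A ^ i.2 • i.1)
  refine ⟨(s ×ˢ Finset.range b).image u, le_antisymm ?_ ?_⟩
  · rw [Submodule.span_le]
    intro z hz
    obtain ⟨i, hi, rfl⟩ := Finset.mem_image.1 hz
    refine ⟨_, L.smul_mem _ (hs ▸ Submodule.subset_span (Finset.mem_product.1 hi).1), rfl⟩
  · rintro _ ⟨x, hx, rfl⟩
    rw [← hs] at hx
    set N := Submodule.span A (((s ×ˢ Finset.range b).image u : Finset (A ⊗[k] ModT k O b)) :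
      Set (A ⊗[k] ModT k O b))
    have hu : ∀ y ∈ s, ∀ j, projF k O b A (tR k A ^ j • y) ∈ N := by
      intro y hy j
      by_cases hj : j < b
      · exact Submodule.subset_span (Finset.mem_image_of_mem u (Finset.mem_product.2
          ⟨hy, Finset.mem_range.2 hj⟩) : u (y, j) ∈ _)
      · rw [(projF_eq_zero_iff b _).2 ⟨tM k A O ^ (j - b) * y, ?_⟩]
        · exact zero_mem _
        · rw [tR_pow_smul, ← mul_assoc, ← pow_add, Nat.add_sub_cancel' (not_lt.1 hj)]
    have hstab : ∀ y ∈ s, ∀ r : A ⊗[k] k⟦X⟧, projF k O b A (r • y) ∈ N := by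
      intro y hy r
      obtain ⟨w, hw⟩ := exists_eq_sum_add b r
      rw [hw, cover_smul_def, map_add, add_mul, map_add, map_sum, Finset.sum_mul, map_sum]
      refine add_mem (Submodule.sum_mem _ fun j _ => ?_) ?_
      · rw [map_smul, smul_mul_assoc, map_smul, ← cover_smul_def]
        exact N.smul_mem _ (hu y hy j)
      · rw [map_mul (coverAlgHom k O A), mul_assoc, map_pow, coverAlgHom_tR,
          (projF_eq_zero_iff b _).2 ⟨_, rfl⟩]
        exact zero_mem _
    rw [← one_smul (A ⊗[k] k⟦X⟧) x]
    generalize (1 : A ⊗[k] k⟦X⟧) = r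
    induction hx using Submodule.span_induction generalizing r with
    | zero => rw [smul_zero, map_zero]; exact zero_mem _
    | mem y hy => exact hstab y hy r
    | add y z _ _ hy hz =>
      rw [cover_smul_def, mul_add, map_add]
      exact add_mem (hy r) (hz r)
    | smul r' y hy h => rw [smul_smul]; exact h _

theorem rankAtStalk_eq_finrank_bcSub {V : Type u} [AddCommGroup V] [Module k V]
    (S : Submodule A (A ⊗[k] V)) [Module.Finite A (A ⊗[k] V ⧸ S)]
    [Module.Projective A (A ⊗[k] V ⧸ S)] (p : PrimeSpectrum A) :
    Module.rankAtStalk (R := A) (A ⊗[k] V ⧸ S) p = Module.finrank p.asIdeal.ResidueField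
        ((p.asIdeal.ResidueField ⊗[k] V) ⧸ bcSub (toκ k p) S) := by
  have hb := isBaseChange_liftQ
    (isBaseChange_bcMap (k := k) (V := V) (A := A) (B := p.asIdeal.ResidueField)) S
  have h1 := Module.rankAtStalk_isBaseChange hb ⊥
  have h2 : PrimeSpectrum.comap (algebraMap A p.asIdeal.ResidueField) ⊥ = p := by
    ext x
    exact Ideal.algebraMap_residueField_eq_zero
  rw [h2] at h1
  rw [← h1]
  change Module.rankAtStalk (R := p.asIdeal.ResidueField)
    ((p.asIdeal.ResidueField ⊗[k] V) ⧸ bcSub (toκ k p) S) ⊥ = _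
  rw [Module.rankAtStalk_eq_finrank_of_free]
  rfl

/-- A lattice with branch divisor defined by `t^b` whose quotient is flat over `A` defines a point
of the Quot scheme: flatness and finite presentation give projectivity, and the order of the
discriminant gives the rank. -/
theorem isQuotSub_imageSub {L : Submodule (A ⊗[k] k⟦X⟧) (A ⊗[k] O)}
    (h : HasLocDiscr L d (tR k A ^ b) True) (o : Module.Basis (Fin d) k⟦X⟧ O)
    (ha : Associated (Algebra.discr k⟦X⟧ o) (PowerSeries.X ^ a))
    (hflat : ∀ I : Ideal A, ∀ z ∈ L, z ∈ I • (⊤ : Submodule A (A ⊗[k] O)) →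
      z ∈ I • L.restrictScalars A) :
    IsQuotSub (scalars O b) (((b : ℚ) - a) / 2) (imageSub b L) := by
  obtain ⟨m, hm⟩ := exists_basis_cover (A := A) o
  have := finite_modT o b
  have hL := h.smul_mem m
  have : Module.FinitePresentation A (A ⊗[k] ModT k O b) :=
    Module.finitePresentation_of_projective A _
  have hfp : Module.FinitePresentation A (A ⊗[k] ModT k O b ⧸ imageSub b L) :=
    Module.finitePresentation_of_surjective (imageSub b L).mkQ (Submodule.mkQ_surjective _)
      (by rw [Submodule.ker_mkQ]; exact imageSub_fg h.fg)
  let π : A ⊗[k] O →ₗ[A] A ⊗[k] ModT k O b ⧸ imageSub b L :=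
    (imageSub b L).mkQ ∘ₗ (projF k O b A).toLinearMap
  have hπ : Function.Surjective π := (Submodule.mkQ_surjective _).comp (projF_surjective b)
  have hker : L.restrictScalars A = LinearMap.ker π := by
    ext z
    exact (mem_imageSub hL).symm.trans (Submodule.Quotient.mk_eq_zero _).symm
  have := flat_quotient_of_inf_le (L := L.restrictScalars A) hflat
  have hfl : Module.Flat A (A ⊗[k] ModT k O b ⧸ imageSub b L) :=
    Module.Flat.of_linearEquiv ((Submodule.quotEquivOfEq _ _ hker).trans
      (π.quotKerEquivOfSurjective hπ)).symm
  have hproj : Module.Projective A (A ⊗[k] ModT k O b ⧸ imageSub b L) :=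
    Module.Flat.projective_of_finitePresentation
  refine ⟨stable_imageSub, inferInstance, hproj, fun p => ?_⟩
  have h' : HasLocDiscr (liftSub (imageSub b L) stable_imageSub) d (tR k A ^ b) True := by
    rwa [liftSub_imageSub hL]
  -- The order of the discriminant is `2 δ + a` and equals `b`.
  have h1 := h'.rank_eq o ha p
  have h2 : Module.rankAtStalk (R := A) (A ⊗[k] ModT k O b ⧸ imageSub b L) p =
      Module.finrank p.asIdeal.ResidueField
        ((p.asIdeal.ResidueField ⊗[k] ModT k O b) ⧸ bcSub (toκ k p) (imageSub b L)) := by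
    rw [rankAtStalk_eq_finrank_bcSub]
  rw [h2]
  have h3 := congrArg (Nat.cast : ℕ → ℚ) h1
  push_cast at h3
  linarith

end

/-! ### Isomorphisms away from a divisor -/

section

theorem bijective_awayMap_of_isIso {E M : CommRingCat.{u}} (β : E ⟶ M) (s : E)
    (h : IsIso (Spec.map β ∣_ PrimeSpectrum.basicOpen s)) :
    Function.Bijective (Localization.awayMap β.hom s) := by
  have h1 : IsIso (Spec.map (CommRingCat.ofHom (Localization.awayMap β.hom s))) :=
    (MorphismProperty.arrow_mk_iso_iff (MorphismProperty.isomorphisms Scheme)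
      (SpecMapRestrictBasicOpenIso β s)).1 h
  have h2 : IsIso (CommRingCat.ofHom (Localization.awayMap β.hom s)) := by
    have : IsIso (Scheme.Spec.map (CommRingCat.ofHom (Localization.awayMap β.hom s)).op) := h1
    rw [← isIso_op_iff]
    exact isIso_of_reflects_iso (CommRingCat.ofHom (Localization.awayMap β.hom s)).op Scheme.Spec
  exact (ConcreteCategory.isIso_iff_bijective _).1 h2

/-- If `Spec M → Spec E` is an isomorphism over `D(s)`, then `E` and `M` agree up to powers of
`s`. -/
theorem exists_pow_of_isIso {E M : CommRingCat.{u}} (β : E ⟶ M) (s : E)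
    (h : IsIso (Spec.map β ∣_ PrimeSpectrum.basicOpen s)) :
    (∀ x, β.hom x = 0 → ∃ n : ℕ, s ^ n * x = 0) ∧
      ∀ z, ∃ (n : ℕ) (x : E), β.hom x = β.hom s ^ n * z := by
  have hb := bijective_awayMap_of_isIso β s h
  have hmap : ∀ x : E, Localization.awayMap β.hom s (algebraMap E _ x) =
      algebraMap M (Localization.Away (β.hom s)) (β.hom x) := fun x => by
    simp [Localization.awayMap, IsLocalization.Away.map]
  constructor
  · intro x hx
    have h1 : algebraMap E (Localization.Away s) x = algebraMap E (Localization.Away s) 0 := by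
      apply hb.1
      rw [hmap, hmap, hx, map_zero, map_zero, map_zero]
    obtain ⟨⟨_, n, rfl⟩, hn⟩ := (IsLocalization.eq_iff_exists (Submonoid.powers s)
      (Localization.Away s)).1 h1
    exact ⟨n, hn.trans (mul_zero _)⟩
  · intro z
    obtain ⟨y, hy⟩ := hb.2 (algebraMap M _ z)
    obtain ⟨n, x, hx⟩ := IsLocalization.Away.surj s y
    have h1 := congrArg (Localization.awayMap β.hom s) hx
    rw [map_mul, map_pow, hmap, hmap, hy, ← map_pow, ← map_mul] at h1
    obtain ⟨⟨_, N, rfl⟩, hN⟩ := (IsLocalization.eq_iff_exists (Submonoid.powers (β.hom s))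
      (Localization.Away (β.hom s))).1 h1
    refine ⟨N + n, s ^ N * x, ?_⟩
    simp only at hN
    rw [map_mul, map_pow, ← hN]
    ring

variable {R E : Type u} [CommRing R] [CommRing E] [Algebra R E] {d : ℕ}

theorem IsCoverWithDiscr.eq_zero_of_smul_eq_zero
    {P : ∀ U : (Spec (CommRingCat.of R)).Opens, Γ(Spec (CommRingCat.of R), U) → Prop}
    (h : IsCoverWithDiscr (Spec.map (CommRingCat.ofHom (algebraMap R E))) d P) {s : R}
    (hs : ∀ x, s * x = 0 → x = 0) {x : E} (hx : s • x = 0) : x = 0 := by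
  rw [← Submodule.mem_bot R]
  refine mem_of_forall_prime (A := R) fun y => ?_
  obtain ⟨U, hU, hyU, e, he⟩ := h.2 y
  obtain ⟨_, ⟨f, rfl⟩, hyf, hfU⟩ :=
    PrimeSpectrum.isTopologicalBasis_basic_opens.exists_subset_of_mem_open
      (show y ∈ U.carrier from hyU) U.isOpen
  have hle : (PrimeSpectrum.basicOpen f : (Spec (CommRingCat.of R)).Opens) ≤ U := hfU
  obtain ⟨e', he'⟩ := exists_basis_of_le
    (Spec.map (CommRingCat.ofHom (algebraMap R E))) hU (IsAffineOpen.Spec_basicOpen f) hle e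
  obtain ⟨ρ, ρ', hρ, hρ', hc, -⟩ := exists_away_sections
    (CommRingCat.ofHom (algebraMap R E)) f
  let := ρ.toAlgebra
  let := ρ'.toAlgebra
  let := ((Spec.map (CommRingCat.ofHom (algebraMap R E))).app
    (PrimeSpectrum.basicOpen f)).hom.toAlgebra
  have h1 : ρ s • ρ' x = 0 := by
    rw [Algebra.smul_def]
    refine (congrArg (· * ρ' x) (hc s)).trans ?_
    refine (map_mul ρ' _ _).symm.trans ?_
    change ρ' (algebraMap R E s * x) = 0
    rw [← Algebra.smul_def, hx, map_zero]
  have hreg : ∀ c, ρ s * c = 0 → c = 0 := by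
    intro c hcs
    obtain ⟨n, w, hw⟩ := IsLocalization.Away.surj f c
    change c * ρ f ^ n = ρ w at hw
    have h2 : ρ (s * w) = ρ 0 := by
      have h : ρ s * (c * ρ f ^ n) = 0 := by
        rw [← mul_assoc, hcs, zero_mul]
      rw [map_mul, ← hw, map_zero]
      exact h
    obtain ⟨⟨_, N, rfl⟩, hN⟩ := (IsLocalization.eq_iff_exists (Submonoid.powers f)
      Γ(Spec (CommRingCat.of R), PrimeSpectrum.basicOpen f)).1 h2
    have h3 : f ^ N * w = 0 := hs _ (by
      rw [mul_left_comm]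
      exact hN.trans (mul_zero _))
    have h4 := congrArg ρ h3
    rw [map_mul, map_pow, ← hw, map_zero] at h4
    have hu : IsUnit (ρ f) := IsLocalization.Away.algebraMap_isUnit f
    rw [(hu.pow N).mul_right_eq_zero, (hu.pow n).mul_left_eq_zero] at h4
    exact h4
  have h5 : ρ' x = ρ' 0 := by
    rw [map_zero]
    apply e'.repr.injective
    ext i
    have h6 := congrArg (fun z => e'.repr z i) h1
    simp only [map_smul, Finsupp.smul_apply, smul_eq_mul, map_zero, Finsupp.zero_apply] at h6
    rw [map_zero, Finsupp.zero_apply]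
    exact hreg _ h6
  obtain ⟨⟨_, N, rfl⟩, hN⟩ := (IsLocalization.eq_iff_exists
    (Submonoid.powers (algebraMap R E f)) Γ(Spec (CommRingCat.of E),
      Spec.map (CommRingCat.ofHom (algebraMap R E)) ⁻¹ᵁ PrimeSpectrum.basicOpen f)).1 h5
  refine ⟨f ^ N, fun h => hyf (y.2.mem_of_pow_mem _ h), ?_⟩
  rw [Submodule.mem_bot, Algebra.smul_def, map_pow]
  exact hN.trans (mul_zero _)

end

/-! ### Products with `T` -/

section
variable {k : Type u} [Field k]
  {A B : Type u} [CommRing A] [Algebra k A] [CommRing B] [Algebra k B]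
  {O : Type u} [CommRing O] [Algebra k O] [Algebra k⟦X⟧ O] [IsScalarTower k k⟦X⟧ O] {b d : ℕ}
  {T : Over (Spec (CommRingCat.of k))}

theorem tensorPoint_fst (W : Type u) [CommRing W] [Algebra k W] (x : specOver k A ⟶ T) :
    tensorPoint W x ≫ prodFst W T =
      specMap (Algebra.TensorProduct.includeRight : W →ₐ[k] A ⊗[k] W) :=
  IsPullback.lift_fst _ _ _ _

theorem tensorPoint_snd (W : Type u) [CommRing W] [Algebra k W] (x : specOver k A ⟶ T) :
    tensorPoint W x ≫ prodSnd W T =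
      specMap (Algebra.TensorProduct.includeLeft : A →ₐ[k] A ⊗[k] W) ≫ pointHom x :=
  IsPullback.lift_snd _ _ _ _

theorem isPullback_specMap_tensor (A W : Type u) [CommRing A] [Algebra k A] [CommRing W]
    [Algebra k W] :
    IsPullback (specMap (Algebra.TensorProduct.includeRight : W →ₐ[k] A ⊗[k] W))
      (specMap (Algebra.TensorProduct.includeLeft : A →ₐ[k] A ⊗[k] W)) (specStr k W)
      (specStr k A) :=
  (isPullback_SpecMap_of_isPushout _ _ _ _
    (CommRingCat.isPushout_tensorProduct k A W)).flip

/-- The fibre of `Spec W × T → T` over a point `Spec A → T` is `Spec (A ⊗ W)`. -/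
theorem isPullback_tensorPoint (W : Type u) [CommRing W] [Algebra k W] (x : specOver k A ⟶ T) :
    IsPullback (tensorPoint W x)
      (specMap (Algebra.TensorProduct.includeLeft : A →ₐ[k] A ⊗[k] W)) (prodSnd W T)
      (pointHom x) := by
  refine IsPullback.of_right ?_ (tensorPoint_snd W x) (isPullback_prodSpec W T)
  rw [tensorPoint_fst, pointHom_str]
  exact isPullback_specMap_tensor A W

theorem prod_hom_ext {W : Type u} [CommRing W] [Algebra k W] {Z : Scheme.{u}}
    {f g : Z ⟶ prodSpec W T} (h : f ≫ prodFst W T = g ≫ prodFst W T)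
    (h' : f ≫ prodSnd W T = g ≫ prodSnd W T) : f = g :=
  (isPullback_prodSpec W T).hom_ext h h'

theorem tensorPoint_specOverMap (W : Type u) [CommRing W] [Algebra k W] (f : A →ₐ[k] B)
    (x : specOver k A ⟶ T) :
    tensorPoint W (specOverMap f ≫ x) = specMap (bcO W f) ≫ tensorPoint W x := by
  apply prod_hom_ext
  · rw [Category.assoc, tensorPoint_fst, tensorPoint_fst, ← specMap_comp]
    congr 1
    ext w
    simp [bcO]
  · rw [Category.assoc, tensorPoint_snd, tensorPoint_snd, ← Category.assoc, ← specMap_comp]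
    change _ ≫ specMap f ≫ pointHom x = _
    rw [← Category.assoc, ← specMap_comp]
    congr 2

theorem coverAlgHom_comp_includeLeft :
    ((coverAlgHom k O A).restrictScalars k).comp
      (Algebra.TensorProduct.includeLeft : A →ₐ[k] A ⊗[k] k⟦X⟧) =
      (Algebra.TensorProduct.includeLeft : A →ₐ[k] A ⊗[k] O) := by
  ext w
  change w ⊗ₜ[k] (algebraMap k⟦X⟧ O 1) = w ⊗ₜ[k] 1
  rw [map_one]

theorem tensorPoint_baseCover (x : specOver k A ⟶ T) :
    tensorPoint O x ≫ baseCover O T =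
      specMap ((coverAlgHom k O A).restrictScalars k) ≫ tensorPoint k⟦X⟧ x := by
  apply prod_hom_ext
  · rw [Category.assoc, Category.assoc, baseCover, prodMapLeft_fst, tensorPoint_fst,
      ← Category.assoc, tensorPoint_fst, ← specMap_comp, ← specMap_comp]
    congr 1
  · rw [Category.assoc, Category.assoc, baseCover, prodMapLeft_snd, tensorPoint_snd,
      tensorPoint_snd, ← Category.assoc, ← specMap_comp]
    congr 2
    exact (coverAlgHom_comp_includeLeft (O := O)).symm

/-- The fibre of `C̃ × T → Δ × T` over `Δ × Spec A`. -/
theorem isPullback_tensorPoint_baseCover (x : specOver k A ⟶ T) :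
    IsPullback (tensorPoint O x) (specMap ((coverAlgHom k O A).restrictScalars k))
      (baseCover O T) (tensorPoint k⟦X⟧ x) := by
  refine IsPullback.of_bot ?_ (tensorPoint_baseCover x) (isPullback_tensorPoint k⟦X⟧ x)
  rw [baseCover, prodMapLeft_snd, ← specMap_comp]
  rw [coverAlgHom_comp_includeLeft]
  exact isPullback_tensorPoint O x

theorem tensorPoint_sigma (x : specOver k A ⟶ T) :
    (tensorPoint k⟦X⟧ x).appTop.hom (sigma b T) =
      (Scheme.ΓSpecIso (CommRingCat.of (A ⊗[k] k⟦X⟧))).inv.hom (tR k A ^ b) := by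
  have h := congrArg (fun q => q.appTop.hom
    ((Scheme.ΓSpecIso (CommRingCat.of k⟦X⟧)).inv.hom ((PowerSeries.X : k⟦X⟧) ^ b)))
    (tensorPoint_fst k⟦X⟧ x)
  simp only [Scheme.Hom.comp_appTop] at h
  refine h.trans ?_
  have h2 := congrArg (fun q => q.hom ((PowerSeries.X : k⟦X⟧) ^ b))
    (Scheme.ΓSpecIso_inv_naturality (CommRingCat.ofHom
      (Algebra.TensorProduct.includeRight : k⟦X⟧ →ₐ[k] A ⊗[k] k⟦X⟧).toRingHom))
  refine h2.symm.trans ?_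
  change (Scheme.ΓSpecIso (CommRingCat.of (A ⊗[k] k⟦X⟧))).inv.hom
    ((Algebra.TensorProduct.includeRight : k⟦X⟧ →ₐ[k] A ⊗[k] k⟦X⟧) _) = _
  congr 1
  rw [map_pow]
  rfl

end

/-! ### Charts of a crimp -/

section
variable {k : Type u} [Field k]
  {A B : Type u} [CommRing A] [Algebra k A] [CommRing B] [Algebra k B]
  {O : Type u} [CommRing O] [Algebra k O] [Algebra k⟦X⟧ O] [IsScalarTower k k⟦X⟧ O] {b d : ℕ}
  {T : Over (Spec (CommRingCat.of k))} (D : Crimp O d b T) (x : specOver k A ⟶ T)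
  {E E' : Type u} [CommRing E] [CommRing E']

variable {D x} in
theorem specMap_coverAlgHom {α : A ⊗[k] k⟦X⟧ →+* E} {β : E →+* A ⊗[k] O}
    (comp : ∀ r, β (α r) = coverAlgHom k O A r) :
    Spec.map (CommRingCat.ofHom β) ≫ Spec.map (CommRingCat.ofHom α) =
      specMap ((coverAlgHom k O A).restrictScalars k) := by
  rw [← Spec.map_comp, ← CommRingCat.ofHom_comp]
  exact congrArg (fun q => Spec.map (CommRingCat.ofHom q)) (RingHom.ext comp)

/-- The base change of the crimp `D` along `x : Spec A → T` is `C̃ × Spec A → Spec E → Δ × Spec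
A`, with morphisms given by `β` and `α`. -/
structure Crimp.IsChart (α : A ⊗[k] k⟦X⟧ →+* E) (β : E →+* A ⊗[k] O) : Prop where
  comp : ∀ r, β (α r) = coverAlgHom k O A r
  exists_hom : ∃ ψ : Spec (CommRingCat.of E) ⟶ D.C,
    IsPullback ψ (Spec.map (CommRingCat.ofHom α)) D.φ (tensorPoint k⟦X⟧ x) ∧
      Spec.map (CommRingCat.ofHom β) ≫ ψ = tensorPoint O x ≫ D.ν

theorem Crimp.exists_isChart : ∃ (E : Type u) (_ : CommRing E) (α : A ⊗[k] k⟦X⟧ →+* E)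
    (β : E →+* A ⊗[k] O), D.IsChart x α β := by
  have : IsAffineHom D.φ := D.cover.1
  have H := IsPullback.of_hasPullback D.φ (tensorPoint k⟦X⟧ x)
  have : IsAffine (Limits.pullback D.φ (tensorPoint k⟦X⟧ x)) :=
    isAffine_of_isAffineHom (pullback.snd D.φ (tensorPoint k⟦X⟧ x))
  let i := (Limits.pullback D.φ (tensorPoint k⟦X⟧ x)).isoSpec
  obtain ⟨α, hα⟩ := Spec.map_surjective (i.inv ≫ pullback.snd D.φ (tensorPoint k⟦X⟧ x))
  have hw : (tensorPoint O x ≫ D.ν) ≫ D.φ =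
      specMap ((coverAlgHom k O A).restrictScalars k) ≫ tensorPoint k⟦X⟧ x := by
    rw [Category.assoc, D.comp_eq, tensorPoint_baseCover]
  obtain ⟨β, hβ⟩ := Spec.map_surjective (pullback.lift _ _ hw ≫ i.hom)
  refine ⟨_, _, α.hom, β.hom, fun r => ?_, i.inv ≫ pullback.fst _ _, ?_, ?_⟩
  · have h : Spec.map β ≫ Spec.map α = specMap ((coverAlgHom k O A).restrictScalars k) := by
      rw [hα, hβ, Category.assoc, i.hom_inv_id_assoc, pullback.lift_snd]
    rw [← Spec.map_comp] at h
    exact congrArg (fun q => q.hom r) (Spec.map_injective h)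
  · refine IsPullback.of_iso H i (Iso.refl _) (Iso.refl _) (Iso.refl _) ?_ ?_ ?_ ?_
    · rw [Iso.refl_hom, Category.comp_id, i.hom_inv_id_assoc]
    · change _ = _ ≫ Spec.map α
      rw [Iso.refl_hom, Category.comp_id, hα, i.hom_inv_id_assoc]
    · rw [Iso.refl_hom, Iso.refl_hom, Category.id_comp, Category.comp_id]
    · rw [Iso.refl_hom, Iso.refl_hom, Category.id_comp, Category.comp_id]
  · change Spec.map β ≫ _ = _
    rw [hβ, Category.assoc, i.hom_inv_id_assoc, pullback.lift_fst]

variable {D x} {α : A ⊗[k] k⟦X⟧ →+* E} {β : E →+* A ⊗[k] O}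
  {α' : A ⊗[k] k⟦X⟧ →+* E'} {β' : E' →+* A ⊗[k] O}

/-- The image in `A ⊗ O` of the algebra of a chart depends only on the crimp and the point. -/
theorem Crimp.IsChart.range_le (h : D.IsChart x α β) (h' : D.IsChart x α' β') (z : E) :
    ∃ z', β' z' = β z := by
  obtain ⟨ψ, hψ, hβ⟩ := h.exists_hom
  obtain ⟨ψ', hψ', hβ'⟩ := h'.exists_hom
  obtain ⟨γ, hγ⟩ := Spec.map_surjective (hψ.lift _ _ hψ'.w)
  refine ⟨γ.hom z, ?_⟩
  have key : Spec.map (CommRingCat.ofHom β') ≫ Spec.map γ = Spec.map (CommRingCat.ofHom β) := by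
    apply hψ.hom_ext
    · rw [hγ, Category.assoc, hψ.lift_fst, hβ, hβ']
    · rw [hγ, Category.assoc, hψ.lift_snd, specMap_coverAlgHom h.comp, specMap_coverAlgHom h'.comp]
  rw [← Spec.map_comp] at key
  exact congrArg (fun q => q.hom z) (Spec.map_injective key)

theorem preimage_basicOpen_ΓSpecIso {R S : CommRingCat.{u}} (f : R ⟶ S) (r : R) :
    Spec.map f ⁻¹ᵁ (Spec R).basicOpen ((Scheme.ΓSpecIso R).inv.hom r) =
      PrimeSpectrum.basicOpen (f.hom r) := by
  rw [Scheme.preimage_basicOpen_top]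
  have h := congrArg (fun q => q.hom r) (Scheme.ΓSpecIso_inv_naturality f)
  refine (congrArg (Spec S).basicOpen h.symm).trans ?_
  exact basicOpen_eq_of_affine (f.hom r)

theorem Crimp.IsChart.isIso (h : D.IsChart x α β) :
    IsIso (Spec.map (CommRingCat.ofHom β) ∣_ PrimeSpectrum.basicOpen (α (tR k A ^ b))) := by
  obtain ⟨ψ, hψ, hβ⟩ := h.exists_hom
  have H : IsPullback (tensorPoint O x) (Spec.map (CommRingCat.ofHom β)) D.ν ψ := by
    refine IsPullback.of_bot ?_ hβ.symm hψ
    rw [specMap_coverAlgHom h.comp, D.comp_eq]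
    exact isPullback_tensorPoint_baseCover x
  have h1 := isIso_restrict_of_isPullback H _ D.isIso_away
  have h2 : ψ ⁻¹ᵁ D.φ ⁻¹ᵁ (prodSpec k⟦X⟧ T).basicOpen (sigma b T) =
      PrimeSpectrum.basicOpen (α (tR k A ^ b)) := by
    rw [← Scheme.Hom.comp_preimage, hψ.w, Scheme.Hom.comp_preimage,
      Scheme.preimage_basicOpen_top (tensorPoint k⟦X⟧ x), tensorPoint_sigma]
    exact preimage_basicOpen_ΓSpecIso (CommRingCat.ofHom α) (tR k A ^ b)
  rw [h2] at h1
  exact h1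

theorem Crimp.IsChart.isCover (h : D.IsChart x α β) :
    IsCoverWithBranch (Spec.map (CommRingCat.ofHom α)) d
      ((Scheme.ΓSpecIso (CommRingCat.of (A ⊗[k] k⟦X⟧))).inv.hom (tR k A ^ b)) := by
  obtain ⟨ψ, hψ, hβ⟩ := h.exists_hom
  rw [← tensorPoint_sigma x]
  exact D.cover.of_isPullback hψ

/-- A crimp is a birational modification, so its functions embed in the functions on `C̃ × Spec
A`. -/
theorem Crimp.IsChart.injective (h : D.IsChart x α β) : Function.Injective β := by
  rw [injective_iff_map_eq_zero]
  intro z hz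
  obtain ⟨n, hn⟩ := (exists_pow_of_isIso _ _ h.isIso).1 z hz
  let := α.toAlgebra
  refine IsCoverWithDiscr.eq_zero_of_smul_eq_zero (R := A ⊗[k] k⟦X⟧) (s := tR k A ^ (b * n))
    h.isCover (fun y hy => tR_pow_mul_eq_zero hy) ?_
  rw [Algebra.smul_def, pow_mul, map_pow]
  exact hn

attribute [local instance] coverAlgebra

variable (α β) in
/-- The image of the algebra of a chart in `A ⊗ O`, as a submodule over `A ⊗ k⟦t⟧`. -/
def rangeSub (comp : ∀ r, β (α r) = coverAlgHom k O A r) :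
    Submodule (A ⊗[k] k⟦X⟧) (A ⊗[k] O) where
  carrier := Set.range β
  zero_mem' := ⟨0, map_zero _⟩
  add_mem' := by
    rintro _ _ ⟨x, rfl⟩ ⟨y, rfl⟩
    exact ⟨x + y, map_add _ _ _⟩
  smul_mem' := by
    rintro r _ ⟨x, rfl⟩
    refine ⟨α r * x, ?_⟩
    rw [map_mul, comp, cover_smul_def]

theorem Crimp.IsChart.hasLocDiscr (h : D.IsChart x α β) (o : Module.Basis (Fin d) k⟦X⟧ O) :
    HasLocDiscr (rangeSub α β h.comp) d (tR k A ^ b) True := by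
  let := α.toAlgebra
  let β' : E →ₐ[A ⊗[k] k⟦X⟧] A ⊗[k] O := { β with commutes' := h.comp }
  have hrange : LinearMap.range β'.toLinearMap = rangeSub α β h.comp := by
    ext z
    exact Iff.rfl
  obtain ⟨m, hm⟩ := exists_basis_cover (A := A) o
  choose n x hx using fun i => (exists_pow_of_isIso _ _ h.isIso).2 (m i)
  rw [← hrange]
  refine (hasLocDiscr_iff (β := β') h.injective m (s := tR k A ^ (b * ∑ i, n i)) (fun i => ?_)
    (fun x hx => tR_pow_mul_eq_zero hx) _ True).1 ?_
  · rw [hrange]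
    refine ⟨α (tR k A ^ (b * (∑ i, n i - n i))) * x i, ?_⟩
    have hle : n i ≤ ∑ i, n i := Finset.single_le_sum (fun _ _ => Nat.zero_le _)
      (Finset.mem_univ i)
    have h1 : β (x i) = β (α (tR k A ^ b)) ^ n i * m i := hx i
    rw [map_mul, h.comp, h1, h.comp, ← map_pow, ← mul_assoc, ← map_mul, ← pow_mul, ← pow_add,
      ← mul_add, Nat.sub_add_cancel hle, cover_smul_def]
  · exact IsCoverWithDiscr.mono h.isCover fun U δ h =>
      ⟨Ideal.span_singleton_le_span_singleton.1 h.ge,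
        fun _ => Ideal.span_singleton_le_span_singleton.1 h.le⟩

end

/-! ### Base change of charts and flatness -/

section
variable {k : Type u} [Field k]
  {A B : Type u} [CommRing A] [Algebra k A] [CommRing B] [Algebra k B]
  {O : Type u} [CommRing O] [Algebra k O] [Algebra k⟦X⟧ O] [IsScalarTower k k⟦X⟧ O] {b d : ℕ}
  {T : Over (Spec (CommRingCat.of k))} {D : Crimp O d b T} {x : specOver k A ⟶ T}
  {E : Type u} [CommRing E]
  {α : A ⊗[k] k⟦X⟧ →+* E} {β : E →+* A ⊗[k] O}

theorem isPullback_specMap_bcO (W : Type u) [CommRing W] [Algebra k W] (f : A →ₐ[k] B) :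
    IsPullback (specMap (bcO W f))
      (specMap (Algebra.TensorProduct.includeLeft : B →ₐ[k] B ⊗[k] W))
      (specMap (Algebra.TensorProduct.includeLeft : A →ₐ[k] A ⊗[k] W)) (specMap f) := by
  refine IsPullback.of_right ?_ ?_ (isPullback_tensorPoint W (𝟙 (specOver k A)))
  · rw [← tensorPoint_specOverMap]
    exact isPullback_tensorPoint W (specOverMap f ≫ 𝟙 _)
  · rw [← specMap_comp, ← specMap_comp]
    congr 1

/-- Charts of a crimp are compatible with base change: over `B`, the algebra is `B ⊗ E`. -/
theorem Crimp.IsChart.baseChange [Algebra A E] (hA : ∀ r, algebraMap A E r = α (r ⊗ₜ 1))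
    (h : D.IsChart x α β) [Algebra A B]
    (f : A →ₐ[k] B) (hf : f.toRingHom = algebraMap A B) :
    ∃ (α' : B ⊗[k] k⟦X⟧ →+* B ⊗[A] E) (β' : B ⊗[A] E →+* B ⊗[k] O),
      D.IsChart (specOverMap f ≫ x) α' β' ∧
      ∀ (r : B) (z : E), β' (r ⊗ₜ z) = r • bcO O f (β z) := by
  let θ : E →+* B ⊗[A] E := (Algebra.TensorProduct.includeRight : E →ₐ[A] B ⊗[A] E).toRingHom
  let ι : B →+* B ⊗[A] E := (Algebra.TensorProduct.includeLeftRingHom)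
  obtain ⟨ψ, hψ, hβ⟩ := h.exists_hom
  have H1 : IsPullback (Spec.map (CommRingCat.ofHom θ)) (Spec.map (CommRingCat.ofHom ι))
      (Spec.map (CommRingCat.ofHom (algebraMap A E))) (specMap f) := by
    rw [specMap, hf]
    exact isPullback_SpecMap_of_isPushout _ _ _ _ (CommRingCat.isPushout_tensorProduct A B E).flip
  have H2 := isPullback_specMap_bcO k⟦X⟧ f
  have hα : Spec.map (CommRingCat.ofHom (algebraMap A E)) = Spec.map (CommRingCat.ofHom α) ≫
      specMap (Algebra.TensorProduct.includeLeft : A →ₐ[k] A ⊗[k] k⟦X⟧) := by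
    rw [specMap, ← Spec.map_comp, ← CommRingCat.ofHom_comp]
    exact congrArg (fun q => Spec.map (CommRingCat.ofHom q)) (RingHom.ext hA)
  have hw : (Spec.map (CommRingCat.ofHom θ) ≫ Spec.map (CommRingCat.ofHom α)) ≫
      specMap (Algebra.TensorProduct.includeLeft : A →ₐ[k] A ⊗[k] k⟦X⟧) =
      Spec.map (CommRingCat.ofHom ι) ≫ specMap f := by
    rw [Category.assoc, ← hα, H1.w]
  obtain ⟨α', hα'⟩ := Spec.map_surjective (H2.lift _ _ hw)
  have H3 : IsPullback (Spec.map (CommRingCat.ofHom θ)) (Spec.map α')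
      (Spec.map (CommRingCat.ofHom α)) (specMap (bcO k⟦X⟧ f)) := by
    refine IsPullback.of_bot ?_ ?_ H2
    · rw [hα', H2.lift_snd, ← hα]
      exact H1
    · rw [hα', H2.lift_fst]
  have hO : (specMap (bcO O f) ≫ Spec.map (CommRingCat.ofHom β)) ≫
      Spec.map (CommRingCat.ofHom (algebraMap A E)) =
      specMap (Algebra.TensorProduct.includeLeft : B →ₐ[k] B ⊗[k] O) ≫ specMap f := by
    rw [hα, Category.assoc, ← Category.assoc (Spec.map _), specMap_coverAlgHom h.comp,
      ← specMap_comp, coverAlgHom_comp_includeLeft, (isPullback_specMap_bcO O f).w]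
  obtain ⟨β', hβ'⟩ := Spec.map_surjective (H1.lift _ _ hO)
  have e1 : Spec.map β' ≫ Spec.map (CommRingCat.ofHom θ) =
      specMap (bcO O f) ≫ Spec.map (CommRingCat.ofHom β) := by
    rw [hβ', H1.lift_fst]
  have e2 : Spec.map β' ≫ Spec.map (CommRingCat.ofHom ι) =
      specMap (Algebra.TensorProduct.includeLeft : B →ₐ[k] B ⊗[k] O) := by
    rw [hβ', H1.lift_snd]
  have e3 : Spec.map β' ≫ Spec.map α' = specMap ((coverAlgHom k O B).restrictScalars k) := by
    apply H2.hom_ext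
    · rw [Category.assoc, hα', H2.lift_fst, ← Category.assoc, e1, Category.assoc,
        specMap_coverAlgHom h.comp, ← specMap_comp, ← specMap_comp]
      congr 1
      exact AlgHom.ext fun r => bcO_coverAlgHom f r
    · rw [Category.assoc, hα', H2.lift_snd, e2, ← specMap_comp, coverAlgHom_comp_includeLeft]
  refine ⟨α'.hom, β'.hom, ⟨fun r => ?_, Spec.map (CommRingCat.ofHom θ) ≫ ψ, ?_, ?_⟩, fun r z => ?_⟩
  · rw [← Spec.map_comp] at e3
    exact congrArg (fun q => q.hom r) (Spec.map_injective e3)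
  · rw [tensorPoint_specOverMap]
    exact H3.paste_horiz hψ
  · refine (Category.assoc _ _ _).symm.trans ?_
    refine (congrArg (· ≫ ψ) e1).trans ?_
    rw [Category.assoc, hβ, tensorPoint_specOverMap, Category.assoc]
  · rw [← Spec.map_comp] at e1
    have e1' : β'.hom (θ z) = bcO O f (β z) :=
      congrArg (fun q => q.hom z) (Spec.map_injective (e1.trans (Spec.map_comp _ _).symm))
    rw [← Spec.map_comp] at e2
    have e2' : β'.hom (ι r) = r ⊗ₜ 1 :=
      congrArg (fun q => q.hom r) (Spec.map_injective e2)
    have h1 : (r ⊗ₜ[A] z : B ⊗[A] E) = ι r * θ z := by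
      change _ = (r ⊗ₜ[A] 1) * (1 ⊗ₜ[A] z)
      rw [Algebra.TensorProduct.tmul_mul_tmul, mul_one, one_mul]
    rw [h1, map_mul, e1', e2', Algebra.smul_def]
    rfl

theorem mem_smul_of_tmul_eq_zero {A E : Type*} [CommRing A] [AddCommGroup E] [Module A E]
    {I : Ideal A} {w : E} (h : (1 ⊗ₜ w : (A ⧸ I) ⊗[A] E) = 0) : w ∈ I • (⊤ : Submodule A E) := by
  have h1 := congrArg (TensorProduct.quotTensorEquivQuotSMul E I) h
  rw [map_zero] at h1
  refine (Submodule.Quotient.mk_eq_zero _).1 (Eq.trans ?_ h1)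
  exact ((TensorProduct.quotTensorEquivQuotSMul_mk_tmul I 1 w).trans
    (congrArg Submodule.Quotient.mk (one_smul A w))).symm

attribute [local instance] coverAlgebra

theorem Crimp.IsChart.rangeSub_baseChange {E' : Type u} [CommRing E']
    {f : A →ₐ[k] B}
    {α' : B ⊗[k] k⟦X⟧ →+* E'} {β' : E' →+* B ⊗[k] O}
    (h : D.IsChart x α β) (h' : D.IsChart (specOverMap f ≫ x) α' β') :
    rangeSub α' β' h'.comp = Submodule.span (B ⊗[k] k⟦X⟧) (bcO O f '' rangeSub α β h.comp) := by
  let := (α.comp (Algebra.TensorProduct.includeLeftRingHom)).toAlgebra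
  let := f.toRingHom.toAlgebra
  obtain ⟨α₁, β₁, h₁, h₂⟩ := h.baseChange (fun r => rfl) f rfl
  apply le_antisymm
  · rintro _ ⟨z, rfl⟩
    obtain ⟨w, hw⟩ := h'.range_le h₁ z
    rw [← hw]
    clear hw
    induction w with
    | zero => rw [map_zero]; exact Submodule.zero_mem _
    | add y z hy hz => rw [map_add]; exact Submodule.add_mem _ hy hz
    | tmul r z =>
      rw [h₂, ← algebraMap_cover_smul]
      exact Submodule.smul_mem _ _ (Submodule.subset_span ⟨_, ⟨z, rfl⟩, rfl⟩)
  · rw [Submodule.span_le]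
    rintro _ ⟨_, ⟨z, rfl⟩, rfl⟩
    obtain ⟨w, hw⟩ := h₁.range_le h' (1 ⊗ₜ z)
    exact ⟨w, by rw [hw, h₂, one_smul]⟩

/-- The lattice `E` of a crimp satisfies `E ∩ I (A ⊗ O) = I E` for ideals `I` of `A`, because `E /
I E` still embeds in `(A / I) ⊗ O`, as the lattice of a crimp over `A / I`. -/
theorem Crimp.IsChart.mem_smul (h : D.IsChart x α β) (I : Ideal A) (z : A ⊗[k] O)
    (hz : z ∈ rangeSub α β h.comp) (hI : z ∈ I • (⊤ : Submodule A (A ⊗[k] O))) :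
    z ∈ I • (rangeSub α β h.comp).restrictScalars A := by
  let := (α.comp (Algebra.TensorProduct.includeLeftRingHom)).toAlgebra
  let f := Ideal.Quotient.mkₐ k I
  obtain ⟨α₁, β₁, h₁, h₂⟩ := h.baseChange (fun r => rfl) f rfl
  obtain ⟨w, rfl⟩ := hz
  let βA : E →ₗ[A] A ⊗[k] O :=
    { β with
      map_smul' := fun r z => by
        rw [Algebra.smul_def]
        refine (map_mul β _ _).trans ?_
        refine (congrArg (· * β z) (h.comp _)).trans ?_
        exact ((coverAlgHom k O A).commutes r ▸ Algebra.smul_def r (β z)).symm }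
  have h0 : bcO O f (β w) = 0 := by
    refine Submodule.smul_induction_on hI (fun r hr y _ => ?_) fun y y' hy hy' => ?_
    · have h1 : f r = 0 := Ideal.Quotient.eq_zero_iff_mem.2 hr
      rw [Algebra.smul_def, map_mul]
      change f r ⊗ₜ 1 * _ = _
      rw [h1, TensorProduct.zero_tmul, zero_mul]
    · rw [map_add, hy, hy', add_zero]
  -- The base change of the chart to `A / I` is again a chart of a crimp, so `E / I E` embeds in
  -- `(A / I) ⊗ O`.
  have h3 : (1 ⊗ₜ w : (A ⧸ I) ⊗[A] E) = 0 := h₁.injective (by rw [h₂, h0, smul_zero, map_zero])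
  have h4 : w ∈ I • (⊤ : Submodule A E) := mem_smul_of_tmul_eq_zero h3
  have h5 := Submodule.mem_map_of_mem (f := βA) h4
  rw [Submodule.map_smul''] at h5
  have h6 : Submodule.map βA ⊤ ≤ (rangeSub α β h.comp).restrictScalars A := by
    rintro _ ⟨y, -, rfl⟩
    exact ⟨y, rfl⟩
  exact Submodule.smul_mono le_rfl h6 h5

end

/-! ### The family of a crimp -/

section
variable {k : Type u} [Field k]
  {A B : Type u} [CommRing A] [Algebra k A] [CommRing B] [Algebra k B]
  {O : Type u} [CommRing O] [Algebra k O] [Algebra k⟦X⟧ O] [IsScalarTower k k⟦X⟧ O] {b d a : ℕ}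
  {T : Over (Spec (CommRingCat.of k))} (D : Crimp O d b T) (x : specOver k A ⟶ T)
  {E E' : Type u} [CommRing E] [CommRing E']
  {δ : ℚ}

attribute [local instance] coverAlgebra

/-- The lattice of functions does not depend on the chart. -/
theorem Crimp.exists_sub : ∃ L : Submodule (A ⊗[k] k⟦X⟧) (A ⊗[k] O),
    ∀ (E : Type u) [CommRing E] (α : A ⊗[k] k⟦X⟧ →+* E) (β : E →+* A ⊗[k] O)
      (h : D.IsChart x α β), rangeSub α β h.comp = L := by
  obtain ⟨E', _, α', β', h'⟩ := D.exists_isChart x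
  refine ⟨rangeSub α' β' h'.comp, fun E _ α β h => le_antisymm ?_ ?_⟩
  · rintro _ ⟨z, rfl⟩
    exact h.range_le h' z
  · rintro _ ⟨z, rfl⟩
    exact h'.range_le h z

/-- The lattice of functions on a crimp over `Spec A`, as a submodule of `A ⊗ O`. -/
def Crimp.sub : Submodule (A ⊗[k] k⟦X⟧) (A ⊗[k] O) := (D.exists_sub x).choose

variable {D x} {α : A ⊗[k] k⟦X⟧ →+* E} {β : E →+* A ⊗[k] O}

theorem Crimp.IsChart.rangeSub_eq (h : D.IsChart x α β) : rangeSub α β h.comp = D.sub x :=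
  (D.exists_sub x).choose_spec E α β h

theorem Crimp.IsChart.mem_sub (h : D.IsChart x α β) {z : A ⊗[k] O} :
    z ∈ D.sub x ↔ ∃ w, β w = z := by
  rw [← h.rangeSub_eq]
  exact Iff.rfl

variable (D x)

theorem Crimp.sub_specOverMap (f : A →ₐ[k] B) :
    D.sub (specOverMap f ≫ x) = Submodule.span (B ⊗[k] k⟦X⟧) (bcO O f '' D.sub x) := by
  obtain ⟨E, _, α, β, h⟩ := D.exists_isChart x
  obtain ⟨E', _, α', β', h'⟩ := D.exists_isChart (specOverMap f ≫ x)
  rw [← h.rangeSub_eq, ← h'.rangeSub_eq, h.rangeSub_baseChange h']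

theorem Crimp.hasLocDiscr (o : Module.Basis (Fin d) k⟦X⟧ O) :
    HasLocDiscr (D.sub x) d (tR k A ^ b) True := by
  obtain ⟨E, _, α, β, h⟩ := D.exists_isChart x
  exact h.rangeSub_eq ▸ h.hasLocDiscr o

theorem Crimp.isQuotSub (o : Module.Basis (Fin d) k⟦X⟧ O)
    (ha : Associated (Algebra.discr k⟦X⟧ o) (PowerSeries.X ^ a)) :
    IsQuotSub (scalars O b) (((b : ℚ) - a) / 2) (imageSub b (D.sub x)) := by
  refine isQuotSub_imageSub (D.hasLocDiscr x o) o ha ?_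
  obtain ⟨E, _, α, β, h⟩ := D.exists_isChart x
  rw [← h.rangeSub_eq]
  exact fun I z => h.mem_smul I z

/-- The family of quotients of `F` defined by a crimp. -/
def Crimp.family (o : Module.Basis (Fin d) k⟦X⟧ O)
    (ha : Associated (Algebra.discr k⟦X⟧ o) (PowerSeries.X ^ a)) :
    QuotFamily O b (((b : ℚ) - a) / 2) T where
  S A _ _ x := imageSub b (D.sub x)
  smul_mem A _ _ x r s hs := by
    rw [← mulLeft_baseChange]
    exact stable_imageSub _ ⟨r, rfl⟩ s hs
  finite A _ _ x := (D.isQuotSub x o ha).finite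
  projective A _ _ x := (D.isQuotSub x o ha).projective
  rank_eq A _ _ x := (D.isQuotSub x o ha).rank_eq
  map_eq A B _ _ _ _ f x := by
    rw [D.sub_specOverMap, ← bcSub_imageSub]
    rfl

variable (o : Module.Basis (Fin d) k⟦X⟧ O)
    (ha : Associated (Algebra.discr k⟦X⟧ o) (PowerSeries.X ^ a))

theorem Crimp.isSubalgebra_family : (D.family o ha).IsSubalgebra where
  mul_mem A _ _ x := by
    obtain ⟨E, _, α, β, h⟩ := D.exists_isChart x
    rintro _ ⟨z, hz, rfl⟩ _ ⟨w, hw, rfl⟩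
    obtain ⟨z, rfl⟩ := h.mem_sub.1 hz
    obtain ⟨w, rfl⟩ := h.mem_sub.1 hw
    exact ⟨β (z * w), h.mem_sub.2 ⟨_, rfl⟩, by rw [map_mul, map_mul]⟩
  one_mem A _ _ x := by
    obtain ⟨E, _, α, β, h⟩ := D.exists_isChart x
    exact ⟨1, h.mem_sub.2 ⟨1, map_one _⟩, map_one _⟩

theorem Crimp.sub_family : (D.family o ha).sub x = D.sub x := by
  obtain ⟨m, hm⟩ := exists_basis_cover (A := A) o
  exact liftSub_imageSub ((D.hasLocDiscr x o).smul_mem m)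

theorem Crimp.isInY_family : (D.family o ha).IsInY d := by
  rw [QuotFamily.isInY_iff o]
  refine ⟨D.isSubalgebra_family o ha, fun A _ _ x => ?_⟩
  rw [D.sub_family x o ha]
  intro y
  obtain ⟨f, hf, e, he, n, h1, h2⟩ := D.hasLocDiscr x o y
  exact ⟨f, hf, e, he, n, h1, False.elim⟩

variable {D x} {o ha}

/-- A subalgebra with the same image in `A ⊗ O` gives another chart. -/
theorem Crimp.IsChart.of_range {α' : A ⊗[k] k⟦X⟧ →+* E'} {β' : E' →+* A ⊗[k] O}
    (h : D.IsChart x α β) (hinj : Function.Injective β') (hr : ∀ z, (∃ w, β' w = z) ↔ z ∈ D.sub x)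
    (comp : ∀ r, β' (α' r) = coverAlgHom k O A r) : D.IsChart x α' β' := by
  have hrange : β.range = β'.range := by
    ext z
    exact h.mem_sub.symm.trans (hr z).symm
  let i : E ≃+* β.range := RingEquiv.ofBijective β.rangeRestrict
    ⟨fun y z hyz => h.injective (congrArg Subtype.val hyz), β.rangeRestrict_surjective⟩
  let i' : E' ≃+* β'.range := RingEquiv.ofBijective β'.rangeRestrict
    ⟨fun y z hyz => hinj (congrArg Subtype.val hyz), β'.rangeRestrict_surjective⟩
  let e : E ≃+* E' := (i.trans (RingEquiv.subringCongr hrange)).trans i'.symm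
  have he : ∀ z, β' (e z) = β z := fun z =>
    congrArg Subtype.val (i'.apply_symm_apply (RingEquiv.subringCongr hrange (i z)))
  let σ : CommRingCat.of E ⟶ CommRingCat.of E' := CommRingCat.ofHom e.toRingHom
  have : IsIso σ := e.toCommRingCatIso.isIso_hom
  have h1 : Spec.map σ ≫ Spec.map (CommRingCat.ofHom α) = Spec.map (CommRingCat.ofHom α') := by
    rw [← Spec.map_comp]
    exact congrArg (fun q => Spec.map (CommRingCat.ofHom q)) (RingHom.ext fun r =>
      hinj ((he _).trans ((h.comp r).trans (comp r).symm)))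
  have h2 : Spec.map (CommRingCat.ofHom β') ≫ Spec.map σ = Spec.map (CommRingCat.ofHom β) := by
    rw [← Spec.map_comp]
    exact congrArg (fun q => Spec.map (CommRingCat.ofHom q)) (RingHom.ext he)
  obtain ⟨ψ, hψ, hβ⟩ := h.exists_hom
  refine ⟨comp, Spec.map σ ≫ ψ, ?_, ?_⟩
  · have h3 := (IsPullback.of_horiz_isIso ⟨h1.trans (Category.comp_id _).symm⟩).paste_horiz hψ
    rw [Category.id_comp] at h3
    exact h3
  · rw [← Category.assoc, h2, hβ]

variable {Q : QuotFamily O b δ T}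

theorem QuotFamily.IsSubalgebra.constructs_iff (hQ : Q.IsSubalgebra) :
    hQ.Constructs D ↔ ∀ (A : Type u) [CommRing A] [Algebra k A] (x : specOver k A ⟶ T),
      D.IsChart x (hQ.str x).toRingHom (hQ.OC x).val.toRingHom :=
  ⟨fun h A _ _ x => ⟨fun _ => rfl, h A x⟩, fun h A _ _ x => (h A x).exists_hom⟩

theorem QuotFamily.IsSubalgebra.isChart_iff (hQ : Q.IsSubalgebra) (x : specOver k A ⟶ T) :
    D.IsChart x (hQ.str x).toRingHom (hQ.OC x).val.toRingHom ↔ D.sub x = Q.sub x := by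
  have hr : ∀ z, (∃ w, (hQ.OC x).val.toRingHom w = z) ↔ z ∈ Q.sub x := fun z =>
    ⟨fun ⟨w, hw⟩ => hw ▸ w.2, fun h => ⟨⟨z, h⟩, rfl⟩⟩
  constructor
  · intro h
    ext z
    exact h.mem_sub.trans (hr z)
  · intro h
    obtain ⟨E, _, α, β, hc⟩ := D.exists_isChart x
    exact hc.of_range Subtype.val_injective (fun z => h ▸ hr z) fun _ => rfl

/-- A crimp is the one constructed from a family of subalgebras if and only if their lattices
agree at all points. -/
theorem QuotFamily.IsSubalgebra.constructs_iff_sub (hQ : Q.IsSubalgebra) :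
    hQ.Constructs D ↔ ∀ (A : Type u) [CommRing A] [Algebra k A] (x : specOver k A ⟶ T),
      D.sub x = Q.sub x := by
  rw [hQ.constructs_iff]
  exact forall_congr' fun A => forall_congr' fun _ => forall_congr' fun _ => forall_congr' fun x =>
    hQ.isChart_iff x

theorem Crimp.constructs_family : (D.isSubalgebra_family o ha).Constructs D := by
  rw [QuotFamily.IsSubalgebra.constructs_iff_sub]
  exact fun A _ _ x => (D.sub_family x o ha).symm

theorem QuotFamily.S_eq_of_sub_eq {Q Q' : QuotFamily O b δ T} (h : Q.sub x = Q'.sub x) :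
    Q.S A x = Q'.S A x := by
  ext z
  obtain ⟨w, rfl⟩ := projF_surjective b z
  change w ∈ Q.sub x ↔ w ∈ Q'.sub x
  rw [h]

end

/-! ### Crimps are determined by their lattices -/

section

/-- The pullback of an affine open cover along a morphism for which the preimages are affine. -/
def AffineOpenCover.ofIsPullback {Z X : Scheme.{u}} {h : Z ⟶ X}
    (𝒰 : Scheme.AffineOpenCover.{u} X) {E : 𝒰.I₀ → CommRingCat.{u}} {ψ : ∀ i, Spec (E i) ⟶ Z}
    {π : ∀ i, Spec (E i) ⟶ Spec (𝒰.X i)} (H : ∀ i, IsPullback (ψ i) (π i) h (𝒰.f i)) :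
    Scheme.AffineOpenCover.{u} Z where
  I₀ := 𝒰.I₀
  X := E
  f := ψ
  idx z := 𝒰.idx (h z)
  covers z := by
    obtain ⟨w, hw⟩ := 𝒰.covers (h z)
    obtain ⟨y, hy, -⟩ := Scheme.exists_preimage_of_isPullback (H (𝒰.idx (h z))) z w hw.symm
    exact ⟨y, hy⟩
  map_prop i := MorphismProperty.of_isPullback (H i).flip (𝒰.map_prop i)

variable {k : Type u} [Field k]
  {A B : Type u} [CommRing A] [Algebra k A] [CommRing B] [Algebra k B]
  {O : Type u} [CommRing O] [Algebra k O] [Algebra k⟦X⟧ O] [IsScalarTower k k⟦X⟧ O] {b d a : ℕ}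
  {T : Over (Spec (CommRingCat.of k))} {D D' : Crimp O d b T} {x : specOver k A ⟶ T}

/-- Crimps with the same lattice at a point have a common chart there. -/
theorem Crimp.exists_common_chart (h : D.sub x = D'.sub x) :
    ∃ (E : Type u) (_ : CommRing E) (α : A ⊗[k] k⟦X⟧ →+* E) (β : E →+* A ⊗[k] O),
      D.IsChart x α β ∧ D'.IsChart x α β := by
  obtain ⟨E, _, α, β, hc⟩ := D.exists_isChart x
  obtain ⟨E', _, α', β', hc'⟩ := D'.exists_isChart x
  exact ⟨E, _, α, β, hc, hc'.of_range hc.injective (fun z => h ▸ hc.mem_sub.symm) hc.comp⟩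

/-- Functoriality of charts in the point of `T`. -/
theorem exists_chart_map {E F : CommRingCat.{u}} {f : A →ₐ[k] B}
    {C : Scheme.{u}} {ν : prodSpec O T ⟶ C} {φ : C ⟶ prodSpec k⟦X⟧ T}
    {α : CommRingCat.of (A ⊗[k] k⟦X⟧) ⟶ E} {β : E ⟶ CommRingCat.of (A ⊗[k] O)}
    {γ : CommRingCat.of (B ⊗[k] k⟦X⟧) ⟶ F} {ε : F ⟶ CommRingCat.of (B ⊗[k] O)}
    (hβ : Spec.map β ≫ Spec.map α = specMap ((coverAlgHom k O A).restrictScalars k))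
    (hε : Spec.map ε ≫ Spec.map γ = specMap ((coverAlgHom k O B).restrictScalars k))
    {ψ : Spec E ⟶ C} {χ : Spec F ⟶ C}
    (hψ : IsPullback ψ (Spec.map α) φ (tensorPoint k⟦X⟧ x))
    (hψ' : Spec.map β ≫ ψ = tensorPoint O x ≫ ν)
    (hχ : χ ≫ φ = Spec.map γ ≫ tensorPoint k⟦X⟧ (specOverMap f ≫ x))
    (hχ' : Spec.map ε ≫ χ = tensorPoint O (specOverMap f ≫ x) ≫ ν) :
    ∃ θ : Spec F ⟶ Spec E, θ ≫ ψ = χ ∧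
      θ ≫ Spec.map α = Spec.map γ ≫ specMap (bcO k⟦X⟧ f) ∧
      Spec.map ε ≫ θ = specMap (bcO O f) ≫ Spec.map β := by
  rw [tensorPoint_specOverMap, ← Category.assoc] at hχ
  refine ⟨hψ.lift _ _ hχ, hψ.lift_fst _ _ _, hψ.lift_snd _ _ _, ?_⟩
  apply hψ.hom_ext
  · rw [Category.assoc, hψ.lift_fst, hχ', tensorPoint_specOverMap, Category.assoc, Category.assoc,
      hψ']
  · rw [Category.assoc, hψ.lift_snd, Category.assoc, hβ, ← Category.assoc, hε, ← specMap_comp,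
      ← specMap_comp]
    congr 1
    exact AlgHom.ext fun r => (bcO_coverAlgHom f r).symm

/-- Compatibility of common charts of two crimps along a base change `f`. The point `p` of the
chart over `A` comes from the section `r` of the chart over `B`, and the morphism between the
charts is the same for both crimps, because it is determined by its composite with the inclusion
of `C̃`. -/
theorem comp_chart_eq_of_common_chart {y : specOver k B ⟶ T} {f : A →ₐ[k] B}
    (hy : specOverMap f ≫ x = y)
    {E F : CommRingCat.{u}}
    {α : CommRingCat.of (A ⊗[k] k⟦X⟧) ⟶ E} {β : E ⟶ CommRingCat.of (A ⊗[k] O)}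
    {γ : CommRingCat.of (B ⊗[k] k⟦X⟧) ⟶ F} {ε : F ⟶ CommRingCat.of (B ⊗[k] O)}
    (hβ : Spec.map β ≫ Spec.map α = specMap ((coverAlgHom k O A).restrictScalars k))
    (hε : Spec.map ε ≫ Spec.map γ = specMap ((coverAlgHom k O B).restrictScalars k))
    (hinj : Function.Injective ε.hom)
    {ψ : Spec E ⟶ D.C} {ψ' : Spec E ⟶ D'.C} {χ : Spec F ⟶ D.C} {χ' : Spec F ⟶ D'.C}
    (hψ : IsPullback ψ (Spec.map α) D.φ (tensorPoint k⟦X⟧ x))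
    (hψν : Spec.map β ≫ ψ = tensorPoint O x ≫ D.ν)
    (hψ' : IsPullback ψ' (Spec.map α) D'.φ (tensorPoint k⟦X⟧ x))
    (hψν' : Spec.map β ≫ ψ' = tensorPoint O x ≫ D'.ν)
    (hχ : χ ≫ D.φ = Spec.map γ ≫ tensorPoint k⟦X⟧ y)
    (hχν : Spec.map ε ≫ χ = tensorPoint O y ≫ D.ν)
    (hχ' : χ' ≫ D'.φ = Spec.map γ ≫ tensorPoint k⟦X⟧ y)
    (hχν' : Spec.map ε ≫ χ' = tensorPoint O y ≫ D'.ν)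
    {p : Spec (CommRingCat.of B) ⟶ Spec E} {r : Spec (CommRingCat.of B) ⟶ Spec F}
    (hp : p ≫ Spec.map α ≫ specMap (Algebra.TensorProduct.includeLeft : A →ₐ[k] A ⊗[k] k⟦X⟧) =
      specMap f)
    (hr : r ≫ χ = p ≫ ψ)
    (hr' : r ≫ Spec.map γ ≫ specMap (Algebra.TensorProduct.includeLeft : B →ₐ[k] B ⊗[k] k⟦X⟧) =
      𝟙 _) : p ≫ ψ' = r ≫ χ' := by
  subst hy
  obtain ⟨θ, h1, h2, h3⟩ := exists_chart_map hβ hε hψ hψν hχ hχν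
  obtain ⟨θ', h1', h2', h3'⟩ := exists_chart_map hβ hε hψ' hψν' hχ' hχν'
  -- Both morphisms of charts extend the base change of `C̃`, and functions on the chart embed in
  -- functions on `C̃`.
  have hθ : θ = θ' := by
    obtain ⟨t, rfl⟩ := Spec.map_surjective θ
    obtain ⟨t', rfl⟩ := Spec.map_surjective θ'
    have h4 := h3.trans h3'.symm
    rw [← Spec.map_comp, ← Spec.map_comp] at h4
    congr 1
    refine ConcreteCategory.hom_ext _ _ fun z => hinj ?_
    exact congrArg (fun q => q.hom z) (Spec.map_injective h4)
  have hrθ : r ≫ θ = p := by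
    apply hψ.hom_ext
    · rw [Category.assoc, h1, hr]
    · apply (isPullback_tensorPoint k⟦X⟧ x).hom_ext
      · rw [Category.assoc, Category.assoc, Category.assoc, ← hψ.w, ← Category.assoc θ, h1,
          ← Category.assoc, hr, Category.assoc]
      · rw [Category.assoc, Category.assoc, Category.assoc, hp, ← Category.assoc θ, h2,
          Category.assoc, (isPullback_specMap_bcO k⟦X⟧ f).w, ← Category.assoc, ← Category.assoc]
        rw [Category.assoc r, hr', Category.id_comp]
  rw [← hrθ, Category.assoc, hθ, h1']

/-- Common charts of two crimps with the same lattices have the same overlaps in both curves. -/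
theorem comp_chart_eq_of_comp_eq (h : ∀ (A : Type u) [CommRing A] [Algebra k A] (x : specOver k A ⟶
    T),
      D.sub x = D'.sub x) {A₁ A₂ : Type u} [CommRing A₁] [Algebra k A₁] [CommRing A₂] [Algebra k A₂]
    {x₁ : specOver k A₁ ⟶ T} {x₂ : specOver k A₂ ⟶ T} {E₁ E₂ : CommRingCat.{u}}
    {α₁ : CommRingCat.of (A₁ ⊗[k] k⟦X⟧) ⟶ E₁} {β₁ : E₁ ⟶ CommRingCat.of (A₁ ⊗[k] O)}
    {α₂ : CommRingCat.of (A₂ ⊗[k] k⟦X⟧) ⟶ E₂} {β₂ : E₂ ⟶ CommRingCat.of (A₂ ⊗[k] O)}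
    (hβ₁ : Spec.map β₁ ≫ Spec.map α₁ = specMap ((coverAlgHom k O A₁).restrictScalars k))
    (hβ₂ : Spec.map β₂ ≫ Spec.map α₂ = specMap ((coverAlgHom k O A₂).restrictScalars k))
    {ψ₁ : Spec E₁ ⟶ D.C} {ψ₁' : Spec E₁ ⟶ D'.C} {ψ₂ : Spec E₂ ⟶ D.C} {ψ₂' : Spec E₂ ⟶ D'.C}
    (hψ₁ : IsPullback ψ₁ (Spec.map α₁) D.φ (tensorPoint k⟦X⟧ x₁))
    (hψν₁ : Spec.map β₁ ≫ ψ₁ = tensorPoint O x₁ ≫ D.ν)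
    (hψ₁' : IsPullback ψ₁' (Spec.map α₁) D'.φ (tensorPoint k⟦X⟧ x₁))
    (hψν₁' : Spec.map β₁ ≫ ψ₁' = tensorPoint O x₁ ≫ D'.ν)
    (hψ₂ : IsPullback ψ₂ (Spec.map α₂) D.φ (tensorPoint k⟦X⟧ x₂))
    (hψν₂ : Spec.map β₂ ≫ ψ₂ = tensorPoint O x₂ ≫ D.ν)
    (hψ₂' : IsPullback ψ₂' (Spec.map α₂) D'.φ (tensorPoint k⟦X⟧ x₂))
    (hψν₂' : Spec.map β₂ ≫ ψ₂' = tensorPoint O x₂ ≫ D'.ν)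
    {B : CommRingCat.{u}} {p : Spec B ⟶ Spec E₁} {q : Spec B ⟶ Spec E₂}
    (hpq : p ≫ ψ₁ = q ≫ ψ₂) : p ≫ ψ₁' = q ≫ ψ₂' := by
  obtain ⟨_, y, hy⟩ := exists_point B (p ≫ ψ₁ ≫ D.φ ≫ prodSnd k⟦X⟧ T)
  have e₁ : (p ≫ Spec.map α₁ ≫
      specMap (Algebra.TensorProduct.includeLeft : A₁ →ₐ[k] A₁ ⊗[k] k⟦X⟧)) ≫ pointHom x₁ =
      pointHom y := by
    rw [hy, Category.assoc, Category.assoc, ← tensorPoint_snd, ← Category.assoc (Spec.map α₁),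
      ← hψ₁.w, Category.assoc]
  have e₂ : (q ≫ Spec.map α₂ ≫
      specMap (Algebra.TensorProduct.includeLeft : A₂ →ₐ[k] A₂ ⊗[k] k⟦X⟧)) ≫ pointHom x₂ =
      pointHom y := by
    rw [hy, ← Category.assoc p, hpq, Category.assoc, Category.assoc, Category.assoc,
      ← tensorPoint_snd, ← Category.assoc (Spec.map α₂), ← hψ₂.w, Category.assoc]
  obtain ⟨f₁, hf₁, hy₁⟩ := exists_algHom_of_pointHom x₁ y _ e₁
  obtain ⟨f₂, hf₂, hy₂⟩ := exists_algHom_of_pointHom x₂ y _ e₂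
  obtain ⟨F, _, γ, ε, hc, hc'⟩ := Crimp.exists_common_chart (h B y)
  obtain ⟨χ, hχ, hχν⟩ := hc.exists_hom
  obtain ⟨χ', hχ', hχν'⟩ := hc'.exists_hom
  have hρ : (p ≫ ψ₁ ≫ D.φ) ≫ prodSnd k⟦X⟧ T = 𝟙 _ ≫ pointHom y := by
    rw [hy, Category.id_comp, Category.assoc, Category.assoc]
  have hρ' : (p ≫ ψ₁) ≫ D.φ = (isPullback_tensorPoint k⟦X⟧ y).lift _ _ hρ ≫
      tensorPoint k⟦X⟧ y := by
    rw [IsPullback.lift_fst, Category.assoc]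
  have hr : hχ.lift _ _ hρ' ≫ χ = p ≫ ψ₁ := hχ.lift_fst _ _ _
  have hr' : hχ.lift _ _ hρ' ≫ Spec.map (CommRingCat.ofHom γ) ≫
      specMap (Algebra.TensorProduct.includeLeft : B →ₐ[k] B ⊗[k] k⟦X⟧) = 𝟙 _ := by
    rw [← Category.assoc, hχ.lift_snd, IsPullback.lift_snd]
    rfl
  have k₁ := comp_chart_eq_of_common_chart hy₁ hβ₁ (specMap_coverAlgHom hc.comp) hc.injective hψ₁ hψν₁
    hψ₁' hψν₁'
    hχ.w hχν hχ'.w hχν' hf₁.symm hr hr'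
  have k₂ := comp_chart_eq_of_common_chart hy₂ hβ₂ (specMap_coverAlgHom hc.comp) hc.injective hψ₂ hψν₂
    hψ₂' hψν₂'
    hχ.w hχν hχ'.w hχν' hf₂.symm (hr.trans hpq) hr'
  exact k₁.trans k₂.symm

/-- A crimp is determined up to isomorphism by its lattices: common charts cover both curves, and
the identifications of the charts glue. -/
theorem Crimp.equiv_of_sub_eq
    (h : ∀ (A : Type u) [CommRing A] [Algebra k A] (x : specOver k A ⟶ T),
      D.sub x = D'.sub x) : D ≈ D' := by
  obtain ⟨𝒰⟩ : Nonempty (Scheme.AffineOpenCover.{u} T.left) := ⟨T.left.affineOpenCover⟩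
  choose alg x hx using fun i => exists_point (𝒰.X i) (𝒰.f i)
  choose E ring α β hc hc' using fun i => Crimp.exists_common_chart (h _ (x i))
  choose ψ hψ hψν using fun i => (hc i).exists_hom
  choose ψ' hψ' hψν' using fun i => (hc' i).exists_hom
  have hO : ∀ i, IsPullback (tensorPoint O (x i))
      (specMap (Algebra.TensorProduct.includeLeft : 𝒰.X i →ₐ[k] 𝒰.X i ⊗[k] O))
      (prodSnd O T) (𝒰.f i) := fun i => hx i ▸ isPullback_tensorPoint O (x i)
  have hR : ∀ i, IsPullback (tensorPoint k⟦X⟧ (x i))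
      (specMap (Algebra.TensorProduct.includeLeft : 𝒰.X i →ₐ[k] 𝒰.X i ⊗[k] k⟦X⟧))
      (prodSnd k⟦X⟧ T) (𝒰.f i) := fun i => hx i ▸ isPullback_tensorPoint k⟦X⟧ (x i)
  let 𝒱 := AffineOpenCover.ofIsPullback 𝒰 fun i => (hψ i).paste_vert (hR i)
  let 𝒱' := AffineOpenCover.ofIsPullback 𝒰 fun i => (hψ' i).paste_vert (hR i)
  let 𝒲 := AffineOpenCover.ofIsPullback 𝒰 hO
  -- Glue the identifications of the common charts in both directions.
  obtain ⟨u, hu⟩ := AffineOpenCover.exists_glue 𝒱 ψ' fun (i j : 𝒰.I₀) B p q hpq =>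
    comp_chart_eq_of_comp_eq h (specMap_coverAlgHom (hc i).comp) (specMap_coverAlgHom (hc j).comp)
      (hψ i) (hψν i) (hψ' i) (hψν' i) (hψ j) (hψν j) (hψ' j) (hψν' j) hpq
  obtain ⟨v, hv⟩ := AffineOpenCover.exists_glue 𝒱' ψ fun (i j : 𝒰.I₀) B p q hpq =>
    comp_chart_eq_of_comp_eq (fun A _ _ x => (h A x).symm) (specMap_coverAlgHom (hc i).comp)
      (specMap_coverAlgHom (hc j).comp) (hψ' i)
      (hψν' i) (hψ i) (hψν i) (hψ' j) (hψν' j) (hψ j) (hψν j) hpq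
  refine ⟨⟨u, v, ?_, ?_⟩, ?_, ?_⟩
  · refine AffineOpenCover.hom_ext 𝒱 _ _ fun i => ?_
    refine (Category.assoc _ _ _).symm.trans ((congrArg (· ≫ v) (hu i)).trans ?_)
    exact (hv i).trans (Category.comp_id _).symm
  · refine AffineOpenCover.hom_ext 𝒱' _ _ fun i => ?_
    refine (Category.assoc _ _ _).symm.trans ((congrArg (· ≫ u) (hv i)).trans ?_)
    exact (hu i).trans (Category.comp_id _).symm
  · refine AffineOpenCover.hom_ext 𝒲 _ _ fun i => ?_
    refine (Category.assoc _ _ _).symm.trans ((congrArg (· ≫ u) (hψν i).symm).trans ?_)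
    refine (Category.assoc _ _ _).trans ((congrArg (_ ≫ ·) (hu i)).trans (hψν' i))
  · refine AffineOpenCover.hom_ext 𝒱 _ _ fun i => ?_
    refine (Category.assoc _ _ _).symm.trans ((congrArg (· ≫ D'.φ) (hu i)).trans ?_)
    exact (hψ' i).w.trans (hψ i).w.symm

end

/-! ### The sheaf of algebras of a family -/

section
variable {k : Type u} [Field k]
  {A B : Type u} [CommRing A] [Algebra k A] [CommRing B] [Algebra k B]
  {O : Type u} [CommRing O] [Algebra k O] [Algebra k⟦X⟧ O] [IsScalarTower k k⟦X⟧ O] {b d a : ℕ}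
  {δ : ℚ} {T : Over (Spec (CommRingCat.of k))} {Q : QuotFamily O b δ T} (hQ : Q.IsSubalgebra)
  {x : specOver k A ⟶ T} {y : specOver k B ⟶ T} {f : A →ₐ[k] B}

theorem QuotFamily.IsSubalgebra.bcO_mem (hf : specOverMap f ≫ x = y) (z : hQ.OC x) :
    bcO O f z ∈ hQ.OC y := by
  change projF k O b B (bcO O f z) ∈ Q.S B y
  rw [projF_bcO, ← hf, Q.map_eq_bcSub]
  exact bcMap_mem_bcSub f z.2

/-- The restriction homomorphism between the algebras of a family along a base change of points.
-/
def QuotFamily.IsSubalgebra.mapOC (hf : specOverMap f ≫ x = y) : hQ.OC x →+* hQ.OC y :=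
  ((bcO O f).toRingHom.comp (hQ.OC x).val.toRingHom).codRestrict (hQ.OC y) (hQ.bcO_mem hf)

theorem QuotFamily.IsSubalgebra.mapOC_algebraMap (hf : specOverMap f ≫ x = y) (r : A) :
    hQ.mapOC hf (algebraMap A (hQ.OC x) r) = algebraMap B (hQ.OC y) (f r) := by
  apply Subtype.ext
  change bcO O f (r ⊗ₜ 1) = f r ⊗ₜ 1
  rw [bcO_tmul]

/-- The algebras of a family are quasi-coherent: along a localization of the base they are
localized. -/
theorem QuotFamily.IsSubalgebra.isLocalization_mapOC [Algebra A B] [IsScalarTower k A B] (r : A)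
    [IsLocalization.Away r B] (hf : specOverMap (IsScalarTower.toAlgHom k A B) ≫ x = y) :
    letI := (hQ.mapOC hf).toAlgebra
    IsLocalization.Away (algebraMap A (hQ.OC x) r) (hQ.OC y) := by
  let := (hQ.mapOC hf).toAlgebra
  have halg : ∀ z, algebraMap (hQ.OC x) (hQ.OC y) z = hQ.mapOC hf z := fun _ => rfl
  have hpow : ∀ n, algebraMap (hQ.OC x) (hQ.OC y) (algebraMap A (hQ.OC x) r ^ n) =
      algebraMap B (hQ.OC y) (algebraMap A B r) ^ n := fun n => by
    rw [map_pow, halg, hQ.mapOC_algebraMap]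
    rfl
  refine ⟨?_, ?_, ?_⟩
  · rintro ⟨_, n, rfl⟩
    rw [hpow]
    exact ((IsLocalization.Away.algebraMap_isUnit r).map (algebraMap B (hQ.OC y))).pow n
  · intro w
    obtain ⟨n, z, hz⟩ := exists_pow_smul_eq_bcMap (k := k) r (w : B ⊗[k] O)
    have h1 : bcMap _ (IsScalarTower.toAlgHom k A B) (projF k O b A z) ∈
        bcSub (IsScalarTower.toAlgHom k A B) (Q.S A x) := by
      rw [← projF_bcO, ← Q.map_eq_bcSub, hf]
      change projF k O b B (bcMap O _ z) ∈ _
      rw [← hz, ← algebraMap_smul B (r ^ n), map_smul]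
      exact (Q.S B y).smul_mem _ w.2
    obtain ⟨m, hm⟩ := exists_pow_smul_mem_of_bcMap_mem r h1
    rw [← map_smul] at hm
    refine ⟨⟨⟨r ^ m • z, hm⟩, ⟨_, m + n, rfl⟩⟩, ?_⟩
    apply Subtype.ext
    simp only
    rw [hpow]
    change (w : B ⊗[k] O) * _ = bcMap O (IsScalarTower.toAlgHom k A B) (r ^ m • z)
    rw [bcMap_smul, ← hz]
    simp only [← map_pow]
    change (w : B ⊗[k] O) * algebraMap B _ _ = _
    rw [mul_comm, ← Algebra.smul_def]
    simp only [IsScalarTower.coe_toAlgHom', algebraMap_smul]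
    rw [pow_add, mul_smul]
  · intro z w hzw
    obtain ⟨n, hn⟩ := exists_pow_smul_eq_of_bcMap_eq (k := k) (B := B) r
      (x := (z : A ⊗[k] O)) (y := w) (congrArg Subtype.val hzw)
    refine ⟨⟨_, n, rfl⟩, Subtype.ext ?_⟩
    simp only [← map_pow]
    rw [← Algebra.smul_def, ← Algebra.smul_def]
    exact hn

theorem isLocalization_away_congr {R S : Type*} [CommRing R] [CommRing S] {a a' : Algebra R S}
    {r : R} (h : @IsLocalization.Away R _ r S _ a)
    (h' : ∀ c, @algebraMap R S _ _ a c = @algebraMap R S _ _ a' c) :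
    @IsLocalization.Away R _ r S _ a' :=
  Algebra.algebra_ext a a' h' ▸ h

variable (T) in
/-- The `k`-algebra structure on the sections of a `k`-scheme over an affine open subset. -/
abbrev secAlgebra (U : T.left.AffineZariskiSite) : Algebra k Γ(T.left, U.toOpens) :=
  (Spec.preimage (U.2.fromSpec ≫ T.hom)).hom.toAlgebra

attribute [local instance] secAlgebra

variable (T) in
/-- The point of a `k`-scheme given by an affine open subset. -/
def secPoint (U : T.left.AffineZariskiSite) : specOver k Γ(T.left, U.toOpens) ⟶ T :=
  Over.homMk U.2.fromSpec (Spec.map_preimage (U.2.fromSpec ≫ T.hom)).symm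

theorem exists_secHom {U V : T.left.AffineZariskiSite} (i : V ⟶ U) :
    ∃ f : Γ(T.left, U.toOpens) →ₐ[k] Γ(T.left, V.toOpens),
      f.toRingHom = (T.left.presheaf.map
        ((Scheme.AffineZariskiSite.toOpensFunctor T.left).map i).op).hom ∧
      specOverMap f ≫ secPoint T U = secPoint T V := by
  obtain ⟨f, h1, h2⟩ := exists_algHom_of_pointHom (secPoint T U) (secPoint T V)
    (Spec.map (T.left.presheaf.map ((Scheme.AffineZariskiSite.toOpensFunctor T.left).map i).op))
    (U.2.map_fromSpec V.2 _)
  exact ⟨f, congrArg CommRingCat.Hom.hom (Spec.map_injective h1), h2⟩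

/-- The restriction of sections from an affine open subset to a smaller one, as a homomorphism of
`k`-algebras. -/
def secHom {U V : T.left.AffineZariskiSite} (i : V ⟶ U) :
    Γ(T.left, U.toOpens) →ₐ[k] Γ(T.left, V.toOpens) := (exists_secHom i).choose

theorem secHom_apply {U V : T.left.AffineZariskiSite} (i : V ⟶ U) (r : Γ(T.left, U.toOpens)) :
    secHom i r = (T.left.presheaf.map
        ((Scheme.AffineZariskiSite.toOpensFunctor T.left).map i).op).hom r :=
  congrArg (fun q => q r) (exists_secHom i).choose_spec.1

theorem specOverMap_secHom {U V : T.left.AffineZariskiSite} (i : V ⟶ U) :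
    specOverMap (secHom i) ≫ secPoint T U = secPoint T V :=
  (exists_secHom i).choose_spec.2

theorem secHom_id (U : T.left.AffineZariskiSite) : secHom (𝟙 U) = AlgHom.id k _ := by
  ext r
  exact (secHom_apply _ r).trans
    (congrArg (fun q => q.hom r) (T.left.presheaf.map_id (op U.toOpens)))

theorem secHom_comp {U V W : T.left.AffineZariskiSite} (i : V ⟶ U) (j : W ⟶ V) :
    secHom (j ≫ i) = (secHom j).comp (secHom i) := by
  ext r
  refine (secHom_apply _ r).trans (Eq.trans (congrArg (fun q => q.hom r)
    (T.left.presheaf.map_comp ((Scheme.AffineZariskiSite.toOpensFunctor T.left).map i).op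
      ((Scheme.AffineZariskiSite.toOpensFunctor T.left).map j).op)) ?_)
  exact (secHom_apply j _).symm.trans (congrArg (secHom j) (secHom_apply i r).symm)

theorem bcO_id (z : A ⊗[k] O) : bcO O (AlgHom.id k A) z = z := by
  change Algebra.TensorProduct.map _ _ z = z
  rw [Algebra.TensorProduct.map_id]
  rfl

theorem bcO_comp {C : Type u} [CommRing C] [Algebra k C] (f : A →ₐ[k] B) (g : B →ₐ[k] C)
    (z : A ⊗[k] O) : bcO O (g.comp f) z = bcO O g (bcO O f z) := by
  induction z with
  | zero => simp only [map_zero]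
  | add r s hr hs => simp only [map_add, hr, hs]
  | tmul r s => rfl

/-- The sheaf of algebras `O_C` on the affine open subsets of `T`. -/
def QuotFamily.IsSubalgebra.functorOC : T.left.AffineZariskiSiteᵒᵖ ⥤ CommRingCat.{u} where
  obj U := CommRingCat.of (hQ.OC (secPoint T U.unop))
  map i := CommRingCat.ofHom (hQ.mapOC (specOverMap_secHom i.unop))
  map_id U := by
    refine ConcreteCategory.hom_ext _ _ fun z => Subtype.ext ?_
    change bcO O (secHom (𝟙 _)) _ = _
    rw [secHom_id, bcO_id]
    rfl
  map_comp i j := by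
    refine ConcreteCategory.hom_ext _ _ fun z => Subtype.ext ?_
    change bcO O (secHom (j.unop ≫ i.unop)) _ = _
    rw [secHom_comp, bcO_comp]
    rfl

/-- The structure map from the functions on `T` to the sheaf of algebras `O_C`. -/
def QuotFamily.IsSubalgebra.functorOCStr :
    (Scheme.AffineZariskiSite.toOpensFunctor T.left).op ⋙ T.left.presheaf ⟶ hQ.functorOC where
  app U := CommRingCat.ofHom (algebraMap Γ(T.left, U.unop.toOpens) (hQ.OC (secPoint T U.unop)))
  naturality U V i := by
    refine ConcreteCategory.hom_ext _ _ fun r => ?_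
    have h := hQ.mapOC_algebraMap (specOverMap_secHom i.unop) r
    exact (h.trans (congrArg (algebraMap _ _) (secHom_apply i.unop r))).symm

/-- The sheaf of algebras `O_C` is quasi-coherent over `T`. -/
theorem QuotFamily.IsSubalgebra.coequifibered : hQ.functorOCStr.Coequifibered := by
  refine Scheme.AffineZariskiSite.coequifibered_iff_forall_isLocalizationAway.2 fun U r => ?_
  let i := homOfLE (U.basicOpen_le r)
  let : Algebra Γ(T.left, U.toOpens) Γ(T.left, (U.basicOpen r).toOpens) :=
    (secHom i).toRingHom.toAlgebra
  have : IsScalarTower k Γ(T.left, U.toOpens) Γ(T.left, (U.basicOpen r).toOpens) :=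
    .of_algebraMap_eq fun c => ((secHom i).commutes c).symm
  have : IsLocalization.Away r Γ(T.left, (U.basicOpen r).toOpens) := by
    have h := U.2.isLocalization_basicOpen r
    exact isLocalization_away_congr (h := h) fun c => (secHom_apply i c).symm
  exact hQ.isLocalization_mapOC r (specOverMap_secHom i)

end

/-! ### Gluing the curve of a family -/

section
variable {k : Type u} [Field k]
  {A B : Type u} [CommRing A] [Algebra k A] [CommRing B] [Algebra k B]
  {O : Type u} [CommRing O] [Algebra k O] [Algebra k⟦X⟧ O] [IsScalarTower k k⟦X⟧ O] {b d a : ℕ}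
  {δ : ℚ} {T : Over (Spec (CommRingCat.of k))} {Q : QuotFamily O b δ T} (hQ : Q.IsSubalgebra)
  {x : specOver k A ⟶ T} {y : specOver k B ⟶ T} {f : A →ₐ[k] B}

attribute [local instance] secAlgebra

theorem QuotFamily.IsSubalgebra.curveφ_mapOC (hf : specOverMap f ≫ x = y) :
    Spec.map (CommRingCat.ofHom (hQ.mapOC hf)) ≫ hQ.curveφ x =
      hQ.curveφ y ≫ specMap (bcO k⟦X⟧ f) := by
  change _ ≫ Spec.map _ = Spec.map _ ≫ Spec.map _
  rw [← Spec.map_comp, ← Spec.map_comp]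
  congr 1
  refine ConcreteCategory.hom_ext _ _ fun r => Subtype.ext ?_
  exact bcO_coverAlgHom f r

theorem QuotFamily.IsSubalgebra.curveν_mapOC (hf : specOverMap f ≫ x = y) :
    hQ.curveν y ≫ Spec.map (CommRingCat.ofHom (hQ.mapOC hf)) =
      specMap (bcO O f) ≫ hQ.curveν x := by
  change Spec.map _ ≫ _ = Spec.map _ ≫ Spec.map _
  rw [← Spec.map_comp, ← Spec.map_comp]
  rfl

theorem isPullback_comp_iso {C : Type*} [Category* C] {W X Y Y' Z : C} {a : W ⟶ X} {b : W ⟶ Y}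
    {c : X ⟶ Z} {d : Y ⟶ Z} (h : IsPullback a b c d) (e : Y ≅ Y') {b' : W ⟶ Y'} {d' : Y' ⟶ Z}
    (hb : b ≫ e.hom = b') (hd : e.hom ≫ d' = d) : IsPullback a b' c d' := by
  subst hb hd
  exact IsPullback.of_iso h (Iso.refl _) (Iso.refl _) e (Iso.refl _) (by simp) (by simp) (by simp)
    (by simp)

/-- The relative spectrum of the sheaf of algebras `O_C` over `T`, with its charts over the affine
open subsets of `T` and its universal property as their colimit. -/
theorem QuotFamily.IsSubalgebra.exists_glued : ∃ (C : Scheme.{u}) (π : C ⟶ T.left)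
    (ι : ∀ U : T.left.AffineZariskiSite, Spec (CommRingCat.of (hQ.OC (secPoint T U))) ⟶ C),
    (∀ U, IsPullback (ι U)
      (Spec.map (CommRingCat.ofHom (algebraMap Γ(T.left, U.toOpens) (hQ.OC (secPoint T U))))) π
      (pointHom (secPoint T U))) ∧
    (∀ {U V : T.left.AffineZariskiSite} (i : V ⟶ U),
      Spec.map (CommRingCat.ofHom (hQ.mapOC (specOverMap_secHom i))) ≫ ι U = ι V) ∧
    (∀ (Z : Scheme.{u})
      (g : ∀ U : T.left.AffineZariskiSite, Spec (CommRingCat.of (hQ.OC (secPoint T U))) ⟶ Z),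
      (∀ {U V : T.left.AffineZariskiSite} (i : V ⟶ U),
        Spec.map (CommRingCat.ofHom (hQ.mapOC (specOverMap_secHom i))) ≫ g U = g V) →
      ∃ h : C ⟶ Z, ∀ U, ι U ≫ h = g U) ∧
    ∀ (Z : Scheme.{u}) (g h : C ⟶ Z), (∀ U, ι U ≫ g = ι U ≫ h) → g = h := by
  let G := Scheme.AffineZariskiSite.relativeGluingData hQ.coequifibered
  have : (G.functor ⋙ Scheme.forget).IsLocallyDirected :=
    Scheme.Cover.RelativeGluingData.instIsLocallyDirectedI₀CompFunctorForgetOfIsThin ..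
  refine ⟨G.glued, G.toBase, fun U => colimit.ι G.functor U, fun U => ?_,
    fun i => colimit.w G.functor i, fun Z g hg => ?_, fun Z g h H => colimit.hom_ext H⟩
  · refine isPullback_comp_iso (G.isPullback_natTrans_ι_toBase U).flip U.2.isoSpec ?_ ?_
    · exact (Category.assoc _ _ _).trans ((congrArg (_ ≫ ·) U.2.isoSpec.inv_hom_id).trans
        (Category.comp_id _))
    · exact (Iso.eq_inv_comp _).1 U.2.isoSpec_inv_ι.symm
  · let c : Cocone G.functor :=
      { pt := Z
        ι :=
          { app := fun U => g U
            naturality := fun V U i => (hg i).trans (Category.comp_id _).symm } }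
    exact ⟨colimit.desc G.functor c, fun U => colimit.ι_desc c U⟩

theorem QuotFamily.IsSubalgebra.curveφ_includeLeft : hQ.curveφ x ≫
      specMap (Algebra.TensorProduct.includeLeft : _ →ₐ[k] _ ⊗[k] k⟦X⟧) =
      Spec.map (CommRingCat.ofHom (algebraMap A (hQ.OC x))) := by
  change Spec.map _ ≫ Spec.map _ = _
  rw [← Spec.map_comp]
  congr 1
  refine ConcreteCategory.hom_ext _ _ fun r => Subtype.ext ?_
  exact (coverAlgHom k O _).commutes r

theorem QuotFamily.IsSubalgebra.curveν_curveφ : hQ.curveν x ≫ hQ.curveφ x =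
      specMap ((coverAlgHom k O A).restrictScalars k) :=
  specMap_coverAlgHom (β := (hQ.OC x).val.toRingHom) (α := (hQ.str x).toRingHom) fun _ => rfl

variable (T) in
/-- The pullback of the cover by affine open subsets to a product. -/
abbrev prodCover (W : Type u) [CommRing W] [Algebra k W] : (prodSpec W T).OpenCover :=
  (Scheme.AffineZariskiSite.directedCover T.left).pullback₁ (prodSnd W T)

theorem isPullback_tensorPoint_secPoint (W : Type u) [CommRing W] [Algebra k W]
    (U : T.left.AffineZariskiSite) :
    IsPullback (tensorPoint W (secPoint T U))
      (specMap (Algebra.TensorProduct.includeLeft : _ →ₐ[k] _ ⊗[k] W) ≫ U.2.isoSpec.inv)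
      (prodSnd W T) ((Scheme.AffineZariskiSite.directedCover T.left).f U) :=
  isPullback_comp_iso (isPullback_tensorPoint W (secPoint T U)) U.2.isoSpec.symm rfl
    U.2.isoSpec_inv_ι

instance isOpenImmersion_tensorPoint (W : Type u) [CommRing W] [Algebra k W]
    (U : T.left.AffineZariskiSite) : IsOpenImmersion (tensorPoint W (secPoint T U)) :=
  MorphismProperty.of_isPullback (isPullback_tensorPoint_secPoint W U).flip
    ((Scheme.AffineZariskiSite.directedCover T.left).map_prop U)

/-- The two forms of the open cover of `Spec W × T` by the preimages of affine open subsets of `T`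
factor through each other. -/
theorem exists_prodCover_lift (W : Type u) [CommRing W] [Algebra k W]
    (U : T.left.AffineZariskiSite) :
    ∃ (l : (prodCover T W).X U ⟶ Spec (CommRingCat.of (Γ(T.left, U.toOpens) ⊗[k] W)))
      (s : Spec (CommRingCat.of (Γ(T.left, U.toOpens) ⊗[k] W)) ⟶ (prodCover T W).X U),
      l ≫ tensorPoint W (secPoint T U) = (prodCover T W).f U ∧
      s ≫ (prodCover T W).f U = tensorPoint W (secPoint T U) := by
  have H := isPullback_tensorPoint_secPoint W U
  exact ⟨H.lift (pullback.fst _ _) (pullback.snd _ _) pullback.condition,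
    pullback.lift _ _ H.w, H.lift_fst _ _ _, pullback.lift_fst _ _ _⟩

theorem specMap_bcO_secHom (W : Type u) [CommRing W] [Algebra k W]
    {U V : T.left.AffineZariskiSite} (i : V ⟶ U) :
    specMap (bcO W (secHom i)) ≫ tensorPoint W (secPoint T U) = tensorPoint W (secPoint T V) := by
  rw [← tensorPoint_specOverMap, specOverMap_secHom]

theorem prodSpec_hom_ext {W : Type u} [CommRing W] [Algebra k W] {Z : Scheme.{u}}
    {g h : prodSpec W T ⟶ Z}
    (H : ∀ U, tensorPoint W (secPoint T U) ≫ g = tensorPoint W (secPoint T U) ≫ h) : g = h := by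
  refine Scheme.Cover.hom_ext (prodCover T W) _ _
    fun (U : T.left.AffineZariskiSite) => ?_
  obtain ⟨l, s, hl, hs⟩ := exists_prodCover_lift W U
  rw [← hl, Category.assoc, Category.assoc, H]

theorem exists_prodSpec_hom {W : Type u} [CommRing W] [Algebra k W] {Z : Scheme.{u}}
    (g : ∀ U : T.left.AffineZariskiSite, Spec (CommRingCat.of (Γ(T.left, U.toOpens) ⊗[k] W)) ⟶ Z)
    (hg : ∀ {U V : T.left.AffineZariskiSite} (i : V ⟶ U), specMap (bcO W (secHom i)) ≫ g U = g V) :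
    ∃ h : prodSpec W T ⟶ Z, ∀ U, tensorPoint W (secPoint T U) ≫ h = g U := by
  choose l s hl hs using exists_prodCover_lift (T := T) W
  refine ⟨Scheme.OpenCover.glueMorphismsOfLocallyDirected (prodCover T W) (fun U => l U ≫ g U)
    ?_, fun U => ?_⟩
  · intro (V : T.left.AffineZariskiSite) (U : T.left.AffineZariskiSite) i
    have e := specMap_bcO_secHom W (U := U) (V := V) i
    have h : Scheme.Cover.trans (prodCover T W) i ≫ l U = l V ≫ specMap (bcO W (secHom i)) :=
      (cancel_mono (tensorPoint W (secPoint T U))).1 <|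
        (Category.assoc _ _ _).trans <| (congrArg (_ ≫ ·) (hl U)).trans <|
        (Scheme.Cover.trans_map (prodCover T W) i).trans <| (hl V).symm.trans <|
        (congrArg (l V ≫ ·) e.symm).trans (Category.assoc _ _ _).symm
    exact (Category.assoc _ _ _).symm.trans ((congrArg (· ≫ g U) h).trans
      ((Category.assoc _ _ _).trans (congrArg (l V ≫ ·) (hg i))))
  · have h : s U ≫ l U = 𝟙 _ := by
      rw [← cancel_mono (tensorPoint W (secPoint T U)), Category.assoc, hl, hs, Category.id_comp]
    refine (congrArg (· ≫ _) (hs U).symm).trans ((Category.assoc _ _ _).trans ?_)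
    refine (congrArg (s U ≫ ·)
      ((prodCover T W).map_glueMorphismsOfLocallyDirected _ _ _)).trans ?_
    exact (Category.assoc _ _ _).symm.trans ((congrArg (· ≫ g U) h).trans (Category.id_comp _))

/-- The curve of a family of subalgebras, with its morphisms from `C̃ × T` and to `Δ × T`, and
with its description over the affine open subsets of `T`. -/
theorem QuotFamily.IsSubalgebra.exists_curve : ∃ (C : Scheme.{u}) (ν : prodSpec O T ⟶ C)
    (φ : C ⟶ prodSpec k⟦X⟧ T), ν ≫ φ = baseCover O T ∧ ∀ U : T.left.AffineZariskiSite,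
      ∃ ψ : Spec (CommRingCat.of (hQ.OC (secPoint T U))) ⟶ C,
        IsPullback ψ (hQ.curveφ (secPoint T U)) φ (tensorPoint k⟦X⟧ (secPoint T U)) ∧
        hQ.curveν (secPoint T U) ≫ ψ = tensorPoint O (secPoint T U) ≫ ν := by
  obtain ⟨C, π, ι, hπ, hι, hdesc, hext⟩ := hQ.exists_glued
  obtain ⟨φ, hφ⟩ := hdesc _
    (fun U => hQ.curveφ (secPoint T U) ≫ tensorPoint k⟦X⟧ (secPoint T U)) (fun {U V} i => by
      rw [← Category.assoc, hQ.curveφ_mapOC, Category.assoc, ← tensorPoint_specOverMap,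
        specOverMap_secHom])
  have hφπ : φ ≫ prodSnd k⟦X⟧ T = π := by
    refine hext _ _ _ fun U => ?_
    rw [← Category.assoc, hφ, Category.assoc, tensorPoint_snd, (hπ U).w, ← Category.assoc,
      curveφ_includeLeft]
  have hP : ∀ U, IsPullback (ι U) (hQ.curveφ (secPoint T U)) φ
      (tensorPoint k⟦X⟧ (secPoint T U)) := fun U => by
    refine IsPullback.of_bot ?_ (hφ U) (isPullback_tensorPoint k⟦X⟧ (secPoint T U))
    rw [curveφ_includeLeft, hφπ]
    exact hπ U
  obtain ⟨ν, hν⟩ := exists_prodSpec_hom (W := O) (T := T)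
    (fun U => hQ.curveν (secPoint T U) ≫ ι U) (fun {U V} i => by
      rw [← Category.assoc, ← hQ.curveν_mapOC (specOverMap_secHom i), Category.assoc, hι])
  refine ⟨C, ν, φ, ?_, fun U => ⟨ι U, hP U, (hν U).symm⟩⟩
  refine prodSpec_hom_ext fun U => ?_
  rw [← Category.assoc, hν, Category.assoc, hφ, ← Category.assoc, curveν_curveφ,
    tensorPoint_baseCover]

end

/-! ### Locality on the target -/

section

theorem of_forall_isPullback (P : MorphismProperty Scheme.{u}) [IsZariskiLocalAtTarget P]
    {X Y : Scheme.{u}} {φ : X ⟶ Y}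
    (h : ∀ y : Y, ∃ (X' Y' : Scheme.{u}) (ψ : X' ⟶ X) (φ' : X' ⟶ Y') (j : Y' ⟶ Y),
      IsPullback ψ φ' φ j ∧ IsOpenImmersion j ∧ (∃ y', j y' = y) ∧ P φ') : P φ := by
  choose X' Y' ψ φ' j H hj hy hP using h
  let 𝒰 : Y.OpenCover := Scheme.Cover.mkOfCovers Y Y' j (fun y => ⟨y, hy y⟩) hj
  rw [IsZariskiLocalAtTarget.iff_of_openCover (P := P) 𝒰]
  intro (y : Y)
  change P (pullback.snd φ (j y))
  rw [← (H y).isoPullback_inv_snd]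
  exact (P.cancel_left_of_respectsIso _ _).2 (hP y)

theorem isIso_restrict_of_forall_isPullback {X Y : Scheme.{u}} {φ : X ⟶ Y} (W : Y.Opens)
    (h : ∀ y : Y, ∃ (X' Y' : Scheme.{u}) (ψ : X' ⟶ X) (φ' : X' ⟶ Y') (j : Y' ⟶ Y),
      IsPullback ψ φ' φ j ∧ IsOpenImmersion j ∧ (∃ y', j y' = y) ∧ IsIso (φ' ∣_ (j ⁻¹ᵁ W))) :
    IsIso (φ ∣_ W) := by
  refine of_forall_isPullback (MorphismProperty.isomorphisms Scheme.{u}) fun w => ?_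
  obtain ⟨X', Y', ψ, φ', j, H, hj, ⟨y', hy'⟩, hi⟩ := h w.1
  have hUY : φ' ⁻¹ᵁ (j ⁻¹ᵁ W) = ψ ⁻¹ᵁ (φ ⁻¹ᵁ W) ⊓ φ' ⁻¹ᵁ (j ⁻¹ᵁ W) := by
    rw [← Scheme.Hom.comp_preimage, ← Scheme.Hom.comp_preimage, H.w, inf_idem]
  have hp := Scheme.Hom.isPullback_resLE H (le_refl (j ⁻¹ᵁ W)) (le_refl (φ ⁻¹ᵁ W)) hUY
  rw [Scheme.Hom.resLE_eq_morphismRestrict, Scheme.Hom.resLE_eq_morphismRestrict,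
    Scheme.Hom.resLE_eq_morphismRestrict] at hp
  refine ⟨_, _, _, _, _, hp, inferInstance, ⟨⟨y', ?_⟩, ?_⟩, hi⟩
  · change j y' ∈ W
    rw [hy']
    exact w.2
  · exact Subtype.ext ((morphismRestrict_base_coe _ _ _).trans hy')

theorem IsCoverWithBranch.of_forall_isPullback {X Y : Scheme.{u}} {φ : X ⟶ Y} {d : ℕ}
    {g : Γ(Y, ⊤)}
    (h : ∀ y : Y, ∃ (X' Y' : Scheme.{u}) (ψ : X' ⟶ X) (φ' : X' ⟶ Y') (j : Y' ⟶ Y),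
      IsPullback ψ φ' φ j ∧ IsOpenImmersion j ∧ (∃ y', j y' = y) ∧
        IsCoverWithBranch φ' d (j.appTop.hom g)) : IsCoverWithBranch φ d g := by
  have hloc : IsZariskiLocalAtTarget (@IsAffineHom.{u}) :=
    @HasAffineProperty.instIsZariskiLocalAtTarget _ _ instHasAffinePropertyIsAffineHomIsAffine
  have haff : IsAffineHom φ := @Crimping.of_forall_isPullback _ hloc _ _ _ fun y => by
    obtain ⟨X', Y', ψ, φ', j, H, hj, hy, hP⟩ := h y
    exact ⟨X', Y', ψ, φ', j, H, hj, hy, hP.1⟩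
  refine ⟨haff, fun y => ?_⟩
  obtain ⟨X', Y', ψ, φ', j, H, hj, ⟨y', rfl⟩, hP⟩ := h y
  obtain ⟨V, hV, hyV, e, he⟩ := hP.2 y'
  have hU : IsAffineOpen (j ''ᵁ V) := hV.image_of_isOpenImmersion j
  refine ⟨j ''ᵁ V, hU, ⟨y', hyV, rfl⟩, ?_⟩
  have hVU : V ≤ j ⁻¹ᵁ (j ''ᵁ V) := (j.preimage_image_eq V).ge
  have hle : φ' ⁻¹ᵁ V ≤ ψ ⁻¹ᵁ φ ⁻¹ᵁ (j ''ᵁ V) := by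
    rw [← Scheme.Hom.comp_preimage, H.w, Scheme.Hom.comp_preimage]
    exact fun x hx => hVU hx
  have hUY : φ' ⁻¹ᵁ V = ψ ⁻¹ᵁ (φ ⁻¹ᵁ (j ''ᵁ V)) ⊓ φ' ⁻¹ᵁ V := (inf_eq_right.mpr hle).symm
  have hpo := (isIso_pushoutSection_iff H hVU le_rfl hUY).mp
    (isIso_pushoutSection_of_isAffineOpen H hVU le_rfl hUY hU hV (hU.preimage φ))
  rw [← Scheme.Hom.app_eq_appLE, ← Scheme.Hom.app_eq_appLE] at hpo
  have hj : IsIso (j.appLE (j ''ᵁ V) V hVU) := by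
    rw [← j.appIso_hom' V]
    infer_instance
  have hψ := hpo.isIso_inl_of_isIso
  let jinv := inv (j.appLE (j ''ᵁ V) V hVU)
  have hpo' : IsPushout (φ'.app V) jinv (inv (ψ.appLE _ _ hle)) (φ.app (j ''ᵁ V)) :=
    IsPushout.of_vert_isIso ⟨by
      rw [IsIso.comp_inv_eq, Category.assoc, IsIso.eq_inv_comp]
      exact hpo.w.symm⟩
  obtain ⟨e', he'⟩ := exists_basis_of_isPushout hpo' e
  refine ⟨e', ?_⟩
  have h2 := congrArg (Ideal.map jinv.hom) he
  rw [Ideal.map_span, Ideal.map_span, Set.image_singleton, Set.image_singleton,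
    ← res_appTop j g _ V hVU] at h2
  rw [he']
  refine h2.trans (congrArg (fun z => Ideal.span {z}) ?_)
  exact congrArg (fun q => q.hom (res g (j ''ᵁ V)))
    (IsIso.hom_inv_id (j.appLE (j ''ᵁ V) V hVU))

/-- If `E` is a subalgebra of `M` which contains `s M`, then `Spec M → Spec E` is an isomorphism
over `D(s)`. -/
theorem isIso_restrict_of_exists {E M : CommRingCat.{u}} (β : E ⟶ M) (s : E)
    (hinj : Function.Injective β.hom) (h : ∀ z, ∃ x : E, β.hom x = β.hom s * z) :
    IsIso (Spec.map β ∣_ PrimeSpectrum.basicOpen s) := by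
  have hmap : ∀ x : E, Localization.awayMap β.hom s (algebraMap E _ x) =
      algebraMap M (Localization.Away (β.hom s)) (β.hom x) := fun x => by
    simp [Localization.awayMap, IsLocalization.Away.map]
  have hb : Function.Bijective (Localization.awayMap β.hom s) := by
    constructor
    · exact IsLocalization.map_injective_of_injective _ _ _ hinj
    · intro z
      obtain ⟨n, w, hw⟩ := IsLocalization.Away.surj (β.hom s) z
      obtain ⟨x, hx⟩ := h w
      have hu : IsUnit (algebraMap E (Localization.Away s) s) :=
        IsLocalization.Away.algebraMap_isUnit s
      obtain ⟨v, hv⟩ := (hu.pow (n + 1)).exists_right_inv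
      refine ⟨algebraMap E _ x * v, ?_⟩
      have hu' : IsUnit (algebraMap M (Localization.Away (β.hom s)) (β.hom s)) :=
        IsLocalization.Away.algebraMap_isUnit _
      refine (hu'.pow (n + 1)).mul_right_cancel ?_
      have h1 := congrArg (Localization.awayMap β.hom s) hv
      rw [map_mul, map_pow, hmap, map_one] at h1
      rw [map_mul, hmap, hx, map_mul, ← hw]
      linear_combination (algebraMap M (Localization.Away (β.hom s)) (β.hom s) *
        (z * algebraMap M (Localization.Away (β.hom s)) (β.hom s) ^ n)) * h1
  have : IsIso (CommRingCat.ofHom (Localization.awayMap β.hom s)) :=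
    (ConcreteCategory.isIso_iff_bijective _).2 hb
  exact (MorphismProperty.arrow_mk_iso_iff (MorphismProperty.isomorphisms Scheme)
      (SpecMapRestrictBasicOpenIso β s)).2
    (inferInstanceAs (IsIso (Spec.map (CommRingCat.ofHom (Localization.awayMap β.hom s)))))

end

/-! ### The crimp of a family -/

section
variable {k : Type u} [Field k]
  {A B : Type u} [CommRing A] [Algebra k A] [CommRing B] [Algebra k B]
  {O : Type u} [CommRing O] [Algebra k O] [Algebra k⟦X⟧ O] [IsScalarTower k k⟦X⟧ O] {b d a : ℕ}
  {T : Over (Spec (CommRingCat.of k))} {δ : ℚ} {Q : QuotFamily O b δ T}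

attribute [local instance] secAlgebra

/-- Every point of `Spec W × T` lies over an affine open subset of `T`. -/
theorem exists_tensorPoint_eq {W : Type u} [CommRing W] [Algebra k W] (y : prodSpec W T) :
    ∃ (U : T.left.AffineZariskiSite)
      (z : Spec (CommRingCat.of (Γ(T.left, U.toOpens) ⊗[k] W))),
      tensorPoint W (secPoint T U) z = y := by
  obtain ⟨U, hy⟩ : ∃ U : T.left.AffineZariskiSite, prodSnd W T y ∈ U.toOpens := by
    obtain ⟨_, ⟨U, hU, rfl⟩, hy, -⟩ := T.left.isBasis_affineOpens.exists_subset_of_mem_open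
      (Set.mem_univ (prodSnd W T y)) isOpen_univ
    exact ⟨⟨U, hU⟩, hy⟩
  obtain ⟨w, hw⟩ : prodSnd W T y ∈ Set.range (pointHom (secPoint T U)) :=
    (IsAffineOpen.range_fromSpec U.2).symm ▸ hy
  obtain ⟨z, hz, -⟩ := Scheme.exists_preimage_of_isPullback
    (isPullback_tensorPoint W (secPoint T U)) y w hw.symm
  exact ⟨U, z, hz⟩

attribute [local instance] coverAlgebra

theorem QuotFamily.IsSubalgebra.isIso_curveν (hQ : Q.IsSubalgebra) (x : specOver k A ⟶ T) :
    IsIso (hQ.curveν x ∣_ PrimeSpectrum.basicOpen (hQ.str x (tR k A ^ b))) := by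
  refine isIso_restrict_of_exists (CommRingCat.ofHom (hQ.OC x).val.toRingHom) _
    Subtype.val_injective fun z => ?_
  refine ⟨⟨tR k A ^ b • z, tR_pow_smul_mem_liftSub (hS := (Q.isQuotSub x).stable) z⟩, ?_⟩
  exact cover_smul_def _ _

theorem exists_secPoint_factor (x : specOver k A ⟶ T) (p : PrimeSpectrum A) :
    ∃ g ∉ p.asIdeal, ∃ (U : T.left.AffineZariskiSite)
      (f : Γ(T.left, U.toOpens) →ₐ[k] Localization.Away g),
      specOverMap f ≫ secPoint T U = specOverMap (locHom k g) ≫ x := by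
  obtain ⟨g, hg, U, j, hj⟩ := exists_locHom_factor (k := k)
    (Scheme.AffineZariskiSite.directedCover T.left) (pointHom x) p
  have hU : IsAffineOpen U.toOpens := U.2
  have h : (j ≫ hU.isoSpec.hom) ≫ pointHom (secPoint T U) =
      pointHom (specOverMap (locHom k g) ≫ x) := by
    refine (Category.assoc _ _ _).trans (Eq.trans ?_ hj)
    exact congrArg (j ≫ ·) ((Iso.eq_inv_comp _).1 hU.isoSpec_inv_ι.symm)
  obtain ⟨f, -, hf⟩ := exists_algHom_of_pointHom _ _ _ h
  exact ⟨g, hg, U, f, hf⟩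

/-- Families are determined by their lattices on affine open subsets. -/
theorem QuotFamily.ext_secPoint {Q Q' : QuotFamily O b δ T}
    (h : ∀ U, Q.sub (secPoint T U) = Q'.sub (secPoint T U)) : Q = Q' := by
  refine QuotFamily.ext ?_
  funext A _ _ x
  refine submodule_eq_of_forall_prime fun p => ?_
  obtain ⟨g, hg, U, f, hf⟩ := exists_secPoint_factor x p
  refine ⟨g, hg, ?_⟩
  rw [← Q.map_eq_bcSub, ← Q'.map_eq_bcSub, ← hf, Q.map_eq_bcSub, Q'.map_eq_bcSub,
    QuotFamily.S_eq_of_sub_eq (h U)]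

/-- Every family in `Y` is the family of a crimp. -/
theorem QuotFamily.IsInY.exists_crimp {Q : QuotFamily O b (((b : ℚ) - a) / 2) T} (h : Q.IsInY d)
    (o : Module.Basis (Fin d) k⟦X⟧ O)
    (ha : Associated (Algebra.discr k⟦X⟧ o) (PowerSeries.X ^ a)) :
    ∃ D : Crimp O d b T, D.family o ha = Q := by
  obtain ⟨hQ, -⟩ := id h
  obtain ⟨C, ν, φ, hνφ, H⟩ := hQ.exists_curve
  choose ψ hψ hψν using H
  -- Both conditions on a crimp are local on the target and hold over the affine open subsets of
  -- `T`.
  have hC : IsCoverWithBranch φ d (sigma b T) := by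
    refine IsCoverWithBranch.of_forall_isPullback fun y => ?_
    obtain ⟨U, z, hz⟩ := exists_tensorPoint_eq y
    refine ⟨_, _, _, _, _, hψ U, inferInstance, ⟨z, hz⟩, ?_⟩
    rw [tensorPoint_sigma]
    exact ((hQ.isCover_iff (secPoint T U) o True).2 (h.hasLocDiscr o ha rfl _)).toBranch
  have hiso : IsIso (ν ∣_ (φ ⁻¹ᵁ (prodSpec k⟦X⟧ T).basicOpen (sigma b T))) := by
    refine isIso_restrict_of_forall_isPullback _ fun y => ?_
    obtain ⟨U, z, hz⟩ := exists_tensorPoint_eq (φ y)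
    obtain ⟨w, hw, -⟩ := Scheme.exists_preimage_of_isPullback (hψ U) y z hz.symm
    have H : IsPullback (tensorPoint O (secPoint T U)) (hQ.curveν (secPoint T U)) ν (ψ U) := by
      refine IsPullback.of_bot ?_ (hψν U).symm (hψ U)
      rw [hQ.curveν_curveφ, hνφ]
      exact isPullback_tensorPoint_baseCover _
    have hψo : IsOpenImmersion (ψ U) :=
      MorphismProperty.of_isPullback (P := @IsOpenImmersion) (hψ U).flip
        (isOpenImmersion_tensorPoint k⟦X⟧ U)
    refine ⟨_, _, _, _, _, H, hψo, ⟨w, hw⟩, ?_⟩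
    have h2 : ψ U ⁻¹ᵁ φ ⁻¹ᵁ (prodSpec k⟦X⟧ T).basicOpen (sigma b T) =
        PrimeSpectrum.basicOpen (hQ.str (secPoint T U) (tR k _ ^ b)) := by
      rw [← Scheme.Hom.comp_preimage, (hψ U).w, Scheme.Hom.comp_preimage,
        Scheme.preimage_basicOpen_top (tensorPoint k⟦X⟧ (secPoint T U)), tensorPoint_sigma]
      exact preimage_basicOpen_ΓSpecIso (CommRingCat.ofHom (hQ.str (secPoint T U)).toRingHom)
        (tR k _ ^ b)
    rw [h2]
    exact hQ.isIso_curveν _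
  refine ⟨⟨C, ν, φ, hνφ, hC, hiso⟩, QuotFamily.ext_secPoint fun U => ?_⟩
  rw [Crimp.sub_family]
  exact (hQ.isChart_iff (secPoint T U)).1 ⟨fun _ => rfl, ψ U, hψ U, hψν U⟩

end

/-! ### Representability of the functor of crimps -/

section
variable {k : Type u} [Field k]
  {A B : Type u} [CommRing A] [Algebra k A] [CommRing B] [Algebra k B]
  {O : Type u} [CommRing O] [Algebra k O] [Algebra k⟦X⟧ O] [IsScalarTower k k⟦X⟧ O] {b d a : ℕ}
  {T T' : Over (Spec (CommRingCat.of k))} {D D' : Crimp O d b T} (x : specOver k A ⟶ T)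

theorem tensorPoint_comp (W : Type u) [CommRing W] [Algebra k W] (y : specOver k A ⟶ T')
    (g : T' ⟶ T) : tensorPoint W (y ≫ g) = tensorPoint W y ≫ prodMapRight W g := by
  apply (isPullback_prodSpec W T).hom_ext
  · rw [Category.assoc, prodMapRight_fst]
    exact (tensorPoint_fst W _).trans (tensorPoint_fst W _).symm
  · rw [Category.assoc, prodMapRight_snd, ← Category.assoc]
    exact (tensorPoint_snd W _).trans ((Category.assoc _ _ _).symm.trans
      (congrArg (· ≫ g.left) (tensorPoint_snd W y).symm))

variable {x} in
theorem Crimp.sub_eq_of_equiv (h : D ≈ D') : D.sub x = D'.sub x := by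
  obtain ⟨i, h1, h2⟩ := h
  obtain ⟨E, _, α, β, hc⟩ := D.exists_isChart x
  obtain ⟨ψ, hψ, hψν⟩ := hc.exists_hom
  have hc' : D'.IsChart x α β := by
    refine ⟨hc.comp, ψ ≫ i.hom, ?_, ?_⟩
    · exact IsPullback.of_iso hψ (Iso.refl _) i (Iso.refl _) (Iso.refl _) (by simp) (by simp)
        (by simp [h2]) (by simp)
    · rw [← Category.assoc, hψν, Category.assoc, h1]
  exact hc.rangeSub_eq.symm.trans hc'.rangeSub_eq

theorem Crimp.sub_pullback (D : Crimp O d b T) (g : T' ⟶ T) (y : specOver k A ⟶ T') :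
    (D.pullback g).sub y = D.sub (y ≫ g) := by
  obtain ⟨E, _, α, β, hc⟩ := (D.pullback g).exists_isChart y
  obtain ⟨ψ, hψ, hψν⟩ := hc.exists_hom
  have hc' : D.IsChart (y ≫ g) α β := by
    refine ⟨hc.comp, ψ ≫ D.pullbackFst g, ?_, ?_⟩
    · rw [tensorPoint_comp]
      exact hψ.paste_horiz (D.isPullback_pullback g)
    · rw [← Category.assoc, hψν, Category.assoc, Crimp.pullback_ν_fst, tensorPoint_comp,
        Category.assoc]
  exact hc.rangeSub_eq.symm.trans hc'.rangeSub_eq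

variable (o : Module.Basis (Fin d) k⟦X⟧ O)
    (ha : Associated (Algebra.discr k⟦X⟧ o) (PowerSeries.X ^ a))

theorem Crimp.family_pullback (D : Crimp O d b T) (g : T' ⟶ T) :
    (D.pullback g).family o ha = (D.family o ha).pullback g := by
  refine QuotFamily.ext ?_
  funext A _ _ y
  exact congrArg (imageSub b) (D.sub_pullback g y)

theorem Crimp.family_eq_iff : D.family o ha = D'.family o ha ↔ D ≈ D' := by
  refine ⟨fun h => Crimp.equiv_of_sub_eq fun A _ _ x => ?_, fun h => QuotFamily.ext ?_⟩
  · rw [← D.sub_family x o ha, h, D'.sub_family]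
  · funext A _ _ x
    exact congrArg (imageSub b) (Crimp.sub_eq_of_equiv h)

theorem Crimp.exists_constructs {Q : QuotFamily O b (((b : ℚ) - a) / 2) T}
    (h : D.family o ha = Q) : ∃ hS : Q.IsSubalgebra, hS.Constructs D := by
  subst h
  exact ⟨D.isSubalgebra_family o ha, Crimp.constructs_family⟩

/-- The functor of crimps is represented by the locus `Y` in the Quot scheme: taking a crimp to
its family is injective on isomorphism classes by `Crimp.family_eq_iff`, its image is `Y` by
`Crimp.isInY_family` and `QuotFamily.IsInY.exists_crimp`, and it commutes with pullback. -/
theorem exists_crimpFunctor_representableBy (o : Module.Basis (Fin d) k⟦X⟧ O)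
    (ha : Associated (Algebra.discr k⟦X⟧ o) (PowerSeries.X ^ a))
    {Q Y : Over (Spec (CommRingCat.of k))}
    (hQ : (quotFunctor O b (((b : ℚ) - a) / 2)).RepresentableBy Q) {j : Y ⟶ Q} [Mono j]
    (hj : ∀ (T : Over (Spec (CommRingCat.of k))) (f : T ⟶ Q),
      (∃ g : T ⟶ Y, g ≫ j = f) ↔ QuotFamily.IsInY (hQ.homEquiv f) d) :
    ∃ hY : (crimpFunctor O d b).RepresentableBy Y,
      ∀ (T : Over (Spec (CommRingCat.of k))) (g : T ⟶ Y),
        ∃ (hS : QuotFamily.IsSubalgebra (hQ.homEquiv (g ≫ j))) (D : Crimp O d b T),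
          hS.Constructs D ∧ hY.homEquiv g = Quotient.mk _ D := by
  choose D hD using fun (T : Over (Spec (CommRingCat.of k))) (g : T ⟶ Y) =>
    QuotFamily.IsInY.exists_crimp ((hj T (g ≫ j)).1 ⟨g, rfl⟩) o ha
  have hbij : ∀ T, Function.Bijective
      (fun g : T ⟶ Y => (Quotient.mk _ (D T g) : (crimpFunctor O d b).obj (op T))) := by
    intro T
    constructor
    · intro g g' h
      have h1 := (Crimp.family_eq_iff o ha).2 (Quotient.exact h)
      rw [hD, hD] at h1
      exact (cancel_mono j).1 (hQ.homEquiv.injective h1)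
    · intro c
      induction c using Quotient.inductionOn with | _ E => ?_
      obtain ⟨f, hf⟩ := hQ.homEquiv.surjective (E.family o ha)
      obtain ⟨g, rfl⟩ := (hj T f).2 (hf ▸ E.isInY_family o ha)
      exact ⟨g, Quotient.sound ((Crimp.family_eq_iff o ha).1 ((hD T g).trans hf))⟩
  let hY : (crimpFunctor O d b).RepresentableBy Y :=
    { homEquiv := fun {T} => Equiv.ofBijective _ (hbij T)
      homEquiv_comp := fun {T T'} f g => by
        refine Quotient.sound ((Crimp.family_eq_iff o ha).1 ?_)
        change _ = ((D T' g).pullback f).family o ha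
        rw [Crimp.family_pullback, hD, hD, Category.assoc, hQ.homEquiv_comp]
        rfl }
  refine ⟨hY, fun T g => ?_⟩
  obtain ⟨hS, h⟩ := Crimp.exists_constructs o ha (hD T g)
  exact ⟨hS, D T g, h, rfl⟩

end

end

end Crimping

theorem mainTheorem6 {k : Type u} [Field k] [IsAlgClosed k] [CharZero k]
    (O : Type u) [CommRing O] [Algebra k O] [Algebra k⟦X⟧ O] [IsScalarTower k k⟦X⟧ O]
    [Module.Finite k⟦X⟧ O] [Module.Free k⟦X⟧ O] (d a b : ℕ)
    (hd : Module.finrank k⟦X⟧ O = d)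
    (het : Algebra.Etale k⸨X⸩ (k⸨X⸩ ⊗[k⟦X⟧] O))
    (ha : Ideal.span {Algebra.discr k⟦X⟧ (Module.finBasis k⟦X⟧ O)} =
      Ideal.span {(PowerSeries.X : k⟦X⟧) ^ a}) :
    ∃ (Q Y : Over (Spec (CommRingCat.of k)))
      (hQ : (Crimping.quotFunctor O b (((b : ℚ) - (a : ℚ)) / 2)).RepresentableBy Q)
      (j : Y ⟶ Q) (hY : (Crimping.crimpFunctor O d b).RepresentableBy Y),
      IsClosedImmersion j.left ∧
      (∀ (T : Over (Spec (CommRingCat.of k))) (f : T ⟶ Q),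
        (∃ g : T ⟶ Y, g ≫ j = f) ↔ Crimping.QuotFamily.IsInY (hQ.homEquiv f) d) ∧
      (∀ (T : Over (Spec (CommRingCat.of k))) (g : T ⟶ Y),
        ∃ (hS : Crimping.QuotFamily.IsSubalgebra (hQ.homEquiv (g ≫ j)))
          (D : Crimping.Crimp O d b T),
          hS.Constructs D ∧ hY.homEquiv g = Quotient.mk _ D) ∧
      Crimping.IsProjective Y := by
  have hδ : Associated (Algebra.discr k⟦X⟧ ((Module.finBasis k⟦X⟧ O).reindex (finCongr hd)))
      ((PowerSeries.X : k⟦X⟧) ^ a) := by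
    rw [Module.Basis.coe_reindex, Algebra.discr_reindex]
    exact Ideal.span_singleton_eq_span_singleton.1 ha
  have := Crimping.finite_modT ((Module.finBasis k⟦X⟧ O).reindex (finCongr hd)) b
  obtain ⟨Q, hQ, n, i, hi⟩ :=
    Crimping.exists_quotFunctor_representableBy (k := k) (((b : ℚ) - (a : ℚ)) / 2) O b
  -- `Q` is closed in projective space, so that finitely many charts suffice to define `Y`.
  have hC : CompactSpace Q.left := hi.isClosedEmbedding.compactSpace
  have hS : QuasiSeparatedSpace Q.left := by
    have : Q.left.IsSeparated := ⟨by
      rw [← terminal.comp_from i.left]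
      infer_instance⟩
    infer_instance
  -- `Y` is the locus in `Q` where the universal family satisfies the conditions.
  obtain ⟨Y, j, hj, hY⟩ := (hQ.homEquiv (𝟙 Q)).exists_closed _ hδ
  have hY' : ∀ (T : Over (Spec (CommRingCat.of k))) (f : T ⟶ Q),
      (∃ g : T ⟶ Y, g ≫ j = f) ↔ Crimping.QuotFamily.IsInY (hQ.homEquiv f) d := by
    intro T f
    rw [hY, hQ.homEquiv_eq f]
    rfl
  have : Mono j := Over.mono_of_mono_left j
  obtain ⟨hY'', h⟩ := Crimping.exists_crimpFunctor_representableBy _ hδ hQ hY'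
  exact ⟨Q, Y, hQ, j, hY'', hj, hY', h, n, j ≫ i,
    inferInstanceAs (IsClosedImmersion (j.left ≫ i.left))⟩
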